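/- Let $n\in\mathbb Z$, $m\in\mathbb C$, and put $\Theta_0=n+m$, $\Theta_\infty=m-n+1$, $\sigma_3=\mathrm{diag}(1,-1)$. **The inverse monodromy problem.** Let $x\in\mathbb C\setminus\{0\}$ with $-\pi<\mathrm{Arg}(x)<\pi$, and let $\zeta(\lambda)=\mathrm i x(\lambda+2\mathrm i-\lambda^{-1})$. Let $L=\{\lambda\ne0:\ \zeta(\lambda)\in\mathbb R\}\cup\{0\}$. If $\mathrm{Im}\,x\neq0$, then $L\setminus\{0,-\mathrm i\}$ consists of four arcs: $L^\infty_{\nearrow}$ ($|\lambda|>1$, $\zeta<0$) and $L^\infty_{\swarrow}$ ($|\lambda|>1$, $\zeta>0$), oriented from $\infty$ to $-\mathrm i$, and $L^0_{\nearrow}$ ($|\lambda|<1$, $\zeta<0$) and $L^0_{\swarrow}$ ($|\lambda|<1$, $\zeta>0$), oriented from $-\mathrm i$ to $0$. Put $$V^\infty_{\nearrow}=\begin{bmatrix}1&\frac{\sqrt{2\pi}}{\Gamma(\frac12-m)}\\0&1\end{bmatrix},\quad V^0_{\nearrow}=\begin{bmatrix}1&-\frac{\sqrt{2\pi}}{\Gamma(\frac12-m)}\\0&1\end{bmatrix},\quad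 V^0_{\swarrow}=\begin{bmatrix}\mathrm e^{\mathrm i\pi m}&0\\\frac{\sqrt{2\pi}}{\Gamma(\frac12+m)}&\mathrm e^{-\mathrm i\pi m}\end{bmatrix},\quad V^\infty_{\swarrow}=\begin{bmatrix}-\mathrm e^{-\mathrm i\pi m}&0\\\frac{\sqrt{2\pi}}{\Gamma(\frac12+m)}&-\mathrm e^{\mathrm i\pi m}\end{bmatrix},$$ where $1/\Gamma$ vanishes at the poles of $\Gamma$. Let $\lambda^p$ denote the branch of the power function that is cut along $L^\infty_{\swarrow}\cup L^0_{\swarrow}$ and for which $\arg\lambda=0$ for large positive $\lambda$ if $\mathrm{Im}\,x\ge0$, and $\arg\lambda=\pi$ for large negative $\lambda$ if $\mathrm{Im}\,x\le0$ (the two normalizations agree for $x>0$). The problem is to find a $2\times2$ matrix function $\Psi(\lambda)=\Psi^{(n)}(\lambda;x,m)$ such that: * $\Psi$ is analytic in $\mathbb C\setminus L$, and at every point of $L\setminus\{0\}$ it extends analytically to that point from each of the sectors into which $L$ divides a small disk about the point. * With $\Psi_\pm$ denoting the boundary values from the left/right, $\Psi_+=\Psi_-V^\infty_{\nearrow}$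 on $L^\infty_{\nearrow}$, $\Psi_+=\Psi_-V^0_{\nearrow}$ on $L^0_{\nearrow}$, $\Psi_+=(-1)^n\Psi_-V^0_{\swarrow}$ on $L^0_{\swarrow}$, and $\Psi_+=(-1)^n\Psi_-V^\infty_{\swarrow}$ on $L^\infty_{\swarrow}$. For $x>0$, where $L$ is the union of the imaginary axis and the unit circle, the jump conditions are the limits of these as $\mathrm{Arg}(x)\to0$: those displayed hold on the imaginary axis, for $|\lambda|>1$ and for $|\lambda|<1$, and on the unit circle the boundary value from outside equals the one from inside times $V^\infty_{\nearrow}$ where $\mathrm{Re}\,\lambda>0$, and times $V^0_{\nearrow}$ where $\mathrm{Re}\,\lambda<0$. * There are asymptotic expansions, for $\lambda\in\mathbb C\setminus L$, with matrix coefficients, $$\Psi\,\lambda^{\Theta_\infty\sigma_3/2}\mathrm e^{-\mathrm ix\lambda\sigma_3/2}\sim\mathbb I+\sum_{k\ge1}\Psi^\infty_k(x)\lambda^{-k}\ (\lambda\to\infty),\qquad \Psi\,\lambda^{-\Theta_0\sigma_3/2}\mathrm e^{\mathrm ix\lambda^{-1}\sigma_3/2}\sim\sum_{k\ge0}\Psi^0_k(x)\lambda^{k}\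 (\lambda\to0).$$ **Lemma.** Let $D\subset\mathbb C\setminus(-\infty,0]$ be a domain (nonempty, open, connected), and suppose that for every $x\in D$ the inverse monodromy problem has a solution $\Psi(\lambda;x)$, with expansion coefficients $\Psi^\infty_k(x)$, $\Psi^0_k(x)$. Define on $D$ $$y=-\mathrm ix\Psi^\infty_{1,12},\quad v=\mathrm ix\Psi^\infty_{1,21},\quad s=-x\Psi^0_{0,11}\Psi^0_{0,12},\quad t=\frac{\Psi^0_{0,21}}{\Psi^0_{0,11}}.$$ 1. The matrix $$M(x)=\begin{bmatrix}\frac{\mathrm ix}2-\mathrm ist&\mathrm is\\-\mathrm it(st-x)&-\frac{\mathrm ix}2+\mathrm ist\end{bmatrix},$$ defined where $\Psi^0_{0,11}(x)\ne0$, extends analytically to $D$, and with this extension, for all $x\in D$ and all $\lambda\in\mathbb C\setminus L$ (where $L$ depends on $x$), $\Psi(\lambda;x)$ is differentiable in $\lambda$ and in $x$ and satisfies the Lax system $$\frac{\partial\Psi}{\partial\lambda}=\Big(\frac{\mathrm ix}2\sigma_3+\frac1\lambda\begin{bmatrix}-\frac12\Theta_\infty&y\\v&\frac12\Theta_\infty\end{bmatrix}+\frac1{\lambda^2}M\Big)\Psi,\qquad\frac{\partial\Psi}{\partial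 x}=\Big(\frac{\mathrm i\lambda}2\sigma_3+\frac1x\begin{bmatrix}0&y\\v&0\end{bmatrix}-\frac1{\lambda x}M\Big)\Psi.$$ 2. None of $\Psi^0_{0,11}$, $\Psi^0_{0,12}$, $\Psi^0_{0,22}$ vanishes identically on $D$. 3. The function $u=-y/s$ is meromorphic on $D$, its zeros are isolated, and it satisfies the Painlevé-III equation $$u''=\frac{(u')^2}u-\frac{u'}x+\frac{4\Theta_0u^2+4(1-\Theta_\infty)}x+4u^3-\frac4u$$ at every point of $D$ at which it is analytic and nonzero. -/

import Mathlib

open Complex Filter Topology Asymptotics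

namespace PIII

noncomputable section

/-- `2 × 2` complex matrices. -/
abbrev Mat := Matrix (Fin 2) (Fin 2) ℂ

/-- The Pauli matrix `σ₃`. -/
def sigma3 : Mat := !![1, 0; 0, -1]

/-- `exp (c σ₃) = diag (exp c, exp (-c))`. -/
def expSigma3 (c : ℂ) : Mat := !![exp c, 0; 0, exp (-c)]

/-- The parameter `Θ₀ = n + m`. -/
def theta0 (n : ℤ) (m : ℂ) : ℂ := n + m

/-- The parameter `Θ_∞ = m - n + 1`. -/
def thetaInf (n : ℤ) (m : ℂ) : ℂ := m - n + 1

/-! ### The jump contour -/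

/-- `ζ = i x (λ + 2 i - λ⁻¹) = i x (λ + i)² / λ`. -/
def zeta (x l : ℂ) : ℂ := I * x * (l + 2 * I - l⁻¹)

/-- The jump contour `L`: the set where `ζ` is real, together with the endpoint `0` of its arcs.
For `x` off the real axis it consists of four arcs that meet only at `-i`, the only point that it
has in common with the unit circle; for `x > 0` it is the union of the imaginary axis and the unit
circle, the limit of these contours as `arg x → 0` from either side. -/
def contour (x : ℂ) : Set ℂ := {l | l = 0 ∨ (zeta x l).im = 0}

/-- `Ω^∞_+`. -/
def OmInfPos (x : ℂ) : Set ℂ := {l | 1 < ‖l‖ ∧ 0 < (zeta x l).im}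
/-- `Ω^∞_-`. -/
def OmInfNeg (x : ℂ) : Set ℂ := {l | 1 < ‖l‖ ∧ (zeta x l).im < 0}
/-- `Ω^0_+`. -/
def OmZeroPos (x : ℂ) : Set ℂ := {l | l ≠ 0 ∧ ‖l‖ < 1 ∧ 0 < (zeta x l).im}
/-- `Ω^0_-`. -/
def OmZeroNeg (x : ℂ) : Set ℂ := {l | l ≠ 0 ∧ ‖l‖ < 1 ∧ (zeta x l).im < 0}

/-- The arc from `∞` to `-i` where `ζ < 0`; `Ω^∞_+` is on its left, `Ω^∞_-` on its right. -/
def arcInfUp (x : ℂ) : Set ℂ := {l | 1 < ‖l‖ ∧ (zeta x l).im = 0 ∧ (zeta x l).re < 0}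
/-- The arc from `∞` to `-i` where `ζ > 0`; `Ω^∞_-` is on its left, `Ω^∞_+` on its right. -/
def arcInfLow (x : ℂ) : Set ℂ := {l | 1 < ‖l‖ ∧ (zeta x l).im = 0 ∧ 0 < (zeta x l).re}
/-- The arc from `-i` to `0` where `ζ < 0`; `Ω^0_-` is on its left, `Ω^0_+` on its right. -/
def arcZeroUp (x : ℂ) : Set ℂ :=
  {l | l ≠ 0 ∧ ‖l‖ < 1 ∧ (zeta x l).im = 0 ∧ (zeta x l).re < 0}
/-- The arc from `-i` to `0` where `ζ > 0`; `Ω^0_+` is on its left, `Ω^0_-` on its right. -/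
def arcZeroLow (x : ℂ) : Set ℂ :=
  {l | l ≠ 0 ∧ ‖l‖ < 1 ∧ (zeta x l).im = 0 ∧ 0 < (zeta x l).re}

/-! ### The branch of `log λ` that is cut along the two arcs where `ζ > 0` -/

/-- The branch of `(λ / i) ^ (1/2)`, cut where `ζ ≥ 0`, which is a square root `w` of `λ / i` with
`x ^ (1/2) * (w + w⁻¹) = (-ζ) ^ (1/2)` (principal square roots of `x` and of `-ζ`). -/
def branchRoot (x l : ℂ) : ℂ := -I * (l + I) * x ^ (1 / 2 : ℂ) / (-zeta x l) ^ (1 / 2 : ℂ)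

/-- The branch of `log λ`, cut along the arcs where `ζ > 0`, whose imaginary part is `0` for large
positive `λ` if `0 ≤ Im x`, and `π` for large negative `λ` if `Im x ≤ 0`. -/
def branchLog (x l : ℂ) : ℂ := 2 * log (branchRoot x l) + I * (Real.pi / 2)

theorem sq_half (z : ℂ) : (z ^ (1 / 2 : ℂ)) ^ 2 = z := by
  rw [← cpow_nat_mul]; norm_num

theorem half_re_pos {z : ℂ} (hz : z ∈ slitPlane) : 0 < (z ^ (1 / 2 : ℂ)).re := by
  have hz0 : z ≠ 0 := slitPlane_ne_zero hz
  rw [cpow_def_of_ne_zero hz0, exp_re]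
  refine mul_pos (Real.exp_pos _) (Real.cos_pos_of_mem_Ioo ?_)
  have h1 : (log z * (1 / 2 : ℂ)).im = arg z / 2 := by
    have : (1 / 2 : ℂ) = ((1 / 2 : ℝ) : ℂ) := by push_cast; ring
    rw [this, im_mul_ofReal, log_im]; ring
  rw [h1]
  have h2 := neg_pi_lt_arg z
  have h3 : arg z < Real.pi := lt_of_le_of_ne (arg_le_pi z) (mem_slitPlane_iff_arg.1 hz).1
  constructor <;> linarith

theorem zeta_eq {l : ℂ} (x : ℂ) (hl : l ≠ 0) : zeta x l = I * x * (l + I) ^ 2 / l := by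
  unfold zeta
  field_simp
  ring_nf
  simp only [I_sq]
  ring

theorem branchRoot_sq {x l : ℂ} (hx : x ≠ 0) (hl : l ≠ 0) (hl' : l ≠ -I) :
    branchRoot x l ^ 2 = l / I := by
  have h : l + I ≠ 0 := fun h => hl' (eq_neg_of_add_eq_zero_left h)
  unfold branchRoot
  rw [div_pow, sq_half, mul_pow, sq_half, zeta_eq x hl]
  field_simp [I_ne_zero]
  simp [I_sq]

theorem exp_branchLog {x l : ℂ} (hx : x ≠ 0) (hl : l ≠ 0) (hl' : l ≠ -I) :
    exp (branchLog x l) = l := by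
  have h2 := branchRoot_sq hx hl hl'
  have h0 : branchRoot x l ≠ 0 := by
    intro h
    rw [h] at h2
    simp only [ne_eq, OfNat.ofNat_ne_zero, not_false_eq_true, zero_pow] at h2
    exact (div_ne_zero hl I_ne_zero) h2.symm
  unfold branchLog
  rw [exp_add, two_mul, exp_add, exp_log h0, ← pow_two, h2]
  have : exp (I * (Real.pi / 2)) = I := by
    rw [mul_comm]; exact exp_pi_div_two_mul_I
  rw [this]
  field_simp

theorem branchRoot_mem_slitPlane {x l : ℂ} (hx : x ∈ slitPlane) (hl : l ≠ 0)
    (hz : -zeta x l ∈ slitPlane) : branchRoot x l ∈ slitPlane := by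
  have hx0 := slitPlane_ne_zero hx
  have hl' : l ≠ -I := by
    rintro rfl
    apply slitPlane_ne_zero hz
    rw [zeta_eq x (by simp)]
    simp
  have h2 := branchRoot_sq hx0 hl hl'
  have hxp := half_re_pos hx
  have hzp := half_re_pos hz
  rw [mem_slitPlane_iff]
  by_contra hcon
  push Not at hcon
  obtain ⟨h1, h3⟩ := hcon
  have hw : branchRoot x l = ((branchRoot x l).re : ℂ) := Complex.ext rfl (by simp [h3])
  set ρ : ℝ := (branchRoot x l).re with hρ
  have hlI : l = I * (ρ : ℂ) ^ 2 := by
    rw [hw] at h2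
    field_simp at h2
    rw [← h2, mul_comm]
  have hz0 : (-zeta x l) ^ (1 / 2 : ℂ) ≠ 0 := fun h => by rw [h] at hzp; simp at hzp
  have h4 : ((ρ ^ 2 + 1 : ℝ) : ℂ) * x ^ (1 / 2 : ℂ) = (ρ : ℂ) * (-zeta x l) ^ (1 / 2 : ℂ) := by
    have h5 : branchRoot x l * (-zeta x l) ^ (1 / 2 : ℂ)
        = -I * (l + I) * x ^ (1 / 2 : ℂ) := by
      unfold branchRoot
      exact div_mul_cancel₀ _ hz0
    rw [← hw, h5]
    have : -I * (l + I) = ((ρ ^ 2 + 1 : ℝ) : ℂ) := by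
      rw [hlI]; push_cast; ring_nf; simp [I_sq]
    rw [this]
  have h6 := congrArg Complex.re h4
  rw [re_ofReal_mul, re_ofReal_mul] at h6
  nlinarith [sq_nonneg ρ, mul_pos (show (0 : ℝ) < ρ ^ 2 + 1 by positivity) hxp]

/-- `branchLog` is analytic in `λ` off the cut. -/
theorem differentiableAt_branchLog {x l : ℂ} (hx : x ∈ slitPlane) (hl : l ≠ 0)
    (hz : -zeta x l ∈ slitPlane) : DifferentiableAt ℂ (branchLog x) l := by
  have hw := branchRoot_mem_slitPlane hx hl hz
  have hzd : DifferentiableAt ℂ (fun l => (-zeta x l) ^ (1 / 2 : ℂ)) l := by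
    refine DifferentiableAt.cpow ?_ (differentiableAt_const _) hz
    unfold zeta
    fun_prop (disch := assumption)
  have hz0 : (-zeta x l) ^ (1 / 2 : ℂ) ≠ 0 := fun h => by
    have := half_re_pos hz
    rw [h] at this; simp at this
  have hwd : DifferentiableAt ℂ (branchRoot x) l := by
    unfold branchRoot
    exact DifferentiableAt.div (by fun_prop) hzd hz0
  unfold branchLog
  exact ((hwd.clog hw).const_mul 2).add_const _

theorem branchRoot_eq {x l w : ℂ} (hl : l ≠ 0) (hw : w ^ 2 = l / I)
    (hpos : 0 < (x ^ (1 / 2 : ℂ) * (w + w⁻¹)).re) : branchRoot x l = w := by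
  have hw0 : w ≠ 0 := by rintro rfl; simp [hl] at hw
  have hlw : l = I * w ^ 2 := by rw [hw]; field_simp
  have key : -I * (l + I) * x ^ (1 / 2 : ℂ) = w * (x ^ (1 / 2 : ℂ) * (w + w⁻¹)) := by
    have : -I * (l + I) = w ^ 2 + 1 := by
      rw [hlw]; ring_nf; simp [I_sq]
    rw [this]; field_simp
  have hsq : -zeta x l = (x ^ (1 / 2 : ℂ) * (w + w⁻¹)) ^ 2 := by
    rw [mul_pow, sq_half, zeta_eq x hl, hlw]
    field_simp
    ring_nf
    simp only [I_sq]
    ring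
  have hq0 : x ^ (1 / 2 : ℂ) * (w + w⁻¹) ≠ 0 := fun h => by rw [h] at hpos; simp at hpos
  unfold branchRoot
  rw [key, hsq, one_div, sq_cpow_two_inv (by simpa using hpos)]
  rw [one_div] at hq0
  exact mul_div_cancel_right₀ _ hq0

theorem half_im_mul (x : ℂ) :
    2 * ((x ^ (1 / 2 : ℂ)).re * (x ^ (1 / 2 : ℂ)).im) = x.im := by
  have h := congrArg Complex.im (sq_half x)
  rw [pow_two, mul_im] at h
  linarith

theorem arg_aux {c t : ℝ} (hc : 0 < c) (ht : t = 1 ∨ t = -1) :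
    arg (c * (1 + t * I)) = t * (Real.pi / 4) := by
  have hp : (0 : ℝ) < √2 := by positivity
  have h2 : √2 * √2 = (2 : ℝ) := Real.mul_self_sqrt (by norm_num)
  have hpi := Real.pi_pos
  have hcos : Real.cos (t * (Real.pi / 4)) = √2 / 2 := by
    rcases ht with rfl | rfl <;> simp
  have hsin : Real.sin (t * (Real.pi / 4)) = t * (√2 / 2) := by
    rcases ht with rfl | rfl <;> simp
  have hw : (c : ℂ) * (1 + t * I) = ((c * √2 : ℝ) : ℂ) *
      (((Real.cos (t * (Real.pi / 4)) : ℝ) : ℂ) + ((Real.sin (t * (Real.pi / 4)) : ℝ) : ℂ) * I) := by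
    rw [hcos, hsin]
    have h2' : (√2 : ℂ) * (√2 : ℂ) = 2 := by exact_mod_cast h2
    push_cast
    linear_combination (-(c : ℂ) / 2 * (1 + t * I)) * h2'
  rw [hw, ofReal_cos, ofReal_sin]
  refine arg_mul_cos_add_sin_mul_I (by positivity) ?_
  rcases ht with rfl | rfl <;> constructor <;> linarith

theorem branchLog_im_aux {x : ℂ} {r t : ℝ} (hx : x ∈ slitPlane) (hr : 1 < r)
    (ht : t = 1 ∨ t = -1) (hxi : t * x.im ≤ 0) :
    (branchLog x ((-t * r : ℝ) : ℂ)).im = t * (Real.pi / 2) + Real.pi / 2 := by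
  have hc : 0 < √(r / 2) := Real.sqrt_pos.2 (by linarith)
  have hc2 : √(r / 2) ^ 2 = r / 2 := Real.sq_sqrt (by linarith)
  set c := √(r / 2) with hcdef
  have hc0 : (c : ℂ) ≠ 0 := by exact_mod_cast hc.ne'
  have ht2 : t * t = 1 := by rcases ht with rfl | rfl <;> norm_num
  have ht2' : (t : ℂ) * t = 1 := by exact_mod_cast ht2
  have hr2 : (r : ℂ) = 2 * (c : ℂ) ^ 2 := by
    have : r = 2 * c ^ 2 := by rw [hc2]; ring
    exact_mod_cast this
  have hl : ((-t * r : ℝ) : ℂ) ≠ 0 := by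
    have : t ≠ 0 := by rcases ht with rfl | rfl <;> norm_num
    have h : -t * r ≠ 0 := mul_ne_zero (neg_ne_zero.2 this) (by linarith)
    exact_mod_cast h
  have hinv : ((c : ℂ) * (1 + t * I))⁻¹ = (1 - t * I) / (2 * c) := by
    refine inv_eq_of_mul_eq_one_right ?_
    field_simp
    ring_nf
    rw [pow_two, ht2', I_sq]
    norm_num
  have hw : ((c : ℂ) * (1 + t * I)) ^ 2 = ((-t * r : ℝ) : ℂ) / I := by
    push_cast
    rw [eq_div_iff I_ne_zero, hr2]
    have hI : I * I = -1 := I_mul_I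
    linear_combination ((c : ℂ) ^ 2 * (2 * t + t * t * I)) * hI - (c : ℂ) ^ 2 * I * ht2'
  have hpos : 0 < (x ^ (1 / 2 : ℂ) * ((c : ℂ) * (1 + t * I) + ((c : ℂ) * (1 + t * I))⁻¹)).re := by
    have hform : (c : ℂ) * (1 + t * I) + ((c : ℂ) * (1 + t * I))⁻¹
        = ((c + 1 / (2 * c) : ℝ) : ℂ) + ((t * (c - 1 / (2 * c)) : ℝ) : ℂ) * I := by
      rw [hinv]; push_cast; field_simp; ring
    rw [hform, mul_re]
    simp only [add_re, add_im, ofReal_re, ofReal_im, re_ofReal_mul, im_ofReal_mul, I_re, I_im]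
    have hx1 := half_re_pos hx
    have hx2 := half_im_mul x
    set a := (x ^ (1 / 2 : ℂ)).re
    set b := (x ^ (1 / 2 : ℂ)).im
    have htb : t * b ≤ 0 := by
      have : a * (t * b) ≤ 0 := by
        have : a * (t * b) = t * x.im / 2 := by rw [← hx2]; ring
        rw [this]; linarith
      exact nonpos_of_mul_nonpos_right this hx1
    have h1 : 0 ≤ c - 1 / (2 * c) := by
      rw [sub_nonneg, div_le_iff₀ (by positivity)]
      nlinarith
    have h2 : 0 < c + 1 / (2 * c) := by positivity
    nlinarith [mul_pos hx1 h2, mul_nonneg (neg_nonneg.2 htb) h1]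
  have hroot := branchRoot_eq hl hw hpos
  have harg := arg_aux hc ht
  unfold branchLog
  rw [hroot]
  have h1 : (2 * log ((c : ℂ) * (1 + t * I)) + I * (Real.pi / 2)).im
      = 2 * arg ((c : ℂ) * (1 + t * I)) + Real.pi / 2 := by
    rw [add_im]
    congr 1
    · rw [show (2 : ℂ) = ((2 : ℝ) : ℂ) by norm_num, im_ofReal_mul, log_im]
    · rw [show I * ((Real.pi : ℂ) / 2) = ((Real.pi / 2 : ℝ) : ℂ) * I by push_cast; ring,
        im_ofReal_mul, I_im, mul_one]
  rw [h1, harg]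
  ring

/-- Normalization of the branch for `Im x ≥ 0`. -/
theorem branchLog_im_of_pos {x : ℂ} {r : ℝ} (hx : x ∈ slitPlane) (hxi : 0 ≤ x.im)
    (hr : 1 < r) : (branchLog x (r : ℂ)).im = 0 := by
  have h := branchLog_im_aux (t := -1) hx hr (Or.inr rfl) (by linarith)
  simpa using h

/-- Normalization of the branch for `Im x ≤ 0`. -/
theorem branchLog_im_of_neg {x : ℂ} {r : ℝ} (hx : x ∈ slitPlane) (hxi : x.im ≤ 0)
    (hr : 1 < r) : (branchLog x (-(r : ℂ))).im = Real.pi := by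
  have h := branchLog_im_aux (t := 1) hx hr (Or.inl rfl) (by linarith)
  rw [show ((-1 * r : ℝ) : ℂ) = -(r : ℂ) by push_cast; ring] at h
  rw [h]; ring

/-! ### The jump matrices -/

def VInfUp (m : ℂ) : Mat := !![1, √(2 * Real.pi) / Gamma (1 / 2 - m); 0, 1]

def VZeroUp (m : ℂ) : Mat := !![1, -(√(2 * Real.pi) / Gamma (1 / 2 - m)); 0, 1]

def VZeroLow (m : ℂ) : Mat :=
  !![exp (I * Real.pi * m), 0; √(2 * Real.pi) / Gamma (1 / 2 + m), exp (-(I * Real.pi * m))]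

def VInfLow (m : ℂ) : Mat :=
  !![-exp (-(I * Real.pi * m)), 0; √(2 * Real.pi) / Gamma (1 / 2 + m), -exp (I * Real.pi * m)]

/-- The boundary values `F₊`, `F₋` of `F` at `l` from the sets `Sp`, `Sm` exist and satisfy
`F₊ = F₋ V`. -/
def HasJump (F : ℂ → Mat) (Sp Sm : Set ℂ) (V : Mat) (l : ℂ) : Prop :=
  ∃ P M : Mat, Tendsto F (𝓝[Sp] l) (𝓝 P) ∧ Tendsto F (𝓝[Sm] l) (𝓝 M) ∧ P = M * V

/-! ### The inverse monodromy problem -/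

/-- `F = Ψ^{(n)}(· ; x, m)` solves the inverse monodromy problem for `x` with `-π < arg x < π`,
and `cInf k`, `c0 k` are the coefficients of its expansions at `∞` and at `0`. -/
structure IsSolution (n : ℤ) (m x : ℂ) (F : ℂ → Mat) (cInf c0 : ℕ → Mat) : Prop where
  analytic : ∀ l ∉ contour x, ∀ i j, AnalyticAt ℂ (fun z => F z i j) l
  /-- Near each nonzero point `p` of the contour, `F` extends analytically to `p` from each of the
  sectors into which the contour divides a small disk about `p`. -/
  extends_to_contour : ∀ p ∈ contour x, p ≠ 0 → ∃ r > 0, ∀ z ∈ Metric.ball p r \ contour x,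
    ∃ G : ℂ → Mat, (∀ i j, AnalyticOnNhd ℂ (fun w => G w i j) (Metric.ball p r)) ∧
      Set.EqOn F G (connectedComponentIn (Metric.ball p r \ contour x) z)
  jump_infUp : ∀ l ∈ arcInfUp x, HasJump F (OmInfPos x) (OmInfNeg x) (VInfUp m) l
  jump_zeroUp : ∀ l ∈ arcZeroUp x, HasJump F (OmZeroNeg x) (OmZeroPos x) (VZeroUp m) l
  jump_zeroLow : ∀ l ∈ arcZeroLow x,
    HasJump F (OmZeroPos x) (OmZeroNeg x) ((-1 : ℂ) ^ n • VZeroLow m) l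
  jump_infLow : ∀ l ∈ arcInfLow x,
    HasJump F (OmInfNeg x) (OmInfPos x) ((-1 : ℂ) ^ n • VInfLow m) l
  /-- For `x > 0` the two arcs where `ζ < 0` run partly along the unit circle; these are the limits
  as `arg x ↓ 0` of the jump conditions on them (those for `arg x ↑ 0` are the same, because
  `VInfUp m` and `VZeroUp m` are inverse to each other). -/
  jump_circle_right : x.im = 0 → ∀ l : ℂ, ‖l‖ = 1 → 0 < l.re →
    HasJump F (OmInfPos x) (OmZeroNeg x) (VInfUp m) l
  jump_circle_left : x.im = 0 → ∀ l : ℂ, ‖l‖ = 1 → l.re < 0 →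
    HasJump F (OmInfNeg x) (OmZeroPos x) (VZeroUp m) l
  cInf_zero : cInf 0 = 1
  /-- `Ψ λ^{Θ_∞ σ₃/2} e^{-i x λ σ₃/2} = 1 + Ψ^∞_1 λ⁻¹ + ⋯` as `λ → ∞`. -/
  at_infinity : ∀ (N : ℕ) (i j : Fin 2),
    (fun l => (F l * expSigma3 (thetaInf n m / 2 * branchLog x l) *
        expSigma3 (-(I * x * l / 2)) - ∑ k ∈ Finset.range N, (l⁻¹) ^ k • cInf k) i j)
      =O[Bornology.cobounded ℂ ⊓ 𝓟 (contour x)ᶜ] fun l => (l⁻¹) ^ N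
  /-- `Ψ λ^{-Θ₀ σ₃/2} e^{i x λ⁻¹ σ₃/2} = Ψ^0_0 + Ψ^0_1 λ + ⋯` as `λ → 0`. -/
  at_zero : ∀ (N : ℕ) (i j : Fin 2),
    (fun l => (F l * expSigma3 (-(theta0 n m / 2 * branchLog x l)) *
        expSigma3 (I * x * l⁻¹ / 2) - ∑ k ∈ Finset.range N, l ^ k • c0 k) i j)
      =O[𝓝[(contour x)ᶜ] 0] fun l => l ^ N

/-! ### The Lax pair -/

/-- The coefficient of `λ⁻²` in the first Lax matrix, in terms of the potentials `s` and `t`. -/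
def laxM (x s t : ℂ) : Mat :=
  !![I * x / 2 - I * s * t, I * s; -(I * t * (s * t - x)), -(I * x / 2) + I * s * t]

/-- The matrix `A` of `∂Ψ/∂λ = A Ψ`, `M` being the coefficient of `λ⁻²`. -/
def laxA (Θ x y v : ℂ) (M : Mat) (l : ℂ) : Mat :=
  (I * x / 2) • sigma3 + l⁻¹ • !![-(Θ / 2), y; v, Θ / 2] + (l⁻¹ ^ 2) • M

/-- The matrix `B` of `∂Ψ/∂x = B Ψ`, `M` being the coefficient of `-(λ x)⁻¹`. -/
def laxB (x y v : ℂ) (M : Mat) (l : ℂ) : Mat :=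
  (I * l / 2) • sigma3 + x⁻¹ • !![0, y; v, 0] - (l * x)⁻¹ • M

/-- The potentials, in terms of the coefficients `Ψ^∞_1 = cInf 1` and `Ψ^0_0 = c0 0`. -/
def potY (cInf : ℂ → ℕ → Mat) (x : ℂ) : ℂ := -(I * x * cInf x 1 0 1)
def potV (cInf : ℂ → ℕ → Mat) (x : ℂ) : ℂ := I * x * cInf x 1 1 0
def potS (c0 : ℂ → ℕ → Mat) (x : ℂ) : ℂ := -(x * c0 x 0 0 0 * c0 x 0 0 1)
def potT (c0 : ℂ → ℕ → Mat) (x : ℂ) : ℂ := c0 x 0 1 0 / c0 x 0 0 0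

/-! ### The Painlevé-III equation -/

/-- The Painlevé-III equation for `u` at the point `x`. -/
def PIIIAt (Θ₀ Θinf : ℂ) (u : ℂ → ℂ) (x : ℂ) : Prop :=
  deriv (deriv u) x = (deriv u x) ^ 2 / u x - deriv u x / x
    + (4 * Θ₀ * u x ^ 2 + 4 * (1 - Θinf)) / x + 4 * u x ^ 3 - 4 / u x

/-- `u` is meromorphic on `D`, does not vanish identically near any point of `D`, and satisfies
the Painlevé-III equation at every point of `D` at which it is analytic and nonzero. -/
def IsMeromorphicPIIISolution (Θ₀ Θinf : ℂ) (u : ℂ → ℂ) (D : Set ℂ) : Prop :=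
  MeromorphicOn u D ∧ (∀ᶠ x in codiscreteWithin D, u x ≠ 0) ∧
    ∀ x ∈ D, AnalyticAt ℂ u x → u x ≠ 0 → PIIIAt Θ₀ Θinf u x

end

end PIII

namespace PIII

/-! ### Half-strips at the end of a cylinder and deformation of contours. -/

noncomputable section

/-! The solution is only assumed to exist for each x separately, so its differentiability in x has
to be proved. The proof works on the logarithmic plane λ = -i e^μ. There ζ = 2x(cosh μ - 1) is even,
the contour depends on x but its complement is dense, and λ ↦ -1/λ becomes μ ↦ -μ.

Continuation (`exists_continuation`). Multiplying Ψ by the constant factors read off from the jumps,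
sheet by sheet, removes every jump. At the critical points of ζ, where arcs may cross, the result is
bounded, so the singularities are removable. This gives an entire Φ with Φ(μ + 2πi) = Φ(μ)C, where C
= `monod n m` has C² = -1 and det C = 1. The symmetry μ ↦ -μ exchanges 0 and ∞ and replaces n by 1 -
n (`IsCont.mirror`), so only the right end of the cylinder has to be analysed. There Φ, and Φ times
a triangular Stokes matrix, have the prescribed expansion in two overlapping half-strips
(`IsCont.halfAsymp`). The strips depend on an angle β that has only to be near -arg x, so that one β
serves all parameters near a given x.

Equation in λ (`Asym.logDeriv`). The determinant of Φ and the function Φ'Φ⁻¹ are periodic and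
entire, with known behaviour at both ends. Liouville's theorem gives det Φ = 1 and Φ'Φ⁻¹ = (x
e^μ/2)σ₃ + const - (x e^{-μ}/2)K with K = b₀σ₃b₀⁻¹. The matrix K is polynomial in the entries of
Ψ⁰₀, which is why M extends over the zeros of Ψ⁰₀,₁₁.

Equation in x (`SolPair.exists_first_order`). For nearby parameters the quotient r = Φ_{x+h}Φ_x⁻¹ is
periodic and entire, because C does not depend on x. Near each end, inserting the ratio of the
exponentials turns r into a pair of functions, one for each half-strip, that tend to a common limit
and differ on the overlaps by O(h) times a rapidly decaying factor. The limit is 1 at the right end.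
Cauchy's formula on the cylinder (`cylinder_estimate`) and a self-improving bound
(`EndData.estimates`) then give r = 1 + O(h) with uniform constants. Inserting this in the
expansions gives r - 1 - hB = o(h) on far vertical lines, in a weighted sense that a
Phragmén–Lindelöf argument carries to the middle. Hence ∂Φ/∂x = BΦ, and Cauchy's estimate in μ
allows Φ'Φ⁻¹ to be differentiated in x as well.

Painlevé. The compatibility of the two equations (`SolFamily.hasDerivAt_logDer`) is an ordinary
differential system for y, v and the entries p, q, r of M. The relations p² + qr = -x²/4 and -Θ_∞p +
yr + vq = ixΘ₀/2 eliminate v and r, and what remains for u = -iy/q = -y/s and p is equivalent to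
Painlevé-III (`LaxSystem.piii`).

Non-vanishing. The functions y and q have no common zero (`SolPair.not_lower_triangular`): otherwise
Φ would be lower triangular, which forces either m = -1/2, contradicting the upper right entry of C,
or Θ₀ = Θ_∞, which is impossible because Θ_∞ - Θ₀ = 1 - 2n is odd. The differential system then
shows that neither y nor q vanishes identically near a point, and a similar argument treats Ψ⁰₀,₂₂.
-/

/-- The filter `Re μ → ∞` within the closed horizontal strip `lo ≤ Im μ ≤ hi`. -/
def stripAt (lo hi : ℝ) : Filter ℂ := comap Complex.re atTop ⊓ 𝓟 {μ | μ.im ∈ Set.Icc lo hi}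

theorem eventually_stripAt {lo hi : ℝ} {p : ℂ → Prop} :
    (∀ᶠ μ in stripAt lo hi, p μ) ↔ ∃ A : ℝ, ∀ μ : ℂ, A ≤ μ.re → μ.im ∈ Set.Icc lo hi → p μ := by
  unfold stripAt
  rw [eventually_inf_principal, eventually_comap, eventually_atTop]
  constructor
  · rintro ⟨A, hA⟩
    exact ⟨A, fun μ h1 h2 => hA μ.re h1 μ rfl h2⟩
  · rintro ⟨A, hA⟩
    exact ⟨A, fun b hb μ h1 h2 => hA μ (h1 ▸ hb) h2⟩

theorem stripAt_mono {lo hi lo' hi' : ℝ} (h1 : lo' ≤ lo) (h2 : hi ≤ hi') :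
    stripAt lo hi ≤ stripAt lo' hi' :=
  inf_le_inf le_rfl (principal_mono.2 fun _ h => ⟨h1.trans h.1, h.2.trans h2⟩)

theorem tendsto_exp_neg_stripAt {lo hi : ℝ} :
    Tendsto (fun μ : ℂ => Real.exp (-μ.re)) (stripAt lo hi) (𝓝 0) :=
  Real.tendsto_exp_neg_atTop_nhds_zero.comp (tendsto_comap.mono_left inf_le_left)

theorem tendsto_add_two_pi {lo hi : ℝ} {f : ℂ → ℂ} {c : ℂ} (s : ℝ)
    (h : Tendsto f (stripAt (lo + s) (hi + s)) (𝓝 c)) :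
    Tendsto (fun μ => f (μ + s * I)) (stripAt lo hi) (𝓝 c) := by
  refine h.comp ?_
  unfold stripAt
  refine tendsto_inf.2 ⟨tendsto_inf_left ?_, tendsto_inf_right ?_⟩
  · rw [tendsto_comap_iff]
    have : (Complex.re ∘ fun μ : ℂ => μ + s * I) = Complex.re := by ext μ; simp
    rw [this]; exact tendsto_comap
  · refine tendsto_principal_principal.2 fun μ hμ => ?_
    simp only [Set.mem_ofPred_eq, Set.mem_Icc, add_im, mul_im, ofReal_re, I_im, mul_one, ofReal_im,
      I_re, mul_zero, add_zero] at hμ ⊢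
    constructor <;> linarith [hμ.1, hμ.2]

/-- The integral of `f` over a vertical segment. -/
def vint (f : ℂ → ℂ) (a lo hi : ℝ) : ℂ := ∫ y in lo..hi, f (a + y * I)

theorem tendsto_vint {f : ℂ → ℂ} {lo hi : ℝ} {c : ℂ} (hle : lo ≤ hi)
    (hf : ∃ a : ℝ, ∀ μ : ℂ, a ≤ μ.re → μ.im ∈ Set.Icc lo hi → ContinuousAt f μ)
    (h : Tendsto f (stripAt lo hi) (𝓝 c)) :
    Tendsto (fun T : ℝ => vint f T lo hi) atTop (𝓝 ((hi - lo : ℝ) * c)) := by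
  rw [Metric.tendsto_atTop]
  intro η hη
  have hpos : 0 < hi - lo + 1 := by linarith
  have h1 := (Metric.tendsto_nhds.1 h) (η / (hi - lo + 1)) (by positivity)
  obtain ⟨A, hA⟩ := eventually_stripAt.1 h1
  obtain ⟨a, ha⟩ := hf
  refine ⟨max A a, fun T hT => ?_⟩
  obtain ⟨hT, hTa⟩ := max_le_iff.1 hT
  have hint : vint f T lo hi - (hi - lo : ℝ) * c = ∫ y in lo..hi, (f (T + y * I) - c) := by
    rw [intervalIntegral.integral_sub]
    · simp [vint]
    · refine ContinuousOn.intervalIntegrable fun y hy => ?_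
      rw [Set.uIcc_of_le hle] at hy
      have : ContinuousAt f ((T : ℂ) + y * I) := ha _ (by simpa using hTa) (by simpa using hy)
      exact (ContinuousAt.comp (f := fun y : ℝ => (T : ℂ) + y * I) this
        (by fun_prop)).continuousWithinAt
    · simp
  rw [dist_eq_norm, hint]
  have hb : ‖∫ y in lo..hi, (f (T + y * I) - c)‖ ≤ η / (hi - lo + 1) * |hi - lo| := by
    refine intervalIntegral.norm_integral_le_of_norm_le_const fun y hy => ?_
    rw [Set.uIoc_of_le hle] at hy
    have := hA (T + y * I) (by simpa using hT) (by simpa using ⟨hy.1.le, hy.2⟩)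
    rw [dist_eq_norm] at this
    exact this.le
  rw [abs_of_nonneg (by linarith)] at hb
  refine hb.trans_lt ?_
  rw [div_mul_eq_mul_div, div_lt_iff₀ hpos]
  nlinarith

theorem rect_eq {f : ℂ → ℂ} {a T lo hi : ℝ} (hf : ∀ μ : ℂ, μ.re ∈ Set.uIcc a T →
    μ.im ∈ Set.uIcc lo hi → DifferentiableAt ℂ f μ) :
    I * (vint f T lo hi - vint f a lo hi)
      = (∫ t in a..T, f (t + hi * I)) - ∫ t in a..T, f (t + lo * I) := by
  have h := integral_boundary_rect_eq_zero_of_differentiableOn f (a + lo * I) (T + hi * I)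
    (fun μ hμ => by
      obtain ⟨h1, h2⟩ := hμ
      simp at h1 h2
      exact (hf μ h1 h2).differentiableWithinAt)
  simp at h
  unfold vint
  linear_combination h

/-- Contour deformation for a function that is given by `fP` on the half strip
`lo ≤ Im μ ≤ mid` and by `fN` on the half strip `mid ≤ Im μ ≤ lo + 2π`, up to small jumps. -/
theorem norm_vint_sub_le {fP fN : ℂ → ℂ} {a lo mid D : ℝ} {L : ℂ}
    (h1 : lo ≤ mid) (h2 : mid ≤ lo + 2 * Real.pi)
    (hP : ∀ μ : ℂ, a ≤ μ.re → μ.im ∈ Set.Icc lo mid → DifferentiableAt ℂ fP μ)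
    (hN : ∀ μ : ℂ, a ≤ μ.re → μ.im ∈ Set.Icc mid (lo + 2 * Real.pi) → DifferentiableAt ℂ fN μ)
    (hmid : ∀ t : ℝ, a ≤ t → ‖fP (t + mid * I) - fN (t + mid * I)‖ ≤ D * Real.exp (-t))
    (hlo : ∀ t : ℝ, a ≤ t →
      ‖fP (t + lo * I) - fN (t + (lo + 2 * Real.pi : ℝ) * I)‖ ≤ D * Real.exp (-t))
    (hL : Tendsto (fun T : ℝ => vint fP T lo mid + vint fN T mid (lo + 2 * Real.pi)) atTop (𝓝 L)) :
    ‖vint fP a lo mid + vint fN a mid (lo + 2 * Real.pi) - L‖ ≤ 2 * D * Real.exp (-a) := by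
  have hD : 0 ≤ D := by
    have := (norm_nonneg _).trans (hmid a le_rfl)
    exact nonneg_of_mul_nonneg_left this (Real.exp_pos _)
  -- Moving the line from Re = a to Re = T by Cauchy's theorem on two rectangles leaves the
  -- integrals of the two jumps along horizontal segments. Each is at most D times the integral of
  -- e^{-t} over [a, T].
  have key : ∀ T : ℝ, a ≤ T → ‖vint fP a lo mid + vint fN a mid (lo + 2 * Real.pi) -
      (vint fP T lo mid + vint fN T mid (lo + 2 * Real.pi))‖ ≤ 2 * D * Real.exp (-a) := by
    intro T hT
    have e1 := rect_eq (f := fP) (a := a) (T := T) (lo := lo) (hi := mid) (fun μ k1 k2 => by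
      rw [Set.uIcc_of_le hT] at k1; rw [Set.uIcc_of_le h1] at k2; exact hP μ k1.1 k2)
    have e2 := rect_eq (f := fN) (a := a) (T := T) (lo := mid) (hi := lo + 2 * Real.pi)
      (fun μ k1 k2 => by
        rw [Set.uIcc_of_le hT] at k1; rw [Set.uIcc_of_le h2] at k2; exact hN μ k1.1 k2)
    have cP : ∀ b ∈ Set.Icc lo mid, IntervalIntegrable (fun t : ℝ => fP (t + b * I))
        MeasureTheory.volume a T := fun b hb => by
      refine ContinuousOn.intervalIntegrable fun t ht => ?_
      rw [Set.uIcc_of_le hT] at ht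
      have : ContinuousAt fP ((t : ℂ) + b * I) :=
        (hP (t + b * I) (by simpa using ht.1) (by simpa using hb)).continuousAt
      exact (ContinuousAt.comp (f := fun t : ℝ => (t : ℂ) + b * I) this
        (by fun_prop)).continuousWithinAt
    have cN : ∀ b ∈ Set.Icc mid (lo + 2 * Real.pi),
        IntervalIntegrable (fun t : ℝ => fN (t + b * I)) MeasureTheory.volume a T := fun b hb => by
      refine ContinuousOn.intervalIntegrable fun t ht => ?_
      rw [Set.uIcc_of_le hT] at ht
      have : ContinuousAt fN ((t : ℂ) + b * I) :=
        (hN (t + b * I) (by simpa using ht.1) (by simpa using hb)).continuousAt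
      exact (ContinuousAt.comp (f := fun t : ℝ => (t : ℂ) + b * I) this
        (by fun_prop)).continuousWithinAt
    have e3 := intervalIntegral.integral_sub (cP mid ⟨h1, le_rfl⟩) (cN mid ⟨le_rfl, h2⟩)
    have e4 := intervalIntegral.integral_sub (cP lo ⟨le_rfl, h1⟩)
      (cN (lo + 2 * Real.pi) ⟨h2, le_rfl⟩)
    have hexp : ∫ t in a..T, D * Real.exp (-t) ≤ D * Real.exp (-a) := by
      rw [intervalIntegral.integral_const_mul]
      have : ∫ t in a..T, Real.exp (-t) = Real.exp (-a) - Real.exp (-T) := by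
        rw [intervalIntegral.integral_comp_neg (fun t => Real.exp t)]
        simp
      rw [this]
      exact mul_le_mul_of_nonneg_left (by linarith [Real.exp_pos (-T)]) hD
    have ib : ∀ g : ℝ → ℂ, (∀ t, a ≤ t → ‖g t‖ ≤ D * Real.exp (-t)) →
        ‖∫ t in a..T, g t‖ ≤ D * Real.exp (-a) := fun g hg =>
      (intervalIntegral.norm_integral_le_of_norm_le hT
        (Eventually.of_forall fun t ht => hg t ht.1.le)
        ((by fun_prop : Continuous fun t => D * Real.exp (-t)).intervalIntegrable _ _)).trans hexp
    have i1 := ib _ hmid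
    have i2 := ib _ hlo
    rw [e3] at i1
    rw [e4] at i2
    have : ‖I * (vint fP a lo mid + vint fN a mid (lo + 2 * Real.pi) -
      (vint fP T lo mid + vint fN T mid (lo + 2 * Real.pi)))‖ ≤ 2 * D * Real.exp (-a) := by
      have e5 : I * (vint fP a lo mid + vint fN a mid (lo + 2 * Real.pi) -
          (vint fP T lo mid + vint fN T mid (lo + 2 * Real.pi)))
          = ((∫ t in a..T, fP (t + lo * I)) - ∫ t in a..T, fN (t + (lo + 2 * Real.pi : ℝ) * I))
            - ((∫ t in a..T, fP (t + mid * I)) - ∫ t in a..T, fN (t + mid * I)) := by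
        linear_combination -e1 - e2
      rw [e5]
      refine (norm_sub_le _ _).trans ?_
      linarith
    rwa [norm_mul, norm_I, one_mul] at this
  refine le_of_tendsto ((tendsto_const_nhds.sub hL).norm) ?_
  filter_upwards [eventually_ge_atTop a] with T hT using key T hT

/-! ### The periodic Cauchy kernel -/

/-- The `2πi`-periodic Cauchy kernel. -/
def kap (z : ℂ) : ℂ := (1 - exp (-z))⁻¹

theorem kap_add (z : ℂ) : kap (z + 2 * Real.pi * I) = kap z := by
  unfold kap
  rw [neg_add, exp_add, exp_neg (2 * Real.pi * I), exp_two_pi_mul_I]; simp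

/-- The kernel tends to 1 at the right end and to 0 at the left end. This reflection formula reduces
integrals at the left end of the cylinder to integrals at the right end. -/
theorem kap_neg {z : ℂ} (hz : exp z ≠ 1) : kap (-z) = 1 - kap z := by
  unfold kap
  have h1 : 1 - exp z ≠ 0 := sub_ne_zero.2 (Ne.symm hz)
  have h2 : exp z - 1 ≠ 0 := sub_ne_zero.2 hz
  rw [neg_neg, exp_neg]
  have h0 := exp_ne_zero z
  have h3 : 1 - (exp z)⁻¹ = (exp z - 1) / exp z := by field_simp
  rw [h3, inv_div]
  field_simp
  ring

theorem differentiableAt_kap {z : ℂ} (hz : exp (-z) ≠ 1) : DifferentiableAt ℂ kap z := by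
  unfold kap
  exact DifferentiableAt.inv (by fun_prop) (sub_ne_zero.2 (Ne.symm hz))

theorem norm_kap_le {z : ℂ} {r : ℝ} (hr : 0 < r) (hz : r ≤ z.re) : ‖kap z‖ ≤ (1 - Real.exp (-r))⁻¹ := by
  unfold kap
  rw [norm_inv]
  have h1 : Real.exp (-r) < 1 := by simpa using hr
  refine inv_anti₀ (by linarith) ?_
  have h2 : ‖exp (-z)‖ ≤ Real.exp (-r) := by
    rw [norm_exp, neg_re]; exact Real.exp_le_exp.2 (by linarith)
  have h3 := norm_sub_norm_le 1 (exp (-z))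
  rw [norm_one] at h3
  linarith

theorem exp_ne_one_of_re {z : ℂ} (hz : z.re ≠ 0) : exp z ≠ 1 := fun h => by
  have := congrArg norm h
  rw [norm_exp, norm_one, Real.exp_eq_one_iff] at this
  exact hz this

theorem tendsto_kap {lo hi : ℝ} (l : ℂ) :
    Tendsto (fun μ => kap (μ - l)) (stripAt lo hi) (𝓝 1) := by
  have h : Tendsto (fun μ : ℂ => exp (-(μ - l))) (stripAt lo hi) (𝓝 0) := by
    rw [tendsto_zero_iff_norm_tendsto_zero]
    have h1 := (tendsto_exp_neg_stripAt (lo := lo) (hi := hi)).mul_const (Real.exp l.re)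
    rw [zero_mul] at h1
    refine h1.congr fun μ => ?_
    rw [norm_exp, ← Real.exp_add]
    simp; ring
  have h2 := (h.const_sub 1).inv₀ (by simp)
  simpa [kap] using h2

/-! ### Pairs of functions with small jumps, and Cauchy's formula on the cylinder. -/

section

/-- Two entire functions that nearly agree on the overlaps of two half strips which together cover
a half cylinder, and have the same limit at its end. -/
structure SmallJump (β δ : ℝ) (c : ℂ) (sP sN : ℂ → ℂ) : Prop where
  dP : Differentiable ℂ sP
  dN : Differentiable ℂ sN
  up : ∀ μ : ℂ, 1 ≤ μ.re → |μ.im - (β + Real.pi)| ≤ 1 / 8 →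
    ‖sP μ - sN μ‖ ≤ δ * Real.exp (-(2 * μ.re))
  low : ∀ μ : ℂ, 1 ≤ μ.re → |μ.im - β| ≤ 1 / 8 →
    ‖sP μ - sN (μ + 2 * Real.pi * I)‖ ≤ δ * Real.exp (-(2 * μ.re))
  limP : Tendsto sP (stripAt (β - 1 / 8) (β + Real.pi + 1 / 8)) (𝓝 c)
  limN : Tendsto sN (stripAt (β + Real.pi - 1 / 8) (β + 2 * Real.pi + 1 / 8)) (𝓝 c)

variable {β δ : ℝ} {c : ℂ} {sP sN : ℂ → ℂ}

theorem SmallJump.nonneg (h : SmallJump β δ c sP sN) : 0 ≤ δ := by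
  have := (norm_nonneg _).trans (h.up (1 + (β + Real.pi : ℝ) * I) (by simp) (by simp))
  exact nonneg_of_mul_nonneg_left this (Real.exp_pos _)

/-- Turning the cylinder by π exchanges the roles of the two half-strips, so an estimate for the
first member of a pair also gives one for the second. -/
theorem SmallJump.shift (h : SmallJump β δ c sP sN) :
    SmallJump (β + Real.pi) δ c sN (fun μ => sP (μ - 2 * Real.pi * I)) where
  dP := h.dN
  dN := h.dP.comp (by fun_prop)
  up μ h1 h2 := by
    have := h.low (μ - 2 * Real.pi * I) (by simpa using h1) (by
      simp at h2 ⊢; convert h2 using 2; ring)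
    rw [norm_sub_rev]
    simpa using this
  low μ h1 h2 := by
    rw [norm_sub_rev]
    simpa using h.up μ h1 h2
  limP := h.limN.mono_left (stripAt_mono (by linarith) (by linarith))
  limN := by
    have := tendsto_add_two_pi (lo := β + Real.pi + Real.pi - 1 / 8)
      (hi := β + Real.pi + 2 * Real.pi + 1 / 8) (f := sP) (c := c) (-(2 * Real.pi))
      (h.limP.mono_left (stripAt_mono (by linarith) (by linarith)))
    refine this.congr fun μ => ?_
    congr 1; push_cast; ring

/-- The integral of a nearly continuous pair against a periodic kernel, over a period. -/
theorem SmallJump.norm_vint_mul_sub_le (h : SmallJump β δ c sP sN) {k : ℂ → ℂ} {a K : ℝ}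
    (ha : 1 ≤ a) (hk : ∀ μ : ℂ, a ≤ μ.re → DifferentiableAt ℂ k μ)
    (hper : ∀ μ, k (μ + 2 * Real.pi * I) = k μ) (hK : ∀ μ : ℂ, a ≤ μ.re → ‖k μ‖ ≤ K)
    (hlim : ∀ lo hi, Tendsto k (stripAt lo hi) (𝓝 1)) :
    ‖vint (fun μ => sP μ * k μ) a β (β + Real.pi) +
      vint (fun μ => sN μ * k μ) a (β + Real.pi) (β + 2 * Real.pi) - 2 * Real.pi * c‖
      ≤ 2 * δ * K := by
  have hpi := Real.pi_pos
  have hK0 : 0 ≤ K := (norm_nonneg _).trans (hK a (by simp))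
  have hδ := h.nonneg
  have hdP : ∀ μ : ℂ, a ≤ μ.re → DifferentiableAt ℂ (fun μ => sP μ * k μ) μ :=
    fun μ h1 => (h.dP μ).mul (hk μ h1)
  have hdN : ∀ μ : ℂ, a ≤ μ.re → DifferentiableAt ℂ (fun μ => sN μ * k μ) μ :=
    fun μ h1 => (h.dN μ).mul (hk μ h1)
  have hexp : ∀ t : ℝ, a ≤ t → Real.exp (-(2 * t)) ≤ Real.exp (-t) := fun t ht =>
    Real.exp_le_exp.2 (by linarith)
  have main := norm_vint_sub_le (fP := fun μ => sP μ * k μ) (fN := fun μ => sN μ * k μ)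
    (a := a) (lo := β) (mid := β + Real.pi) (D := δ * K) (L := 2 * Real.pi * c)
    (by linarith) (by linarith) (fun μ h1 _ => hdP μ h1) (fun μ h1 _ => hdN μ h1) ?_ ?_ ?_
  · refine main.trans ?_
    have : Real.exp (-a) ≤ 1 := Real.exp_le_one_iff.2 (by linarith)
    nlinarith [mul_nonneg hδ hK0]
  · intro t ht
    have h1 := h.up (t + (β + Real.pi : ℝ) * I) (by simpa using ha.trans ht) (by simp)
    have h2 := hK (t + (β + Real.pi : ℝ) * I) (by simpa using ht)
    simp only [add_re, ofReal_re, mul_re, I_re, mul_zero, ofReal_im, I_im, mul_one, sub_self,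
      add_zero] at h1
    rw [← sub_mul, norm_mul]
    have := mul_le_mul (h1.trans (mul_le_mul_of_nonneg_left (hexp t ht) hδ)) h2 (norm_nonneg _)
      (by positivity)
    linarith
  · intro t ht
    have h1 := h.low (t + β * I) (by simpa using ha.trans ht) (by simp)
    have h2 := hK (t + β * I) (by simpa using ht)
    simp only [add_re, ofReal_re, mul_re, I_re, mul_zero, ofReal_im, I_im, mul_one, sub_self,
      add_zero] at h1
    have e : (t : ℂ) + (β + 2 * Real.pi : ℝ) * I = t + β * I + 2 * Real.pi * I := by
      push_cast; ring
    rw [e, hper, ← sub_mul, norm_mul]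
    have := mul_le_mul (h1.trans (mul_le_mul_of_nonneg_left (hexp t ht) hδ)) h2 (norm_nonneg _)
      (by positivity)
    linarith
  · have l1 := tendsto_vint (f := fun μ => sP μ * k μ) (lo := β) (hi := β + Real.pi)
      (c := c * 1) (by linarith) ⟨a, fun μ h1 _ => (hdP μ h1).continuousAt⟩
      ((h.limP.mono_left (stripAt_mono (by linarith) (by linarith))).mul (hlim _ _))
    have l2 := tendsto_vint (f := fun μ => sN μ * k μ) (lo := β + Real.pi)
      (hi := β + 2 * Real.pi) (c := c * 1) (by linarith)
      ⟨a, fun μ h1 _ => (hdN μ h1).continuousAt⟩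
      ((h.limN.mono_left (stripAt_mono (by linarith) (by linarith))).mul (hlim _ _))
    have := l1.add l2
    convert this using 2
    push_cast; ring

theorem vint_add {f : ℂ → ℂ} {a lo mid hi : ℝ} (hf : ∀ μ : ℂ, μ.re = a → ContinuousAt f μ) :
    vint f a lo mid + vint f a mid hi = vint f a lo hi := by
  have : Continuous fun y : ℝ => f (a + y * I) := continuous_iff_continuousAt.2 fun y =>
    ContinuousAt.comp (f := fun y : ℝ => (a : ℂ) + y * I) (hf _ (by simp)) (by fun_prop)
  exact intervalIntegral.integral_add_adjacent_intervals (this.intervalIntegrable _ _)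
    (this.intervalIntegrable _ _)

/-- To the right of the pole the line can be pushed to +∞, where the kernel is 1. -/
theorem vint_kap_of_lt {a lo : ℝ} {l : ℂ} (h : l.re < a) :
    vint (fun μ => kap (μ - l)) a lo (lo + 2 * Real.pi) = 2 * Real.pi := by
  have hpi := Real.pi_pos
  have hd : ∀ μ : ℂ, a ≤ μ.re → DifferentiableAt ℂ (fun μ => kap (μ - l)) μ := fun μ hμ =>
    (differentiableAt_kap (exp_ne_one_of_re (by simp; linarith))).comp μ (by fun_prop)
  have := norm_vint_sub_le (fP := fun μ => kap (μ - l)) (fN := fun μ => kap (μ - l))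
    (a := a) (lo := lo) (mid := lo + Real.pi) (D := 0) (L := 2 * Real.pi)
    (by linarith) (by linarith) (fun μ h1 _ => hd μ h1) (fun μ h1 _ => hd μ h1)
    (by simp) (fun t _ => by
      have e : (t : ℂ) + (lo + 2 * Real.pi : ℝ) * I - l = (t + lo * I - l) + 2 * Real.pi * I := by
        push_cast; ring
      rw [e, kap_add]; simp) ?_
  · rw [mul_zero, zero_mul, norm_le_zero_iff, sub_eq_zero] at this
    rw [← this, vint_add]
    exact fun μ hμ => (hd μ hμ.ge).continuousAt
  · have l1 := tendsto_vint (lo := lo) (hi := lo + Real.pi)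
      (by linarith) ⟨a, fun μ h1 _ => (hd μ h1).continuousAt⟩ (tendsto_kap l)
    have l2 := tendsto_vint (lo := lo + Real.pi) (hi := lo + 2 * Real.pi)
      (by linarith) ⟨a, fun μ h1 _ => (hd μ h1).continuousAt⟩ (tendsto_kap l)
    have := l1.add l2
    convert this using 2
    push_cast; ring

theorem vint_comp_neg (f : ℂ → ℂ) (a lo hi : ℝ) :
    vint (fun μ => f (-μ)) a lo hi = vint f (-a) (-hi) (-lo) := by
  unfold vint
  have := intervalIntegral.integral_comp_neg (a := lo) (b := hi) fun y : ℝ => f ((-a : ℝ) + y * I)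
  rw [← this]
  refine intervalIntegral.integral_congr fun y _ => ?_
  show f _ = f _
  congr 1; push_cast; ring

/-- Reduced by `kap_neg` to the integral on the other side of the pole, which equals the length of
the period. -/
theorem vint_kap_of_gt {a lo : ℝ} {l : ℂ} (h : a < l.re) :
    vint (fun μ => kap (μ - l)) a lo (lo + 2 * Real.pi) = 0 := by
  have h1 : vint (fun μ => kap (μ - l)) a lo (lo + 2 * Real.pi)
      = vint (fun μ => 1 - kap (-μ - -l)) a lo (lo + 2 * Real.pi) := by
    unfold vint
    refine intervalIntegral.integral_congr fun y _ => ?_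
    show kap (a + y * I - l) = 1 - kap (-(a + y * I) - -l)
    rw [show (a + y * I - l : ℂ) = - (-(a + y * I) - -l) by ring, kap_neg]
    exact exp_ne_one_of_re (by simp; linarith)
  have h2 : Continuous fun y : ℝ => kap (-((a : ℂ) + y * I) - -l) :=
    continuous_iff_continuousAt.2 fun y => ContinuousAt.comp
      (f := fun y : ℝ => -((a : ℂ) + y * I) - -l)
      (differentiableAt_kap (exp_ne_one_of_re (by simp; linarith))).continuousAt (by fun_prop)
  have h3 : vint (fun μ => 1 - kap (-μ - -l)) a lo (lo + 2 * Real.pi)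
      = 2 * Real.pi - vint (fun μ => kap (-μ - -l)) a lo (lo + 2 * Real.pi) := by
    unfold vint
    rw [intervalIntegral.integral_sub (by simp) (h2.intervalIntegrable _ _)]
    simp
  rw [h1, h3, vint_comp_neg (fun μ => kap (μ - -l))]
  have := vint_kap_of_lt (a := -a) (lo := -(lo + 2 * Real.pi)) (l := -l) (by simpa using h)
  rw [show -(lo + 2 * Real.pi) + 2 * Real.pi = -lo by ring] at this
  rw [this, sub_self]

/-- `(s μ - s l) κ(μ - l)`, extended over `l`. -/
def diffKap (s : ℂ → ℂ) (l μ : ℂ) : ℂ :=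
  dslope s l μ / dslope (fun z => 1 - exp (-(z - l))) l μ

theorem diffKap_of_ne {s : ℂ → ℂ} {l μ : ℂ} (h : μ ≠ l) :
    diffKap s l μ = (s μ - s l) * kap (μ - l) := by
  unfold diffKap kap
  rw [dslope_of_ne _ h, dslope_of_ne _ h, slope_def_field, slope_def_field]
  have h1 : μ - l ≠ 0 := sub_ne_zero.2 h
  simp only [sub_self, neg_zero, exp_zero, sub_zero]
  rw [div_div_div_cancel_right₀ h1, div_eq_mul_inv]

theorem exp_ne_one_of_im {z : ℂ} (h0 : z ≠ 0) (h : |z.im| < 2 * Real.pi) : exp z ≠ 1 := by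
  rw [Ne, exp_eq_one_iff]
  rintro ⟨n, hn⟩
  have h1 : z.im = n * (2 * Real.pi) := by rw [hn]; simp
  rw [h1, abs_mul, abs_of_pos Real.two_pi_pos] at h
  have h2 : |(n : ℝ)| < 1 := by
    by_contra hc
    push Not at hc
    nlinarith [Real.two_pi_pos]
  have h3 : n = 0 := by
    have : |n| < 1 := by exact_mod_cast h2
    exact Int.abs_lt_one_iff.1 this
  rw [h3] at hn
  simp at hn
  exact h0 hn

/-- In the strip of half-width 2π about l the only zero of 1 - e^{-(μ - l)} is μ = l, and it is
simple, so the divided slope in the denominator has no zero there. -/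
theorem differentiableAt_diffKap {s : ℂ → ℂ} (hs : Differentiable ℂ s) {l μ : ℂ}
    (h : |(μ - l).im| < 2 * Real.pi) : DifferentiableAt ℂ (diffKap s l) μ := by
  have hd : ∀ f : ℂ → ℂ, Differentiable ℂ f → Differentiable ℂ (dslope f l) := fun f hf =>
    differentiableOn_univ.1 ((differentiableOn_dslope univ_mem).2 hf.differentiableOn)
  have hg : Differentiable ℂ fun z => 1 - exp (-(z - l)) := by fun_prop
  refine (hd s hs μ).div (hd _ hg μ) ?_
  rcases eq_or_ne μ l with rfl | hne
  · rw [dslope_same]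
    have : HasDerivAt (fun z => 1 - exp (-(z - μ))) 1 μ := by
      have h1 : HasDerivAt (fun z => -(z - μ)) (-1) μ := ((hasDerivAt_id μ).sub_const μ).neg
      have h2 := (h1.cexp).const_sub 1
      simpa using h2
    rw [this.deriv]; exact one_ne_zero
  · rw [dslope_of_ne _ hne, slope_def_field]
    refine div_ne_zero ?_ (sub_ne_zero.2 hne)
    simp only [sub_self, neg_zero, exp_zero, sub_zero]
    refine sub_ne_zero.2 (Ne.symm (exp_ne_one_of_im ?_ ?_))
    · exact neg_ne_zero.2 (sub_ne_zero.2 hne)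
    · rwa [neg_im, abs_neg]

/-- Cauchy's formula on an annulus, in the logarithmic coordinate. -/
theorem cauchy_annulus {r : ℂ → ℂ} (hr : Differentiable ℂ r)
    (hper : ∀ μ, r (μ + 2 * Real.pi * I) = r μ) {a b : ℝ} {l : ℂ} (ha : a < l.re) (hb : l.re < b) :
    vint (fun μ => r μ * kap (μ - l)) b (l.im - Real.pi) (l.im + Real.pi) -
      vint (fun μ => r μ * kap (μ - l)) a (l.im - Real.pi) (l.im + Real.pi)
      = 2 * Real.pi * r l := by
  have hpi := Real.pi_pos
  have hR := rect_eq (f := diffKap r l) (a := a) (T := b) (lo := l.im - Real.pi)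
    (hi := l.im + Real.pi) (fun μ _ h2 => differentiableAt_diffKap hr (by
      rw [Set.uIcc_of_le (by linarith)] at h2
      rw [sub_im, abs_lt]; constructor <;> linarith [h2.1, h2.2]))
  -- The horizontal sides are a period apart and avoid l, so the explicit formula for `diffKap`
  -- applies on both and is periodic.
  have hside : ∀ t : ℝ, diffKap r l (t + (l.im + Real.pi : ℝ) * I)
      = diffKap r l (t + (l.im - Real.pi : ℝ) * I) := fun t => by
    have n1 : (t + (l.im + Real.pi : ℝ) * I : ℂ) ≠ l := fun h => by
      have := congrArg Complex.im h
      simp at this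
    have n2 : (t + (l.im - Real.pi : ℝ) * I : ℂ) ≠ l := fun h => by
      have := congrArg Complex.im h
      simp at this
    rw [diffKap_of_ne n1, diffKap_of_ne n2]
    have e : (t + (l.im + Real.pi : ℝ) * I : ℂ)
        = t + (l.im - Real.pi : ℝ) * I + 2 * Real.pi * I := by push_cast; ring
    rw [e, hper, add_sub_right_comm, kap_add]
  -- On vertical lines that avoid l the subtracted constant r l multiplies the integral of the
  -- kernel alone, which is 2π to the right of l and 0 to the left.
  have hline : ∀ t : ℝ, t ≠ l.re → vint (diffKap r l) t (l.im - Real.pi) (l.im + Real.pi)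
      = vint (fun μ => r μ * kap (μ - l)) t (l.im - Real.pi) (l.im + Real.pi)
        - r l * vint (fun μ => kap (μ - l)) t (l.im - Real.pi) (l.im + Real.pi) := fun t ht => by
    unfold vint
    have c1 : Continuous fun y : ℝ => kap ((t : ℂ) + y * I - l) :=
      continuous_iff_continuousAt.2 fun y => ContinuousAt.comp
        (f := fun y : ℝ => (t : ℂ) + y * I - l)
        (differentiableAt_kap (exp_ne_one_of_re (by simpa [sub_eq_zero] using ht.symm))).continuousAt
        (by fun_prop)
    have c2 : Continuous fun y : ℝ => r ((t : ℂ) + y * I) := hr.continuous.comp (by fun_prop)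
    rw [← intervalIntegral.integral_const_mul]
    refine Eq.trans ?_ (intervalIntegral.integral_sub ((c2.mul c1).intervalIntegrable _ _) ((c1.const_mul (r l)).intervalIntegrable _ _))
    refine intervalIntegral.integral_congr fun y _ => ?_
    show diffKap r l _ = r (t + y * I) * kap (t + y * I - l) - r l * kap (t + y * I - l)
    rw [diffKap_of_ne (fun h => ht (by have := congrArg Complex.re h; simpa using this)), sub_mul]
  simp only [hside, sub_self, mul_eq_zero, I_ne_zero, false_or] at hR
  rw [hline b hb.ne', hline a ha.ne] at hR
  have k1 := vint_kap_of_lt (lo := l.im - Real.pi) hb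
  have k2 := vint_kap_of_gt (lo := l.im - Real.pi) ha
  rw [show l.im - Real.pi + 2 * Real.pi = l.im + Real.pi by ring] at k1 k2
  rw [k1, k2] at hR
  linear_combination hR

end

/-! ### Estimates at the ends and in the middle of the cylinder. -/

section

variable {β δ : ℝ} {c : ℂ} {sP sN : ℂ → ℂ}

theorem norm_vint_le {f : ℂ → ℂ} {a lo hi B : ℝ} (h : lo ≤ hi)
    (hf : ∀ μ : ℂ, μ.re = a → μ.im ∈ Set.Icc lo hi → ‖f μ‖ ≤ B) :
    ‖vint f a lo hi‖ ≤ B * (hi - lo) := by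
  rw [← abs_of_nonneg (sub_nonneg.2 h)]
  refine intervalIntegral.norm_integral_le_of_norm_le_const fun y hy => ?_
  rw [Set.uIoc_of_le h] at hy
  exact hf _ (by simp) (by simpa using ⟨hy.1.le, hy.2⟩)

theorem norm_kap_eq (z : ℂ) : ‖kap z‖ = Real.exp z.re / ‖exp z - 1‖ := by
  unfold kap
  have h0 := exp_ne_zero z
  have : 1 - exp (-z) = (exp z - 1) / exp z := by rw [exp_neg]; field_simp
  rw [this, inv_div, norm_div, norm_exp]

/-- With R = e^{Re z}, the range of Im z gives |e^z - 1|² ≥ R² - 2R cos(1/8) + 1 ≥ sin²(1/8) ≥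
0.12², and 1/0.12 < 9. -/
theorem norm_kap_le_of_im {z : ℂ} (h1 : 1 / 8 ≤ |z.im|) (h2 : |z.im| ≤ Real.pi + 1 / 8) :
    ‖kap z‖ ≤ 9 * Real.exp z.re := by
  have hpi := Real.pi_gt_three
  have hcos : Real.cos z.im ≤ Real.cos (1 / 8) := by
    rw [← Real.cos_abs]
    rcases le_or_gt |z.im| Real.pi with h | h
    · exact Real.cos_le_cos_of_nonneg_of_le_pi (by norm_num) h h1
    · exact (Real.cos_nonpos_of_pi_div_two_le_of_le (by linarith) (by linarith)).trans
        (Real.cos_nonneg_of_mem_Icc ⟨by linarith, by linarith⟩)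
  have hsin : 0.12 < Real.sin (1 / 8) := by
    have := Real.sin_gt_sub_cube (x := 1 / 8) (by norm_num)
    norm_num at this ⊢; linarith
  have hn : 0.12 ≤ ‖exp z - 1‖ := by
    refine le_of_sq_le_sq ?_ (norm_nonneg _) |>.trans le_rfl
    rw [← normSq_eq_norm_sq, normSq_apply]
    simp only [sub_re, sub_im, exp_re, exp_im, one_re, one_im, sub_zero]
    have e1 := Real.sin_sq_add_cos_sq z.im
    have e2 := Real.sin_sq_add_cos_sq (1 / 8)
    have e3 := Real.exp_pos z.re
    have e4 := mul_le_mul_of_nonneg_left hcos e3.le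
    have e5 := sq_nonneg (Real.exp z.re - Real.cos (1 / 8))
    have e6 : 0.12 ^ 2 ≤ Real.sin (1 / 8) ^ 2 := pow_le_pow_left₀ (by norm_num) hsin.le 2
    have e7 : (Real.exp z.re * Real.cos z.im - 1) * (Real.exp z.re * Real.cos z.im - 1) +
        Real.exp z.re * Real.sin z.im * (Real.exp z.re * Real.sin z.im)
        = Real.exp z.re ^ 2 - 2 * (Real.exp z.re * Real.cos z.im) + 1 := by
      linear_combination Real.exp z.re ^ 2 * e1
    rw [e7]
    nlinarith
  rw [norm_kap_eq, div_le_iff₀ (by linarith)]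
  nlinarith [Real.exp_pos z.re]

/-- The function (s(μ) - sP(l))κ(μ - l) is integrated over a period, on the line Re μ = 1 and far to
the right. The far integral tends to 2π(c - sP(l)). On Re μ = 1 the kernel is O(e^{-Re l}). The
lines along which sP and sN are matched lie 1/8 outside the strip that contains l, so κ = O(e^{Re μ
- Re l}) on them. A jump of size e^{-2 Re μ} is therefore still integrable against κ and leaves a
factor e^{-Re l}. -/
theorem SmallJump.norm_sub_limit_le (h : SmallJump β δ c sP sN) {c' : ℂ} {δ' : ℝ}
    (hP : ∀ μ : ℂ, μ.re = 1 → μ.im ∈ Set.Icc (β - 1 / 8) (β + Real.pi + 1 / 8) → ‖sP μ - c'‖ ≤ δ')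
    (hN : ∀ μ : ℂ, μ.re = 1 → μ.im ∈ Set.Icc (β + Real.pi - 1 / 8) (β + 2 * Real.pi + 1 / 8) →
      ‖sN μ - c'‖ ≤ δ') {l : ℂ} (hl : 2 ≤ l.re) (hli : l.im ∈ Set.Icc β (β + Real.pi)) :
    ‖sP l - c‖ ≤ 10 * (δ + δ') * Real.exp (-l.re) := by
  have hpi := Real.pi_gt_three
  have hpi4 := Real.pi_le_four
  have hδ := h.nonneg
  obtain ⟨hl1, hl2⟩ := hli
  have hδ' : 0 ≤ δ' := (norm_nonneg _).trans (hP (1 + β * I) (by simp) (by simp; linarith))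
  set E := Real.exp (-l.re) with hE
  have hEp : 0 < E := Real.exp_pos _
  have hkd : ∀ μ : ℂ, μ.im ∈ Set.Icc (β + Real.pi + 1 / 8) (β + 2 * Real.pi - 1 / 8) →
      DifferentiableAt ℂ (fun μ => (sN μ - sP l) * kap (μ - l)) μ := fun μ hμ => by
    obtain ⟨h1, h2⟩ := hμ
    refine ((h.dN μ).sub_const _).mul
      ((differentiableAt_kap (exp_ne_one_of_im ?_ ?_)).comp μ (by fun_prop))
    · intro h0
      have := congrArg Complex.im h0
      simp at this; linarith
    · rw [neg_im, abs_neg, sub_im, abs_lt]; constructor <;> linarith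
  have hdd : ∀ μ : ℂ, μ.im ∈ Set.Icc (β - 1 / 8) (β + Real.pi + 1 / 8) →
      DifferentiableAt ℂ (diffKap sP l) μ := fun μ hμ => by
    refine differentiableAt_diffKap h.dP ?_
    rw [sub_im, abs_lt]; constructor <;> linarith [hμ.1, hμ.2]
  have hper : ∀ μ, kap (μ + 2 * Real.pi * I - l) = kap (μ - l) := fun μ => by
    rw [add_sub_right_comm, kap_add]
  have main := norm_vint_sub_le (fP := diffKap sP l) (fN := fun μ => (sN μ - sP l) * kap (μ - l))
    (a := 1) (lo := β - 1 / 8) (mid := β + Real.pi + 1 / 8) (D := δ * (9 * E))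
    (L := 2 * Real.pi * (c - sP l)) (by linarith) (by linarith)
    (fun μ _ h2 => hdd μ h2) (fun μ _ h2 => hkd μ ⟨h2.1, by linarith [h2.2]⟩) ?_ ?_ ?_
  rotate_left
  · intro t ht
    have hne : (t : ℂ) + (β + Real.pi + 1 / 8 : ℝ) * I ≠ l := fun h0 => by
      have := congrArg Complex.im h0
      simp at this; linarith
    rw [diffKap_of_ne hne, ← sub_mul, sub_sub_sub_cancel_right, norm_mul]
    have k1 := h.up (t + (β + Real.pi + 1 / 8 : ℝ) * I) (by simpa using ht) (by
      simp only [add_im, ofReal_im, mul_im, ofReal_re, I_im, I_re]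
      rw [abs_le]; constructor <;> ring_nf <;> norm_num)
    have k2 := norm_kap_le_of_im (z := t + (β + Real.pi + 1 / 8 : ℝ) * I - l)
      (by rw [le_abs]; left; simp; linarith) (by rw [abs_le]; simp; constructor <;> linarith)
    simp only [sub_re, add_re, ofReal_re, mul_re, I_re, mul_zero, ofReal_im, I_im, mul_one,
      sub_self, add_zero] at k1 k2
    refine (mul_le_mul k1 k2 (norm_nonneg _) (by positivity)).trans (le_of_eq ?_)
    rw [hE, show -(2 * t) = -t + -t by ring, Real.exp_add, sub_eq_add_neg, Real.exp_add,
      Real.exp_neg t]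
    have := (Real.exp_pos t).ne'
    field_simp
  · intro t ht
    have hne : (t : ℂ) + (β - 1 / 8 : ℝ) * I ≠ l := fun h0 => by
      have := congrArg Complex.im h0
      simp at this; linarith
    have e : (t : ℂ) + (β - 1 / 8 + 2 * Real.pi : ℝ) * I
        = t + (β - 1 / 8 : ℝ) * I + 2 * Real.pi * I := by push_cast; ring
    rw [diffKap_of_ne hne, e, hper, ← sub_mul, sub_sub_sub_cancel_right, norm_mul]
    have k1 := h.low (t + (β - 1 / 8 : ℝ) * I) (by simpa using ht) (by
      simp only [add_im, ofReal_im, mul_im, ofReal_re, I_im, I_re]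
      rw [abs_le]; constructor <;> ring_nf <;> norm_num)
    have k2 := norm_kap_le_of_im (z := t + (β - 1 / 8 : ℝ) * I - l)
      (by rw [le_abs]; right; simp; linarith) (by rw [abs_le]; simp; constructor <;> linarith)
    simp only [sub_re, add_re, ofReal_re, mul_re, I_re, mul_zero, ofReal_im, I_im, mul_one,
      sub_self, add_zero] at k1 k2
    refine (mul_le_mul k1 k2 (norm_nonneg _) (by positivity)).trans (le_of_eq ?_)
    rw [hE, show -(2 * t) = -t + -t by ring, Real.exp_add, sub_eq_add_neg, Real.exp_add,
      Real.exp_neg t]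
    have := (Real.exp_pos t).ne'
    field_simp
  · have l1 := tendsto_vint (f := diffKap sP l) (lo := β - 1 / 8) (hi := β + Real.pi + 1 / 8)
      (c := (c - sP l) * 1) (by linarith) ⟨1, fun μ _ h2 => (hdd μ h2).continuousAt⟩ (by
        refine ((h.limP.sub_const (sP l)).mul (tendsto_kap l)).congr' ?_
        refine eventually_stripAt.2 ⟨l.re + 1, fun μ hμ _ => ?_⟩
        exact (diffKap_of_ne (fun h0 => by rw [h0] at hμ; linarith)).symm)
    have l2 := tendsto_vint (f := fun μ => (sN μ - sP l) * kap (μ - l))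
      (lo := β + Real.pi + 1 / 8) (hi := β - 1 / 8 + 2 * Real.pi)
      (c := (c - sP l) * 1) (by linarith)
      ⟨1, fun μ _ h2 => (hkd μ ⟨h2.1, by linarith [h2.2]⟩).continuousAt⟩
      (((h.limN.mono_left (stripAt_mono (by linarith) (by linarith))).sub_const _).mul
        (tendsto_kap l))
    have := l1.add l2
    convert this using 2
    push_cast; ring
  -- Here |e^{μ - l}| = e · e^{-Re l} ≤ 1/2, so the denominator of the kernel is at least 1/2 and
  -- the quotient is at most 2e · E < 6E.
  have hk1 : ∀ μ : ℂ, μ.re = 1 → ‖kap (μ - l)‖ ≤ 6 * E := fun μ hμ => by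
    have hz : (μ - l).re = 1 + -l.re := by simp [hμ]; ring
    have he1 := Real.exp_one_lt_d9
    have hexp : Real.exp (1 + -l.re) = Real.exp 1 * E := by rw [Real.exp_add]
    have hsmall : Real.exp (1 + -l.re) ≤ 1 / 2 := by
      have h3 : Real.exp (1 + -l.re) ≤ Real.exp (-1) := Real.exp_le_exp.2 (by linarith)
      have h4 : Real.exp (-1) ≤ 1 / 2 := by
        rw [Real.exp_neg, inv_le_comm₀ (Real.exp_pos _) (by norm_num)]
        have := Real.exp_one_gt_d9; norm_num at this ⊢; linarith
      linarith
    have hb : 1 / 2 ≤ ‖exp (μ - l) - 1‖ := by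
      have h3 := norm_sub_norm_le 1 (exp (μ - l))
      rw [norm_one, norm_sub_rev, norm_exp, hz] at h3
      linarith
    rw [norm_kap_eq, hz, div_le_iff₀ (by linarith), hexp]
    nlinarith [mul_pos hEp (norm_pos_iff.2 (fun h0 => by rw [h0, norm_zero] at hb; linarith :
      exp (μ - l) - 1 ≠ 0))]
  have hck : ∀ μ : ℂ, μ.re = 1 → ContinuousAt (fun μ => kap (μ - l)) μ := fun μ hμ =>
    ((differentiableAt_kap (exp_ne_one_of_re (by simp [hμ]; linarith))).comp μ
      (by fun_prop)).continuousAt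
  have hci : ∀ (f : ℂ → ℂ), Differentiable ℂ f → ∀ a b, IntervalIntegrable
      (fun y : ℝ => f ((1 : ℝ) + y * I) * kap ((1 : ℝ) + y * I - l)) MeasureTheory.volume a b := by
    intro f hf a b
    refine Continuous.intervalIntegrable (continuous_iff_continuousAt.2 fun y => ?_) _ _
    exact ContinuousAt.comp (f := fun y : ℝ => ((1 : ℝ) : ℂ) + y * I)
      (g := fun μ => f μ * kap (μ - l)) ((hf _).continuousAt.mul (hck _ (by simp))) (by fun_prop)
  have hsplit : ∀ (s : ℂ → ℂ), Differentiable ℂ s → ∀ a b,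
      vint (fun μ => (s μ - sP l) * kap (μ - l)) 1 a b
      = vint (fun μ => (s μ - c') * kap (μ - l)) 1 a b
        + (c' - sP l) * vint (fun μ => kap (μ - l)) 1 a b := by
    intro s hs a b
    unfold vint
    rw [← intervalIntegral.integral_const_mul]
    refine Eq.trans ?_ (intervalIntegral.integral_add
      (hci (fun μ => s μ - c') (hs.sub_const _) a b)
      (hci (fun _ => c' - sP l) (differentiable_const _) a b))
    refine intervalIntegral.integral_congr fun y _ => ?_
    show _ = (s _ - c') * kap _ + (c' - sP l) * kap _
    ring
  have hfirst : vint (diffKap sP l) 1 (β - 1 / 8) (β + Real.pi + 1 / 8)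
      = vint (fun μ => (sP μ - sP l) * kap (μ - l)) 1 (β - 1 / 8) (β + Real.pi + 1 / 8) := by
    refine intervalIntegral.integral_congr fun y _ => diffKap_of_ne fun h0 => ?_
    have := congrArg Complex.re h0
    simp at this; linarith
  rw [hfirst, hsplit sP h.dP, hsplit sN h.dN] at main
  -- The line Re μ = 1 is to the left of l, so the kernel has integral 0 over a period. The unknown
  -- sP l in the integrand may therefore be replaced by c', from which sP and sN differ by at most
  -- δ'.
  have hzero := vint_kap_of_gt (a := 1) (lo := β - 1 / 8) (l := l) (by linarith)
  rw [← vint_add (mid := β + Real.pi + 1 / 8) hck] at hzero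
  have b1 := norm_vint_le (f := fun μ => (sP μ - c') * kap (μ - l)) (a := 1) (lo := β - 1 / 8)
    (hi := β + Real.pi + 1 / 8) (B := δ' * (6 * E)) (by linarith) fun μ h1 h2 => by
      rw [norm_mul]; exact mul_le_mul (hP μ h1 h2) (hk1 μ h1) (norm_nonneg _) hδ'
  have b2 := norm_vint_le (f := fun μ => (sN μ - c') * kap (μ - l)) (a := 1)
    (lo := β + Real.pi + 1 / 8) (hi := β - 1 / 8 + 2 * Real.pi) (B := δ' * (6 * E)) (by linarith)
    fun μ h1 h2 => by
      rw [norm_mul]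
      exact mul_le_mul (hN μ h1 ⟨by linarith [h2.1], by linarith [h2.2]⟩) (hk1 μ h1)
        (norm_nonneg _) hδ'
  set A1 := vint (fun μ => (sP μ - c') * kap (μ - l)) 1 (β - 1 / 8) (β + Real.pi + 1 / 8)
  set A2 := vint (fun μ => (sN μ - c') * kap (μ - l)) 1 (β + Real.pi + 1 / 8)
    (β - 1 / 8 + 2 * Real.pi)
  set k1 := vint (fun μ => kap (μ - l)) 1 (β - 1 / 8) (β + Real.pi + 1 / 8)
  set k2 := vint (fun μ => kap (μ - l)) 1 (β + Real.pi + 1 / 8) (β - 1 / 8 + 2 * Real.pi)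
  have e1 : 2 * Real.pi * (sP l - c) = (A1 + (c' - sP l) * k1 + (A2 + (c' - sP l) * k2)
      - 2 * Real.pi * (c - sP l)) - A1 - A2 := by
    linear_combination (-(c' - sP l)) * hzero
  have e2 : ‖2 * Real.pi * (sP l - c)‖ ≤ 2 * (δ * (9 * E)) * Real.exp (-1)
      + δ' * (6 * E) * (2 * Real.pi) := by
    rw [e1]
    refine (norm_sub_le _ _).trans ((add_le_add_left (norm_sub_le _ _) _).trans ?_)
    have : δ' * (6 * E) * (2 * Real.pi)
        = δ' * (6 * E) * (β + Real.pi + 1 / 8 - (β - 1 / 8))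
          + δ' * (6 * E) * (β - 1 / 8 + 2 * Real.pi - (β + Real.pi + 1 / 8)) := by ring
    linarith
  have hem : Real.exp (-1) ≤ 1 := Real.exp_le_one_iff.2 (by norm_num)
  have e3 : ‖2 * Real.pi * (sP l - c)‖ = 2 * Real.pi * ‖sP l - c‖ := by
    rw [norm_mul, norm_mul, norm_real, Real.norm_of_nonneg Real.pi_pos.le]; simp
  rw [e3] at e2
  have hδE : 0 ≤ δ * E := by positivity
  have hδE' : 0 ≤ δ' * E := by positivity
  have e4 : 2 * (δ * (9 * E)) * Real.exp (-1) ≤ 18 * (δ * E) := by nlinarith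
  have e5 : 2 * Real.pi * ‖sP l - c‖ ≤ 2 * Real.pi * (10 * (δ + δ') * E) := by
    refine e2.trans ?_
    have : 18 * (δ * E) ≤ 2 * Real.pi * 10 * (δ * E) :=
      mul_le_mul_of_nonneg_right (by linarith) hδE
    have h' : δ' * (6 * E) * (2 * Real.pi) ≤ 2 * Real.pi * 10 * (δ' * E) := by
      nlinarith [mul_nonneg hδE' Real.pi_pos.le]
    linarith
  exact le_of_mul_le_mul_left e5 (by positivity)

/-- The comparison estimates on the cylinder: a periodic entire function which nearly agrees, over
the two ends of the cylinder, with nearly continuous pairs, is nearly constant. -/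
theorem cylinder_estimate {r tP tN : ℂ → ℂ} {c₀ : ℂ} (hr : Differentiable ℂ r)
    (hper : ∀ μ, r (μ + 2 * Real.pi * I) = r μ)
    (hs : SmallJump β δ c sP sN) (ht : SmallJump β δ c₀ tP tN)
    (hsP : ∀ μ : ℂ, μ.re ∈ Set.Icc 1 3 → μ.im ∈ Set.Icc (β - 1 / 8) (β + Real.pi + 1 / 8) →
      ‖sP μ - r μ‖ ≤ δ)
    (hsN : ∀ μ : ℂ, μ.re ∈ Set.Icc 1 3 →
      μ.im ∈ Set.Icc (β + Real.pi - 1 / 8) (β + 2 * Real.pi + 1 / 8) → ‖sN μ - r μ‖ ≤ δ)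
    (htP : ∀ μ : ℂ, μ.re ∈ Set.Icc 1 3 → μ.im ∈ Set.Icc (β - 1 / 8) (β + Real.pi + 1 / 8) →
      ‖tP μ - r (-μ)‖ ≤ δ)
    (htN : ∀ μ : ℂ, μ.re ∈ Set.Icc 1 3 →
      μ.im ∈ Set.Icc (β + Real.pi - 1 / 8) (β + 2 * Real.pi + 1 / 8) → ‖tN μ - r (-μ)‖ ≤ δ) :
    (∀ l : ℂ, |l.re| ≤ 2 → ‖r l - c‖ ≤ 400 * δ) ∧
    (∀ l : ℂ, 2 ≤ l.re → l.im ∈ Set.Icc β (β + Real.pi) →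
      ‖sP l - c‖ ≤ 400 * δ * Real.exp (-l.re)) ∧
    (∀ l : ℂ, 2 ≤ l.re → l.im ∈ Set.Icc (β + Real.pi) (β + 2 * Real.pi) →
      ‖sN l - c‖ ≤ 400 * δ * Real.exp (-l.re)) ∧
    (∀ l : ℂ, 2 ≤ l.re → l.im ∈ Set.Icc β (β + Real.pi) → ‖tP l - c‖ ≤ 400 * δ) ∧
    (∀ l : ℂ, 2 ≤ l.re → l.im ∈ Set.Icc (β + Real.pi) (β + 2 * Real.pi) →
      ‖tN l - c‖ ≤ 400 * δ) := by
  have hpi := Real.pi_gt_three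
  have hpi4 := Real.pi_le_four
  have hδ := hs.nonneg
  -- On Re μ = 3 the function r may be replaced by the pair, at a cost of 2δ · 2π. The pair
  -- integrates to 2πc up to 4δ, and 4 + 4π ≤ 20.
  have A : ∀ {c sP sN r : _} (_ : Differentiable ℂ r) (_ : SmallJump β δ c sP sN)
      (_ : ∀ μ : ℂ, μ.re ∈ Set.Icc 1 3 → μ.im ∈ Set.Icc (β - 1 / 8) (β + Real.pi + 1 / 8) →
      ‖sP μ - r μ‖ ≤ δ)
      (_ : ∀ μ : ℂ, μ.re ∈ Set.Icc 1 3 →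
        μ.im ∈ Set.Icc (β + Real.pi - 1 / 8) (β + 2 * Real.pi + 1 / 8) → ‖sN μ - r μ‖ ≤ δ)
      (k : ℂ → ℂ) (_ : ∀ μ : ℂ, 3 ≤ μ.re → DifferentiableAt ℂ k μ)
      (_ : ∀ μ, k (μ + 2 * Real.pi * I) = k μ) (_ : ∀ μ : ℂ, 3 ≤ μ.re → ‖k μ‖ ≤ 2)
      (_ : ∀ lo hi, Tendsto k (stripAt lo hi) (𝓝 1)),
      ‖vint (fun μ => r μ * k μ) 3 β (β + 2 * Real.pi) - 2 * Real.pi * c‖ ≤ 20 * δ := by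
    intro c sP sN r hr hs hsP hsN k hkd hkp hkb hkl
    have m := hs.norm_vint_mul_sub_le (by norm_num : (1 : ℝ) ≤ 3) hkd hkp hkb hkl
    have ci : ∀ f : ℂ → ℂ, Differentiable ℂ f → ∀ a b, IntervalIntegrable
        (fun y : ℝ => f ((3 : ℝ) + y * I) * k ((3 : ℝ) + y * I)) MeasureTheory.volume a b := by
      intro f hf a b
      refine Continuous.intervalIntegrable (continuous_iff_continuousAt.2 fun y => ?_) _ _
      exact ContinuousAt.comp (f := fun y : ℝ => ((3 : ℝ) : ℂ) + y * I) (g := fun μ => f μ * k μ)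
        ((hf _).continuousAt.mul (hkd _ (by simp)).continuousAt) (by fun_prop)
    have sub : ∀ s : ℂ → ℂ, Differentiable ℂ s → ∀ a b,
        vint (fun μ => s μ * k μ) 3 a b - vint (fun μ => r μ * k μ) 3 a b
          = vint (fun μ => (s μ - r μ) * k μ) 3 a b := by
      intro s hs a b
      refine (intervalIntegral.integral_sub (ci s hs a b) (ci r hr a b)).symm.trans ?_
      refine intervalIntegral.integral_congr fun y _ => ?_
      show _ = (s _ - r _) * k _
      ring
    have b1 := norm_vint_le (f := fun μ => (sP μ - r μ) * k μ) (a := 3) (lo := β)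
      (hi := β + Real.pi) (B := δ * 2) (by linarith) fun μ h1 h2 => by
        rw [norm_mul]
        exact mul_le_mul (hsP μ (by rw [h1]; norm_num) ⟨by linarith [h2.1], by linarith [h2.2]⟩)
          (hkb μ h1.ge) (norm_nonneg _) hδ
    have b2 := norm_vint_le (f := fun μ => (sN μ - r μ) * k μ) (a := 3) (lo := β + Real.pi)
      (hi := β + 2 * Real.pi) (B := δ * 2) (by linarith) fun μ h1 h2 => by
        rw [norm_mul]
        exact mul_le_mul (hsN μ (by rw [h1]; norm_num) ⟨by linarith [h2.1], by linarith [h2.2]⟩)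
          (hkb μ h1.ge) (norm_nonneg _) hδ
    rw [← sub sP hs.dP] at b1
    rw [← sub sN hs.dN] at b2
    rw [← vint_add (f := fun μ => r μ * k μ) (mid := β + Real.pi)
      fun μ hμ => (hr μ).continuousAt.mul (hkd μ hμ.ge).continuousAt]
    set X1 := vint (fun μ => sP μ * k μ) 3 β (β + Real.pi)
    set X2 := vint (fun μ => sN μ * k μ) 3 (β + Real.pi) (β + 2 * Real.pi)
    set Y1 := vint (fun μ => r μ * k μ) 3 β (β + Real.pi)
    set Y2 := vint (fun μ => r μ * k μ) 3 (β + Real.pi) (β + 2 * Real.pi)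
    have e : Y1 + Y2 - 2 * Real.pi * c
        = (X1 + X2 - 2 * Real.pi * c) - (X1 - Y1) - (X2 - Y2) := by ring
    rw [e]
    refine (norm_sub_le _ _).trans ((add_le_add_left (norm_sub_le _ _) _).trans ?_)
    nlinarith
  have kd : ∀ l : ℂ, |l.re| ≤ 2 → ∀ μ : ℂ, 3 ≤ μ.re → DifferentiableAt ℂ (fun μ => kap (μ - l)) μ :=
    fun l hl μ hμ => (differentiableAt_kap (exp_ne_one_of_re (by
      rw [abs_le] at hl; simp; linarith))).comp μ (by fun_prop)
  have kp : ∀ l μ : ℂ, kap (μ + 2 * Real.pi * I - l) = kap (μ - l) := fun l μ => by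
    rw [add_sub_right_comm, kap_add]
  have kb : ∀ l : ℂ, |l.re| ≤ 2 → ∀ μ : ℂ, 3 ≤ μ.re → ‖kap (μ - l)‖ ≤ 2 := fun l hl μ hμ => by
    refine (norm_kap_le one_pos (by rw [abs_le] at hl; simp; linarith)).trans ?_
    have h4 : Real.exp (-1) ≤ 1 / 2 := by
      rw [Real.exp_neg, inv_le_comm₀ (Real.exp_pos _) (by norm_num)]
      have := Real.exp_one_gt_d9; norm_num at this ⊢; linarith
    rw [inv_le_comm₀ (by linarith) (by norm_num)]
    linarith
  have perint : ∀ (f : ℂ → ℂ), (∀ μ, f (μ + 2 * Real.pi * I) = f μ) → ∀ a s t : ℝ,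
      vint f a s (s + 2 * Real.pi) = vint f a t (t + 2 * Real.pi) := by
    intro f hf a s t
    refine Function.Periodic.intervalIntegral_add_eq (fun y => ?_) s t
    show f _ = f _
    rw [← hf (a + y * I)]; congr 1; push_cast; ring
  -- Cauchy's formula on |Re μ| ≤ 3. The right boundary contributes nearly 2πc. On the left
  -- boundary, `kap_neg` turns the integral into a difference of two integrals that are both near
  -- 2πc₀, so the unknown limit c₀ cancels.
  have main1 : ∀ l : ℂ, |l.re| ≤ 2 → ‖r l - c‖ ≤ 10 * δ := by
    intro l hl
    have hl' := abs_le.1 hl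
    have hl'' : |(-l).re| ≤ 2 := by simpa using hl
    have cau := cauchy_annulus hr hper (a := -3) (b := 3) (l := l) (by linarith) (by linarith)
    have rp : ∀ μ, r (μ + 2 * Real.pi * I) * kap (μ + 2 * Real.pi * I - l) = r μ * kap (μ - l) :=
      fun μ => by rw [hper, kp]
    rw [show l.im + Real.pi = l.im - Real.pi + 2 * Real.pi by ring,
      perint _ rp 3 _ β, perint _ rp (-3) _ (-(β + 2 * Real.pi)),
      show -(β + 2 * Real.pi) + 2 * Real.pi = -β by ring,
      ← vint_comp_neg (fun μ => r μ * kap (μ - l))] at cau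
    have m1 := A hr hs hsP hsN (fun μ => kap (μ - l)) (kd l hl) (kp l) (kb l hl)
      (fun _ _ => tendsto_kap l)
    have hrn : Differentiable ℂ fun μ => r (-μ) := hr.comp differentiable_neg
    have m2 := A hrn ht htP htN (fun μ => kap (μ - -l)) (kd (-l) hl'') (kp (-l)) (kb (-l) hl'')
      (fun _ _ => tendsto_kap (-l))
    have m3 := A hrn ht htP htN (fun _ => 1) (fun _ _ => differentiableAt_const _) (fun _ => rfl)
      (fun _ _ => by simp) (fun _ _ => tendsto_const_nhds)
    have e : vint (fun μ => r (-μ) * kap (-μ - l)) 3 β (β + 2 * Real.pi)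
        = vint (fun μ => r (-μ) * 1) 3 β (β + 2 * Real.pi)
          - vint (fun μ => r (-μ) * kap (μ - -l)) 3 β (β + 2 * Real.pi) := by
      have i1 : Continuous fun y : ℝ => r (-(((3 : ℝ) : ℂ) + y * I)) * 1 :=
        (hr.continuous.comp (by fun_prop)).mul continuous_const
      have i2 : Continuous fun y : ℝ => r (-(((3 : ℝ) : ℂ) + y * I))
          * kap (((3 : ℝ) : ℂ) + y * I - -l) :=
        (hr.continuous.comp (by fun_prop)).mul (continuous_iff_continuousAt.2 fun y =>
          ContinuousAt.comp (f := fun y : ℝ => ((3 : ℝ) : ℂ) + y * I) (g := fun μ => kap (μ - -l))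
            (kd (-l) hl'' _ (by simp)).continuousAt (by fun_prop))
      refine Eq.trans ?_ (intervalIntegral.integral_sub (i1.intervalIntegrable _ _)
        (i2.intervalIntegrable _ _))
      refine intervalIntegral.integral_congr fun y _ => ?_
      show r _ * kap (-(((3 : ℝ) : ℂ) + y * I) - l) = _
      rw [show -(((3 : ℝ) : ℂ) + y * I) - l = -(((3 : ℝ) : ℂ) + y * I - -l) by ring, kap_neg]
      · ring
      · refine exp_ne_one_of_re ?_
        simp; linarith
    rw [e] at cau
    set Z1 := vint (fun μ => r μ * kap (μ - l)) 3 β (β + 2 * Real.pi)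
    set Z2 := vint (fun μ => r (-μ) * kap (μ - -l)) 3 β (β + 2 * Real.pi)
    set Z3 := vint (fun μ => r (-μ) * 1) 3 β (β + 2 * Real.pi)
    have e2 : 2 * Real.pi * (r l - c) = (Z1 - 2 * Real.pi * c) - (Z3 - 2 * Real.pi * c₀)
        + (Z2 - 2 * Real.pi * c₀) := by linear_combination -cau
    have e3 : ‖2 * Real.pi * (r l - c)‖ = 2 * Real.pi * ‖r l - c‖ := by
      rw [norm_mul, norm_mul, norm_real, Real.norm_of_nonneg Real.pi_pos.le]; simp
    have e4 : 2 * Real.pi * ‖r l - c‖ ≤ 60 * δ := by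
      rw [← e3, e2]
      refine (norm_add_le _ _).trans ((add_le_add_left (norm_sub_le _ _) _).trans ?_)
      linarith
    nlinarith [norm_nonneg (r l - c)]
  have near : ∀ {s r' : ℂ → ℂ} {μ : ℂ}, ‖s μ - r' μ‖ ≤ δ → ‖r' μ - c‖ ≤ 10 * δ →
      ‖s μ - c‖ ≤ 11 * δ := by
    intro s r' μ h1 h2
    have := norm_add_le (s μ - r' μ) (r' μ - c)
    rw [sub_add_sub_cancel] at this
    linarith
  have sP1 : ∀ μ : ℂ, μ.re ∈ Set.Icc 1 2 → μ.im ∈ Set.Icc (β - 1 / 8) (β + Real.pi + 1 / 8) →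
      ‖sP μ - c‖ ≤ 11 * δ := fun μ h1 h2 =>
    near (hsP μ ⟨h1.1, by linarith [h1.2]⟩ h2)
      (main1 μ (by rw [abs_le]; constructor <;> linarith [h1.1, h1.2]))
  have sN1 : ∀ μ : ℂ, μ.re ∈ Set.Icc 1 2 →
      μ.im ∈ Set.Icc (β + Real.pi - 1 / 8) (β + 2 * Real.pi + 1 / 8) → ‖sN μ - c‖ ≤ 11 * δ :=
    fun μ h1 h2 => near (hsN μ ⟨h1.1, by linarith [h1.2]⟩ h2)
      (main1 μ (by rw [abs_le]; constructor <;> linarith [h1.1, h1.2]))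
  have tP1 : ∀ μ : ℂ, μ.re ∈ Set.Icc 1 2 → μ.im ∈ Set.Icc (β - 1 / 8) (β + Real.pi + 1 / 8) →
      ‖tP μ - c‖ ≤ 11 * δ := fun μ h1 h2 =>
    near (r' := fun μ => r (-μ)) (htP μ ⟨h1.1, by linarith [h1.2]⟩ h2)
      (main1 (-μ) (by rw [abs_le]; simp; constructor <;> linarith [h1.1, h1.2]))
  have tN1 : ∀ μ : ℂ, μ.re ∈ Set.Icc 1 2 →
      μ.im ∈ Set.Icc (β + Real.pi - 1 / 8) (β + 2 * Real.pi + 1 / 8) → ‖tN μ - c‖ ≤ 11 * δ :=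
    fun μ h1 h2 => near (r' := fun μ => r (-μ)) (htN μ ⟨h1.1, by linarith [h1.2]⟩ h2)
      (main1 (-μ) (by rw [abs_le]; simp; constructor <;> linarith [h1.1, h1.2]))
  have I12 : (1 : ℝ) ∈ Set.Icc (1 : ℝ) 2 := by norm_num
  have estP : ∀ {c₁ : ℂ} {sP sN : ℂ → ℂ}, SmallJump β δ c₁ sP sN →
      (∀ μ : ℂ, μ.re ∈ Set.Icc 1 2 → μ.im ∈ Set.Icc (β - 1 / 8) (β + Real.pi + 1 / 8) →
        ‖sP μ - c‖ ≤ 11 * δ) →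
      (∀ μ : ℂ, μ.re ∈ Set.Icc 1 2 →
        μ.im ∈ Set.Icc (β + Real.pi - 1 / 8) (β + 2 * Real.pi + 1 / 8) → ‖sN μ - c‖ ≤ 11 * δ) →
      (∀ l : ℂ, 2 ≤ l.re → l.im ∈ Set.Icc β (β + Real.pi) →
        ‖sP l - c₁‖ ≤ 120 * δ * Real.exp (-l.re)) ∧
      (∀ l : ℂ, 2 ≤ l.re → l.im ∈ Set.Icc (β + Real.pi) (β + 2 * Real.pi) →
        ‖sN l - c₁‖ ≤ 120 * δ * Real.exp (-l.re)) := by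
    intro c₁ sP sN hs h1 h2
    refine ⟨fun l hl hli => ?_, fun l hl hli => ?_⟩
    · have := hs.norm_sub_limit_le (c' := c) (δ' := 11 * δ) (fun μ k1 k2 => h1 μ (k1 ▸ I12) k2)
        (fun μ k1 k2 => h2 μ (k1 ▸ I12) k2) hl hli
      exact this.trans (le_of_eq (by ring))
    · have := hs.shift.norm_sub_limit_le (c' := c) (δ' := 11 * δ)
        (fun μ k1 k2 => h2 μ (k1 ▸ I12) ⟨k2.1, by linarith [k2.2]⟩)
        (fun μ k1 k2 => h1 (μ - 2 * Real.pi * I) (by simp [k1]) (by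
          obtain ⟨k2, k3⟩ := k2
          simp; constructor <;> linarith)) hl ⟨hli.1, by linarith [hli.2]⟩
      exact this.trans (le_of_eq (by ring))
  obtain ⟨sP2, sN2⟩ := estP hs sP1 sN1
  obtain ⟨tP2, tN2⟩ := estP ht tP1 tN1
  have exp1 : ∀ l : ℂ, 2 ≤ l.re → Real.exp (-l.re) ≤ 1 := fun l hl =>
    Real.exp_le_one_iff.2 (by linarith)
  -- At the point 2 + iβ the function tP is close both to its limit c₀ and, through r, to c.
  have hc0 : ‖c₀ - c‖ ≤ 131 * δ := by
    have h1 := tP2 (2 + β * I) (by simp) (by simp; linarith)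
    have h2 := tP1 (2 + β * I) (by simp) (by simp; linarith)
    have h3 := exp1 (2 + β * I) (by simp)
    have h4 := norm_sub_le (tP (2 + β * I) - c) (tP (2 + β * I) - c₀)
    rw [sub_sub_sub_cancel_left] at h4
    nlinarith
  have fin : ∀ {z : ℂ} {e : ℝ}, ‖z - c₀‖ ≤ 120 * δ * e → e ≤ 1 → ‖z - c‖ ≤ 400 * δ := by
    intro z e h1 h2
    have h4 := norm_add_le (z - c₀) (c₀ - c)
    rw [sub_add_sub_cancel] at h4
    nlinarith
  refine ⟨fun l hl => (main1 l hl).trans (by linarith), fun l hl hli => (sP2 l hl hli).trans ?_,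
    fun l hl hli => (sN2 l hl hli).trans ?_, fun l hl hli => fin (tP2 l hl hli) (exp1 l hl),
    fun l hl hli => fin (tN2 l hl hli) (exp1 l hl)⟩
  all_goals exact mul_le_mul_of_nonneg_right (by linarith) (Real.exp_pos _).le

end

/-! ### The logarithmic coordinate -/

/-- The coordinate `λ = -i e^μ`. -/
def lam (μ : ℂ) : ℂ := -I * exp μ

theorem lam_ne_zero (μ : ℂ) : lam μ ≠ 0 := mul_ne_zero (neg_ne_zero.2 I_ne_zero) (exp_ne_zero _)

theorem inv_lam (μ : ℂ) : (lam μ)⁻¹ = I * exp (-μ) := by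
  unfold lam; rw [exp_neg, mul_inv, inv_neg, inv_I, neg_neg]

theorem norm_lam (μ : ℂ) : ‖lam μ‖ = Real.exp μ.re := by simp [lam, norm_exp]

theorem differentiable_lam : Differentiable ℂ lam := by unfold lam; fun_prop

theorem analyticAt_lam (μ : ℂ) : AnalyticAt ℂ lam μ := differentiable_lam.analyticAt μ

theorem lam_add (μ : ℂ) : lam (μ + 2 * Real.pi * I) = lam μ := by
  unfold lam; rw [exp_add, exp_two_pi_mul_I, mul_one]

theorem lam_neg (μ : ℂ) : lam (-μ) = -(lam μ)⁻¹ := by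
  rw [inv_lam]; unfold lam; ring

theorem exp_eq_lam (μ : ℂ) : exp (μ - I * (Real.pi / 2)) = lam μ := by
  unfold lam
  rw [exp_sub, mul_comm I, exp_pi_div_two_mul_I, div_I]; ring

theorem zeta_lam (x μ : ℂ) : zeta x (lam μ) = 2 * x * (cosh μ - 1) := by
  unfold zeta
  rw [inv_lam, lam, cosh]
  linear_combination (x * (2 - exp μ - exp (-μ))) * I_sq

theorem zeta_neg_inv (x l : ℂ) : zeta x (-l⁻¹) = zeta x l := by
  unfold zeta; rw [inv_neg, inv_inv]; ring

theorem lam_mem_contour {x μ : ℂ} : lam μ ∈ contour x ↔ (zeta x (lam μ)).im = 0 := by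
  unfold contour; simp [lam_ne_zero]

theorem differentiable_zeta_lam (x : ℂ) : Differentiable ℂ fun μ => zeta x (lam μ) := by
  simp only [zeta_lam]; fun_prop

theorem hasStrictDerivAt_zeta_lam (x μ : ℂ) :
    HasStrictDerivAt (fun μ => zeta x (lam μ)) (2 * x * sinh μ) μ := by
  simp only [zeta_lam]
  have h : HasStrictDerivAt (fun μ => cosh μ - 1) (sinh μ) μ := (hasStrictDerivAt_cosh μ).sub_const 1
  exact HasStrictDerivAt.const_mul (2 * x) h

/-- The map μ ↦ ζ is entire and not constant, hence open, so its imaginary part cannot vanish on an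
open set. -/
theorem neBot_nhdsWithin_compl_contour {x : ℂ} (hx : x ≠ 0) (μ : ℂ) :
    (𝓝[{ν | lam ν ∉ contour x}] μ).NeBot := by
  have hopen : IsOpenMap fun μ => zeta x (lam μ) := by
    refine (AnalyticOnNhd.is_constant_or_isOpenMap
      (fun μ _ => (differentiable_zeta_lam x).analyticAt μ)).resolve_left ?_
    rintro ⟨w, hw⟩
    have h1 := hw 0
    have h2 := hw (Real.pi * I)
    simp only [zeta_lam] at h1 h2
    rw [cosh_mul_I, ← h1] at h2
    simp at h2
    norm_num at h2
    exact hx h2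
  rw [nhdsWithin, inf_principal_neBot_iff]
  intro U hU
  have h1 := hopen.image_mem_nhds hU
  obtain ⟨ε, hε, hball⟩ := Metric.mem_nhds_iff.1 h1
  by_contra hcon
  rw [Set.not_nonempty_iff_eq_empty] at hcon
  have hreal : ∀ ν ∈ U, (zeta x (lam ν)).im = 0 := fun ν hν => by
    by_contra h
    have : ν ∈ U ∩ {ν | lam ν ∉ contour x} := ⟨hν, fun h' => h (lam_mem_contour.1 h')⟩
    rw [hcon] at this; exact this
  have h2 : zeta x (lam μ) + (ε / 2 : ℝ) * I ∈ Metric.ball (zeta x (lam μ)) ε := by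
    rw [Metric.mem_ball, dist_eq_norm]
    simp [abs_of_pos hε]
    linarith
  obtain ⟨ν, hν, he⟩ := hball h2
  have h3 := congrArg Complex.im he
  simp only [add_im, mul_im, ofReal_re, I_im, mul_one, ofReal_im, I_re, mul_zero, add_zero] at h3
  rw [hreal ν hν, hreal μ (mem_of_mem_nhds hU)] at h3
  linarith

/-! ### Analytic extension over a set with empty interior -/

/-- The extension is the limit of f along Ω. Since Ω accumulates at every point, this limit equals
any local analytic candidate, so no compatibility between the candidates has to be checked. -/
theorem exists_analytic_extension {f : ℂ → ℂ} {Ω D : Set ℂ} (hΩ : ∀ μ, (𝓝[Ω] μ).NeBot)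
    (h : ∀ μ ∈ D, ∃ g, AnalyticAt ℂ g μ ∧ ∀ᶠ ν in 𝓝 μ, ν ∈ Ω → f ν = g ν) :
    ∃ Φ : ℂ → ℂ, (∀ μ ∈ D, AnalyticAt ℂ Φ μ) ∧ ∀ μ ∈ D, μ ∈ Ω → Φ μ = f μ := by
  have key : ∀ μ g, AnalyticAt ℂ g μ → (∀ᶠ ν in 𝓝 μ, ν ∈ Ω → f ν = g ν) →
      limUnder (𝓝[Ω] μ) f = g μ := by
    intro μ g hg hfg
    have := hΩ μ
    refine Tendsto.limUnder_eq ?_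
    refine (hg.continuousAt.continuousWithinAt (s := Ω)).tendsto.congr' ?_
    filter_upwards [eventually_nhdsWithin_of_eventually_nhds hfg, self_mem_nhdsWithin] with ν h1 h2
    exact (h1 h2).symm
  refine ⟨fun μ => limUnder (𝓝[Ω] μ) f, fun μ hμ => ?_, fun μ hμ hμ' => ?_⟩
  · obtain ⟨g, hg, hfg⟩ := h μ hμ
    refine hg.congr ?_
    filter_upwards [hg.eventually_analyticAt, eventually_eventually_nhds.2 hfg] with ν h1 h2
    exact (key ν g h1 h2).symm
  · obtain ⟨g, hg, hfg⟩ := h μ hμ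
    exact (key μ g hg hfg).trans (hfg.self_of_nhds hμ').symm

/-- Analytic extension, allowing exceptional points near which the function is bounded. -/
theorem exists_entire_extension {f : ℂ → ℂ} {Ω S : Set ℂ} (hΩ : ∀ μ, (𝓝[Ω] μ).NeBot)
    (hS : ∀ μ, ∀ᶠ ν in 𝓝[≠] μ, ν ∉ S)
    (h : ∀ μ ∉ S, ∃ g, AnalyticAt ℂ g μ ∧ ∀ᶠ ν in 𝓝 μ, ν ∈ Ω → f ν = g ν)
    (hb : ∀ μ ∈ S, μ ∉ Ω ∧ ∃ B : ℝ, ∀ᶠ ν in 𝓝 μ, ν ∈ Ω → ‖f ν‖ ≤ B) :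
    ∃ Φ : ℂ → ℂ, Differentiable ℂ Φ ∧ ∀ μ ∈ Ω, Φ μ = f μ := by
  have hSo : IsOpen Sᶜ := by
    refine isOpen_iff_mem_nhds.2 fun μ hμ => ?_
    have := eventually_nhdsWithin_iff.1 (hS μ)
    filter_upwards [this] with ν hν
    by_cases h0 : ν = μ
    · rwa [h0]
    · exact hν h0
  obtain ⟨Φ₁, h1, h2⟩ := exists_analytic_extension hΩ h
  obtain ⟨Φ, h3, h4⟩ := exists_analytic_extension (f := f) (D := Set.univ) hΩ
    (fun μ _ => by
      by_cases hμ : μ ∈ S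
      · obtain ⟨hμΩ, B, hB⟩ := hb μ hμ
        obtain ⟨U, hU, hUo, hUμ⟩ := eventually_nhds_iff.1
          ((eventually_nhdsWithin_iff.1 (hS μ)).and (eventually_eventually_nhds.2 hB))
        have hd : DifferentiableOn ℂ Φ₁ (U \ {μ}) := fun ν hν =>
          (h1 ν ((hU ν hν.1).1 hν.2)).differentiableAt.differentiableWithinAt
        have hbd : BddAbove (norm ∘ Φ₁ '' (U \ {μ})) := by
          refine ⟨B, ?_⟩
          rintro _ ⟨ν, hν, rfl⟩
          have := hΩ ν
          have hνS := (hU ν hν.1).1 hν.2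
          refine le_of_tendsto ((h1 ν hνS).continuousAt.continuousWithinAt (s := Ω)).norm ?_
          filter_upwards [eventually_nhdsWithin_of_eventually_nhds (hU ν hν.1).2,
            self_mem_nhdsWithin, eventually_nhdsWithin_of_eventually_nhds (hSo.mem_nhds hνS)]
            with ξ k1 k2 k3
          rw [h2 ξ k3 k2]; exact k1 k2
        -- Riemann's removable singularity theorem. The bound for f on Ω passes to Φ₁ on the
        -- punctured neighbourhood by density.
        have hup := differentiableOn_update_limUnder_of_bddAbove (hUo.mem_nhds hUμ) hd hbd
        refine ⟨_, hup.analyticAt (hUo.mem_nhds hUμ), ?_⟩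
        filter_upwards [hUo.mem_nhds hUμ] with ν hν hνΩ
        have hne : ν ≠ μ := fun h0 => hμΩ (h0 ▸ hνΩ)
        rw [Function.update_of_ne hne]
        exact (h2 ν ((hU ν hν).1 hne) hνΩ).symm
      · exact h μ hμ)
  exact ⟨Φ, fun μ => (h3 μ trivial).differentiableAt, fun μ hμ => h4 μ trivial hμ⟩

/-! ### The connection matrices -/

/-- Euler's reflection formula, Γ(1/2 + m)Γ(1/2 - m) = π / cos(πm). It also covers the poles, where
both sides are 0 with the convention 1/Γ = 0. -/
theorem stokes_mul (m : ℂ) : √(2 * Real.pi) / Gamma (1 / 2 - m) * (√(2 * Real.pi) / Gamma (1 / 2 + m))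
    = exp (I * Real.pi * m) + exp (-(I * Real.pi * m)) := by
  have h := Gamma_mul_Gamma_one_sub (1 / 2 + m)
  have e1 : 1 - (1 / 2 + m) = 1 / 2 - m := by ring
  have e2 : sin (Real.pi * (1 / 2 + m)) = cos (Real.pi * m) := by
    rw [show (Real.pi * (1 / 2 + m) : ℂ) = Real.pi * m + Real.pi / 2 by ring, sin_add_pi_div_two]
  rw [e1, e2] at h
  have hs : (√(2 * Real.pi) : ℂ) * √(2 * Real.pi) = 2 * Real.pi := by
    rw [← ofReal_mul, Real.mul_self_sqrt (by positivity)]; push_cast; ring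
  rw [div_mul_div_comm, hs, mul_comm (Gamma _), h, div_div_eq_mul_div,
    mul_assoc, mul_comm (Real.pi : ℂ), ← mul_assoc, mul_div_cancel_right₀ _ (by
      exact_mod_cast Real.pi_ne_zero), cos]
  rw [show (Real.pi * m * I : ℂ) = I * Real.pi * m by ring,
    show (-(Real.pi * m) * I : ℂ) = -(I * Real.pi * m) by ring]
  ring

theorem VInfUp_mul_VZeroUp (m : ℂ) : VInfUp m * VZeroUp m = 1 := by
  simp [VInfUp, VZeroUp, Matrix.one_fin_two]

theorem VZeroUp_mul_VInfUp (m : ℂ) : VZeroUp m * VInfUp m = 1 := by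
  simp [VInfUp, VZeroUp, Matrix.one_fin_two]

/-- The consistency of the four jumps around -i. It makes the two cut arcs carry the same monodromy
matrix. -/
theorem VInfUp_mul_VInfLow_mul_VInfUp (m : ℂ) : VInfUp m * VInfLow m * VInfUp m = VZeroLow m := by
  have h := stokes_mul m
  unfold VInfUp VInfLow VZeroLow
  set c := √(2 * Real.pi) / Gamma (1 / 2 - m)
  set g := √(2 * Real.pi) / Gamma (1 / 2 + m)
  set e := exp (I * Real.pi * m)
  set e' := exp (-(I * Real.pi * m))
  ext i j
  fin_cases i <;> fin_cases j <;> simp [Matrix.mul_apply, Fin.sum_univ_two]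
  · linear_combination h
  · linear_combination c * h
  · linear_combination h

theorem neg_one_zpow_mul_self (n : ℤ) : ((-1 : ℂ) ^ n) * (-1 : ℂ) ^ n = 1 := by
  rw [← mul_zpow]; simp

/-- The monodromy matrix of the continuation. -/
def monod (n : ℤ) (m : ℂ) : Mat := (-1 : ℂ) ^ n • (VInfLow m * VInfUp m)

/-- The product has determinant 1, and its trace vanishes by `stokes_mul`, so this is an instance of
the Cayley–Hamilton theorem. -/
theorem VInfLow_mul_sq (m : ℂ) : (VInfLow m * VInfUp m) * (VInfLow m * VInfUp m) = -1 := by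
  have h := stokes_mul m
  have he : exp (I * Real.pi * m) * exp (-(I * Real.pi * m)) = 1 := by
    rw [← exp_add]; simp
  unfold VInfUp VInfLow
  set c := √(2 * Real.pi) / Gamma (1 / 2 - m)
  set g := √(2 * Real.pi) / Gamma (1 / 2 + m)
  set e := exp (I * Real.pi * m)
  set e' := exp (-(I * Real.pi * m))
  ext i j
  fin_cases i <;> fin_cases j <;> simp [Matrix.mul_apply, Fin.sum_univ_two]
  · linear_combination -e' * h - he
  · linear_combination -e' * c * h
  · linear_combination g * h
  · linear_combination (g * c - e) * h - he

theorem monod_mul_self (n : ℤ) (m : ℂ) : monod n m * monod n m = -1 := by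
  unfold monod
  rw [smul_mul_smul_comm, neg_one_zpow_mul_self, one_smul, VInfLow_mul_sq]

/-- The monodromy matrix, as a unit. -/
def monodU (n : ℤ) (m : ℂ) : Matˣ where
  val := monod n m
  inv := -monod n m
  val_inv := by rw [mul_neg, monod_mul_self, neg_neg]
  inv_val := by rw [neg_mul, monod_mul_self, neg_neg]

theorem monodU_val (n : ℤ) (m : ℂ) : (monodU n m : Mat) = monod n m := rfl

theorem monodU_sq (n : ℤ) (m : ℂ) : monodU n m ^ (2 : ℤ) = -1 := by
  ext1
  rw [zpow_ofNat, pow_two]; simp [monodU_val, monod_mul_self]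

/-- The powers are only ±1 and ± the matrix itself. The bound is uniform in the sheet index, which
need not be constant near a critical point of ζ. -/
theorem norm_monodU_zpow_le (n : ℤ) (m : ℂ) : ∃ B : ℝ, ∀ (k : ℤ) (i j : Fin 2),
    ‖((monodU n m ^ k : Matˣ) : Mat) i j‖ ≤ B := by
  obtain ⟨S, hpos, hS⟩ : ∃ S : ℝ, 0 ≤ S ∧ ∀ i j, ‖monod n m i j‖ ≤ S := by
    refine ⟨∑ i, ∑ j, ‖monod n m i j‖,
      Finset.sum_nonneg fun _ _ => Finset.sum_nonneg fun _ _ => norm_nonneg _, fun i j => ?_⟩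
    refine (Finset.single_le_sum (f := fun j => ‖monod n m i j‖) (fun _ _ => norm_nonneg _)
      (Finset.mem_univ j)).trans ?_
    exact Finset.single_le_sum (f := fun i => ∑ j, ‖monod n m i j‖)
      (fun _ _ => Finset.sum_nonneg fun _ _ => norm_nonneg _) (Finset.mem_univ i)
  refine ⟨1 + S, fun k i j => ?_⟩
  have hsum := hS i j
  have h1 : ‖(1 : Mat) i j‖ ≤ 1 := by
    rw [Matrix.one_apply]; split_ifs <;> simp
  rcases Int.even_or_odd' k with ⟨q, rfl | rfl⟩
  · rw [zpow_mul, monodU_sq]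
    rcases Int.even_or_odd q with h | h <;>
      simp only [h.neg_one_zpow, Units.val_one, Units.val_neg, Matrix.neg_apply, norm_neg] <;>
      linarith
  · rw [zpow_add, zpow_mul, monodU_sq, zpow_one]
    rcases Int.even_or_odd q with h | h <;>
      simp only [h.neg_one_zpow, one_mul, neg_mul, Units.val_neg, Matrix.neg_apply, norm_neg,
        monodU_val] <;> linarith

theorem smul_VInfLow_mul (n : ℤ) (m : ℂ) :
    ((-1 : ℂ) ^ n • VInfLow m) * (VInfUp m * ((monodU n m)⁻¹ : Matˣ)) = 1 := by
  rw [← mul_assoc, smul_mul_assoc]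
  exact (monodU n m).mul_inv

theorem smul_VZeroLow_eq (n : ℤ) (m : ℂ) :
    (-1 : ℂ) ^ n • VZeroLow m = VInfUp m * (monodU n m : Mat) := by
  rw [monodU_val, monod, mul_smul_comm, ← mul_assoc, VInfUp_mul_VInfLow_mul_VInfUp]

/-! ### Gluing across the contour and boundedness where its arcs cross. -/

theorem exists_local_inverse {q : ℂ → ℂ} {q' μ₀ : ℂ} (h : HasStrictDerivAt q q' μ₀) (h0 : q' ≠ 0)
    {W : Set ℂ} (hW : W ∈ 𝓝 μ₀) :
    ∃ (φ : ℂ → ℂ) (ρ : ℝ), 0 < ρ ∧ ContinuousOn φ (Metric.ball (q μ₀) ρ) ∧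
      (∀ z ∈ Metric.ball (q μ₀) ρ, φ z ∈ W ∧ q (φ z) = z) ∧ φ (q μ₀) = μ₀ ∧
      ∀ᶠ μ in 𝓝 μ₀, q μ ∈ Metric.ball (q μ₀) ρ ∧ φ (q μ) = μ := by
  let e := (h.hasStrictFDerivAt_equiv h0).toOpenPartialHomeomorph q
  have hsrc : μ₀ ∈ e.source := (h.hasStrictFDerivAt_equiv h0).mem_toOpenPartialHomeomorph_source
  have htgt : q μ₀ ∈ e.target := e.map_source hsrc
  have hsym : e.symm (q μ₀) = μ₀ := e.left_inv hsrc
  have hc : ContinuousAt e.symm (q μ₀) := e.continuousAt_symm htgt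
  have hmem : e.symm ⁻¹' W ∩ e.target ∈ 𝓝 (q μ₀) :=
    inter_mem (hc.preimage_mem_nhds (by rw [hsym]; exact hW)) (e.open_target.mem_nhds htgt)
  obtain ⟨ρ, hρ, hball⟩ := Metric.mem_nhds_iff.1 hmem
  refine ⟨e.symm, ρ, hρ, e.continuousOn_symm.mono fun z hz => (hball hz).2,
    fun z hz => ⟨(hball hz).1, e.right_inv (hball hz).2⟩, hsym, ?_⟩
  filter_upwards [e.open_source.mem_nhds hsrc,
    h.hasDerivAt.continuousAt.preimage_mem_nhds (Metric.ball_mem_nhds _ hρ)] with μ h1 h2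
  exact ⟨h2, e.left_inv h1⟩

theorem HasJump.symm {F : ℂ → Mat} {A B : Set ℂ} {U U' : Mat} {l : ℂ} (h : HasJump F A B U l)
    (hU : U * U' = 1) : HasJump F B A U' l := by
  obtain ⟨P, M, hP, hM, rfl⟩ := h
  exact ⟨M, _, hM, hP, by rw [mul_assoc, hU, mul_one]⟩

/-- The extension property of a solution at a point of the contour. -/
def ExtendsAt (x : ℂ) (F : ℂ → Mat) (p : ℂ) (r : ℝ) : Prop :=
  ∀ z ∈ Metric.ball p r \ contour x,
    ∃ G : ℂ → Mat, (∀ i j, AnalyticOnNhd ℂ (fun w => G w i j) (Metric.ball p r)) ∧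
      Set.EqOn F G (connectedComponentIn (Metric.ball p r \ contour x) z)

/-- A continuous image of a convex set is connected, so it lies in one component of the disk minus
the contour and a single extension serves all of it. -/
theorem ExtendsAt.exists_of_convex {x p : ℂ} {F : ℂ → Mat} {r : ℝ} (h : ExtendsAt x F p r)
    {φ : ℂ → ℂ} {T : Set ℂ} (hT : Convex ℝ T) (hφ : ContinuousOn φ T)
    (hmem : ∀ z ∈ T, lam (φ z) ∈ Metric.ball p r \ contour x) :
    ∃ G : ℂ → Mat, (∀ i j, AnalyticOnNhd ℂ (fun w => G w i j) (Metric.ball p r)) ∧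
      ∀ z ∈ T, F (lam (φ z)) = G (lam (φ z)) := by
  rcases T.eq_empty_or_nonempty with rfl | ⟨z₀, hz₀⟩
  · exact ⟨0, fun i j => analyticOnNhd_const, by simp⟩
  obtain ⟨G, hG, hFG⟩ := h _ (hmem z₀ hz₀)
  refine ⟨G, hG, fun z hz => hFG ?_⟩
  have hpre : IsPreconnected ((fun z => lam (φ z)) '' T) :=
    hT.isPreconnected.image _ (differentiable_lam.continuous.comp_continuousOn hφ)
  refine hpre.subset_connectedComponentIn ⟨z₀, hz₀, rfl⟩ ?_ ⟨z, hz, rfl⟩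
  rintro _ ⟨w, hw, rfl⟩
  exact hmem w hw

theorem continuousAt_of_entries {G : ℂ → Mat} {p : ℂ}
    (h : ∀ i j, ContinuousAt (fun w => G w i j) p) : ContinuousAt G p :=
  continuousAt_pi.2 fun i => continuousAt_pi.2 fun j => h i j

theorem neBot_upper (ξ : ℂ) (ρ σ : ℝ) (c : ℂ) (hσ : σ ≠ 0) (h : ξ ∈ Metric.ball c ρ)
    (hξ : ξ.im = 0) : (𝓝[Metric.ball c ρ ∩ {z | 0 < σ * z.im}] ξ).NeBot := by
  rw [← mem_closure_iff_nhdsWithin_neBot]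
  have ht : Tendsto (fun t : ℝ => ξ + (σ * t : ℝ) * I) (𝓝[>] 0) (𝓝 ξ) := by
    have : Continuous fun t : ℝ => ξ + (σ * t : ℝ) * I := by fun_prop
    have h2 := this.tendsto 0
    simp only [mul_zero, ofReal_zero, zero_mul, add_zero] at h2
    exact h2.mono_left nhdsWithin_le_nhds
  refine mem_closure_of_tendsto ht ?_
  filter_upwards [ht.eventually (Metric.isOpen_ball.mem_nhds h), self_mem_nhdsWithin] with t h1 h2
  refine ⟨h1, ?_⟩
  have h2' : (0 : ℝ) < t := h2
  simp only [Set.mem_ofPred_eq, add_im, hξ, mul_im, ofReal_re, I_im, mul_one, ofReal_im, I_re,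
    mul_zero, add_zero, zero_add]
  nlinarith [mul_pos (mul_self_pos.2 hσ) h2']

theorem convex_upper (c : ℂ) (ρ σ : ℝ) : Convex ℝ (Metric.ball c ρ ∩ {z | 0 < σ * z.im}) := by
  refine (convex_ball c ρ).inter ?_
  have : {z : ℂ | 0 < σ * z.im} = (fun z : ℂ => σ * z.im) ⁻¹' Set.Ioi 0 := rfl
  rw [this]
  refine (convex_Ioi 0).is_linear_preimage ⟨fun a b => ?_, fun c a => ?_⟩
  · simp; ring
  · simp; ring

/-- Gluing across a regular point of the contour. -/
theorem glue_regular {x μ₀ : ℂ} {F : ℂ → Mat} {f : ℂ → Mat} {r : ℝ} (hr : 0 < r)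
    (hx : x ≠ 0) (hsinh : sinh μ₀ ≠ 0)
    (hext : ExtendsAt x F (lam μ₀) r) (hmem : lam μ₀ ∈ contour x) {Sp Sm : Set ℂ} {W Mp Mm : Mat}
    (hS : ∀ᶠ l in 𝓝 (lam μ₀), ((zeta x l).im = 0 → HasJump F Sp Sm W l) ∧
      (0 < (zeta x l).im → l ∈ Sp) ∧ ((zeta x l).im < 0 → l ∈ Sm))
    (hf : ∀ᶠ μ in 𝓝 μ₀, (0 < (zeta x (lam μ)).im → f μ = F (lam μ) * Mp) ∧
      ((zeta x (lam μ)).im < 0 → f μ = F (lam μ) * Mm))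
    (hW : W * Mp = Mm) (i j : Fin 2) :
    ∃ g : ℂ → ℂ, AnalyticAt ℂ g μ₀ ∧ ∀ᶠ ν in 𝓝 μ₀, lam ν ∉ contour x → f ν i j = g ν := by
  have hcl := differentiable_lam.continuous
  have hq := hasStrictDerivAt_zeta_lam x μ₀
  have hq0 : 2 * x * sinh μ₀ ≠ 0 := mul_ne_zero (mul_ne_zero two_ne_zero hx) hsinh
  -- Since sinh μ₀ ≠ 0, ζ is a local coordinate at μ₀. In it the contour is the real axis and its
  -- two sides are half-disks.
  obtain ⟨φ, ρ, hρ, hφc, hφ, hφ0, hφi⟩ := exists_local_inverse hq hq0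
    (W := lam ⁻¹' (Metric.ball (lam μ₀) r) ∩ {μ | ((zeta x (lam μ)).im = 0 →
      HasJump F Sp Sm W (lam μ)) ∧ (0 < (zeta x (lam μ)).im → lam μ ∈ Sp) ∧
      ((zeta x (lam μ)).im < 0 → lam μ ∈ Sm)})
    (inter_mem (hcl.continuousAt.preimage_mem_nhds (Metric.ball_mem_nhds _ hr))
      (hcl.continuousAt.eventually hS))
  set B := Metric.ball (zeta x (lam μ₀)) ρ with hB
  have side : ∀ σ : ℝ, σ ≠ 0 → ∃ G : ℂ → Mat,
      (∀ i j, AnalyticOnNhd ℂ (fun w => G w i j) (Metric.ball (lam μ₀) r)) ∧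
      ∀ z ∈ B ∩ {z | 0 < σ * z.im}, F (lam (φ z)) = G (lam (φ z)) := by
    intro σ hσ
    refine hext.exists_of_convex (convex_upper _ _ _) (hφc.mono Set.inter_subset_left) ?_
    rintro z ⟨hz, hz'⟩
    refine ⟨(hφ z hz).1.1, fun hc => ?_⟩
    rw [lam_mem_contour, (hφ z hz).2] at hc
    rw [Set.mem_ofPred_eq, hc, mul_zero] at hz'
    exact lt_irrefl _ hz'
  obtain ⟨Gp, hGp, hFp⟩ := side 1 one_ne_zero
  obtain ⟨Gm, hGm, hFm⟩ := side (-1) (by norm_num)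
  have hcompc : ∀ z ∈ B, ContinuousAt (fun z => lam (φ z)) z := fun z hz =>
    hcl.continuousAt.comp (hφc.continuousAt (Metric.isOpen_ball.mem_nhds hz))
  have hlim : ∀ σ : ℝ, σ ≠ 0 → ∀ (G : ℂ → Mat) (S : Set ℂ) (L : Mat),
      (∀ i j, AnalyticOnNhd ℂ (fun w => G w i j) (Metric.ball (lam μ₀) r)) →
      (∀ z ∈ B ∩ {z | 0 < σ * z.im}, F (lam (φ z)) = G (lam (φ z))) →
      (∀ z ∈ B ∩ {z | 0 < σ * z.im}, lam (φ z) ∈ S) →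
      ∀ ξ ∈ B, ξ.im = 0 → Tendsto F (𝓝[S] (lam (φ ξ))) (𝓝 L) → G (lam (φ ξ)) = L := by
    intro σ hσ G S L hG hFG hSS ξ hξ hξr hL
    have hne := neBot_upper ξ ρ σ _ hσ hξ hξr
    have t1 : Tendsto (fun z => lam (φ z)) (𝓝[B ∩ {z | 0 < σ * z.im}] ξ) (𝓝[S] (lam (φ ξ))) :=
      tendsto_nhdsWithin_iff.2 ⟨(hcompc ξ hξ).continuousWithinAt,
        eventually_nhdsWithin_of_forall hSS⟩
    have t2 : Tendsto (fun z => G (lam (φ z))) (𝓝[B ∩ {z | 0 < σ * z.im}] ξ)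
        (𝓝 (G (lam (φ ξ)))) := by
      have hGc : ContinuousAt G (lam (φ ξ)) := continuousAt_of_entries fun i j =>
        (hG i j _ (hφ ξ hξ).1.1).continuousAt
      exact (ContinuousAt.comp (f := fun z => lam (φ z)) hGc (hcompc ξ hξ)).continuousWithinAt
    refine tendsto_nhds_unique t2 ((hL.comp t1).congr' ?_)
    exact eventually_nhdsWithin_of_forall hFG
  have hcross : ∀ ξ ∈ B, ξ.im = 0 → Gp (lam (φ ξ)) * Mp = Gm (lam (φ ξ)) * Mm := by
    intro ξ hξ hξr
    obtain ⟨P, M, hP, hM, hPM⟩ := (hφ ξ hξ).1.2.1 (by rw [(hφ ξ hξ).2]; exact hξr)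
    rw [hlim 1 one_ne_zero Gp Sp P hGp hFp (fun z hz => (hφ z hz.1).1.2.2.1 (by
        rw [(hφ z hz.1).2]; simpa using hz.2)) ξ hξ hξr hP,
      hlim (-1) (by norm_num) Gm Sm M hGm hFm (fun z hz => (hφ z hz.1).1.2.2.2 (by
        rw [(hφ z hz.1).2]; simpa using hz.2)) ξ hξ hξr hM, hPM, mul_assoc, hW]
  have hana : ∀ (G : ℂ → Mat) (M : Mat),
      (∀ i j, AnalyticOnNhd ℂ (fun w => G w i j) (Metric.ball (lam μ₀) r)) →
      AnalyticAt ℂ (fun ν => (G (lam ν) * M) i j) μ₀ := by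
    intro G M hG
    simp only [Matrix.mul_apply, Fin.sum_univ_two]
    have h1 : ∀ k, AnalyticAt ℂ (fun ν => G (lam ν) i k) μ₀ := fun k =>
      (hG i k _ (Metric.mem_ball_self hr)).comp (analyticAt_lam μ₀)
    exact ((h1 0).mul analyticAt_const).add ((h1 1).mul analyticAt_const)
  have hreal0 : (zeta x (lam μ₀)).im = 0 := lam_mem_contour.1 hmem
  -- The jump condition makes the two one-sided continuations agree on a real segment in the
  -- coordinate ζ. This segment accumulates at μ₀, so they agree near μ₀ by the identity theorem.
  have hfreq : ∃ᶠ ν in 𝓝[≠] μ₀, (Gp (lam ν) * Mp) i j = (Gm (lam ν) * Mm) i j := by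
    have t0 : Tendsto (fun t : ℝ => zeta x (lam μ₀) + t) (𝓝[≠] 0) (𝓝 (zeta x (lam μ₀))) := by
      have : Continuous fun t : ℝ => zeta x (lam μ₀) + t := by fun_prop
      have h2 := this.tendsto 0
      simp only [ofReal_zero, add_zero] at h2
      exact h2.mono_left nhdsWithin_le_nhds
    have hB0 : zeta x (lam μ₀) ∈ B := Metric.mem_ball_self hρ
    have hev := t0.eventually (Metric.isOpen_ball.mem_nhds hB0)
    have t1 : Tendsto (fun t : ℝ => φ (zeta x (lam μ₀) + t)) (𝓝[≠] 0) (𝓝[≠] μ₀) := by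
      refine tendsto_nhdsWithin_iff.2 ⟨?_, ?_⟩
      · have := (hφc.continuousAt (Metric.isOpen_ball.mem_nhds hB0)).tendsto.comp t0
        rwa [hφ0] at this
      · filter_upwards [hev, self_mem_nhdsWithin] with t h1 h2 h3
        have h4 := (hφ _ h1).2
        rw [h3] at h4
        have : (t : ℂ) = 0 := by linear_combination -h4
        exact h2 (by simpa using this)
    refine t1.frequently (Eventually.frequently ?_)
    filter_upwards [hev] with t ht
    rw [hcross _ ht (by simp [hreal0])]
  have heq := ((hana Gp Mp hGp).frequently_eq_iff_eventually_eq (hana Gm Mm hGm)).1 hfreq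
  refine ⟨fun ν => (Gp (lam ν) * Mp) i j, hana Gp Mp hGp, ?_⟩
  filter_upwards [heq, hf, hφi] with ν h1 h2 h3 h4
  rw [lam_mem_contour] at h4
  rcases lt_or_gt_of_ne h4 with h5 | h5
  · rw [h1, h2.2 h5]
    have := hFm _ ⟨h3.1, by simpa using h5⟩
    rw [h3.2] at this; rw [this]
  · rw [h2.1 h5]
    have := hFp _ ⟨h3.1, by simpa using h5⟩
    rw [h3.2] at this; rw [this]

/-- Boundedness near a critical point of `ζ`. -/
theorem bounded_critical {x μ₀ : ℂ} {F : ℂ → Mat} {r : ℝ} (hr : 0 < r)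
    (hx : x ≠ 0) (hsinh : sinh μ₀ = 0)
    (hext : ExtendsAt x F (lam μ₀) r) (hmem : lam μ₀ ∈ contour x) :
    ∃ B : ℝ, ∀ᶠ ν in 𝓝 μ₀, lam ν ∉ contour x → ∀ i j, ‖F (lam ν) i j‖ ≤ B := by
  have hcl := differentiable_lam.continuous
  have hcosh : cosh μ₀ = 1 ∨ cosh μ₀ = -1 := by
    have := cosh_sq μ₀
    rw [hsinh] at this
    simpa using this
  -- Where sinh μ₀ = 0, ζ(μ) - ζ(μ₀) is ±4 times the square of s · sinh((μ - μ₀)/2). In that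
  -- coordinate the contour is the union of the two axes, and each open quadrant meets a single
  -- sector.
  set s : ℂ := x ^ (1 / 2 : ℂ) with hs
  have hs2 : s ^ 2 = x := sq_half x
  have hs0 : s ≠ 0 := fun h => hx (by rw [← hs2, h]; simp)
  have him : ∀ μ, (zeta x (lam μ)).im = 0 ↔
      (s * sinh ((μ - μ₀) / 2)).re = 0 ∨ (s * sinh ((μ - μ₀) / 2)).im = 0 := by
    intro μ
    have e1 : zeta x (lam μ) = zeta x (lam μ₀) + cosh μ₀ * 4 * (s * sinh ((μ - μ₀) / 2)) ^ 2 := by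
      rw [zeta_lam, zeta_lam, mul_pow, hs2]
      have e2 : cosh μ = cosh μ₀ * cosh (μ - μ₀) := by
        conv_lhs => rw [show μ = μ₀ + (μ - μ₀) by ring, cosh_add, hsinh]
        ring
      have e3 : cosh (μ - μ₀) = 1 + 2 * sinh ((μ - μ₀) / 2) ^ 2 := by
        conv_lhs => rw [show μ - μ₀ = 2 * ((μ - μ₀) / 2) by ring, cosh_two_mul, cosh_sq]
        ring
      rw [e2, e3]; ring
    have h3 : ((s * sinh ((μ - μ₀) / 2)) ^ 2).im
        = 2 * ((s * sinh ((μ - μ₀) / 2)).re * (s * sinh ((μ - μ₀) / 2)).im) := by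
      rw [pow_two, mul_im]; ring
    rw [e1, add_im, lam_mem_contour.1 hmem, zero_add]
    rcases hcosh with h | h <;> rw [h]
    · rw [show (1 * 4 : ℂ) = ((4 : ℝ) : ℂ) by norm_num, im_ofReal_mul, h3]; simp
    · rw [show (-1 * 4 : ℂ) = ((-4 : ℝ) : ℂ) by norm_num, im_ofReal_mul, h3]; simp
  have hq : HasStrictDerivAt (fun μ => s * sinh ((μ - μ₀) / 2)) (s * (cosh ((μ₀ - μ₀) / 2) * (1 / 2)))
      μ₀ := by
    have h1 : HasStrictDerivAt (fun μ => (μ - μ₀) / 2) (1 / 2) μ₀ :=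
      HasStrictDerivAt.div_const ((hasStrictDerivAt_id μ₀).sub_const μ₀ :
        HasStrictDerivAt (fun μ => μ - μ₀) 1 μ₀) 2
    exact HasStrictDerivAt.const_mul s h1.csinh
  have hq0 : s * (cosh ((μ₀ - μ₀) / 2) * (1 / 2)) ≠ 0 := by simp [hs0]
  obtain ⟨φ, ρ, hρ, hφc, hφ, hφ0, hφi⟩ := exists_local_inverse hq hq0
    (W := lam ⁻¹' (Metric.ball (lam μ₀) r))
    (hcl.continuousAt.preimage_mem_nhds (Metric.ball_mem_nhds _ hr))
  simp only [sub_self, zero_div, sinh_zero, mul_zero] at hφc hφ hφi hφ0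
  set B := Metric.ball (0 : ℂ) ρ
  have quad : ∀ σ τ : ℝ, ∃ C : ℝ, ∀ᶠ ν in 𝓝 μ₀,
      0 < σ * (s * sinh ((ν - μ₀) / 2)).re → 0 < τ * (s * sinh ((ν - μ₀) / 2)).im →
      ∀ i j, ‖F (lam ν) i j‖ ≤ C := by
    intro σ τ
    have hconv : Convex ℝ (B ∩ {z | 0 < τ * z.im} ∩ {z | 0 < σ * z.re}) := by
      refine (convex_upper _ _ _).inter ?_
      have : {z : ℂ | 0 < σ * z.re} = (fun z : ℂ => σ * z.re) ⁻¹' Set.Ioi 0 := rfl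
      rw [this]
      refine (convex_Ioi 0).is_linear_preimage ⟨fun a b => ?_, fun c a => ?_⟩
      · simp; ring
      · simp; ring
    obtain ⟨G, hG, hFG⟩ := hext.exists_of_convex (φ := φ) hconv
      (hφc.mono fun z hz => hz.1.1) (by
        rintro z ⟨⟨hz, hz1⟩, hz2⟩
        refine ⟨(hφ z hz).1, fun hc => ?_⟩
        rw [lam_mem_contour, him, (hφ z hz).2] at hc
        rcases hc with h | h
        · rw [Set.mem_ofPred_eq, h, mul_zero] at hz2; exact lt_irrefl _ hz2
        · rw [Set.mem_ofPred_eq, h, mul_zero] at hz1; exact lt_irrefl _ hz1)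
    have hbd : ∀ i j, ∀ᶠ ν in 𝓝 μ₀, ‖G (lam ν) i j‖ < ‖G (lam μ₀) i j‖ + 1 := fun i j => by
      have hc : ContinuousAt (fun ν => ‖G (lam ν) i j‖) μ₀ :=
        (((hG i j _ (Metric.mem_ball_self hr)).continuousAt).comp hcl.continuousAt).norm
      exact hc.eventually_lt_const (by linarith)
    refine ⟨‖G (lam μ₀) 0 0‖ + ‖G (lam μ₀) 0 1‖ + ‖G (lam μ₀) 1 0‖ + ‖G (lam μ₀) 1 1‖ + 1, ?_⟩
    filter_upwards [hφi, hbd 0 0, hbd 0 1, hbd 1 0, hbd 1 1] with ν h1 b1 b2 b3 b4 h2 h3 i j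
    have := hFG _ ⟨⟨h1.1, h3⟩, h2⟩
    rw [h1.2] at this
    rw [this]
    have n1 := norm_nonneg (G (lam μ₀) 0 0)
    have n2 := norm_nonneg (G (lam μ₀) 0 1)
    have n3 := norm_nonneg (G (lam μ₀) 1 0)
    have n4 := norm_nonneg (G (lam μ₀) 1 1)
    fin_cases i <;> fin_cases j <;> simp <;> linarith
  obtain ⟨C1, h1⟩ := quad 1 1
  obtain ⟨C2, h2⟩ := quad 1 (-1)
  obtain ⟨C3, h3⟩ := quad (-1) 1
  obtain ⟨C4, h4⟩ := quad (-1) (-1)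
  refine ⟨max (max C1 C2) (max C3 C4), ?_⟩
  filter_upwards [h1, h2, h3, h4] with ν h1 h2 h3 h4 hν i j
  rw [lam_mem_contour, him, not_or] at hν
  obtain ⟨hre, him'⟩ := hν
  rcases lt_or_gt_of_ne hre with ha | ha <;> rcases lt_or_gt_of_ne him' with hb | hb
  · exact (h4 (by linarith) (by linarith) i j).trans ((le_max_right _ _).trans (le_max_right _ _))
  · exact (h3 (by linarith) (by linarith) i j).trans ((le_max_left _ _).trans (le_max_right _ _))
  · exact (h2 (by linarith) (by linarith) i j).trans ((le_max_right _ _).trans (le_max_left _ _))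
  · exact (h1 (by linarith) (by linarith) i j).trans ((le_max_left _ _).trans (le_max_left _ _))

/-! ### The sheets of the logarithm -/

theorem exists_int_of_exp_eq {a b : ℂ} (h : exp a = exp b) : ∃ k : ℤ, a = b + 2 * Real.pi * I * k := by
  obtain ⟨k, hk⟩ := exp_eq_exp_iff_exists_int.1 h
  exact ⟨k, by rw [hk]; ring⟩

/-- The sheet of the point `μ` relative to the cut plane on which `branchLog` is defined. -/
def sheet (x μ : ℂ) : ℤ := round ((μ - I * (Real.pi / 2) - branchLog x (lam μ)) / (2 * Real.pi * I)).re

theorem sheet_eq {x μ : ℂ} {k : ℤ}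
    (h : branchLog x (lam μ) + 2 * Real.pi * I * k = μ - I * (Real.pi / 2)) : sheet x μ = k := by
  unfold sheet
  rw [← h, add_sub_cancel_left, mul_div_cancel_left₀ _ two_pi_I_ne_zero]
  simp

theorem sheet_spec {x μ : ℂ} (hx : x ≠ 0) (h : lam μ ∉ contour x) :
    branchLog x (lam μ) + 2 * Real.pi * I * sheet x μ = μ - I * (Real.pi / 2) := by
  have hne : lam μ ≠ -I := fun h0 => h (by
    rw [lam_mem_contour, zeta_eq x (lam_ne_zero μ), h0]; simp)
  obtain ⟨k, hk⟩ := exists_int_of_exp_eq (a := μ - I * (Real.pi / 2)) (b := branchLog x (lam μ))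
    (by rw [exp_eq_lam, exp_branchLog hx (lam_ne_zero μ) hne])
  rw [sheet_eq hk.symm, hk]

/-- Two continuous logarithms of λ differ by an integer multiple of 2πi, which is locally constant.
-/
theorem eventually_sheet_const {ℓ : ℂ → ℂ} {μ₀ : ℂ} (hc : ContinuousAt ℓ μ₀)
    (he : ∀ᶠ μ in 𝓝 μ₀, exp (ℓ μ) = lam μ) :
    ∃ κ : ℤ, ∀ᶠ μ in 𝓝 μ₀, ℓ μ + 2 * Real.pi * I * κ = μ - I * (Real.pi / 2) := by
  obtain ⟨κ, hκ⟩ := exists_int_of_exp_eq (a := μ₀ - I * (Real.pi / 2)) (b := ℓ μ₀)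
    (by rw [exp_eq_lam, he.self_of_nhds])
  refine ⟨κ, ?_⟩
  have hcont : ContinuousAt (fun μ => ‖(μ - I * (Real.pi / 2) - ℓ μ) / (2 * Real.pi * I) - κ‖) μ₀ :=
    ((((continuousAt_id.sub continuousAt_const).sub hc).div_const _).sub continuousAt_const).norm
  have h0 : ‖(μ₀ - I * (Real.pi / 2) - ℓ μ₀) / (2 * Real.pi * I) - κ‖ < 1 := by
    rw [hκ, add_sub_cancel_left, mul_div_cancel_left₀ _ two_pi_I_ne_zero]; simp
  filter_upwards [he, hcont.eventually_lt_const h0] with μ h1 h2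
  obtain ⟨k, hk⟩ := exists_int_of_exp_eq (a := μ - I * (Real.pi / 2)) (b := ℓ μ)
    (by rw [exp_eq_lam, h1])
  rw [hk, add_sub_cancel_left, mul_div_cancel_left₀ _ two_pi_I_ne_zero] at h2
  have h3 : ‖((k - κ : ℤ) : ℂ)‖ < 1 := by push_cast; exact h2
  rw [norm_intCast] at h3
  have h4 : |k - κ| < 1 := by exact_mod_cast h3
  have h5 : k = κ := by have := Int.abs_lt_one_iff.1 h4; omega
  rw [hk, h5]

theorem neg_zeta_mem_slitPlane {x l : ℂ} (h : l ∉ contour x) : -zeta x l ∈ slitPlane := by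
  rw [mem_slitPlane_iff]
  right
  rw [neg_im, neg_ne_zero]
  exact fun h0 => h (Or.inr h0)

/-- The branch of the logarithm on the two sides of its cut. -/
theorem exists_branchLog_cut {x p : ℂ} (hx : x ∈ slitPlane) (hp : p ≠ 0) (hp1 : ‖p‖ ≠ 1)
    (him : (zeta x p).im = 0) (hre : 0 < (zeta x p).re) :
    ∃ ℓ : ℂ → ℂ, ContinuousAt ℓ p ∧ ∀ᶠ l in 𝓝 p, exp (ℓ l) = l ∧
      ((zeta x l).im < 0 → branchLog x l = ℓ l) ∧
      (0 < (zeta x l).im →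
        branchLog x l = ℓ l + 2 * Real.pi * I * (if 1 < ‖p‖ then -1 else 1 : ℤ)) := by
  have hx0 := slitPlane_ne_zero hx
  have hzs : zeta x p ∈ slitPlane := Or.inl hre
  have hzc : ContinuousAt (zeta x) p := by unfold zeta; fun_prop (disch := assumption)
  -- Near the cut (-ζ)^{1/2} = ± i ζ^{1/2}, with a sign that depends on the side. So w is the
  -- continuation of `branchRoot` from the side Im ζ < 0, and on the other side `branchRoot` is -w.
  set w : ℂ → ℂ := fun l => -I * (l + I) * x ^ (1 / 2 : ℂ) / (I * zeta x l ^ (1 / 2 : ℂ)) with hw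
  have hhalf0 : ∀ z : ℂ, z ∈ slitPlane → z ^ (1 / 2 : ℂ) ≠ 0 := fun z hz h => by
    have := half_re_pos hz; rw [h] at this; simp at this
  have hwc : ContinuousAt w p := by
    have h1 : ContinuousAt (fun l => zeta x l ^ (1 / 2 : ℂ)) p :=
      hzc.cpow continuousAt_const hzs
    exact ContinuousAt.div (by fun_prop) (continuousAt_const.mul h1)
      (mul_ne_zero I_ne_zero (hhalf0 _ hzs))
  have hw2 : ∀ l, l ≠ 0 → zeta x l ∈ slitPlane → w l ^ 2 = l / I := by
    intro l hl hz
    have h0 : zeta x l ≠ 0 := slitPlane_ne_zero hz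
    have hlI : (l + I) ≠ 0 := fun h => h0 (by rw [zeta_eq x hl, h]; simp)
    rw [hw]
    simp only
    rw [div_pow, mul_pow, mul_pow, mul_pow, sq_half, sq_half, zeta_eq x hl]
    field_simp
  -- The relation w + w⁻¹ = i t x^{-1/2} with t > 0 has positive imaginary part, and |w|² = ‖p‖
  -- makes that part equal to Im w · (1 - 1/‖p‖). The sign of Im w decides whether log(-w) is log w
  -- - iπ or log w + iπ.
  have hsign : (1 < ‖p‖ → 0 < (w p).im) ∧ (‖p‖ < 1 → (w p).im < 0) := by
    have h2 := hw2 p hp hzs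
    have hwp0 : w p ≠ 0 := fun h => by
      rw [h] at h2
      simp only [ne_eq, OfNat.ofNat_ne_zero, not_false_eq_true, zero_pow] at h2
      exact div_ne_zero hp I_ne_zero h2.symm
    have hsx := half_re_pos hx
    have hsx0 := hhalf0 x hx
    set sx := x ^ (1 / 2 : ℂ)
    have hζ : zeta x p = ((zeta x p).re : ℂ) := Complex.ext rfl (by simp [him])
    have hsz : zeta x p ^ (1 / 2 : ℂ) = ((√(zeta x p).re : ℝ) : ℂ) := by
      conv_lhs => rw [hζ]
      rw [Real.sqrt_eq_rpow, ofReal_cpow hre.le]; simp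
    set t := √(zeta x p).re
    have ht : 0 < t := Real.sqrt_pos.2 hre
    have hp2 : p = I * w p ^ 2 := by rw [h2]; field_simp
    have e1 : w p * (I * (t : ℂ)) = -I * (p + I) * sx := by
      have : w p = -I * (p + I) * sx / (I * (t : ℂ)) := by rw [hw]; simp only; rw [hsz]
      conv_lhs => rw [this]
      exact div_mul_cancel₀ _ (mul_ne_zero I_ne_zero (by exact_mod_cast ht.ne'))
    have e2 : w p + (w p)⁻¹ = (t : ℂ) * (I * sx⁻¹) := by
      have e3 : -I * (p + I) = w p ^ 2 + 1 := by
        rw [mul_add, neg_mul, neg_mul, I_mul_I]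
        nth_rewrite 1 [hp2]
        linear_combination (-(w p) ^ 2) * I_sq
      rw [e3] at e1
      field_simp
      linear_combination -e1
    have e4 := congrArg Complex.im e2
    rw [add_im, inv_im, im_ofReal_mul, mul_im, I_re, I_im, zero_mul, one_mul, zero_add, inv_re] at e4
    have hn : normSq (w p) = ‖p‖ := by
      rw [normSq_eq_norm_sq, ← norm_pow, h2]; simp
    rw [hn] at e4
    have hpp : 0 < ‖p‖ := norm_pos_iff.2 hp
    have hpos : 0 < t * (sx.re / normSq sx) := mul_pos ht (div_pos hsx (normSq_pos.2 hsx0))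
    have e5 : (w p).im * (‖p‖ - 1) = ‖p‖ * (t * (sx.re / normSq sx)) := by
      rw [← e4]; field_simp; ring
    have e6 : 0 < (w p).im * (‖p‖ - 1) := by rw [e5]; positivity
    constructor
    · intro h; exact (pos_iff_pos_of_mul_pos e6).2 (by linarith)
    · intro h; exact (neg_iff_neg_of_mul_pos e6).2 (by linarith)
  have hwim : (w p).im ≠ 0 := by
    rcases lt_or_gt_of_ne hp1 with h | h
    · exact (hsign.2 h).ne
    · exact (hsign.1 h).ne'
  have hws : w p ∈ slitPlane := Or.inr hwim
  have hbr : ∀ l, l ≠ 0 → zeta x l ∈ slitPlane →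
      ((zeta x l).im < 0 → branchRoot x l = w l) ∧ (0 < (zeta x l).im → branchRoot x l = -w l) := by
    intro l hl hz
    have h1 := half_re_pos hz
    have h2 := half_im_mul (zeta x l)
    constructor
    · intro h
      have h3 : (-zeta x l) ^ (1 / 2 : ℂ) = I * zeta x l ^ (1 / 2 : ℂ) := by
        have : -zeta x l = (I * zeta x l ^ (1 / 2 : ℂ)) ^ 2 := by
          rw [mul_pow, sq_half, I_sq]; ring
        rw [this, one_div, sq_cpow_two_inv]
        rw [one_div] at h1 h2
        simp only [mul_re, I_re, zero_mul, I_im, one_mul, zero_sub]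
        nlinarith
      unfold branchRoot; rw [h3]
    · intro h
      have h3 : (-zeta x l) ^ (1 / 2 : ℂ) = -(I * zeta x l ^ (1 / 2 : ℂ)) := by
        have : -zeta x l = (-(I * zeta x l ^ (1 / 2 : ℂ))) ^ 2 := by
          rw [neg_sq, mul_pow, sq_half, I_sq]; ring
        rw [this, one_div, sq_cpow_two_inv]
        rw [one_div] at h1 h2
        simp only [neg_re, mul_re, I_re, zero_mul, I_im, one_mul, zero_sub, neg_neg]
        nlinarith
      unfold branchRoot; rw [h3, div_neg]
  refine ⟨fun l => 2 * log (w l) + I * (Real.pi / 2),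
    ((hwc.clog hws).const_mul 2).add continuousAt_const, ?_⟩
  have hev_sign : ∀ᶠ l in 𝓝 p, if 1 < ‖p‖ then 0 < (w l).im else (w l).im < 0 := by
    have hc : ContinuousAt (fun l => (w l).im) p := continuous_im.continuousAt.comp hwc
    split_ifs with h
    · exact hc.eventually_const_lt (hsign.1 h)
    · exact hc.eventually_lt_const (hsign.2 (lt_of_le_of_ne (not_lt.1 h) hp1))
  filter_upwards [isOpen_ne.mem_nhds hp, hzc.preimage_mem_nhds (isOpen_slitPlane.mem_nhds hzs),
    hev_sign] with l hl hz hs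
  have h2 := hw2 l hl hz
  have hwl0 : w l ≠ 0 := fun h => by
    rw [h] at h2
    simp only [ne_eq, OfNat.ofNat_ne_zero, not_false_eq_true, zero_pow] at h2
    exact div_ne_zero hl I_ne_zero h2.symm
  refine ⟨?_, fun h => ?_, fun h => ?_⟩
  · rw [exp_add, two_mul, exp_add, exp_log hwl0, ← pow_two, h2, mul_comm I, exp_pi_div_two_mul_I]
    field_simp
  · unfold branchLog; rw [(hbr l hl hz).1 h]
  · unfold branchLog
    rw [(hbr l hl hz).2 h]
    split_ifs at hs ⊢ with h1
    · have : log (-w l) = log (w l) - Real.pi * I := by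
        rw [log, log, norm_neg, arg_neg_eq_arg_sub_pi_of_im_pos hs]; push_cast; ring
      rw [this]; push_cast; ring
    · have : log (-w l) = log (w l) + Real.pi * I := by
        rw [log, log, norm_neg, arg_neg_eq_arg_add_pi_of_im_neg hs]; push_cast; ring
      rw [this]; push_cast; ring

/-! ### The continuation of a solution to the logarithmic plane -/

/-- The factor that connects the two sides of the contour. -/
def side (m z : ℂ) : Mat := if 0 < z.im then 1 else VInfUp m

/-- `Φ` is the continuation of `F` to the `μ`-plane. -/
def IsCont (n : ℤ) (m x : ℂ) (F Φ : ℂ → Mat) : Prop :=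
  ∀ (μ : ℂ) (k : ℤ), lam μ ∉ contour x →
    branchLog x (lam μ) + 2 * Real.pi * I * k = μ - I * (Real.pi / 2) →
    Φ μ = F (lam μ) * side m (zeta x (lam μ)) * ((monodU n m ^ k : Matˣ) : Mat)

theorem continuousAt_zeta {x l : ℂ} (hl : l ≠ 0) : ContinuousAt (zeta x) l := by
  unfold zeta; fun_prop (disch := assumption)

/-- The continuation is F times `side` times the power of the monodromy matrix given by the sheet.
On the arcs where ζ < 0 the sheet does not change and `side` absorbs the jump. On the arcs where ζ >
0 the sheet changes by one, and the power of the monodromy matrix absorbs what `side` leaves. On the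
contour, at zeros of sinh μ, boundedness suffices. -/
theorem exists_continuation {n : ℤ} {m x : ℂ} (hx : x ∈ slitPlane) {F : ℂ → Mat} {cInf c0 : ℕ → Mat}
    (h : IsSolution n m x F cInf c0) :
    ∃ Φ : ℂ → Mat, (∀ i j, Differentiable ℂ fun μ => Φ μ i j) ∧ IsCont n m x F Φ := by
  have hx0 := slitPlane_ne_zero hx
  have hcl := differentiable_lam.continuous
  set f : ℂ → Mat := fun μ =>
    F (lam μ) * side m (zeta x (lam μ)) * ((monodU n m ^ sheet x μ : Matˣ) : Mat) with hf
  set Ω : Set ℂ := {ν | lam ν ∉ contour x} with hΩ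
  have hfs : ∀ {μ : ℂ} {k : ℤ}, sheet x μ = k →
      (0 < (zeta x (lam μ)).im → f μ = F (lam μ) * ((monodU n m ^ k : Matˣ) : Mat)) ∧
      ((zeta x (lam μ)).im < 0 →
        f μ = F (lam μ) * (VInfUp m * ((monodU n m ^ k : Matˣ) : Mat))) := by
    intro μ k hk
    constructor
    · intro h1; simp only [hf, side, h1, if_true, mul_one, hk]
    · intro h1; simp only [hf, side, not_lt.2 h1.le, if_false, hk, mul_assoc]
  have hentry : ∀ i j, ∃ Φ : ℂ → ℂ, Differentiable ℂ Φ ∧ ∀ μ ∈ Ω, Φ μ = f μ i j := by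
    intro i j
    refine exists_entire_extension (S := {μ | sinh μ = 0 ∧ lam μ ∈ contour x})
      (neBot_nhdsWithin_compl_contour hx0) (fun μ => ?_) (fun μ hμ => ?_) (fun μ hμ => ?_)
    · have hana : AnalyticAt ℂ sinh μ := differentiable_sinh.analyticAt μ
      rcases hana.eventually_eq_zero_or_eventually_ne_zero with h0 | h0
      · exfalso
        have h1 : AnalyticOnNhd ℂ sinh Set.univ := fun z _ => differentiable_sinh.analyticAt z
        have h2 := h1.eqOn_of_preconnected_of_eventuallyEq (g := fun _ => 0) analyticOnNhd_const
          isPreconnected_univ (Set.mem_univ μ) h0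
        have h3 := h2 (Set.mem_univ (Real.pi / 2 * I))
        rw [sinh_mul_I] at h3
        simp at h3
      · filter_upwards [h0] with ν hν h1
        exact hν h1.1
    · by_cases hc : lam μ ∈ contour x
      · have hsinh : sinh μ ≠ 0 := fun h0 => hμ ⟨h0, hc⟩
        obtain ⟨r, hr, hext⟩ := h.extends_to_contour (lam μ) hc (lam_ne_zero μ)
        have him : (zeta x (lam μ)).im = 0 := lam_mem_contour.1 hc
        have hζc : ContinuousAt (fun l => (zeta x l).re) (lam μ) :=
          continuous_re.continuousAt.comp (continuousAt_zeta (lam_ne_zero μ))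
        have hnormc : ContinuousAt (fun l : ℂ => ‖l‖) (lam μ) := continuous_norm.continuousAt
        have hlne : ∀ᶠ l in 𝓝 (lam μ), l ≠ 0 := isOpen_ne.mem_nhds (lam_ne_zero μ)
        have hre0 : (zeta x (lam μ)).re ≠ 0 := fun hre => by
          have h0 : zeta x (lam μ) = 0 := Complex.ext hre him
          rw [zeta_lam] at h0
          have h1 : cosh μ = 1 := by
            have := (mul_eq_zero.1 h0).resolve_left (mul_ne_zero two_ne_zero hx0)
            exact sub_eq_zero.1 this
          have h2 := cosh_sq μ
          rw [h1] at h2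
          exact hsinh (by simpa using h2)
        -- On the unit circle μ is imaginary and ζ = 2x(cos(Im μ) - 1). Off the critical points this
        -- is real only for real x, and then it is negative.
        have hcirc : ‖lam μ‖ = 1 → x.im = 0 ∧ (zeta x (lam μ)).re < 0 ∧ (lam μ).re ≠ 0 := by
          intro h1
          rw [norm_lam, Real.exp_eq_one_iff] at h1
          have hμI : μ = μ.im * I := by
            apply Complex.ext <;> simp [h1]
          have e1 : zeta x (lam μ) = ((2 * (Real.cos μ.im - 1) : ℝ) : ℂ) * x := by
            rw [zeta_lam, hμI, cosh_mul_I]; push_cast; simp; ring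
          have hs : Real.sin μ.im ≠ 0 := fun hs => hsinh (by
            rw [hμI, sinh_mul_I, ← ofReal_sin, hs]; simp)
          have hc1 : Real.cos μ.im < 1 := by
            refine lt_of_le_of_ne (Real.cos_le_one _) fun h2 => hs ?_
            have := Real.sin_sq_add_cos_sq μ.im
            rw [h2] at this
            nlinarith
          rw [e1, im_ofReal_mul] at him
          have hxi : x.im = 0 := (mul_eq_zero.1 him).resolve_left (by nlinarith)
          refine ⟨hxi, ?_, ?_⟩
          · have hxr : 0 < x.re := by
              rcases mem_slitPlane_iff.1 hx with h2 | h2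
              · exact h2
              · exact absurd hxi h2
            rw [e1, re_ofReal_mul]; nlinarith
          · rw [lam, hμI, exp_mul_I]
            simpa [← ofReal_cos, ← ofReal_sin] using hs
        rcases lt_or_gt_of_ne hre0 with hneg | hpos
        · -- the arcs that are not cut
          have hns : -zeta x (lam μ) ∈ slitPlane := by
            left; rw [neg_re]; linarith
          obtain ⟨κ, hκ⟩ := eventually_sheet_const (μ₀ := μ) (ℓ := fun μ => branchLog x (lam μ))
            (ContinuousAt.comp (f := lam) (differentiableAt_branchLog hx (lam_ne_zero μ)
              hns).continuousAt hcl.continuousAt) (by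
              have : ∀ᶠ ν in 𝓝 μ, (zeta x (lam ν)).re < 0 :=
                (ContinuousAt.comp (f := lam) hζc hcl.continuousAt).eventually_lt_const hneg
              filter_upwards [this] with ν hν
              refine exp_branchLog hx0 (lam_ne_zero ν) fun h0 => ?_
              rw [zeta_eq x (lam_ne_zero ν), h0] at hν
              simp at hν)
          have hff : ∀ᶠ ν in 𝓝 μ, (0 < (zeta x (lam ν)).im →
              f ν = F (lam ν) * ((monodU n m ^ κ : Matˣ) : Mat)) ∧ ((zeta x (lam ν)).im < 0 →
              f ν = F (lam ν) * (VInfUp m * ((monodU n m ^ κ : Matˣ) : Mat))) := by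
            filter_upwards [hκ] with ν hν using hfs (sheet_eq hν)
          have hrev : ∀ᶠ l in 𝓝 (lam μ), (zeta x l).re < 0 := hζc.eventually_lt_const hneg
          rcases lt_trichotomy ‖lam μ‖ 1 with hn | hn | hn
          · refine glue_regular hr hx0 hsinh hext hc (Sp := OmZeroPos x) (Sm := OmZeroNeg x)
              (W := VInfUp m) ?_ hff rfl i j
            filter_upwards [hnormc.eventually_lt_const hn, hrev, hlne] with l l1 l2 l3
            exact ⟨fun hl => (h.jump_zeroUp l ⟨l3, l1, hl, l2⟩).symm (VZeroUp_mul_VInfUp m),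
              fun hl => ⟨l3, l1, hl⟩, fun hl => ⟨l3, l1, hl⟩⟩
          · obtain ⟨hxi, -, hlre⟩ := hcirc hn
            have hxr : 0 < x.re := by
              rcases mem_slitPlane_iff.1 hx with h2 | h2
              · exact h2
              · exact absurd hxi h2
            -- For x > 0 this factorization identifies the regions on the two sides of the unit
            -- circle by the signs of Re λ and of Im ζ.
            have hsgn : ∀ l : ℂ, l ≠ 0 → (zeta x l).im = x.re * (1 - (‖l‖ ^ 2)⁻¹) * l.re := by
              intro l hl
              have e : x = (x.re : ℂ) := Complex.ext rfl (by simp [hxi])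
              have hI : (I * x).re = 0 ∧ (I * x).im = x.re := by simp [hxi]
              unfold zeta
              rw [mul_im, hI.1, hI.2, zero_mul, zero_add]
              simp only [sub_re, add_re, inv_re, mul_re, re_ofNat, I_re, mul_zero, im_ofNat, I_im,
                mul_one, sub_self, add_zero, normSq_eq_norm_sq]
              field_simp
            have hn1 : ∀ l : ℂ, l ≠ 0 → (0 < 1 - (‖l‖ ^ 2)⁻¹ ↔ 1 < ‖l‖) ∧
                (1 - (‖l‖ ^ 2)⁻¹ < 0 ↔ ‖l‖ < 1) := by
              intro l hl
              have hp : 0 < ‖l‖ ^ 2 := by positivity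
              constructor
              · rw [sub_pos, inv_lt_one₀ hp, one_lt_sq_iff₀ (norm_nonneg _)]
              · rw [sub_neg, one_lt_inv₀ hp, sq_lt_one_iff₀ (norm_nonneg _)]
            rcases lt_or_gt_of_ne hlre with hl | hl
            · refine glue_regular hr hx0 hsinh hext hc (Sp := OmZeroPos x) (Sm := OmInfNeg x)
                (W := VInfUp m) ?_ hff rfl i j
              filter_upwards [continuous_re.continuousAt.eventually_lt_const hl, hlne] with l l1 l2
              have hs := hsgn l l2
              obtain ⟨n1, n2⟩ := hn1 l l2
              refine ⟨fun h0 => (h.jump_circle_left hxi l ?_ l1).symm (VZeroUp_mul_VInfUp m),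
                fun h0 => ⟨l2, n2.1 ?_, h0⟩, fun h0 => ⟨n1.1 ?_, h0⟩⟩
              · by_contra hne
                rw [hs] at h0
                have h3 := (mul_eq_zero.1 ((mul_eq_zero.1 h0).resolve_right l1.ne)).resolve_left
                  hxr.ne'
                rcases lt_or_gt_of_ne hne with h4 | h4
                · exact (n2.2 h4).ne h3
                · exact (n1.2 h4).ne' h3
              · rw [hs] at h0
                by_contra! h4
                nlinarith [mul_nonneg hxr.le h4]
              · rw [hs] at h0
                by_contra! h4
                nlinarith [mul_nonneg hxr.le (neg_nonneg.2 h4)]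
            · refine glue_regular hr hx0 hsinh hext hc (Sp := OmInfPos x) (Sm := OmZeroNeg x)
                (W := VInfUp m) ?_ hff rfl i j
              filter_upwards [continuous_re.continuousAt.eventually_const_lt hl, hlne] with l l1 l2
              have hs := hsgn l l2
              obtain ⟨n1, n2⟩ := hn1 l l2
              refine ⟨fun h0 => h.jump_circle_right hxi l ?_ l1,
                fun h0 => ⟨n1.1 ?_, h0⟩, fun h0 => ⟨l2, n2.1 ?_, h0⟩⟩
              · by_contra hne
                rw [hs] at h0
                have h3 := (mul_eq_zero.1 ((mul_eq_zero.1 h0).resolve_right l1.ne')).resolve_left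
                  hxr.ne'
                rcases lt_or_gt_of_ne hne with h4 | h4
                · exact (n2.2 h4).ne h3
                · exact (n1.2 h4).ne' h3
              · rw [hs] at h0
                by_contra! h4
                nlinarith [mul_nonneg hxr.le (neg_nonneg.2 h4)]
              · rw [hs] at h0
                by_contra! h4
                nlinarith [mul_nonneg hxr.le h4]
          · refine glue_regular hr hx0 hsinh hext hc (Sp := OmInfPos x) (Sm := OmInfNeg x)
              (W := VInfUp m) ?_ hff rfl i j
            filter_upwards [hnormc.eventually_const_lt hn, hrev] with l l1 l2
            exact ⟨fun hl => h.jump_infUp l ⟨l1, hl, l2⟩, fun hl => ⟨l1, hl⟩, fun hl => ⟨l1, hl⟩⟩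
        · -- the arcs along which the logarithm is cut
          have hn1 : ‖lam μ‖ ≠ 1 := fun h1 => (hcirc h1).2.1.not_gt hpos
          obtain ⟨ℓ, hℓc, hℓ⟩ := exists_branchLog_cut hx (lam_ne_zero μ) hn1 him hpos
          have hℓ' := hcl.continuousAt.eventually hℓ
          obtain ⟨κ, hκ⟩ := eventually_sheet_const (μ₀ := μ) (ℓ := fun μ => ℓ (lam μ))
            (ContinuousAt.comp (f := lam) hℓc hcl.continuousAt) (hℓ'.mono fun ν hν => hν.1)
          have hrev : ∀ᶠ l in 𝓝 (lam μ), 0 < (zeta x l).re := hζc.eventually_const_lt hpos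
          rcases lt_or_gt_of_ne hn1 with hn | hn
          -- Inside the unit disk the logarithm is larger by 2πi on the side Im ζ > 0 of the cut, so
          -- the sheet index there is κ - 1. Outside the disk it is κ + 1.
          · refine glue_regular hr hx0 hsinh hext hc (Sp := OmZeroPos x) (Sm := OmZeroNeg x)
              (W := (-1 : ℂ) ^ n • VZeroLow m) (Mp := ((monodU n m ^ (κ - 1) : Matˣ) : Mat))
              (Mm := VInfUp m * ((monodU n m ^ κ : Matˣ) : Mat)) ?_ ?_ ?_ i j
            · filter_upwards [hnormc.eventually_lt_const hn, hrev, hlne] with l l1 l2 l3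
              exact ⟨fun hl => h.jump_zeroLow l ⟨l3, l1, hl, l2⟩,
                fun hl => ⟨l3, l1, hl⟩, fun hl => ⟨l3, l1, hl⟩⟩
            · filter_upwards [hκ, hℓ'] with ν h1 h2
              refine ⟨fun h3 => (hfs (sheet_eq ?_)).1 h3, fun h3 => (hfs (sheet_eq ?_)).2 h3⟩
              · rw [h2.2.2 h3, ← h1, if_neg (not_lt.2 hn.le)]; push_cast; ring
              · rw [h2.2.1 h3, ← h1]
            · rw [smul_VZeroLow_eq, mul_assoc, ← Units.val_mul, ← zpow_one_add]
              congr 3; ring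
          · refine glue_regular hr hx0 hsinh hext hc (Sp := OmInfPos x) (Sm := OmInfNeg x)
              (W := VInfUp m * ((monodU n m)⁻¹ : Matˣ))
              (Mp := ((monodU n m ^ (κ + 1) : Matˣ) : Mat))
              (Mm := VInfUp m * ((monodU n m ^ κ : Matˣ) : Mat)) ?_ ?_ ?_ i j
            · filter_upwards [hnormc.eventually_const_lt hn, hrev] with l l1 l2
              exact ⟨fun hl => (h.jump_infLow l ⟨l1, hl, l2⟩).symm (smul_VInfLow_mul n m),
                fun hl => ⟨l1, hl⟩, fun hl => ⟨l1, hl⟩⟩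
            · filter_upwards [hκ, hℓ'] with ν h1 h2
              refine ⟨fun h3 => (hfs (sheet_eq ?_)).1 h3, fun h3 => (hfs (sheet_eq ?_)).2 h3⟩
              · rw [h2.2.2 h3, ← h1, if_pos hn]; push_cast; ring
              · rw [h2.2.1 h3, ← h1]
            · rw [mul_assoc, ← Units.val_mul, zpow_add_one, ← (Commute.refl (monodU n m)).zpow_right κ,
                inv_mul_cancel_left]
      · have hns := neg_zeta_mem_slitPlane hc
        obtain ⟨κ, hκ⟩ := eventually_sheet_const (μ₀ := μ) (ℓ := fun μ => branchLog x (lam μ))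
          (ContinuousAt.comp (f := lam) (differentiableAt_branchLog hx (lam_ne_zero μ)
            hns).continuousAt hcl.continuousAt) (by
            have : ContinuousAt (fun ν => (zeta x (lam ν)).im) μ :=
              continuous_im.continuousAt.comp (differentiable_zeta_lam x).continuous.continuousAt
            have h0 : (zeta x (lam μ)).im ≠ 0 := fun h0 => hc (lam_mem_contour.2 h0)
            filter_upwards [this.eventually_ne h0] with ν hν
            refine exp_branchLog hx0 (lam_ne_zero ν) fun h0 => hν ?_
            rw [zeta_eq x (lam_ne_zero ν), h0]; simp)
        have hana : ∀ M : Mat, AnalyticAt ℂ (fun ν => (F (lam ν) * M) i j) μ := by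
          intro M
          simp only [Matrix.mul_apply, Fin.sum_univ_two]
          have h1 : ∀ k, AnalyticAt ℂ (fun ν => F (lam ν) i k) μ := fun k =>
            AnalyticAt.comp (f := lam) (h.analytic _ hc i k) (analyticAt_lam μ)
          exact ((h1 0).mul analyticAt_const).add ((h1 1).mul analyticAt_const)
        have h0 : (zeta x (lam μ)).im ≠ 0 := fun h0 => hc (lam_mem_contour.2 h0)
        have hcim : ContinuousAt (fun ν => (zeta x (lam ν)).im) μ :=
          continuous_im.continuousAt.comp (differentiable_zeta_lam x).continuous.continuousAt
        rcases lt_or_gt_of_ne h0 with h1 | h1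
        · refine ⟨_, hana (VInfUp m * ((monodU n m ^ κ : Matˣ) : Mat)), ?_⟩
          filter_upwards [hκ, hcim.eventually_lt_const h1] with ν h2 h3 _
          rw [(hfs (sheet_eq h2)).2 h3]
        · refine ⟨_, hana ((monodU n m ^ κ : Matˣ) : Mat), ?_⟩
          filter_upwards [hκ, hcim.eventually_const_lt h1] with ν h2 h3 _
          rw [(hfs (sheet_eq h2)).1 h3]
    · obtain ⟨hsinh, hc⟩ := hμ
      refine ⟨fun h' => h' hc, ?_⟩
      obtain ⟨r, hr, hext⟩ := h.extends_to_contour (lam μ) hc (lam_ne_zero μ)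
      obtain ⟨B, hB⟩ := bounded_critical hr hx0 hsinh hext hc
      obtain ⟨B', hB'⟩ := norm_monodU_zpow_le n m
      have hmul : ∀ (A A' : Mat) (b b' : ℝ), (∀ i j, ‖A i j‖ ≤ b) → (∀ i j, ‖A' i j‖ ≤ b') →
          ∀ i j, ‖(A * A') i j‖ ≤ 2 * (b * b') := by
        intro A A' b b' hA hA' i j
        have hb : 0 ≤ b := (norm_nonneg _).trans (hA 0 0)
        rw [Matrix.mul_apply, Fin.sum_univ_two]
        refine (norm_add_le _ _).trans ?_
        rw [norm_mul, norm_mul]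
        have h1 := mul_le_mul (hA i 0) (hA' 0 j) (norm_nonneg _) hb
        have h2 := mul_le_mul (hA i 1) (hA' 1 j) (norm_nonneg _) hb
        linarith
      have hside : ∃ S : ℝ, ∀ z i j, ‖side m z i j‖ ≤ S := by
        refine ⟨1 + ‖VInfUp m 0 1‖, fun z i j => ?_⟩
        have h1 := norm_nonneg (VInfUp m 0 1)
        unfold side VInfUp at *
        split_ifs <;> fin_cases i <;> fin_cases j <;> simp at * <;> linarith
      obtain ⟨S, hS⟩ := hside
      refine ⟨2 * (2 * (B * S) * B'), ?_⟩
      filter_upwards [hB] with ν hν hνΩ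
      exact hmul _ _ _ _ (hmul _ _ _ _ (hν hνΩ) (hS _)) (hB' _) i j
  choose Φ hΦ1 hΦ2 using hentry
  refine ⟨fun μ => Matrix.of fun i j => Φ i j μ, fun i j => hΦ1 i j, fun μ k hμ hk => ?_⟩
  rw [← sheet_eq hk]
  ext i j
  exact hΦ2 i j μ hμ

section

open scoped Matrix.Norms.Elementwise

/-! ### Periodicity and the symmetry `λ ↦ -1/λ` -/

theorem dense_compl_contour {x : ℂ} (hx : x ≠ 0) : Dense {ν | lam ν ∉ contour x} := fun μ =>
  mem_closure_iff_nhdsWithin_neBot.2 (neBot_nhdsWithin_compl_contour hx μ)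

/-- A full turn keeps λ and raises the sheet index by one. This is checked off the contour and
extended by density. -/
theorem IsCont.add_two_pi {n : ℤ} {m x : ℂ} {F Φ : ℂ → Mat} (hx : x ≠ 0) (h : IsCont n m x F Φ)
    (hΦ : Continuous Φ) (μ : ℂ) : Φ (μ + 2 * Real.pi * I) = Φ μ * monod n m := by
  refine congrFun (Continuous.ext_on (dense_compl_contour hx)
    (hΦ.comp (continuous_id.add continuous_const)) (hΦ.mul continuous_const) fun ν hν => ?_) μ
  have hs := sheet_spec hx hν
  have h1 := h ν _ hν hs
  have h2 := h (ν + 2 * Real.pi * I) (sheet x ν + 1) (by rwa [lam_add]) (by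
    rw [lam_add]; push_cast; linear_combination hs)
  rw [lam_add, zpow_add_one, Units.val_mul, ← mul_assoc, ← h1] at h2
  exact h2

theorem monodU_one_sub (n : ℤ) (m : ℂ) : monodU (1 - n) m = (monodU n m)⁻¹ := by
  refine eq_inv_of_mul_eq_one_left ?_
  ext1
  have h : monod (1 - n) m = -monod n m := by
    unfold monod
    rw [← neg_smul]
    congr 1
    rw [zpow_sub₀ (by norm_num), zpow_one, div_eq_mul_inv, ← inv_zpow]
    norm_num
  rw [Units.val_mul, monodU_val, monodU_val, h, neg_mul, monod_mul_self]; simp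

theorem branchRoot_neg_inv {x l : ℂ} (hl : l ≠ 0) (hz : -zeta x l ∈ slitPlane) :
    branchRoot x (-l⁻¹) = (branchRoot x l)⁻¹ := by
  have h0 : zeta x l ≠ 0 := neg_ne_zero.1 (slitPlane_ne_zero hz)
  refine eq_inv_of_mul_eq_one_left ?_
  unfold branchRoot
  rw [zeta_neg_inv, div_mul_div_comm, ← pow_two, sq_half]
  rw [div_eq_one_iff_eq (neg_ne_zero.2 h0), zeta_eq x hl]
  have h1 : -I * (-l⁻¹ + I) * x ^ (1 / 2 : ℂ) * (-I * (l + I) * x ^ (1 / 2 : ℂ))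
      = (-I) ^ 2 * (-l⁻¹ + I) * (l + I) * (x ^ (1 / 2 : ℂ)) ^ 2 := by ring
  rw [h1, sq_half]
  field_simp
  linear_combination (x * l * (l + I)) * I_sq

theorem branchLog_neg_inv {x l : ℂ} (hx : x ∈ slitPlane) (hl : l ≠ 0)
    (hz : -zeta x l ∈ slitPlane) : branchLog x (-l⁻¹) = -branchLog x l + I * Real.pi := by
  unfold branchLog
  rw [branchRoot_neg_inv hl hz, log_inv _
    (mem_slitPlane_iff_arg.1 (branchRoot_mem_slitPlane hx hl hz)).1]
  ring

theorem neg_inv_mem_contour {x l : ℂ} (hl : l ≠ 0) : -l⁻¹ ∈ contour x ↔ l ∈ contour x := by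
  unfold contour
  simp [hl, zeta_neg_inv]

/-- The inversion λ ↦ -1/λ preserves ζ and sends log λ to -log λ + iπ, so sheet k goes to sheet -k -
1. The shift by one is compensated by the factor `monod`. The reversed powers are powers of the
inverse of the monodromy matrix, which is the monodromy matrix for 1 - n. -/
theorem IsCont.mirror {n : ℤ} {m x : ℂ} {F Φ : ℂ → Mat} (hx : x ∈ slitPlane)
    (h : IsCont n m x F Φ) :
    IsCont (1 - n) m x (fun l => F (-l⁻¹)) (fun μ => Φ (-μ) * monod n m) := by
  intro μ k hμ hk
  have h1 := h (-μ) (-k - 1) (by rwa [lam_neg, neg_inv_mem_contour (lam_ne_zero μ)]) (by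
    rw [lam_neg, branchLog_neg_inv hx (lam_ne_zero μ) (neg_zeta_mem_slitPlane hμ)]
    push_cast; linear_combination -hk)
  rw [lam_neg, zeta_neg_inv] at h1
  simp only
  rw [h1, mul_assoc, monodU_one_sub, ← monodU_val, ← Units.val_mul, ← zpow_add_one, inv_zpow',
    sub_add_cancel]

theorem expSigma3_mul (a b : ℂ) : expSigma3 a * expSigma3 b = expSigma3 (a + b) := by
  unfold expSigma3
  ext i j
  fin_cases i <;> fin_cases j <;> simp [Matrix.mul_apply, Fin.sum_univ_two, ← exp_add]
  ring_nf

theorem expSigma3_zero : expSigma3 0 = 1 := by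
  unfold expSigma3; simp [Matrix.one_fin_two]

/-- The expansion at infinity, as in `IsSolution`. -/
def ExpandsAtInf (Θ x : ℂ) (F : ℂ → Mat) (c : ℕ → Mat) : Prop :=
  ∀ (N : ℕ) (i j : Fin 2),
    (fun l => (F l * expSigma3 (Θ / 2 * branchLog x l) *
        expSigma3 (-(I * x * l / 2)) - ∑ k ∈ Finset.range N, (l⁻¹) ^ k • c k) i j)
      =O[Bornology.cobounded ℂ ⊓ 𝓟 (contour x)ᶜ] fun l => (l⁻¹) ^ N

/-- The exponents match because Θ_∞ for 1 - n is Θ₀ for n. The signs come from (-1/λ)^k, and the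
constant diagonal factor from the term iπ in log(-1/λ) = -log λ + iπ. -/
theorem IsSolution.expandsAtInf_mirror {n : ℤ} {m x : ℂ} {F : ℂ → Mat} {cInf c0 : ℕ → Mat}
    (hx : x ∈ slitPlane) (h : IsSolution n m x F cInf c0) :
    ExpandsAtInf (thetaInf (1 - n) m) x (fun l => F (-l⁻¹))
      (fun k => (-1 : ℂ) ^ k • (c0 k * expSigma3 (theta0 n m / 2 * (I * Real.pi)))) := by
  intro N i j
  have hΘ : thetaInf (1 - n) m = theta0 n m := by unfold thetaInf theta0; push_cast; ring
  set E := expSigma3 (theta0 n m / 2 * (I * Real.pi)) with hE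
  have ht : Tendsto (fun l : ℂ => -l⁻¹) (Bornology.cobounded ℂ ⊓ 𝓟 (contour x)ᶜ)
      (𝓝[(contour x)ᶜ] 0) := by
    refine tendsto_nhdsWithin_iff.2 ⟨?_, ?_⟩
    · have := (tendsto_inv₀_cobounded (α := ℂ)).neg
      rw [neg_zero] at this
      exact this.mono_left inf_le_left
    · have h1 : ∀ᶠ l in Bornology.cobounded ℂ ⊓ 𝓟 (contour x)ᶜ, l ∈ (contour x)ᶜ :=
        mem_inf_of_right (mem_principal_self _)
      filter_upwards [h1] with l hl
      have hl0 : l ≠ 0 := fun h0 => hl (Or.inl h0)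
      exact fun h2 => hl ((neg_inv_mem_contour hl0).1 h2)
  have hO : ∀ j, _ := fun j => (h.at_zero N i j).comp_tendsto ht
  have hsum : (fun l => ∑ q, ((F (-l⁻¹) * expSigma3 (-(theta0 n m / 2 * branchLog x (-l⁻¹))) *
        expSigma3 (I * x * (-l⁻¹)⁻¹ / 2) - ∑ k ∈ Finset.range N, (-l⁻¹) ^ k • c0 k) i q) * E q j)
      =O[Bornology.cobounded ℂ ⊓ 𝓟 (contour x)ᶜ] fun l : ℂ => (-l⁻¹) ^ N :=
    IsBigO.fun_sum fun q _ =>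
      ((hO q).const_mul_left (E q j)).congr_left fun l => mul_comm _ _
  refine (hsum.congr' ?_ EventuallyEq.rfl).trans 
    (IsBigO.of_bound 1 (Eventually.of_forall fun l => by simp))
  have h1 : ∀ᶠ l in Bornology.cobounded ℂ ⊓ 𝓟 (contour x)ᶜ, l ∈ (contour x)ᶜ :=
    mem_inf_of_right (mem_principal_self _)
  filter_upwards [h1] with l hl
  have hl0 : l ≠ 0 := fun h0 => hl (Or.inl h0)
  rw [← Matrix.mul_apply]
  rw [sub_mul, Finset.sum_mul, branchLog_neg_inv hx hl0 (neg_zeta_mem_slitPlane hl), hΘ, hE]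
  simp only [Matrix.mul_assoc, expSigma3_mul]
  refine congrFun (congrFun (congrArg₂ _ ?_ ?_) i) j
  · rw [inv_neg, inv_inv]; congr 2; ring
  · exact Finset.sum_congr rfl fun k _ => by
      rw [smul_mul_assoc, smul_smul, ← mul_pow]; simp

/-! ### The sectors near infinity -/

theorem sin_le_of_mem {ψ : ℝ} (h1 : 1 / 16 ≤ ψ) (h2 : ψ ≤ Real.pi - 1 / 16) :
    Real.sin (1 / 16) ≤ Real.sin ψ := by
  have hpi := Real.pi_gt_three
  rcases le_or_gt ψ (Real.pi / 2) with h | h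
  · exact Real.sin_le_sin_of_le_of_le_pi_div_two (by linarith) h h1
  · rw [← Real.sin_pi_sub ψ]
    exact Real.sin_le_sin_of_le_of_le_pi_div_two (by linarith) (by linarith) (by linarith)

-- The square root p of -ζ with positive real part equals x^{1/2}(w + w⁻¹), with w = `branchRoot`.
-- Far to the right the first term dominates, so its argument ψ exceeds π/2 in absolute value by
-- less than 1/16. Since ψ = (Im μ + arg x - π)/2 - πk, this leaves sheet 0 except near the arc ζ >
-- 0, where k = ±1 may also occur. The sign of Im ζ is opposite to that of sin ψ when |ψ| ≥ 1/16,
-- because Im(-ζ) = 2 Re p Im p.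
set_option maxHeartbeats 2000000 in
theorem sector_cases {x : ℂ} (hx : x ∈ slitPlane) :
    ∃ A : ℝ, ∀ (μ : ℂ) (k : ℤ), A ≤ μ.re → lam μ ∉ contour x →
      branchLog x (lam μ) + 2 * Real.pi * I * k = μ - I * (Real.pi / 2) →
      -(3 / 8) < μ.im + arg x → μ.im + arg x < 2 * Real.pi + 3 / 8 →
      (k = 0 ∧ 0 < (zeta x (lam μ)).im ∧ μ.im + arg x < Real.pi + 1 / 2) ∨
      (k = 0 ∧ (zeta x (lam μ)).im < 0 ∧ Real.pi - 1 / 2 < μ.im + arg x) ∨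
      (k = -1 ∧ (zeta x (lam μ)).im < 0 ∧ |μ.im + arg x| < 1 / 2) ∨
      (k = 1 ∧ 0 < (zeta x (lam μ)).im ∧ |μ.im + arg x - 2 * Real.pi| < 1 / 2) := by
  have hpi := Real.pi_gt_three
  have hx0 := slitPlane_ne_zero hx
  set θ := arg x with hθ
  have hθ1 : -Real.pi < θ := neg_pi_lt_arg x
  have hθ2 : θ < Real.pi := lt_of_le_of_ne (arg_le_pi x) (mem_slitPlane_iff_arg.1 hx).1
  have hθabs : |θ| < Real.pi := abs_lt.2 ⟨hθ1, hθ2⟩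
  -- The bound cos ψ > -η has to exclude both π/2 + 1/16 ≤ |ψ| ≤ π and π < |ψ| ≤ π + |θ|/2. The two
  -- entries of the minimum serve these two ranges.
  set η := min (Real.sin (1 / 16)) (Real.cos (|θ| / 2)) with hη
  have hηpos : 0 < η := lt_min (Real.sin_pos_of_pos_of_lt_pi (by norm_num) (by linarith))
    (Real.cos_pos_of_mem_Ioo ⟨by linarith [abs_nonneg θ], by linarith⟩)
  obtain ⟨A, hA⟩ := ((Real.tendsto_exp_neg_atTop_nhds_zero).eventually_lt_const hηpos).exists
  refine ⟨A, fun μ k hre hμ hk hb1 hb2 => ?_⟩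
  have hl0 := lam_ne_zero μ
  have hnz := neg_zeta_mem_slitPlane hμ
  set w := branchRoot x (lam μ) with hw
  set p := (-zeta x (lam μ)) ^ (1 / 2 : ℂ) with hp
  have hppos : 0 < p.re := half_re_pos hnz
  have hpim := half_im_mul (-zeta x (lam μ))
  rw [← hp, neg_im] at hpim
  have hws := branchRoot_mem_slitPlane hx hl0 hnz
  have hw0 : w ≠ 0 := slitPlane_ne_zero hws
  have hlne : lam μ ≠ -I := fun h0 => hμ (by
    rw [lam_mem_contour, zeta_eq x hl0, h0]; simp)
  have hw2 : w ^ 2 = lam μ / I := branchRoot_sq hx0 hl0 hlne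
  have hlogw : log w = (μ - I * Real.pi) / 2 - Real.pi * I * k := by
    have : 2 * log w + I * (Real.pi / 2) + 2 * Real.pi * I * k = μ - I * (Real.pi / 2) := hk
    linear_combination this / 2
  set φ : ℝ := (μ.im - Real.pi) / 2 - Real.pi * k with hφ
  have hargw : arg w = φ := by
    rw [← log_im, hlogw]; simp [hφ]
  have hφ1 : -Real.pi < φ := hargw ▸ neg_pi_lt_arg w
  have hφ2 : φ ≤ Real.pi := hargw ▸ arg_le_pi w
  set ψ : ℝ := φ + θ / 2 with hψ
  have hpw : p = x ^ (1 / 2 : ℂ) * (w + w⁻¹) := by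
    have hp0 : p ≠ 0 := fun h => by rw [h] at hppos; simp at hppos
    have e1 : w * p = -I * (lam μ + I) * x ^ (1 / 2 : ℂ) := by
      rw [hw, hp]; unfold branchRoot; exact div_mul_cancel₀ _ hp0
    have e2 : -I * (lam μ + I) = w ^ 2 + 1 := by
      rw [hw2, div_I]; linear_combination -I_sq
    rw [e2] at e1
    field_simp
    linear_combination e1
  set r : ℝ := Real.exp (Real.log ‖x‖ / 2) with hr
  have hr0 : 0 < r := Real.exp_pos _
  set a := μ.re with ha
  have hwexp : w = exp ((a / 2 : ℝ) + (φ : ℝ) * I) := by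
    rw [← exp_log hw0, hlogw]
    congr 1
    apply Complex.ext <;> simp [hφ, ha]
  have hxexp : x ^ (1 / 2 : ℂ) = exp ((Real.log ‖x‖ / 2 : ℝ) + (θ / 2 : ℝ) * I) := by
    rw [cpow_def_of_ne_zero hx0]
    congr 1
    rw [log]; push_cast; ring
  have hpform : p = exp (((Real.log ‖x‖ / 2 + a / 2 : ℝ) : ℂ) + ((ψ : ℝ) : ℂ) * I)
      + exp (((Real.log ‖x‖ / 2 - a / 2 : ℝ) : ℂ) + ((θ / 2 - φ : ℝ) : ℂ) * I) := by
    rw [hpw, hwexp, hxexp, ← exp_neg, mul_add, ← exp_add, ← exp_add]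
    congr 2 <;> push_cast [hψ] <;> ring
  have hre_p : p.re = r * Real.exp (a / 2) * (Real.cos ψ + Real.exp (-a) * Real.cos (θ / 2 - φ)) := by
    rw [hpform, add_re, exp_re, exp_re]
    simp only [add_re, ofReal_re, mul_re, I_re, mul_zero, ofReal_im, I_im, mul_one, sub_self,
      add_zero, add_im, mul_im, zero_add]
    rw [sub_eq_add_neg, Real.exp_add, Real.exp_add, ← hr,
      show -(a / 2) = a / 2 + -a by ring, Real.exp_add]
    ring
  have him_p : p.im = r * Real.exp (a / 2) * (Real.sin ψ + Real.exp (-a) * Real.sin (θ / 2 - φ)) := by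
    rw [hpform, add_im, exp_im, exp_im]
    simp only [add_re, ofReal_re, mul_re, I_re, mul_zero, ofReal_im, I_im, mul_one, sub_self,
      add_zero, add_im, mul_im, zero_add]
    rw [sub_eq_add_neg, Real.exp_add, Real.exp_add, ← hr,
      show -(a / 2) = a / 2 + -a by ring, Real.exp_add]
    ring
  have hfac : 0 < r * Real.exp (a / 2) := by positivity
  have hea : Real.exp (-a) < η := (Real.exp_le_exp.2 (by linarith)).trans_lt hA
  have hea0 : 0 < Real.exp (-a) := Real.exp_pos _
  have hcos : -η < Real.cos ψ := by
    rw [hre_p] at hppos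
    have h1 := (pos_iff_pos_of_mul_pos hppos).1 hfac
    have h2 := Real.cos_le_one (θ / 2 - φ)
    nlinarith
  have hψabs : |ψ| < Real.pi / 2 + 1 / 16 := by
    by_contra! hcon
    rw [← Real.cos_abs] at hcos
    have hψle : |ψ| ≤ Real.pi + |θ| / 2 := by
      have := abs_add_le φ (θ / 2)
      have h3 : |φ| ≤ Real.pi := abs_le.2 ⟨hφ1.le, hφ2⟩
      have h4 : |θ / 2| = |θ| / 2 := by rw [abs_div]; simp
      rw [h4] at this
      linarith
    rcases le_or_gt |ψ| Real.pi with h | h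
    · have h1 := Real.cos_le_cos_of_nonneg_of_le_pi (by linarith) h hcon
      rw [add_comm (Real.pi / 2), Real.cos_add_pi_div_two] at h1
      have h2 : η ≤ Real.sin (1 / 16) := min_le_left _ _
      linarith
    · have h1 := Real.cos_le_cos_of_nonneg_of_le_pi (x := |ψ| - Real.pi) (y := |θ| / 2)
        (by linarith) (by linarith [abs_nonneg θ]) (by linarith)
      rw [Real.cos_sub_pi] at h1
      have h2 : η ≤ Real.cos (|θ| / 2) := min_le_right _ _
      linarith
  obtain ⟨hψ1, hψ2⟩ := abs_lt.1 hψabs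
  have hsin_pos : 1 / 16 ≤ ψ → (zeta x (lam μ)).im < 0 := by
    intro h
    have h1 := sin_le_of_mem h (by linarith)
    have h2 : η ≤ Real.sin (1 / 16) := min_le_left _ _
    have h3 := Real.neg_one_le_sin (θ / 2 - φ)
    have h4 : 0 < p.im := by
      rw [him_p]; refine mul_pos hfac ?_; nlinarith
    nlinarith [mul_pos hppos h4]
  have hsin_neg : ψ ≤ -(1 / 16) → 0 < (zeta x (lam μ)).im := by
    intro h
    have h1 := sin_le_of_mem (ψ := -ψ) (by linarith) (by linarith)
    rw [Real.sin_neg] at h1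
    have h2 : η ≤ Real.sin (1 / 16) := min_le_left _ _
    have h3 := Real.sin_le_one (θ / 2 - φ)
    have h4 : p.im < 0 := by
      rw [him_p]; refine mul_neg_of_pos_of_neg hfac ?_; nlinarith
    nlinarith [mul_pos hppos (neg_pos.2 h4)]
  have hne : (zeta x (lam μ)).im ≠ 0 := fun h0 => hμ (lam_mem_contour.2 h0)
  have hψk : ψ = (μ.im + θ - Real.pi) / 2 - Real.pi * k := by rw [hψ, hφ]; ring
  have hk1 : (k : ℝ) < 2 := by
    by_contra! h
    have : Real.pi * 2 ≤ Real.pi * k := mul_le_mul_of_nonneg_left h (by linarith)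
    linarith
  have hk2 : (-2 : ℝ) < k := by
    by_contra! h
    have : Real.pi * k ≤ Real.pi * (-2) := mul_le_mul_of_nonneg_left h (by linarith)
    linarith
  have hk1' : k < 2 := by exact_mod_cast hk1
  have hk2' : -2 < k := by exact_mod_cast hk2
  have hk3 : k = -1 ∨ k = 0 ∨ k = 1 := by omega
  rcases hk3 with rfl | rfl | rfl
  · right; right; left
    push_cast at hψk
    refine ⟨rfl, hsin_pos (by linarith), abs_lt.2 ⟨by linarith, by linarith⟩⟩
  · push_cast at hψk
    rcases lt_or_gt_of_ne hne with h | h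
    · right; left
      refine ⟨rfl, h, ?_⟩
      by_contra! hc
      exact absurd (hsin_neg (by linarith)) (not_lt.2 h.le)
    · left
      refine ⟨rfl, h, ?_⟩
      by_contra! hc
      exact absurd (hsin_pos (by linarith)) (not_lt.2 h.le)
  · right; right; right
    push_cast at hψk
    refine ⟨rfl, hsin_neg (by linarith), abs_lt.2 ⟨by linarith, by linarith⟩⟩

end

section

open scoped Matrix.Norms.Operator

/-! ### Norms of `2 × 2` matrices -/

theorem norm_entry_le (A : Mat) (i j : Fin 2) : ‖A i j‖ ≤ ‖A‖ := by
  have h1 : ‖A i j‖₊ ≤ ∑ q, ‖A i q‖₊ :=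
    Finset.single_le_sum (f := fun q => ‖A i q‖₊) (fun _ _ => zero_le) (Finset.mem_univ j)
  have h2 : (∑ q, ‖A i q‖₊) ≤ Finset.univ.sup fun i => ∑ q, ‖A i q‖₊ :=
    Finset.le_sup (f := fun i => ∑ q, ‖A i q‖₊) (Finset.mem_univ i)
  rw [Matrix.linfty_opNorm_def]
  exact_mod_cast h1.trans h2

theorem norm_le_of_entries {A : Mat} {b : ℝ} (h : ∀ i j, ‖A i j‖ ≤ b) : ‖A‖ ≤ 2 * b := by
  have hb : 0 ≤ b := (norm_nonneg _).trans (h 0 0)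
  lift b to NNReal using hb
  rw [Matrix.linfty_opNorm_def]
  have : (Finset.univ.sup fun i => ∑ q, ‖A i q‖₊) ≤ 2 * b := by
    refine Finset.sup_le fun i _ => ?_
    rw [Fin.sum_univ_two, two_mul]
    exact add_le_add (by exact_mod_cast h i 0) (by exact_mod_cast h i 1)
  exact_mod_cast this

/-! ### Asymptotics in half-strips -/

/-- The exponent of the leading behaviour at infinity. -/
def dd (Θ x μ : ℂ) : ℂ := Θ / 2 * (μ - I * (Real.pi / 2)) - x * exp μ / 2

/-- `Ψ e^{d σ₃} = a₀ + a₁ / λ + O(λ⁻²)` in a half-strip. -/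
def HalfAsymp (Θ x : ℂ) (lo hi : ℝ) (Ψ : ℂ → Mat) (a0 a1 : Mat) : Prop :=
  ∃ C A : ℝ, ∀ μ : ℂ, A ≤ μ.re → lo < μ.im → μ.im < hi →
    ‖Ψ μ * expSigma3 (dd Θ x μ) - a0 - (lam μ)⁻¹ • a1‖ ≤ C * Real.exp (-(2 * μ.re))

/-- Double exponential decay absorbs any power of e^μ. Half of the decay is kept, so that it can
later absorb the growth of the ratio of the exponentials at two values of x. -/
theorem exp_decay (q : ℂ) {κ : ℝ} (hκ : 0 < κ) : ∃ C > 0, ∀ μ w : ℂ, 0 ≤ μ.re → |μ.im| ≤ 10 →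
    w.re ≤ -κ * Real.exp μ.re →
    ‖exp (q * μ + w)‖ ≤ C * Real.exp (-(3 * μ.re) - κ / 2 * Real.exp μ.re) := by
  refine ⟨Real.exp (10 * ‖q‖ + (‖q‖ + 3) ^ 2 / κ), Real.exp_pos _, fun μ w h0 h1 h2 => ?_⟩
  rw [norm_exp, ← Real.exp_add, Real.exp_le_exp, add_re, mul_re]
  have h3 : q.re * μ.re ≤ ‖q‖ * μ.re := mul_le_mul_of_nonneg_right (re_le_norm q) h0
  have h4 : -(q.im * μ.im) ≤ ‖q‖ * 10 := by
    refine (neg_le_abs _).trans ?_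
    rw [abs_mul]
    exact mul_le_mul (abs_im_le_norm q) h1 (abs_nonneg _) (norm_nonneg _)
  have h5 := Real.quadratic_le_exp_of_nonneg h0
  have h6 : μ.re ^ 2 / 2 ≤ Real.exp μ.re := by linarith
  have h7 : (‖q‖ + 3) * μ.re ≤ κ / 2 * Real.exp μ.re + (‖q‖ + 3) ^ 2 / κ := by
    have h8 : κ / 2 * (μ.re ^ 2 / 2) ≤ κ / 2 * Real.exp μ.re :=
      mul_le_mul_of_nonneg_left h6 (by positivity)
    -- Completing the square; this is the source of the constant C.
    have h9 : (‖q‖ + 3) * μ.re ≤ κ / 2 * (μ.re ^ 2 / 2) + (‖q‖ + 3) ^ 2 / κ := by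
      have : κ / 2 * (μ.re ^ 2 / 2) + (‖q‖ + 3) ^ 2 / κ - (‖q‖ + 3) * μ.re
          = (κ * μ.re / 2 - (‖q‖ + 3)) ^ 2 / κ := by
        field_simp; ring
      have h10 : 0 ≤ (κ * μ.re / 2 - (‖q‖ + 3)) ^ 2 / κ := by positivity
      linarith
    linarith
  linarith

theorem ExpandsAtInf.exists_bound {Θ x : ℂ} {F : ℂ → Mat} {c : ℕ → Mat}
    (h : ExpandsAtInf Θ x F c) : ∃ C > 0, ∃ A : ℝ, ∀ l ∉ contour x, A ≤ ‖l‖ →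
      ‖F l * expSigma3 (Θ / 2 * branchLog x l) * expSigma3 (-(I * x * l / 2)) - c 0 - l⁻¹ • c 1‖
        ≤ C * ‖l‖⁻¹ ^ 2 := by
  have h1 : ∀ i j, ∃ C > 0, ∃ A : ℝ, ∀ l ∉ contour x, A ≤ ‖l‖ →
      ‖(F l * expSigma3 (Θ / 2 * branchLog x l) * expSigma3 (-(I * x * l / 2)) - c 0
        - l⁻¹ • c 1) i j‖ ≤ C * ‖l‖⁻¹ ^ 2 := by
    intro i j
    obtain ⟨C, hC, hb⟩ := (h 2 i j).exists_pos
    have hb' := hb.bound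
    rw [eventually_inf_principal, ← comap_norm_atTop, eventually_comap] at hb'
    obtain ⟨A, hA⟩ := eventually_atTop.1 hb'
    refine ⟨C, hC, A, fun l hl hAl => ?_⟩
    have := hA ‖l‖ hAl l rfl hl
    rw [norm_pow, norm_inv] at this
    simpa [Finset.sum_range_succ, sub_sub] using this
  choose C hC A hA using h1
  refine ⟨2 * (C 0 0 + C 0 1 + C 1 0 + C 1 1), by
    have := hC 0 0; have := hC 0 1; have := hC 1 0; have := hC 1 1; positivity,
    max (max (A 0 0) (A 0 1)) (max (A 1 0) (A 1 1)), fun l hl hAl => ?_⟩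
  rw [mul_assoc 2]
  refine norm_le_of_entries fun i j => ?_
  have hle : A i j ≤ ‖l‖ := by
    refine le_trans ?_ hAl
    fin_cases i <;> fin_cases j <;> simp
  refine (hA i j l hl hle).trans (mul_le_mul_of_nonneg_right ?_ (by positivity))
  have h00 := hC 0 0; have h01 := hC 0 1; have h10 := hC 1 0; have h11 := hC 1 1
  fin_cases i <;> fin_cases j <;> simp <;> linarith

/-- Conjugation by the leading exponential multiplies a triangular Stokes entry by e^{-2d}, or by
e^{2d} in `conj_lower`. Each is small near the arc that carries the corresponding jump. -/
theorem conj_upper (d c : ℂ) : expSigma3 (-d) * !![1, c; 0, 1] * expSigma3 d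
    = 1 + (c * exp (-(2 * d))) • !![0, 1; 0, 0] := by
  unfold expSigma3
  have h : exp d * exp (-d) = 1 := by rw [← exp_add]; simp
  have h2 : exp (-(2 * d)) = exp (-d) * exp (-d) := by rw [← exp_add]; ring_nf
  rw [h2]
  ext i j
  fin_cases i <;> fin_cases j <;> simp [Matrix.mul_apply, Fin.sum_univ_two, mul_comm, h]
  ring

theorem conj_lower {q u u' : ℂ} (d g : ℂ) (hu : u * exp q = 1) (hu' : u' * exp (-q) = 1) :
    expSigma3 (q - d) * !![u, 0; g, u'] * expSigma3 d
    = 1 + (g * exp (-q) * exp (2 * d)) • !![0, 0; 1, 0] := by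
  unfold expSigma3
  have h : exp d * exp (-d) = 1 := by rw [← exp_add]; simp
  have h2 : exp (2 * d) = exp d * exp d := by rw [← exp_add]; ring_nf
  have h3 : exp (q - d) = exp q * exp (-d) := by rw [← exp_add]; ring_nf
  have h4 : exp (-(q - d)) = exp (-q) * exp d := by rw [← exp_add]; ring_nf
  rw [h2, h3, h4]
  ext i j
  fin_cases i <;> fin_cases j <;> simp [Matrix.mul_apply, Fin.sum_univ_two]
  · linear_combination (exp d * exp (-d)) * hu + h
  · ring
  · linear_combination (exp d * exp (-d)) * hu' + h

/-- The factor by which the solution changes across the low arc at infinity. -/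
def stokesLow (n : ℤ) (m : ℂ) : Mat := (-1 : ℂ) ^ n • VInfLow m

theorem monod_mul_VZeroUp (n : ℤ) (m : ℂ) : monod n m * VZeroUp m = stokesLow n m := by
  unfold monod stokesLow
  rw [smul_mul_assoc, mul_assoc, VInfUp_mul_VZeroUp, mul_one]

theorem exp_int_pi (n : ℤ) : exp (n * (Real.pi * I)) = (-1) ^ n := by
  rw [exp_int_mul, exp_pi_mul_I]

/-- The diagonal of the jump across the cut is the formal monodromy: it compensates the change of
λ^{Θ_∞σ₃/2} when the logarithm jumps. -/
theorem stokesLow_zero_zero_mul (n : ℤ) (m : ℂ) :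
    stokesLow n m 0 0 * exp (thetaInf n m * Real.pi * I) = 1 := by
  have h1 : exp (thetaInf n m * Real.pi * I)
      = exp (I * Real.pi * m) * exp ((-n : ℤ) * (Real.pi * I)) * exp (Real.pi * I) := by
    rw [← exp_add, ← exp_add]; unfold thetaInf; push_cast; ring_nf
  have h2 : exp (-(I * Real.pi * m)) * exp (I * Real.pi * m) = 1 := by rw [← exp_add]; simp
  have h3 := neg_one_zpow_mul_self n
  rw [h1, exp_int_pi, exp_pi_mul_I, zpow_neg, ← inv_zpow]
  unfold stokesLow VInfLow
  simp
  linear_combination ((-1 : ℂ) ^ n * (-1) ^ n) * h2 + h3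

theorem stokesLow_one_one_mul (n : ℤ) (m : ℂ) :
    stokesLow n m 1 1 * exp (-(thetaInf n m * Real.pi * I)) = 1 := by
  have h1 : exp (-(thetaInf n m * Real.pi * I))
      = exp (-(I * Real.pi * m)) * exp (n * (Real.pi * I)) * (exp (Real.pi * I))⁻¹ := by
    rw [← exp_neg, ← exp_add, ← exp_add]; unfold thetaInf; ring_nf
  have h2 : exp (-(I * Real.pi * m)) * exp (I * Real.pi * m) = 1 := by rw [← exp_add]; simp
  have h3 := neg_one_zpow_mul_self n
  rw [h1, exp_int_pi, exp_pi_mul_I]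
  unfold stokesLow VInfLow
  simp
  linear_combination ((-1 : ℂ) ^ n * (-1) ^ n) * h2 + h3

theorem stokesLow_eq (n : ℤ) (m : ℂ) :
    stokesLow n m = !![stokesLow n m 0 0, 0; stokesLow n m 1 0, stokesLow n m 1 1] := by
  ext i j
  fin_cases i <;> fin_cases j <;> simp [stokesLow, VInfLow]

theorem stokesLow_det (n : ℤ) (m : ℂ) : stokesLow n m 0 0 * stokesLow n m 1 1 = 1 := by
  have h1 := stokesLow_zero_zero_mul n m
  have h2 := stokesLow_one_one_mul n m
  have h3 : exp (thetaInf n m * Real.pi * I) * exp (-(thetaInf n m * Real.pi * I)) = 1 := by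
    rw [← exp_add]; simp
  linear_combination (stokesLow n m 1 1 * exp (-(thetaInf n m * Real.pi * I))) * h1 + h2
    - (stokesLow n m 0 0 * stokesLow n m 1 1) * h3

theorem VInfUp_mul_monodU_inv (n : ℤ) (m : ℂ) :
    VInfUp m * (((monodU n m)⁻¹ : Matˣ) : Mat)
      = !![stokesLow n m 1 1, 0; -stokesLow n m 1 0, stokesLow n m 0 0] := by
  have h := smul_VInfLow_mul n m
  change stokesLow n m * _ = 1 at h
  have h1 : !![stokesLow n m 1 1, 0; -stokesLow n m 1 0, stokesLow n m 0 0] * stokesLow n m = 1 := by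
    have hd := stokesLow_det n m
    conv_lhs => rw [stokesLow_eq n m]
    rw [Matrix.one_fin_two]
    ext i j
    fin_cases i <;> fin_cases j <;> simp [Matrix.mul_apply, Fin.sum_univ_two]
    · linear_combination hd
    · ring
    · linear_combination hd
  exact (left_inv_eq_right_inv h1 h).symm

end

/-! ### Decay of the Stokes factors and asymptotics of the continuation. -/

section

open scoped Matrix.Norms.Operator

theorem re_mul_exp {x : ℂ} (hx : x ≠ 0) (μ : ℂ) :
    (x * exp μ).re = ‖x‖ * Real.exp μ.re * Real.cos (μ.im + arg x) := by
  have h : x * exp μ = exp (log x + μ) := by rw [exp_add, exp_log hx]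
  rw [h, exp_re, add_re, log_re, add_im, log_im, Real.exp_add, Real.exp_log (norm_pos_iff.2 hx),
    add_comm (arg x)]

/-- Up to a power of e^μ, e^{-2d} is e^{x e^μ}, which decays around the arc ζ < 0, where Im μ + arg
x is near π. -/
theorem norm_exp_neg_two_dd_le (Θ : ℂ) {x : ℂ} (hx : x ≠ 0) : ∃ C > 0, ∀ μ : ℂ, 0 ≤ μ.re →
    |μ.im| ≤ 10 → Real.cos (μ.im + arg x) ≤ -(1 / 2) →
    ‖exp (-(2 * dd Θ x μ))‖ ≤ C * Real.exp (-(3 * μ.re) - ‖x‖ / 4 * Real.exp μ.re) := by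
  have hx' := norm_pos_iff.2 hx
  obtain ⟨C, hC, h⟩ := exp_decay (-Θ) (half_pos hx')
  refine ⟨‖exp (Θ * I * (Real.pi / 2))‖ * C, mul_pos (norm_pos_iff.2 (exp_ne_zero _)) hC,
    fun μ h0 h1 h2 => ?_⟩
  have h3 : exp (-(2 * dd Θ x μ)) = exp (Θ * I * (Real.pi / 2)) * exp (-Θ * μ + x * exp μ) := by
    rw [← exp_add]; unfold dd; congr 1; ring
  have h4 := h μ (x * exp μ) h0 h1 (by
    rw [re_mul_exp hx]
    have := mul_le_mul_of_nonneg_left h2 (mul_pos hx' (Real.exp_pos μ.re)).le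
    linarith)
  rw [h3, norm_mul, mul_assoc]
  refine (mul_le_mul_of_nonneg_left h4 (norm_nonneg _)).trans_eq ?_
  ring_nf

theorem norm_exp_two_dd_le (Θ : ℂ) {x : ℂ} (hx : x ≠ 0) : ∃ C > 0, ∀ μ : ℂ, 0 ≤ μ.re →
    |μ.im| ≤ 10 → 1 / 2 ≤ Real.cos (μ.im + arg x) →
    ‖exp (2 * dd Θ x μ)‖ ≤ C * Real.exp (-(3 * μ.re) - ‖x‖ / 4 * Real.exp μ.re) := by
  have hx' := norm_pos_iff.2 hx
  obtain ⟨C, hC, h⟩ := exp_decay Θ (half_pos hx')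
  refine ⟨‖exp (-(Θ * I * (Real.pi / 2)))‖ * C, mul_pos (norm_pos_iff.2 (exp_ne_zero _)) hC,
    fun μ h0 h1 h2 => ?_⟩
  have h3 : exp (2 * dd Θ x μ) = exp (-(Θ * I * (Real.pi / 2))) * exp (Θ * μ + -(x * exp μ)) := by
    rw [← exp_add]; unfold dd; congr 1; ring
  have h4 := h μ (-(x * exp μ)) h0 h1 (by
    rw [neg_re, re_mul_exp hx]
    have := mul_le_mul_of_nonneg_left h2 (mul_pos hx' (Real.exp_pos μ.re)).le
    linarith)
  rw [h3, norm_mul, mul_assoc]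
  refine (mul_le_mul_of_nonneg_left h4 (norm_nonneg _)).trans_eq ?_
  ring_nf

theorem half_le_cos {t : ℝ} (h : |t| ≤ 1) : 1 / 2 ≤ Real.cos t := by
  have := Real.pi_gt_three
  rw [← Real.cos_abs, ← Real.cos_pi_div_three]
  exact Real.cos_le_cos_of_nonneg_of_le_pi (abs_nonneg _) (by linarith) (by linarith)

theorem cos_le_neg_half {t : ℝ} (h : |t - Real.pi| ≤ 1) : Real.cos t ≤ -(1 / 2) := by
  have := half_le_cos h
  rw [Real.cos_sub_pi] at this
  linarith

theorem Dense.le_of_isOpen {S U : Set ℂ} (hS : Dense S) (hU : IsOpen U) {f g : ℂ → ℝ}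
    (hf : Continuous f) (hg : Continuous g) (h : ∀ μ ∈ U, μ ∈ S → f μ ≤ g μ) :
    ∀ μ ∈ U, f μ ≤ g μ := fun _ hμ =>
  closure_minimal (s := U ∩ S) (t := {μ | f μ ≤ g μ}) (fun ν hν => h ν hν.1 hν.2)
    (isClosed_le hf hg) (hS.open_subset_closure_inter hU hμ)

theorem norm_mul_sub_le_of_near_one {Y J a : Mat} {r j : ℝ} (hY : ‖Y - a‖ ≤ r) (hJ : ‖J - 1‖ ≤ j) :
    ‖Y * J - a‖ ≤ r + (‖a‖ + r) * j := by
  have h : Y * J - a = (Y - a) + (a + (Y - a)) * (J - 1) := by noncomm_ring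
  rw [h]
  refine (norm_add_le _ _).trans (add_le_add hY ((norm_mul_le _ _).trans ?_))
  exact mul_le_mul ((norm_add_le _ _).trans (by linarith)) hJ (norm_nonneg _)
    (by linarith [norm_nonneg a, norm_nonneg (Y - a)])

theorem continuous_dd (Θ x : ℂ) : Continuous (dd Θ x) := by unfold dd; fun_prop

theorem continuous_expSigma3 : Continuous expSigma3 := by
  refine continuous_matrix fun i j => ?_
  unfold expSigma3
  fin_cases i <;> fin_cases j <;> simp <;> fun_prop

/-- The passage from the expansion off the contour to the asymptotics of the continuation. -/
theorem halfAsymp_of_factor {Θ x : ℂ} (hx : x ∈ slitPlane) {F Ψ : ℂ → Mat} {c : ℕ → Mat}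
    {lo hi : ℝ} (hΨ : Continuous Ψ) (hexp : ExpandsAtInf Θ x F c) {B A : ℝ}
    (hJ : ∀ μ : ℂ, ∀ k : ℤ, A ≤ μ.re → lo < μ.im → μ.im < hi → lam μ ∉ contour x →
      branchLog x (lam μ) + 2 * Real.pi * I * k = μ - I * (Real.pi / 2) →
      ∃ J : Mat, Ψ μ = F (lam μ) * J ∧
      ‖expSigma3 (Θ * Real.pi * I * k - dd Θ x μ) * J * expSigma3 (dd Θ x μ) - 1‖
        ≤ B * Real.exp (-(2 * μ.re))) :
    HalfAsymp Θ x lo hi Ψ (c 0) (c 1) := by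
  have hx0 := slitPlane_ne_zero hx
  obtain ⟨C, hC, A', hA'⟩ := hexp.exists_bound
  refine ⟨C + (‖c 0‖ + ‖c 1‖ + C) * |B|, max (max A A') 0 + 1, ?_⟩
  set U : Set ℂ := {μ | max (max A A') 0 < μ.re ∧ lo < μ.im ∧ μ.im < hi} with hU
  have hUo : IsOpen U := (isOpen_lt continuous_const continuous_re).inter
    ((isOpen_lt continuous_const continuous_im).inter (isOpen_lt continuous_im continuous_const))
  have key := Dense.le_of_isOpen (dense_compl_contour hx0) hUo
    (f := fun μ => ‖Ψ μ * expSigma3 (dd Θ x μ) - c 0 - (lam μ)⁻¹ • c 1‖)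
    (g := fun μ => (C + (‖c 0‖ + ‖c 1‖ + C) * |B|) * Real.exp (-(2 * μ.re))) ?_ ?_ ?_
  · intro μ h1 h2 h3
    exact key μ ⟨by linarith, h2, h3⟩
  · have h1 : Continuous fun μ => Ψ μ * expSigma3 (dd Θ x μ) :=
      hΨ.matrix_mul (continuous_expSigma3.comp (continuous_dd Θ x))
    have h2 : Continuous fun μ => (lam μ)⁻¹ • c 1 :=
      (differentiable_lam.continuous.inv₀ lam_ne_zero).smul continuous_const
    exact ((h1.sub continuous_const).sub h2).norm
  · fun_prop
  · rintro μ ⟨h1, h2, h3⟩ hμ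
    obtain ⟨h1', h10⟩ := max_lt_iff.1 h1
    obtain ⟨h11, h12⟩ := max_lt_iff.1 h1'
    have hs := sheet_spec hx0 hμ
    obtain ⟨J, hJ1, hJ2⟩ := hJ μ _ h11.le h2 h3 hμ hs
    have hnl : ‖(lam μ)⁻¹‖ = Real.exp (-μ.re) := by rw [norm_inv, norm_lam, Real.exp_neg]
    have hl1 : ‖(lam μ)⁻¹‖ ≤ 1 := by rw [hnl]; exact Real.exp_le_one_iff.2 (by linarith)
    have hl2 : ‖lam μ‖⁻¹ ^ 2 = Real.exp (-(2 * μ.re)) := by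
      rw [← norm_inv, hnl, ← Real.exp_nat_mul]; push_cast; ring_nf
    have hF := hA' (lam μ) hμ (by
      rw [norm_lam]
      have := Real.add_one_le_exp μ.re
      linarith)
    rw [hl2, mul_assoc (F _), expSigma3_mul] at hF
    -- On sheet k, log λ = μ - iπ/2 - 2πik, so the exponent in the hypothesis is d shifted by -Θπik.
    have he : Θ / 2 * branchLog x (lam μ) + -(I * x * lam μ / 2)
        = -(Θ * Real.pi * I * sheet x μ - dd Θ x μ) := by
      unfold dd lam at *
      linear_combination (Θ / 2) * hs + (x * exp μ / 2) * I_sq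
    rw [he] at hF
    have hone : expSigma3 (-(Θ * Real.pi * I * sheet x μ - dd Θ x μ))
        * expSigma3 (Θ * Real.pi * I * sheet x μ - dd Θ x μ) = 1 := by
      rw [expSigma3_mul, neg_add_cancel, expSigma3_zero]
    have hfac : Ψ μ * expSigma3 (dd Θ x μ)
        = F (lam μ) * expSigma3 (-(Θ * Real.pi * I * sheet x μ - dd Θ x μ))
          * (expSigma3 (Θ * Real.pi * I * sheet x μ - dd Θ x μ) * J * expSigma3 (dd Θ x μ)) := by
      rw [hJ1]
      calc F (lam μ) * J * expSigma3 (dd Θ x μ)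
          = F (lam μ) * 1 * J * expSigma3 (dd Θ x μ) := by rw [mul_one]
        _ = _ := by rw [← hone]; simp only [mul_assoc]
    rw [sub_sub] at hF
    have := norm_mul_sub_le_of_near_one hF hJ2
    rw [sub_sub, hfac]
    refine this.trans ?_
    have hE : 0 < Real.exp (-(2 * μ.re)) := Real.exp_pos _
    have hE1 : Real.exp (-(2 * μ.re)) ≤ 1 := Real.exp_le_one_iff.2 (by linarith)
    have ha : ‖c 0 + (lam μ)⁻¹ • c 1‖ ≤ ‖c 0‖ + ‖c 1‖ := by
      refine (norm_add_le _ _).trans (add_le_add le_rfl ?_)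
      rw [norm_smul]
      exact mul_le_of_le_one_left (norm_nonneg _) hl1
    have hB : B * Real.exp (-(2 * μ.re)) ≤ |B| * Real.exp (-(2 * μ.re)) :=
      mul_le_mul_of_nonneg_right (le_abs_self B) hE.le
    have h5 : (‖c 0 + (lam μ)⁻¹ • c 1‖ + C * Real.exp (-(2 * μ.re))) * (B * Real.exp (-(2 * μ.re)))
        ≤ (‖c 0‖ + ‖c 1‖ + C) * (|B| * Real.exp (-(2 * μ.re))) := by
      refine mul_le_mul (add_le_add ha (mul_le_of_le_one_right hC.le hE1)) hB ?_ (by positivity)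
      exact (norm_nonneg _).trans hJ2
    linarith

/-- By `sector_cases` only a few pairs of sheet and side occur in each half-strip. The connecting
factor is either trivial or triangular with the formal monodromy on its diagonal, and its
off-diagonal entry becomes exponentially small after conjugation. The factor `VZeroUp` undoes `side`
in the second strip. The margins 1/4 leave room for β to differ from -arg x by 1/8. -/
theorem IsCont.halfAsymp {n : ℤ} {m x : ℂ} (hx : x ∈ slitPlane) {F Φ : ℂ → Mat} {c : ℕ → Mat} {β : ℝ}
    (h : IsCont n m x F Φ) (hΦ : Continuous Φ) (hexp : ExpandsAtInf (thetaInf n m) x F c)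
    (hβ : |β + arg x| < 1 / 8) :
    HalfAsymp (thetaInf n m) x (β - 1 / 4) (β + Real.pi + 1 / 4) Φ (c 0) (c 1) ∧
    HalfAsymp (thetaInf n m) x (β + Real.pi - 1 / 4) (β + 2 * Real.pi + 1 / 4)
      (fun μ => Φ μ * VZeroUp m) (c 0) (c 1) := by
  have hx0 := slitPlane_ne_zero hx
  have hpi := Real.pi_gt_three
  have hpi' := Real.pi_lt_d2
  obtain ⟨hβ1, hβ2⟩ := abs_lt.1 hβ
  have hθ1 := neg_pi_lt_arg x
  have hθ2 := arg_le_pi x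
  obtain ⟨A, hA⟩ := sector_cases hx
  obtain ⟨C₁, hC₁, h₁⟩ := norm_exp_neg_two_dd_le (thetaInf n m) hx0
  obtain ⟨C₂, hC₂, h₂⟩ := norm_exp_two_dd_le (thetaInf n m) hx0
  set Θ := thetaInf n m with hΘ
  set g := stokesLow n m 1 0 with hg
  set c₁ : ℂ := √(2 * Real.pi) / Gamma (1 / 2 - m) with hc₁
  set E₁ : Mat := !![0, 1; 0, 0]
  set E₂ : Mat := !![0, 0; 1, 0]
  set q₁ := exp (Θ * Real.pi * I) with hq₁
  set q₂ := exp (-(Θ * Real.pi * I)) with hq₂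
  have hweak : ∀ a : ℝ, 0 ≤ a → Real.exp (-(3 * a) - ‖x‖ / 4 * Real.exp a) ≤ Real.exp (-(2 * a)) := by
    intro a ha
    refine Real.exp_le_exp.2 ?_
    have : 0 ≤ ‖x‖ / 4 * Real.exp a := by positivity
    linarith
  set B : ℝ := ‖c₁‖ * C₁ * ‖E₁‖ + (‖g‖ * ‖q₁‖ + ‖g‖ * ‖q₂‖) * C₂ * ‖E₂‖ with hB
  have hBpos : 0 ≤ B := by positivity
  have hupper : ∀ (μ κ : ℂ), ‖κ‖ = ‖c₁‖ → 0 ≤ μ.re → |μ.im| ≤ 10 →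
      |μ.im + arg x - Real.pi| ≤ 1 → ‖(κ * exp (-(2 * dd Θ x μ))) • E₁‖ ≤ B * Real.exp (-(2 * μ.re)) := by
    intro μ κ hκ h0 h1 h2
    have h3 := (h₁ μ h0 h1 (cos_le_neg_half h2)).trans
      (mul_le_mul_of_nonneg_left (hweak _ h0) hC₁.le)
    rw [norm_smul, norm_mul, hκ]
    have h4 := mul_le_mul_of_nonneg_left h3 (norm_nonneg c₁)
    have h5 := mul_le_mul_of_nonneg_right h4 (norm_nonneg E₁)
    have h6 : 0 ≤ (‖g‖ * ‖q₁‖ + ‖g‖ * ‖q₂‖) * C₂ * ‖E₂‖ * Real.exp (-(2 * μ.re)) := by positivity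
    rw [hB, add_mul]
    refine h5.trans (le_trans (le_of_eq ?_) (le_add_of_nonneg_right h6))
    ring
  have hlower : ∀ (μ κ : ℂ), (κ = -g * q₁ ∨ κ = g * q₂) → 0 ≤ μ.re → |μ.im| ≤ 10 →
      1 / 2 ≤ Real.cos (μ.im + arg x) → ‖(κ * exp (2 * dd Θ x μ)) • E₂‖
        ≤ B * Real.exp (-(2 * μ.re)) := by
    intro μ κ hκ h0 h1 h2
    have hκ' : ‖κ‖ ≤ ‖g‖ * ‖q₁‖ + ‖g‖ * ‖q₂‖ := by
      rcases hκ with rfl | rfl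
      · rw [norm_mul, norm_neg]; exact le_add_of_nonneg_right (by positivity)
      · rw [norm_mul]; exact le_add_of_nonneg_left (by positivity)
    have h3 := (h₂ μ h0 h1 h2).trans (mul_le_mul_of_nonneg_left (hweak _ h0) hC₂.le)
    rw [norm_smul, norm_mul]
    have h4 := mul_le_mul hκ' h3 (norm_nonneg _) (by positivity)
    have h5 := mul_le_mul_of_nonneg_right h4 (norm_nonneg E₂)
    have h6 : 0 ≤ ‖c₁‖ * C₁ * ‖E₁‖ * Real.exp (-(2 * μ.re)) := by positivity
    rw [hB, add_mul]
    refine h5.trans (le_trans (le_of_eq ?_) (le_add_of_nonneg_left h6))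
    ring
  have hzero : ∀ μ : ℂ, expSigma3 (0 - dd Θ x μ) * expSigma3 (dd Θ x μ) = 1 := fun μ => by
    rw [expSigma3_mul]; simp [expSigma3_zero]
  have hE0 : ∀ μ : ℂ, 0 ≤ B * Real.exp (-(2 * μ.re)) := fun μ => by positivity
  constructor
  · refine halfAsymp_of_factor hx hΦ hexp (B := B) (A := max A 0) fun μ k h1 h2 h3 hμ hk => ?_
    obtain ⟨h4, h5⟩ := max_le_iff.1 h1
    refine ⟨_, (h μ k hμ hk).trans (mul_assoc _ _ _), ?_⟩
    have him : |μ.im| ≤ 10 := abs_le.2 ⟨by linarith, by linarith⟩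
    rcases hA μ k h4 hμ hk (by linarith) (by linarith) with ⟨rfl, h6, h7⟩ | ⟨rfl, h6, h7⟩ |
      ⟨rfl, h6, h7⟩ | ⟨rfl, h6, h7⟩
    · simp [side, h6, hzero, -zero_sub]
      positivity
    · have e : expSigma3 (Θ * Real.pi * I * (0 : ℤ) - dd Θ x μ)
          * (side m (zeta x (lam μ)) * ((monodU n m ^ (0 : ℤ) : Matˣ) : Mat)) * expSigma3 (dd Θ x μ)
          = 1 + (c₁ * exp (-(2 * dd Θ x μ))) • E₁ := by
        rw [← conj_upper]
        simp [side, not_lt.2 h6.le, VInfUp, hc₁]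
      rw [e, add_sub_cancel_left]
      exact hupper μ c₁ rfl h5 him (abs_le.2 ⟨by linarith, by linarith⟩)
    · have e : expSigma3 (Θ * Real.pi * I * (-1 : ℤ) - dd Θ x μ)
          * (side m (zeta x (lam μ)) * ((monodU n m ^ (-1 : ℤ) : Matˣ) : Mat))
          * expSigma3 (dd Θ x μ) = 1 + (-g * q₁ * exp (2 * dd Θ x μ)) • E₂ := by
        have := conj_lower (q := -(Θ * Real.pi * I)) (dd Θ x μ) (-g) (stokesLow_one_one_mul n m)
          (by rw [neg_neg]; exact stokesLow_zero_zero_mul n m)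
        rw [neg_neg] at this
        rw [side, if_neg (not_lt.2 h6.le), zpow_neg_one, VInfUp_mul_monodU_inv, ← this]
        push_cast
        rw [mul_neg_one]
      rw [e, add_sub_cancel_left]
      exact hlower μ _ (Or.inl rfl) h5 him (half_le_cos (by linarith))
    · obtain ⟨h8, h9⟩ := abs_lt.1 h7
      exfalso; linarith
  · refine halfAsymp_of_factor hx (hΦ.mul continuous_const) hexp (B := B) (A := max A 0)
      fun μ k h1 h2 h3 hμ hk => ?_
    obtain ⟨h4, h5⟩ := max_le_iff.1 h1
    refine ⟨side m (zeta x (lam μ)) * ((monodU n m ^ k : Matˣ) : Mat) * VZeroUp m, by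
      rw [h μ k hμ hk]; simp only [mul_assoc], ?_⟩
    have him : |μ.im| ≤ 10 := abs_le.2 ⟨by linarith, by linarith⟩
    rcases hA μ k h4 hμ hk (by linarith) (by linarith) with ⟨rfl, h6, h7⟩ | ⟨rfl, h6, h7⟩ |
      ⟨rfl, h6, h7⟩ | ⟨rfl, h6, h7⟩
    · have e : expSigma3 (Θ * Real.pi * I * (0 : ℤ) - dd Θ x μ)
          * (side m (zeta x (lam μ)) * ((monodU n m ^ (0 : ℤ) : Matˣ) : Mat) * VZeroUp m)
          * expSigma3 (dd Θ x μ) = 1 + (-c₁ * exp (-(2 * dd Θ x μ))) • E₁ := by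
        rw [← conj_upper]
        simp [side, h6, VZeroUp, hc₁]
      rw [e, add_sub_cancel_left]
      exact hupper μ _ (norm_neg _) h5 him (abs_le.2 ⟨by linarith, by linarith⟩)
    · simp [side, not_lt.2 h6.le, VInfUp_mul_VZeroUp, hzero, -zero_sub]
      positivity
    · obtain ⟨h8, h9⟩ := abs_lt.1 h7
      exfalso; linarith
    · have e : expSigma3 (Θ * Real.pi * I * (1 : ℤ) - dd Θ x μ)
          * (side m (zeta x (lam μ)) * ((monodU n m ^ (1 : ℤ) : Matˣ) : Mat) * VZeroUp m)
          * expSigma3 (dd Θ x μ) = 1 + (g * q₂ * exp (2 * dd Θ x μ)) • E₂ := by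
        have := conj_lower (q := Θ * Real.pi * I) (dd Θ x μ) g (stokesLow_zero_zero_mul n m)
          (stokesLow_one_one_mul n m)
        rw [side, if_pos h6, zpow_one, one_mul, monodU_val, monod_mul_VZeroUp, ← this,
          ← stokesLow_eq]
        push_cast
        rw [mul_one]
      rw [e, add_sub_cancel_left]
      refine hlower μ _ (Or.inr rfl) h5 him ?_
      rw [← Real.cos_sub_two_pi]
      exact half_le_cos (by linarith)

end

section

open scoped Matrix.Norms.Operator

/-! ### Liouville's theorem on the cylinder -/

theorem stripAt_le_sup {lo mid hi : ℝ} : stripAt lo hi ≤ stripAt lo mid ⊔ stripAt mid hi := by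
  intro s hs
  obtain ⟨h1, h2⟩ := mem_sup.1 hs
  obtain ⟨A, hA⟩ := eventually_stripAt.1 (show ∀ᶠ μ in stripAt lo mid, μ ∈ s from h1)
  obtain ⟨B, hB⟩ := eventually_stripAt.1 (show ∀ᶠ μ in stripAt mid hi, μ ∈ s from h2)
  refine eventually_stripAt.2 ⟨max A B, fun μ h3 h4 => ?_⟩
  rcases le_total μ.im mid with h | h
  · exact hA μ ((le_max_left _ _).trans h3) ⟨h4.1, h⟩
  · exact hB μ ((le_max_right _ _).trans h3) ⟨h, h4.2⟩

instance neBot_stripAt (lo : ℝ) : (stripAt lo (lo + 2 * Real.pi)).NeBot := by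
  refine ⟨fun h => ?_⟩
  have h1 : ∀ᶠ _ in stripAt lo (lo + 2 * Real.pi), False := by rw [h]; trivial
  obtain ⟨A, hA⟩ := eventually_stripAt.1 h1
  have := Real.pi_pos
  exact hA ⟨A, lo⟩ le_rfl ⟨le_rfl, by simp; linarith⟩

theorem exists_shift (lo : ℝ) (μ : ℂ) :
    ∃ k : ℤ, (μ + k * (2 * Real.pi * I)).im ∈ Set.Icc lo (lo + 2 * Real.pi) := by
  have hpos : 0 < 2 * Real.pi := by have := Real.pi_pos; linarith
  obtain ⟨k, hk, -⟩ := existsUnique_add_zsmul_mem_Ico hpos μ.im lo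
  refine ⟨k, ?_⟩
  have : (μ + k * (2 * Real.pi * I)).im = μ.im + k • (2 * Real.pi) := by simp
  rw [this]
  exact ⟨hk.1, hk.2.le⟩

theorem periodic_bound {E : Type*} [NormedAddCommGroup E] {f : ℂ → E}
    (hper : Function.Periodic f (2 * Real.pi * I)) {s : Set ℝ} {lo C : ℝ}
    (h : ∀ μ : ℂ, μ.re ∈ s → μ.im ∈ Set.Icc lo (lo + 2 * Real.pi) → ‖f μ‖ ≤ C) (μ : ℂ)
    (hμ : μ.re ∈ s) : ‖f μ‖ ≤ C := by
  obtain ⟨k, hk⟩ := exists_shift lo μ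
  rw [← hper.int_mul k μ]
  exact h _ (by simpa using hμ) hk

theorem exists_bound_rect {E : Type*} [NormedAddCommGroup E] {f : ℂ → E} (hf : Continuous f)
    (a b lo hi : ℝ) : ∃ C : ℝ, ∀ μ : ℂ, μ.re ∈ Set.Icc a b → μ.im ∈ Set.Icc lo hi → ‖f μ‖ ≤ C := by
  obtain ⟨C, hC⟩ := (isCompact_Icc.reProdIm isCompact_Icc :
    IsCompact (Set.Icc a b ×ℂ Set.Icc lo hi)).exists_bound_of_continuousOn hf.continuousOn
  exact ⟨C, fun μ h1 h2 => hC μ ⟨h1, h2⟩⟩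

theorem liouville_cylinder {E : Type*} [NormedAddCommGroup E] [NormedSpace ℂ E] {f : ℂ → E}
    (hf : Differentiable ℂ f) (hper : Function.Periodic f (2 * Real.pi * I)) {lo lo' : ℝ}
    (h1 : f =O[stripAt lo (lo + 2 * Real.pi)] fun _ => (1 : ℝ))
    (h2 : (fun μ => f (-μ)) =O[stripAt lo' (lo' + 2 * Real.pi)] fun _ => (1 : ℝ)) (μ ν : ℂ) :
    f μ = f ν := by
  obtain ⟨C, hC⟩ := h1.bound
  obtain ⟨C', hC'⟩ := h2.bound
  obtain ⟨A, hA⟩ := eventually_stripAt.1 hC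
  obtain ⟨A', hA'⟩ := eventually_stripAt.1 hC'
  obtain ⟨C'', hC''⟩ := exists_bound_rect hf.continuous (-A') A 0 (0 + 2 * Real.pi)
  have hper' : Function.Periodic (fun μ => f (-μ)) (2 * Real.pi * I) := fun μ => by
    simp only
    rw [← hper (-(μ + 2 * Real.pi * I))]; ring_nf
  have e1 : ∀ μ : ℂ, A ≤ μ.re → ‖f μ‖ ≤ C := fun μ h =>
    periodic_bound hper (s := Set.Ici A) (lo := lo) (fun ν h3 h4 => by simpa using hA ν h3 h4) μ h
  have e2 : ∀ μ : ℂ, A' ≤ μ.re → ‖f (-μ)‖ ≤ C' := fun μ h =>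
    periodic_bound hper' (s := Set.Ici A') (lo := lo')
      (fun ν h3 h4 => by simpa using hA' ν h3 h4) μ h
  refine hf.apply_eq_apply_of_bounded ?_ μ ν
  refine (isBounded_iff_forall_norm_le).2 ⟨max C (max C' C''), ?_⟩
  rintro _ ⟨μ, rfl⟩
  rcases le_or_gt A μ.re with h | h
  · exact (e1 μ h).trans (le_max_left _ _)
  · rcases le_or_gt A' (-μ.re) with h3 | h3
    · have := e2 (-μ) (by simpa using h3)
      rw [neg_neg] at this
      exact this.trans ((le_max_left _ _).trans (le_max_right _ _))
    · exact (periodic_bound hper hC'' μ ⟨by linarith, h.le⟩).trans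
        ((le_max_right _ _).trans (le_max_right _ _))

/-! ### Consequences of the asymptotics in one half-strip -/

theorem adj_eq (A : Mat) : A.adjugate = !![A 1 1, -A 0 1; -A 1 0, A 0 0] := Matrix.adjugate_fin_two A

theorem adj_add (A B : Mat) : (A + B).adjugate = A.adjugate + B.adjugate := by
  ext i j; fin_cases i <;> fin_cases j <;> simp [adj_eq] <;> ring

theorem adj_smul (a : ℂ) (A : Mat) : (a • A).adjugate = a • A.adjugate := by
  ext i j; fin_cases i <;> fin_cases j <;> simp [adj_eq]

theorem norm_adj_le (A : Mat) : ‖A.adjugate‖ ≤ 2 * ‖A‖ := by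
  refine norm_le_of_entries fun i j => ?_
  have := norm_entry_le A
  fin_cases i <;> fin_cases j <;> simp [adj_eq, this]

theorem det_expSigma3 (d : ℂ) : (expSigma3 d).det = 1 := by
  simp [expSigma3, Matrix.det_fin_two, ← exp_add]

theorem adj_expSigma3 (d : ℂ) : (expSigma3 d).adjugate = expSigma3 (-d) := by
  simp [expSigma3]

theorem hasDerivAt_mat {f : ℂ → Mat} {f' : Mat} {z : ℂ} :
    HasDerivAt f f' z ↔ ∀ i j, HasDerivAt (fun z => f z i j) (f' i j) z :=
  ⟨fun h i j => hasDerivAt_pi.1 (hasDerivAt_pi.1 h i) j,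
    fun h => hasDerivAt_pi.2 fun i => hasDerivAt_pi.2 fun j => h i j⟩

theorem differentiable_mat {f : ℂ → Mat} :
    Differentiable ℂ f ↔ ∀ i j, Differentiable ℂ fun z => f z i j :=
  ⟨fun h i j z => (hasDerivAt_mat.1 (h z).hasDerivAt i j).differentiableAt,
    fun h z => (hasDerivAt_mat (f' := Matrix.of fun i j => deriv (fun z => f z i j) z).2
      fun i j => (h i j z).hasDerivAt).differentiableAt⟩

theorem hasDerivAt_expSigma3 {d : ℂ → ℂ} {d' z : ℂ} (h : HasDerivAt d d' z) :
    HasDerivAt (fun z => expSigma3 (d z)) (d' • (sigma3 * expSigma3 (d z))) z := by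
  refine hasDerivAt_mat.2 fun i j => ?_
  have h1 := h.cexp
  have h2 := h.neg.cexp
  fin_cases i <;> fin_cases j <;> simp [expSigma3, sigma3]
  · simpa [mul_comm] using h1
  · exact hasDerivAt_const _ _
  · exact hasDerivAt_const _ _
  · simpa [mul_comm] using h2

theorem hasDerivAt_dd (Θ x μ : ℂ) : HasDerivAt (dd Θ x) (Θ / 2 - x * exp μ / 2) μ := by
  unfold dd
  have h1 : HasDerivAt (fun μ : ℂ => Θ / 2 * (μ - I * (Real.pi / 2))) (Θ / 2) μ := by
    simpa using ((hasDerivAt_id μ).sub_const (I * (Real.pi / 2))).const_mul (Θ / 2)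
  exact h1.sub (((Complex.hasDerivAt_exp μ).const_mul x).div_const 2)

theorem differentiable_expSigma3_dd (Θ x : ℂ) :
    Differentiable ℂ fun μ => expSigma3 (dd Θ x μ) := fun μ =>
  (hasDerivAt_expSigma3 (hasDerivAt_dd Θ x μ)).differentiableAt

theorem hasDerivAt_inv_lam (μ : ℂ) : HasDerivAt (fun μ => (lam μ)⁻¹) (-(lam μ)⁻¹) μ := by
  simp only [inv_lam]
  have := (hasDerivAt_neg μ).cexp.const_mul I
  simpa using this

theorem norm_inv_lam (μ : ℂ) : ‖(lam μ)⁻¹‖ = Real.exp (-μ.re) := by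
  rw [norm_inv, norm_lam, Real.exp_neg]

variable {Θ x : ℂ} {lo hi lo' hi' : ℝ} {Ψ : ℂ → Mat} {a0 a1 : Mat}

theorem HalfAsymp.isBigO (h : HalfAsymp Θ x lo hi Ψ a0 a1) (h1 : lo < lo') (h2 : hi' < hi) :
    (fun μ => Ψ μ * expSigma3 (dd Θ x μ) - a0 - (lam μ)⁻¹ • a1)
      =O[stripAt lo' hi'] fun μ => (lam μ)⁻¹ ^ 2 := by
  obtain ⟨C, A, hC⟩ := h
  refine IsBigO.of_bound C (eventually_stripAt.2 ⟨A, fun μ h3 h4 => ?_⟩)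
  rw [norm_pow, norm_inv_lam, ← Real.exp_nat_mul]
  convert hC μ h3 (h1.trans_le h4.1) (h4.2.trans_lt h2) using 3
  push_cast; ring

/-- Cauchy's estimate on disks of a fixed radius. These fit because the smaller strip lies strictly
inside the larger one. -/
theorem HalfAsymp.isBigO_deriv (h : HalfAsymp Θ x lo hi Ψ a0 a1) (hΨ : Differentiable ℂ Ψ)
    (h1 : lo < lo') (h2 : hi' < hi) :
    (fun μ => deriv (fun μ => Ψ μ * expSigma3 (dd Θ x μ)) μ + (lam μ)⁻¹ • a1)
      =O[stripAt lo' hi'] fun μ => (lam μ)⁻¹ ^ 2 := by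
  obtain ⟨C, A, hC⟩ := h
  obtain ⟨r, hr, hr1⟩ := exists_between (lt_min (sub_pos.2 h1) (sub_pos.2 h2))
  obtain ⟨hr2, hr3⟩ := lt_min_iff.1 hr1
  refine IsBigO.of_bound (C * Real.exp (2 * r) / r) (eventually_stripAt.2 ⟨A + r, fun μ h3 h4 => ?_⟩)
  have hY : Differentiable ℂ fun μ => Ψ μ * expSigma3 (dd Θ x μ) :=
    hΨ.mul (differentiable_expSigma3_dd Θ x)
  have hd : ∀ μ, HasDerivAt (fun μ => Ψ μ * expSigma3 (dd Θ x μ) - a0 - (lam μ)⁻¹ • a1)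
      (deriv (fun μ => Ψ μ * expSigma3 (dd Θ x μ)) μ + (lam μ)⁻¹ • a1) μ := fun μ =>
    (((hY μ).hasDerivAt.sub_const a0).fun_sub ((hasDerivAt_inv_lam μ).smul_const a1)).congr_deriv
      (by rw [neg_smul, sub_neg_eq_add]; rfl)
  rw [← (hd μ).deriv]
  have hC0 : ∀ z ∈ Metric.sphere μ r, ‖Ψ z * expSigma3 (dd Θ x z) - a0 - (lam z)⁻¹ • a1‖
      ≤ C * Real.exp (2 * r) * Real.exp (-(2 * μ.re)) := by
    intro z hz
    rw [mem_sphere_iff_norm] at hz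
    have h5 := abs_le.1 ((abs_re_le_norm (z - μ)).trans hz.le)
    have h6 := abs_le.1 ((abs_im_le_norm (z - μ)).trans hz.le)
    rw [sub_re] at h5
    rw [sub_im] at h6
    have h7 := hC z (by linarith [h5.1]) (by linarith [h6.1, h4.1]) (by linarith [h6.2, h4.2])
    have hC1 : 0 ≤ C := by
      have := (norm_nonneg _).trans h7
      exact (mul_nonneg_iff_of_pos_right (Real.exp_pos _)).1 this
    refine h7.trans ?_
    rw [mul_assoc, ← Real.exp_add]
    refine mul_le_mul_of_nonneg_left (Real.exp_le_exp.2 ?_) hC1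
    linarith [h5.1]
  have := norm_deriv_le_of_forall_mem_sphere_norm_le hr
    (Differentiable.diffContOnCl fun z => (hd z).differentiableAt) hC0
  rw [norm_pow, norm_inv_lam, ← Real.exp_nat_mul]
  refine this.trans_eq ?_
  push_cast
  rw [show (2 : ℝ) * -μ.re = -(2 * μ.re) by ring]
  ring

end

/-! ### Expansions of conjugates and of logarithmic derivatives, and Liouville's theorem applied to
them. -/

section

open scoped Matrix.Norms.Operator

theorem tendsto_inv_lam_stripAt {lo hi : ℝ} : Tendsto (fun μ => (lam μ)⁻¹) (stripAt lo hi) (𝓝 0) := by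
  refine tendsto_zero_iff_norm_tendsto_zero.2 ?_
  simp only [norm_inv_lam]
  exact tendsto_exp_neg_stripAt

theorem inv_lam_isBigO_one {lo hi : ℝ} :
    (fun μ => (lam μ)⁻¹) =O[stripAt lo hi] fun _ => (1 : ℂ) :=
  tendsto_inv_lam_stripAt.isBigO_one ℂ

theorem inv_lam_sq_isBigO {lo hi : ℝ} :
    (fun μ => (lam μ)⁻¹ ^ 2) =O[stripAt lo hi] fun μ => (lam μ)⁻¹ := by
  simpa [pow_two] using inv_lam_isBigO_one.mul (isBigO_refl (fun μ => (lam μ)⁻¹) (stripAt lo hi))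

theorem exp_mul_inv_lam (μ : ℂ) : exp μ * (lam μ)⁻¹ = I := by
  rw [inv_lam, mul_left_comm, ← exp_add]; simp

theorem isBigO_adj {α : Type*} {l : Filter α} {r : α → Mat} {g : α → ℂ} (h : r =O[l] g) :
    (fun z => (r z).adjugate) =O[l] g :=
  (IsBigO.of_bound 2 (Eventually.of_forall fun z => norm_adj_le (r z))).trans h

section

variable {lo hi : ℝ} {Y : ℂ → Mat} {a0 a1 : Mat}

/-- `a₀ + a₁ / λ + O(λ⁻²)` is bounded. -/
theorem isBigO_one_of_expansion
    (h : (fun μ => Y μ - a0 - (lam μ)⁻¹ • a1) =O[stripAt lo hi] fun μ => (lam μ)⁻¹ ^ 2) :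
    Y =O[stripAt lo hi] fun _ => (1 : ℂ) := by
  have h1 := h.trans (inv_lam_sq_isBigO.trans inv_lam_isBigO_one)
  have h2 : (fun μ => (lam μ)⁻¹ • a1) =O[stripAt lo hi] fun _ => (1 : ℂ) := by
    simpa using inv_lam_isBigO_one.smul (isBigO_const_const a1 (one_ne_zero (α := ℂ)) (stripAt lo hi))
  have h3 := (h1.add h2).add (isBigO_const_const a0 (one_ne_zero (α := ℂ)) (stripAt lo hi))
  refine h3.congr_left fun μ => ?_
  abel

theorem tendsto_of_expansion
    (h : (fun μ => Y μ - a0 - (lam μ)⁻¹ • a1) =O[stripAt lo hi] fun μ => (lam μ)⁻¹ ^ 2) :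
    Tendsto Y (stripAt lo hi) (𝓝 a0) := by
  have h1 := (h.trans inv_lam_sq_isBigO).trans_tendsto tendsto_inv_lam_stripAt
  have h2 : Tendsto (fun μ => (lam μ)⁻¹ • a1) (stripAt lo hi) (𝓝 0) := by
    simpa using (tendsto_inv_lam_stripAt (lo := lo) (hi := hi)).smul_const a1
  have h3 := (h1.add h2).add_const a0
  rw [zero_add, zero_add] at h3
  refine h3.congr fun μ => ?_
  abel

/-- The adjugate is linear on 2 × 2 matrices, so it replaces the inverse without any information on
the determinant, and the expansions simply multiply out. -/
theorem isBigO_conj (S : Mat)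
    (h : (fun μ => Y μ - a0 - (lam μ)⁻¹ • a1) =O[stripAt lo hi] fun μ => (lam μ)⁻¹ ^ 2) :
    (fun μ => Y μ * S * (Y μ).adjugate - a0 * S * a0.adjugate
      - (lam μ)⁻¹ • (a1 * S * a0.adjugate + a0 * S * a1.adjugate))
      =O[stripAt lo hi] fun μ => (lam μ)⁻¹ ^ 2 := by
  have hb := isBigO_one_of_expansion h
  have hr := isBigO_adj h
  have hS : ∀ A : Mat, (fun _ : ℂ => A) =O[stripAt lo hi] fun _ => (1 : ℂ) := fun A =>
    isBigO_const_const A (one_ne_zero (α := ℂ)) _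
  have t1 : (fun μ => (lam μ)⁻¹ ^ 2 • (a1 * S * a1.adjugate)) =O[stripAt lo hi]
      fun μ => (lam μ)⁻¹ ^ 2 := by
    simpa only [smul_eq_mul, mul_one] using
      (isBigO_refl (fun μ => (lam μ)⁻¹ ^ 2) (stripAt lo hi)).smul (hS (a1 * S * a1.adjugate))
  have t2 : (fun μ => (Y μ - a0 - (lam μ)⁻¹ • a1) * S * (Y μ).adjugate) =O[stripAt lo hi]
      fun μ => (lam μ)⁻¹ ^ 2 := by
    simpa using (h.mul (hS S)).mul (isBigO_adj hb)
  have hlin : (fun μ => a0 + (lam μ)⁻¹ • a1) =O[stripAt lo hi] fun _ => (1 : ℂ) := by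
    refine (hS a0).add ?_
    simpa using inv_lam_isBigO_one.smul (hS a1)
  have t3 : (fun μ => (a0 + (lam μ)⁻¹ • a1) * S * (Y μ - a0 - (lam μ)⁻¹ • a1).adjugate)
      =O[stripAt lo hi] fun μ => (lam μ)⁻¹ ^ 2 := by
    simpa using (hlin.mul (hS S)).mul hr
  refine ((t1.add t2).add t3).congr_left fun μ => ?_
  obtain ⟨r, hr⟩ : ∃ r, Y μ = a0 + (lam μ)⁻¹ • a1 + r := ⟨Y μ - a0 - (lam μ)⁻¹ • a1, by abel⟩
  rw [hr]
  have : a0 + (lam μ)⁻¹ • a1 + r - a0 - (lam μ)⁻¹ • a1 = r := by abel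
  rw [this, adj_add, adj_add, adj_smul]
  simp only [add_mul, mul_add, smul_mul_assoc, mul_smul_comm, smul_add, smul_smul, pow_two]
  abel

end

theorem expSigma3_mul_neg (d : ℂ) : expSigma3 d * expSigma3 (-d) = 1 := by
  rw [expSigma3_mul, add_neg_cancel, expSigma3_zero]

theorem sigma3_mul_expSigma3 (d : ℂ) : sigma3 * expSigma3 d = expSigma3 d * sigma3 := by
  ext i j; fin_cases i <;> fin_cases j <;> simp [sigma3, expSigma3, Matrix.mul_apply]

/-- The constant term of the logarithmic derivative at infinity. -/
def laxConst (Θ x : ℂ) (a0 a1 : Mat) : Mat :=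
  -(Θ / 2) • (a0 * sigma3 * a0.adjugate)
    + (I * x / 2) • (a1 * sigma3 * a0.adjugate + a0 * sigma3 * a1.adjugate)

section

variable {Θ x : ℂ} {lo hi lo' hi' : ℝ} {Ψ : ℂ → Mat} {a0 a1 : Mat}

theorem conj_sigma3_expSigma3 (A : Mat) (d : ℂ) :
    (A * expSigma3 d) * sigma3 * (A * expSigma3 d).adjugate = A * sigma3 * A.adjugate := by
  rw [Matrix.adjugate_mul_distrib, adj_expSigma3]
  calc A * expSigma3 d * sigma3 * (expSigma3 (-d) * A.adjugate)
      = A * (expSigma3 d * sigma3) * expSigma3 (-d) * A.adjugate := by simp only [mul_assoc]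
    _ = A * sigma3 * (expSigma3 d * expSigma3 (-d)) * A.adjugate := by
        rw [← sigma3_mul_expSigma3]; simp only [mul_assoc]
    _ = _ := by rw [expSigma3_mul_neg, mul_one]

theorem logDeriv_eq (hΨ : Differentiable ℂ Ψ) (μ : ℂ) :
    deriv Ψ μ * (Ψ μ).adjugate
      = deriv (fun μ => Ψ μ * expSigma3 (dd Θ x μ)) μ * (Ψ μ * expSigma3 (dd Θ x μ)).adjugate
        - (Θ / 2 - x * exp μ / 2) • ((Ψ μ * expSigma3 (dd Θ x μ)) * sigma3
          * (Ψ μ * expSigma3 (dd Θ x μ)).adjugate) := by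
  have h : deriv (fun μ => Ψ μ * expSigma3 (dd Θ x μ)) μ
      = deriv Ψ μ * expSigma3 (dd Θ x μ) + Ψ μ * ((Θ / 2 - x * exp μ / 2) •
        (sigma3 * expSigma3 (dd Θ x μ))) :=
    ((hΨ μ).hasDerivAt.mul (hasDerivAt_expSigma3 (hasDerivAt_dd Θ x μ))).deriv
  rw [conj_sigma3_expSigma3, h, add_mul, Matrix.adjugate_mul_distrib, adj_expSigma3]
  have e1 : deriv Ψ μ * expSigma3 (dd Θ x μ) * (expSigma3 (-dd Θ x μ) * (Ψ μ).adjugate)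
      = deriv Ψ μ * (Ψ μ).adjugate := by
    rw [mul_assoc, ← mul_assoc (expSigma3 _), expSigma3_mul_neg, one_mul]
  have e2 : Ψ μ * ((Θ / 2 - x * exp μ / 2) • (sigma3 * expSigma3 (dd Θ x μ)))
      * (expSigma3 (-dd Θ x μ) * (Ψ μ).adjugate)
      = (Θ / 2 - x * exp μ / 2) • (Ψ μ * sigma3 * (Ψ μ).adjugate) := by
    rw [mul_smul_comm, smul_mul_assoc]
    congr 1
    calc Ψ μ * (sigma3 * expSigma3 (dd Θ x μ)) * (expSigma3 (-dd Θ x μ) * (Ψ μ).adjugate)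
        = Ψ μ * sigma3 * (expSigma3 (dd Θ x μ) * expSigma3 (-dd Θ x μ)) * (Ψ μ).adjugate := by
          simp only [mul_assoc]
      _ = _ := by rw [expSigma3_mul_neg, mul_one]
  rw [e1, e2, add_sub_cancel_right]

theorem HalfAsymp.isBigO_logDeriv (h : HalfAsymp Θ x lo hi Ψ a0 a1) (hΨ : Differentiable ℂ Ψ)
    (h1 : lo < lo') (h2 : hi' < hi) :
    (fun μ => deriv Ψ μ * (Ψ μ).adjugate - (x * exp μ / 2) • (a0 * sigma3 * a0.adjugate)
      - laxConst Θ x a0 a1) =O[stripAt lo' hi'] fun μ => (lam μ)⁻¹ := by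
  have hY := h.isBigO h1 h2
  have hY' := h.isBigO_deriv hΨ h1 h2
  set Y : ℂ → Mat := fun μ => Ψ μ * expSigma3 (dd Θ x μ) with hYdef
  have hS : ∀ A : Mat, (fun _ : ℂ => A) =O[stripAt lo' hi'] fun _ => (1 : ℂ) := fun A =>
    isBigO_const_const A (one_ne_zero (α := ℂ)) _
  have hc := isBigO_conj sigma3 hY
  have hb := isBigO_adj (isBigO_one_of_expansion hY)
  have hεA : ∀ A : Mat, (fun μ => (lam μ)⁻¹ • A) =O[stripAt lo' hi'] fun μ => (lam μ)⁻¹ := fun A => by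
    simpa using (isBigO_refl (fun μ => (lam μ)⁻¹) (stripAt lo' hi')).smul (hS A)
  have t1 : (fun μ => deriv Y μ * (Y μ).adjugate) =O[stripAt lo' hi'] fun μ => (lam μ)⁻¹ := by
    have : deriv Y =O[stripAt lo' hi'] fun μ => (lam μ)⁻¹ :=
      ((hY'.trans inv_lam_sq_isBigO).sub (hεA a1)).congr_left fun μ => by abel
    simpa using this.mul hb
  have t2 : (fun μ => (Θ / 2) • (Y μ * sigma3 * (Y μ).adjugate - a0 * sigma3 * a0.adjugate))
      =O[stripAt lo' hi'] fun μ => (lam μ)⁻¹ := by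
    refine IsBigO.const_smul_left ?_ (Θ / 2)
    exact ((hc.trans inv_lam_sq_isBigO).add (hεA _)).congr_left fun μ => sub_add_cancel _ _
  -- The growing factor e^μ costs one order of the error. As e^μ λ⁻¹ = i, it turns the first-order
  -- coefficient into a constant term.
  have t3 : (fun μ => (x / 2) • exp μ • (Y μ * sigma3 * (Y μ).adjugate - a0 * sigma3 * a0.adjugate
      - (lam μ)⁻¹ • (a1 * sigma3 * a0.adjugate + a0 * sigma3 * a1.adjugate)))
      =O[stripAt lo' hi'] fun μ => (lam μ)⁻¹ := by
    refine IsBigO.const_smul_left ?_ (x / 2)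
    have := (isBigO_refl exp (stripAt lo' hi')).smul hc
    refine this.trans (IsBigO.of_bound 1 (Eventually.of_forall fun μ => ?_))
    rw [smul_eq_mul, pow_two, ← mul_assoc, exp_mul_inv_lam]; simp
  refine ((t1.sub t2).add t3).congr_left fun μ => ?_
  rw [logDeriv_eq (Θ := Θ) (x := x) hΨ μ]
  have e : exp μ • (lam μ)⁻¹ • (a1 * sigma3 * a0.adjugate + a0 * sigma3 * a1.adjugate)
      = I • (a1 * sigma3 * a0.adjugate + a0 * sigma3 * a1.adjugate) := by
    rw [smul_smul, exp_mul_inv_lam]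
  rw [smul_sub (exp μ), e]
  unfold laxConst
  rw [hYdef]
  module

end

/-! ### The continuation together with its asymptotics -/

/-- The two half-strips overlap and cover a period. The angle β is a parameter rather than -arg x,
so that it can be kept fixed while x varies. -/
structure Asym (n : ℤ) (m x : ℂ) (β : ℝ) (Φ : ℂ → Mat) (a0 a1 : Mat) : Prop where
  diff : Differentiable ℂ Φ
  per : ∀ μ, Φ (μ + 2 * Real.pi * I) = Φ μ * monod n m
  asympP : HalfAsymp (thetaInf n m) x (β - 1 / 4) (β + Real.pi + 1 / 4) Φ a0 a1
  asympN : HalfAsymp (thetaInf n m) x (β + Real.pi - 1 / 4) (β + 2 * Real.pi + 1 / 4)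
    (fun μ => Φ μ * VZeroUp m) a0 a1

theorem det_VZeroUp (m : ℂ) : (VZeroUp m).det = 1 := by simp [VZeroUp, Matrix.det_fin_two]

theorem det_monod (n : ℤ) (m : ℂ) : (monod n m).det = 1 := by
  have h : (monod n m).det = (stokesLow n m).det := by
    rw [← monod_mul_VZeroUp, Matrix.det_mul, det_VZeroUp, mul_one]
  rw [h, stokesLow_eq, Matrix.det_fin_two]
  simpa using stokesLow_det n m

namespace Asym

variable {n : ℤ} {m x : ℂ} {β : ℝ} {Φ : ℂ → Mat} {a0 a1 : Mat}

theorem det_isBigO (h : Asym n m x β Φ a0 a1) :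
    Tendsto (fun μ => (Φ μ).det) (stripAt β (β + 2 * Real.pi)) (𝓝 a0.det) := by
  have key : ∀ {lo hi lo' hi' : ℝ} {Ψ : ℂ → Mat},
      HalfAsymp (thetaInf n m) x lo hi Ψ a0 a1 → lo < lo' → hi' < hi →
      Tendsto (fun μ => (Ψ μ).det) (stripAt lo' hi') (𝓝 a0.det) := by
    intro lo hi lo' hi' Ψ hh h1 h2
    have h3 := tendsto_of_expansion (hh.isBigO h1 h2)
    have h4 : Continuous fun A : Mat => A.det := Continuous.matrix_det continuous_id
    refine (h4.continuousAt.tendsto.comp h3).congr fun μ => ?_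
    simp [Matrix.det_mul, det_expSigma3]
  refine (tendsto_sup.2 ⟨key h.asympP (lo' := β) (hi' := β + Real.pi) (by linarith) (by linarith),
    ?_⟩).mono_left stripAt_le_sup
  have := key h.asympN (lo' := β + Real.pi) (hi' := β + 2 * Real.pi) (by linarith) (by linarith)
  simpa [Matrix.det_mul, det_VZeroUp] using this

theorem logDeriv_isBigO (h : Asym n m x β Φ a0 a1) :
    (fun μ => deriv Φ μ * (Φ μ).adjugate - (x * exp μ / 2) • (a0 * sigma3 * a0.adjugate)
      - laxConst (thetaInf n m) x a0 a1) =O[stripAt β (β + 2 * Real.pi)] fun μ => (lam μ)⁻¹ := by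
  refine (IsBigO.sup (h.asympP.isBigO_logDeriv h.diff (lo' := β) (hi' := β + Real.pi)
    (by linarith) (by linarith)) ?_).mono stripAt_le_sup
  have h1 := h.asympN.isBigO_logDeriv (h.diff.mul_const _) (lo' := β + Real.pi)
    (hi' := β + 2 * Real.pi) (by linarith) (by linarith)
  refine h1.congr_left fun μ => ?_
  have h2 : deriv (fun μ => Φ μ * VZeroUp m) μ = deriv Φ μ * VZeroUp m :=
    ((h.diff μ).hasDerivAt.mul_const _).deriv
  have h3 : VZeroUp m * (VZeroUp m).adjugate = 1 := by
    rw [Matrix.mul_adjugate, det_VZeroUp, one_smul]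
  rw [h2, Matrix.adjugate_mul_distrib, mul_assoc, ← mul_assoc (VZeroUp m), h3, one_mul]

theorem det_periodic (h : Asym n m x β Φ a0 a1) :
    Function.Periodic (fun μ => (Φ μ).det) (2 * Real.pi * I) := fun μ => by
  simp only [h.per, Matrix.det_mul, det_monod, mul_one]

theorem differentiable_det (h : Asym n m x β Φ a0 a1) : Differentiable ℂ fun μ => (Φ μ).det := by
  simp only [Matrix.det_fin_two]
  have := differentiable_mat.1 h.diff
  exact ((this 0 0).mul (this 1 1)).sub ((this 0 1).mul (this 1 0))

/-- Determinants, for a pair of functions exchanged by `μ ↦ -μ`. -/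
theorem det_eq (h : Asym n m x β Φ a0 a1) {n' : ℤ} {b0 b1 : Mat}
    (h' : Asym n' m x β (fun μ => Φ (-μ) * monod n m) b0 b1) :
    (∀ μ, (Φ μ).det = a0.det) ∧ b0.det = a0.det := by
  have h1 := h.det_isBigO
  have h2 := h'.det_isBigO
  have h2' : Tendsto (fun μ => (Φ (-μ)).det) (stripAt β (β + 2 * Real.pi)) (𝓝 b0.det) := by
    simpa [Matrix.det_mul, det_monod] using h2
  have hc := liouville_cylinder h.differentiable_det h.det_periodic (h1.isBigO_one ℝ)
    (h2'.isBigO_one ℝ)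
  have e1 : ∀ μ, (Φ μ).det = a0.det := fun μ =>
    tendsto_nhds_unique (tendsto_const_nhds.congr fun ν => hc μ ν) h1
  exact ⟨e1, tendsto_nhds_unique h2' (tendsto_const_nhds.congr fun ν => (e1 (-ν)).symm)⟩

theorem differentiable_deriv {f : ℂ → Mat} (h : Differentiable ℂ f) : Differentiable ℂ (deriv f) :=
  fun z => ((h.analyticAt z).deriv).differentiableAt

theorem differentiable_adj {f : ℂ → Mat} (h : Differentiable ℂ f) :
    Differentiable ℂ fun z => (f z).adjugate := by
  have h1 := differentiable_mat.1 h
  refine differentiable_mat.2 fun i j => ?_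
  simp only [adj_eq]
  fin_cases i <;> fin_cases j <;> simp <;> exact h1 _ _

/-- The logarithmic derivative of the continuation. -/
theorem logDeriv (h : Asym n m x β Φ 1 a1) {n' : ℤ} {b0 b1 : Mat}
    (h' : Asym n' m x β (fun μ => Φ (-μ) * monod n m) b0 b1) (μ : ℂ) :
    deriv Φ μ * (Φ μ).adjugate = (x * exp μ / 2) • sigma3 + laxConst (thetaInf n m) x 1 a1
      - (x * exp (-μ) / 2) • (b0 * sigma3 * b0.adjugate) ∧
    laxConst (thetaInf n m) x 1 a1 = - laxConst (thetaInf n' m) x b0 b1 := by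
  set K := b0 * sigma3 * b0.adjugate with hK
  have hC : monod n m * (monod n m).adjugate = 1 := by
    rw [Matrix.mul_adjugate, det_monod, one_smul]
  have hper' : ∀ μ, deriv Φ (μ + 2 * Real.pi * I) = deriv Φ μ * monod n m := fun μ => by
    have h1 : (fun μ => Φ (μ + 2 * Real.pi * I)) = fun μ => Φ μ * monod n m := funext h.per
    have h2 : deriv (fun μ => Φ (μ + 2 * Real.pi * I)) μ = deriv (fun μ => Φ μ * monod n m) μ :=
      congrArg (fun f => deriv f μ) h1
    exact (deriv_comp_add_const Φ _ μ).symm.trans <| h2.trans ((h.diff μ).hasDerivAt.mul_const _).deriv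
  -- Subtracting the growing parts at both ends leaves a bounded periodic entire function. It is
  -- constant and tends to 0 on the right, and its limit on the left gives the relation between the
  -- two constant terms.
  set f : ℂ → Mat := fun μ => deriv Φ μ * (Φ μ).adjugate - (x * exp μ / 2) • sigma3
    - laxConst (thetaInf n m) x 1 a1 + (x * exp (-μ) / 2) • K with hf
  have hexp : Function.Periodic exp (2 * Real.pi * I) := exp_periodic
  have hexp' : ∀ μ, exp (-(μ + 2 * Real.pi * I)) = exp (-μ) := fun μ => by
    rw [neg_add]; exact (exp_periodic.neg) (-μ)
  have hfper : Function.Periodic f (2 * Real.pi * I) := fun μ => by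
    simp only [hf]
    rw [hper', h.per, Matrix.adjugate_mul_distrib, mul_assoc, ← mul_assoc (monod n m), hC, one_mul,
      hexp, hexp']
  have hfd : Differentiable ℂ f := by
    have hs : ∀ A : Mat, Differentiable ℂ fun μ : ℂ => (x * exp μ / 2) • A := fun A =>
      (((differentiable_exp.const_mul x).div_const 2).smul_const A)
    have hs' : ∀ A : Mat, Differentiable ℂ fun μ : ℂ => (x * exp (-μ) / 2) • A := fun A =>
      ((((differentiable_exp.comp differentiable_neg).const_mul x).div_const 2).smul_const A)
    exact ((((differentiable_deriv h.diff).mul (differentiable_adj h.diff)).sub (hs _)).sub_const _).add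
      (hs' _)
  have hlim1 : Tendsto f (stripAt β (β + 2 * Real.pi)) (𝓝 0) := by
    have h1 := h.logDeriv_isBigO.trans_tendsto tendsto_inv_lam_stripAt
    have h2 : Tendsto (fun μ => (x * exp (-μ) / 2) • K) (stripAt β (β + 2 * Real.pi)) (𝓝 0) := by
      have : Tendsto (fun μ => ((lam μ)⁻¹ * (x / (2 * I))) • K) (stripAt β (β + 2 * Real.pi))
          (𝓝 ((0 * (x / (2 * I))) • K)) := (tendsto_inv_lam_stripAt.mul_const _).smul_const K
      rw [zero_mul, zero_smul] at this
      refine this.congr fun μ => ?_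
      rw [inv_lam]; congr 1; field_simp
    have h3 := h1.add h2
    rw [add_zero] at h3
    refine h3.congr fun μ => ?_
    simp [hf]
  have hlim2 : Tendsto (fun μ => f (-μ)) (stripAt β (β + 2 * Real.pi))
      (𝓝 (-laxConst (thetaInf n' m) x b0 b1 - laxConst (thetaInf n m) x 1 a1)) := by
    have h1 := h'.logDeriv_isBigO.trans_tendsto tendsto_inv_lam_stripAt
    have h2 : Tendsto (fun μ => (x * exp (-μ) / 2) • sigma3) (stripAt β (β + 2 * Real.pi)) (𝓝 0) := by
      have : Tendsto (fun μ => ((lam μ)⁻¹ * (x / (2 * I))) • sigma3) (stripAt β (β + 2 * Real.pi))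
          (𝓝 ((0 * (x / (2 * I))) • sigma3)) := (tendsto_inv_lam_stripAt.mul_const _).smul_const _
      rw [zero_mul, zero_smul] at this
      refine this.congr fun μ => ?_
      rw [inv_lam]; congr 1; field_simp
    have h3 := (h1.neg.sub h2).add_const
      (-laxConst (thetaInf n' m) x b0 b1 - laxConst (thetaInf n m) x 1 a1)
    rw [neg_zero, sub_zero, zero_add] at h3
    refine h3.congr fun μ => ?_
    have hd : deriv (fun μ => Φ (-μ) * monod n m) μ = -deriv Φ (-μ) * monod n m := by
      have := ((h.diff (-μ)).hasDerivAt.scomp μ (hasDerivAt_neg μ)).mul_const (monod n m)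
      rw [neg_one_smul] at this
      exact this.deriv
    rw [hd, Matrix.adjugate_mul_distrib, mul_assoc, ← mul_assoc (monod n m), hC, one_mul]
    simp only [hf, neg_neg, neg_mul]
    abel
  have hc := liouville_cylinder hfd hfper (hlim1.isBigO_one ℝ) (hlim2.isBigO_one ℝ)
  have hz : ∀ μ, f μ = 0 := fun μ =>
    tendsto_nhds_unique (tendsto_const_nhds.congr fun ν => hc μ ν) hlim1
  constructor
  · have := hz μ
    simp only [hf] at this
    rw [← sub_eq_zero, ← this]; abel
  · have h1 := tendsto_nhds_unique hlim2 (tendsto_const_nhds.congr fun ν => (hz (-ν)).symm)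
    rw [sub_eq_zero] at h1
    exact h1.symm

end Asym

end

/-! ### Consequences of the determinant condition; the solution at both ends. -/

section

open scoped Matrix.Norms.Operator

/-- The product Y · adj Y = det Y · 1 is constant, so the coefficient of λ⁻¹ in its expansion
vanishes. -/
theorem Asym.trace_relation {n : ℤ} {m x : ℂ} {β : ℝ} {Φ : ℂ → Mat} {a0 a1 : Mat}
    (h : Asym n m x β Φ a0 a1) (hdet : ∀ μ, (Φ μ).det = a0.det) :
    a1 * a0.adjugate + a0 * a1.adjugate = 0 := by
  have h1 := isBigO_conj 1 (h.asympP.isBigO (lo' := β) (hi' := β + Real.pi) (by linarith)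
    (by linarith))
  set N : Mat := a1 * 1 * a0.adjugate + a0 * 1 * a1.adjugate with hN
  have h2 : (fun μ => (lam μ)⁻¹ • N) =O[stripAt β (β + Real.pi)] fun μ => (lam μ)⁻¹ ^ 2 := by
    refine h1.neg_left.congr_left fun μ => ?_
    rw [mul_one, mul_one, Matrix.mul_adjugate, Matrix.mul_adjugate, Matrix.det_mul, hdet,
      det_expSigma3, mul_one, sub_self, zero_sub, neg_neg]
  have h3 : (fun _ => N) =O[stripAt β (β + Real.pi)] fun μ => (lam μ)⁻¹ := by
    have := (isBigO_refl lam (stripAt β (β + Real.pi))).smul h2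
    refine (this.congr_left fun μ => ?_).trans (IsBigO.of_bound 1 (Eventually.of_forall fun μ => ?_))
    · rw [smul_smul, mul_inv_cancel₀ (lam_ne_zero μ), one_smul]
    · rw [smul_eq_mul, pow_two, mul_inv_cancel_left₀ (lam_ne_zero μ), one_mul]
  have h4 := h3.trans_tendsto tendsto_inv_lam_stripAt
  have hne : (stripAt β (β + Real.pi)).NeBot := ⟨fun h0 => by
    have h5 : ∀ᶠ _ in stripAt β (β + Real.pi), False := by rw [h0]; trivial
    obtain ⟨A, hA⟩ := eventually_stripAt.1 h5
    exact hA ⟨A, β⟩ le_rfl ⟨le_rfl, by simp; exact Real.pi_pos.le⟩⟩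
  have h5 : N = 0 := tendsto_nhds_unique tendsto_const_nhds h4
  simpa [hN] using h5

theorem IsSolution.expandsAtInf {n : ℤ} {m x : ℂ} {F : ℂ → Mat} {cInf c0 : ℕ → Mat}
    (h : IsSolution n m x F cInf c0) : ExpandsAtInf (thetaInf n m) x F cInf := h.at_infinity

theorem IsSolution.exists_asym {n : ℤ} {m x : ℂ} {F : ℂ → Mat} {cInf c0 : ℕ → Mat}
    (hx : x ∈ slitPlane) (h : IsSolution n m x F cInf c0) :
    ∃ Φ : ℂ → Mat, IsCont n m x F Φ ∧ ∀ β : ℝ, |β + arg x| < 1 / 8 →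
      Asym n m x β Φ 1 (cInf 1) ∧
      Asym (1 - n) m x β (fun μ => Φ (-μ) * monod n m)
        (c0 0 * expSigma3 (theta0 n m / 2 * (I * Real.pi)))
        (-(c0 1 * expSigma3 (theta0 n m / 2 * (I * Real.pi)))) := by
  have hx0 := slitPlane_ne_zero hx
  obtain ⟨Φ, hΦ, hc⟩ := exists_continuation hx h
  have hd : Differentiable ℂ Φ := differentiable_mat.2 hΦ
  have hd' : Differentiable ℂ fun μ => Φ (-μ) * monod n m :=
    (hd.comp differentiable_neg).mul_const _
  have hm := hc.mirror hx
  refine ⟨Φ, hc, fun β hβ => ⟨?_, ?_⟩⟩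
  · obtain ⟨h1, h2⟩ := hc.halfAsymp hx hd.continuous h.expandsAtInf hβ
    rw [h.cInf_zero] at h1 h2
    exact ⟨hd, hc.add_two_pi hx0 hd.continuous, h1, h2⟩
  · obtain ⟨h1, h2⟩ := hm.halfAsymp hx hd'.continuous (h.expandsAtInf_mirror hx) hβ
    simp only [pow_zero, one_smul, pow_one, neg_smul] at h1 h2
    exact ⟨hd', hm.add_two_pi hx0 hd'.continuous, h1, h2⟩

end

section

open scoped Matrix.Norms.Operator

/-! ### Comparison of the solutions at two nearby values of `x` -/

theorem norm_exp_sub_one_le_mul_exp (z : ℂ) : ‖exp z - 1‖ ≤ ‖z‖ * Real.exp ‖z‖ := by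
  simpa using Complex.norm_exp_sub_sum_le_norm_mul_exp z 1

/-- The ratio of the exponential factors at `x₀ + h` and at `x₀`. -/
def twist (h μ : ℂ) : Mat := expSigma3 (-(h * exp μ / 2))

theorem dd_add (Θ x h μ : ℂ) : dd Θ (x + h) μ = dd Θ x μ + -(h * exp μ / 2) := by unfold dd; ring

theorem twist_add (h μ : ℂ) : twist h (μ + 2 * Real.pi * I) = twist h μ := by
  unfold twist; rw [exp_periodic]

theorem differentiable_twist (h : ℂ) : Differentiable ℂ (twist h) := fun μ => by
  have : HasDerivAt (fun μ => -(h * exp μ / 2)) (-(h * exp μ / 2)) μ :=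
    (((Complex.hasDerivAt_exp μ).const_mul h).div_const 2).neg
  exact (hasDerivAt_expSigma3 this).differentiableAt

theorem norm_twist_sub_one_le (h μ : ℂ) :
    ‖twist h μ - 1‖ ≤ ‖h‖ * (Real.exp μ.re * Real.exp (‖h‖ * Real.exp μ.re)) := by
  have hz : ‖-(h * exp μ / 2)‖ = ‖h‖ * Real.exp μ.re / 2 := by
    rw [norm_neg, norm_div, norm_mul, norm_exp]; simp
  have hle : Real.exp (‖h‖ * Real.exp μ.re / 2) ≤ Real.exp (‖h‖ * Real.exp μ.re) :=
    Real.exp_le_exp.2 (half_le_self (by positivity))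
  have h0 : 0 ≤ ‖h‖ * Real.exp μ.re / 2 := by positivity
  have key : ∀ w : ℂ, ‖w‖ = ‖h‖ * Real.exp μ.re / 2 →
      ‖exp w - 1‖ ≤ ‖h‖ * Real.exp μ.re / 2 * Real.exp (‖h‖ * Real.exp μ.re) := fun w hw => by
    refine (norm_exp_sub_one_le_mul_exp w).trans ?_
    rw [hw]
    exact mul_le_mul_of_nonneg_left hle h0
  have h1 := key _ hz
  have h2 := key (-(-(h * exp μ / 2))) (by rw [norm_neg, hz])
  refine (norm_le_of_entries (b := ‖h‖ * Real.exp μ.re / 2 * Real.exp (‖h‖ * Real.exp μ.re))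
    fun i j => ?_).trans_eq (by ring)
  have h3 : 0 ≤ ‖h‖ * Real.exp μ.re / 2 * Real.exp (‖h‖ * Real.exp μ.re) := by positivity
  unfold twist expSigma3
  fin_cases i <;> fin_cases j
  · simpa using h1
  · simpa using h3
  · simpa using h3
  · simpa using h2

/-- `Ψ e^{d σ₃} (Ψ₀ e^{d₀ σ₃})⁻¹`, for functions of determinant one. -/
def quot (h : ℂ) (Ψ Ψ₀ : ℂ → Mat) (μ : ℂ) : Mat := Ψ μ * twist h μ * (Ψ₀ μ).adjugate

theorem quot_eq (Θ x h : ℂ) (Ψ Ψ₀ : ℂ → Mat) (μ : ℂ) :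
    quot h Ψ Ψ₀ μ = (Ψ μ * expSigma3 (dd Θ (x + h) μ)) * (Ψ₀ μ * expSigma3 (dd Θ x μ)).adjugate := by
  unfold quot twist
  rw [Matrix.adjugate_mul_distrib, adj_expSigma3, dd_add, add_comm, ← expSigma3_mul]
  calc _ = Ψ μ * expSigma3 (-(h * exp μ / 2)) * 1 * (Ψ₀ μ).adjugate := by rw [mul_one]
    _ = _ := by rw [← expSigma3_mul_neg (dd Θ x μ)]; simp only [mul_assoc]

theorem tendsto_quot {Θ x h : ℂ} {lo hi lo' hi' : ℝ} {Ψ Ψ₀ : ℂ → Mat} {a0 a1 b0 b1 : Mat}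
    (h1 : HalfAsymp Θ (x + h) lo hi Ψ a0 a1) (h2 : HalfAsymp Θ x lo hi Ψ₀ b0 b1)
    (hlo : lo < lo') (hhi : hi' < hi) :
    Tendsto (quot h Ψ Ψ₀) (stripAt lo' hi') (𝓝 (a0 * b0.adjugate)) := by
  have e1 := tendsto_of_expansion (h1.isBigO hlo hhi)
  have e2 := tendsto_of_expansion (h2.isBigO hlo hhi)
  have hc : Continuous fun A : Mat => A.adjugate := Continuous.matrix_adjugate continuous_id
  refine (e1.mul (hc.continuousAt.tendsto.comp e2)).congr fun μ => ?_
  rw [quot_eq Θ x]; rfl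

theorem adj_mul_self {A : Mat} (h : A.det = 1) : A.adjugate * A = 1 := by
  rw [Matrix.adjugate_mul, h, one_smul]

theorem mul_adj_self {A : Mat} (h : A.det = 1) : A * A.adjugate = 1 := by
  rw [Matrix.mul_adjugate, h, one_smul]

/-- Replacing both functions by their products with `U` multiplies the middle factor. -/
theorem quot_mul_right {h μ : ℂ} {A B U : Mat} (hB : B.det = 1) :
    (A * U) * twist h μ * (B * U).adjugate
      = (A * twist h μ * B.adjugate) * B * (expSigma3 (-(-(h * exp μ / 2))) * U * twist h μ * U.adjugate)
        * B.adjugate := by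
  rw [Matrix.adjugate_mul_distrib]
  calc _ = A * 1 * U * twist h μ * (U.adjugate * B.adjugate) := by rw [mul_one]
    _ = A * (twist h μ * 1 * expSigma3 (-(-(h * exp μ / 2)))) * U * twist h μ
          * (U.adjugate * B.adjugate) := by simp only [mul_one]; unfold twist; rw [expSigma3_mul_neg, mul_one]
    _ = _ := by rw [← adj_mul_self hB]; simp only [mul_assoc]

theorem conj_E12 (A : Mat) (d : ℂ) : A * !![0, 1; 0, 0] * A.adjugate
    = exp (-(2 * d)) • ((A * expSigma3 d) * !![0, 1; 0, 0] * (A * expSigma3 d).adjugate) := by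
  rw [Matrix.adjugate_mul_distrib, adj_expSigma3]
  have h : exp (-(2 * d)) • (expSigma3 d * !![0, 1; 0, 0] * expSigma3 (-d)) = !![0, 1; 0, 0] := by
    have e : exp (-(2 * d)) * (exp d * exp d) = 1 := by rw [← exp_add, ← exp_add]; ring_nf; simp
    ext i j
    fin_cases i <;> fin_cases j <;> simp [expSigma3, e]
  conv_lhs => rw [← h]
  simp only [mul_smul_comm, smul_mul_assoc, mul_assoc]

theorem conj_E21 (A : Mat) (d : ℂ) : A * !![0, 0; 1, 0] * A.adjugate
    = exp (2 * d) • ((A * expSigma3 d) * !![0, 0; 1, 0] * (A * expSigma3 d).adjugate) := by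
  rw [Matrix.adjugate_mul_distrib, adj_expSigma3]
  have h : exp (2 * d) • (expSigma3 d * !![0, 0; 1, 0] * expSigma3 (-d)) = !![0, 0; 1, 0] := by
    have e : exp (2 * d) * (exp (-d) * exp (-d)) = 1 := by
      rw [← exp_add, ← exp_add]; ring_nf; simp
    ext i j
    fin_cases i <;> fin_cases j <;> simp [expSigma3, e]
  conv_lhs => rw [← h]
  simp only [mul_smul_comm, smul_mul_assoc, mul_assoc]

/-- The Stokes matrices do not depend on x, so only the twist fails to commute with them. The jump
has a factor 1 - e^{h e^μ}, which is O(h), and the decaying exponential e^{-2d}. The last factor is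
written with B e^{dσ₃}, which is bounded. -/
theorem quot_jump_up (m : ℂ) {h μ d : ℂ} {A B : Mat} (hB : B.det = 1) :
    (A * VZeroUp m) * twist h μ * (B * VZeroUp m).adjugate - A * twist h μ * B.adjugate
      = (VInfUp m 0 1 * ((1 - exp (h * exp μ)) * exp (-(2 * d)))) •
        (A * twist h μ * B.adjugate * ((B * expSigma3 d) * !![0, 1; 0, 0]
          * (B * expSigma3 d).adjugate)) := by
  rw [quot_mul_right hB]
  have h1 : expSigma3 (-(-(h * exp μ / 2))) * VZeroUp m * twist h μ * (VZeroUp m).adjugate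
      = 1 + (VInfUp m 0 1 * (1 - exp (h * exp μ))) • !![0, 1; 0, 0] := by
    have h2 : VZeroUp m = !![1, -VInfUp m 0 1; 0, 1] := by simp [VZeroUp, VInfUp]
    have h3 : (VZeroUp m).adjugate = 1 + VInfUp m 0 1 • !![0, 1; 0, 0] := by
      rw [h2, adj_eq]; ext i j; fin_cases i <;> fin_cases j <;> simp
    rw [h3, h2]
    unfold twist
    rw [conj_upper, show -(2 * -(h * exp μ / 2)) = h * exp μ by ring]
    ext i j; fin_cases i <;> fin_cases j <;> simp [Matrix.mul_apply, Fin.sum_univ_two]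
    ring
  rw [h1, mul_add, add_mul, mul_one, mul_assoc _ B, mul_adj_self hB, mul_one, add_sub_cancel_left,
    mul_smul_comm, smul_mul_assoc, mul_assoc (_ * twist h μ * _), mul_assoc (_ * twist h μ * _),
    conj_E12 B d, mul_smul_comm, smul_smul, mul_assoc]

theorem quot_jump_low (n : ℤ) (m : ℂ) {h μ d : ℂ} {A B : Mat} (hB : B.det = 1) :
    (A * stokesLow n m) * twist h μ * (B * stokesLow n m).adjugate - A * twist h μ * B.adjugate
      = (stokesLow n m 1 0 * stokesLow n m 1 1 * ((exp (-(h * exp μ)) - 1) * exp (2 * d))) •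
        (A * twist h μ * B.adjugate * ((B * expSigma3 d) * !![0, 0; 1, 0]
          * (B * expSigma3 d).adjugate)) := by
  rw [quot_mul_right hB]
  have h1 : expSigma3 (-(-(h * exp μ / 2))) * stokesLow n m * twist h μ * (stokesLow n m).adjugate
      = 1 + (stokesLow n m 1 0 * stokesLow n m 1 1 * (exp (-(h * exp μ)) - 1)) • !![0, 0; 1, 0] := by
    have hdet := stokesLow_det n m
    set e := exp (-(h * exp μ / 2)) with he
    have e1 : exp (-(h * exp μ)) = e * e := by rw [he, ← exp_add]; ring_nf
    have e2 : exp (-(-(h * exp μ / 2))) * e = 1 := by rw [he, ← exp_add]; simp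
    unfold twist
    rw [stokesLow_eq, e1, adj_eq]
    unfold expSigma3
    rw [← he]
    ext i j; fin_cases i <;> fin_cases j <;> simp [Matrix.mul_apply, Fin.sum_univ_two] at e2 ⊢
    · linear_combination (stokesLow n m 0 0 * stokesLow n m 1 1) * e2 + hdet
    · linear_combination (-stokesLow n m 1 0 * stokesLow n m 1 1) * e2
    · linear_combination (stokesLow n m 0 0 * stokesLow n m 1 1) * e2 + hdet
  rw [h1, mul_add, add_mul, mul_one, mul_assoc _ B, mul_adj_self hB, mul_one, add_sub_cancel_left,
    mul_smul_comm, smul_mul_assoc, mul_assoc (_ * twist h μ * _), mul_assoc (_ * twist h μ * _),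
    conj_E21 B d, mul_smul_comm, smul_smul, mul_assoc (stokesLow n m 1 0 * stokesLow n m 1 1)]

theorem exists_bound_half {f : ℂ → Mat} (hf : Continuous f) {lo hi : ℝ}
    (h : f =O[stripAt lo hi] fun _ => (1 : ℂ)) :
    ∃ C > 0, ∀ μ : ℂ, 1 ≤ μ.re → μ.im ∈ Set.Icc lo hi → ‖f μ‖ ≤ C := by
  obtain ⟨C, hC⟩ := h.bound
  obtain ⟨A, hA⟩ := eventually_stripAt.1 hC
  obtain ⟨C', hC'⟩ := exists_bound_rect hf 1 A lo hi
  refine ⟨max 1 (max C C'), lt_max_of_lt_left one_pos, fun μ h1 h2 => ?_⟩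
  rcases le_total A μ.re with h3 | h3
  · exact (by simpa using hA μ h3 h2 : ‖f μ‖ ≤ C).trans ((le_max_left _ _).trans (le_max_right _ _))
  · exact (hC' μ ⟨h1, h3⟩ h2).trans ((le_max_right _ _).trans (le_max_right _ _))

/-- The constants in the comparison at one end of the cylinder. -/
theorem Asym.exists_end_bounds {n : ℤ} {m x : ℂ} {β : ℝ} {Ψ : ℂ → Mat} {b0 b1 : Mat} (hx : x ≠ 0)
    (hβ : |β + arg x| < 1 / 8) (hΨ : Asym n m x β Ψ b0 b1) (hdet : ∀ μ, (Ψ μ).det = 1) :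
    ∃ K > 0, ∀ (h : ℂ) (A : Mat) (μ : ℂ), ‖h‖ ≤ ‖x‖ / 4 → ‖h‖ ≤ 1 →
      (1 ≤ μ.re → |μ.im - (β + Real.pi)| ≤ 1 / 8 →
        ‖(A * VZeroUp m) * twist h μ * (Ψ μ * VZeroUp m).adjugate - A * twist h μ * (Ψ μ).adjugate‖
          ≤ K * ‖h‖ * ‖A * twist h μ * (Ψ μ).adjugate‖ * Real.exp (-(2 * μ.re))) ∧
      (1 ≤ μ.re → |μ.im - β| ≤ 1 / 8 →
        ‖(A * stokesLow n m) * twist h μ * (Ψ μ * stokesLow n m).adjugate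
          - A * twist h μ * (Ψ μ).adjugate‖
          ≤ K * ‖h‖ * ‖A * twist h μ * (Ψ μ).adjugate‖ * Real.exp (-(2 * μ.re))) ∧
      (μ.re ∈ Set.Icc 1 3 → μ.im ∈ Set.Icc (β - 1 / 8) (β + 2 * Real.pi + 1 / 8) →
        ‖A * twist h μ * (Ψ μ).adjugate - A * (Ψ μ).adjugate‖ ≤ K * ‖h‖ * ‖A * (Ψ μ).adjugate‖ ∧
        ‖(A * VZeroUp m) * twist h μ * (Ψ μ * VZeroUp m).adjugate - A * (Ψ μ).adjugate‖
          ≤ K * ‖h‖ * ‖A * (Ψ μ).adjugate‖) := by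
  have hpi := Real.pi_gt_three
  have hpi' := Real.pi_lt_d2
  obtain ⟨hβ1, hβ2⟩ := abs_lt.1 hβ
  have hθ1 := neg_pi_lt_arg x
  have hθ2 := arg_le_pi x
  set Θ := thetaInf n m with hΘ
  obtain ⟨C₁, hC₁, h₁⟩ := norm_exp_neg_two_dd_le Θ hx
  obtain ⟨C₂, hC₂, h₂⟩ := norm_exp_two_dd_le Θ hx
  have hY := isBigO_one_of_expansion (hΨ.asympP.isBigO (lo' := β - 1 / 8)
    (hi' := β + Real.pi + 1 / 8) (by linarith) (by linarith))
  have hYc : Continuous fun μ => Ψ μ * expSigma3 (dd Θ x μ) :=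
    hΨ.diff.continuous.matrix_mul (continuous_expSigma3.comp (continuous_dd Θ x))
  obtain ⟨Y, hYpos, hYb⟩ := exists_bound_half hYc hY
  obtain ⟨P, hP⟩ := exists_bound_rect hΨ.diff.continuous 1 3 (β - 1 / 8) (β + 2 * Real.pi + 1 / 8)
  obtain ⟨Q, hQ⟩ := exists_bound_rect (hΨ.diff.mul_const (VZeroUp m)).continuous 1 3 (β - 1 / 8)
    (β + 2 * Real.pi + 1 / 8)
  set E₁ : Mat := !![0, 1; 0, 0]
  set E₂ : Mat := !![0, 0; 1, 0]
  set K₁ := ‖VInfUp m 0 1‖ * C₁ * (Y * ‖E₁‖ * (2 * Y)) with hK₁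
  set K₂ := ‖stokesLow n m 1 0 * stokesLow n m 1 1‖ * C₂ * (Y * ‖E₂‖ * (2 * Y)) with hK₂
  set T := Real.exp 3 * Real.exp (Real.exp 3) with hT
  set K := 1 + K₁ + K₂ + |P| * T * (2 * |P|) + |Q| * T * (2 * |Q|) with hK
  have hK₁0 : 0 ≤ K₁ := by positivity
  have hK₂0 : 0 ≤ K₂ := by positivity
  have hT0 : 0 ≤ T := by positivity
  have hP0 : 0 ≤ |P| * T * (2 * |P|) := by positivity
  have hQ0 : 0 ≤ |Q| * T * (2 * |Q|) := by positivity
  -- The growth e^{|h|e^{Re μ}} is absorbed by the remaining decay e^{-(|x|/4)e^{Re μ}}, because |h|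
  -- ≤ |x|/4. Of e^{-3 Re μ} one power is spent on |z|.
  have hdecay : ∀ (h z e : ℂ) (μ : ℂ) (C : ℝ), 0 < C → ‖h‖ ≤ ‖x‖ / 4 → ‖z‖ = ‖h‖ * Real.exp μ.re →
      ‖e‖ ≤ C * Real.exp (-(3 * μ.re) - ‖x‖ / 4 * Real.exp μ.re) →
      ‖(exp z - 1) * e‖ ≤ C * ‖h‖ * Real.exp (-(2 * μ.re)) := by
    intro h z e μ C hC hh hz he
    rw [norm_mul]
    have h1 := norm_exp_sub_one_le_mul_exp z
    rw [hz] at h1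
    have h2 := mul_le_mul h1 he (norm_nonneg _) (by positivity)
    refine h2.trans ?_
    have h3 : Real.exp (‖h‖ * Real.exp μ.re) ≤ Real.exp (‖x‖ / 4 * Real.exp μ.re) :=
      Real.exp_le_exp.2 (mul_le_mul_of_nonneg_right hh (Real.exp_pos _).le)
    calc _ = C * ‖h‖ * (Real.exp μ.re * Real.exp (‖h‖ * Real.exp μ.re)
            * Real.exp (-(3 * μ.re) - ‖x‖ / 4 * Real.exp μ.re)) := by ring
      _ ≤ C * ‖h‖ * (Real.exp μ.re * Real.exp (‖x‖ / 4 * Real.exp μ.re)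
            * Real.exp (-(3 * μ.re) - ‖x‖ / 4 * Real.exp μ.re)) := by gcongr
      _ = _ := by
          rw [← Real.exp_add, ← Real.exp_add]; congr 2; ring
  have hconj : ∀ (E : Mat) (μ : ℂ), 1 ≤ μ.re → μ.im ∈ Set.Icc (β - 1 / 8) (β + Real.pi + 1 / 8) →
      ‖(Ψ μ * expSigma3 (dd Θ x μ)) * E * (Ψ μ * expSigma3 (dd Θ x μ)).adjugate‖
        ≤ Y * ‖E‖ * (2 * Y) := by
    intro E μ h1 h2
    have h3 := hYb μ h1 h2
    refine (norm_mul_le _ _).trans (mul_le_mul ((norm_mul_le _ _).trans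
      (mul_le_mul_of_nonneg_right h3 (norm_nonneg _))) ((norm_adj_le _).trans (by linarith))
      (norm_nonneg _) (by positivity))
  refine ⟨K, by linarith, fun h A μ hh hh1 => ⟨fun h1 h2 => ?_, fun h1 h2 => ?_, fun h1 h2 => ?_⟩⟩
  · obtain ⟨h3, h4⟩ := abs_le.1 h2
    rw [quot_jump_up m (d := dd Θ x μ) (hdet μ), norm_smul, norm_mul]
    have e1 := hdecay h (h * exp μ) (exp (-(2 * dd Θ x μ))) μ C₁ hC₁ hh (by rw [norm_mul, norm_exp])
      (h₁ μ (by linarith) (abs_le.2 ⟨by linarith, by linarith⟩)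
        (cos_le_neg_half (abs_le.2 ⟨by linarith, by linarith⟩)))
    rw [← norm_neg, ← neg_mul, neg_sub] at e1
    have e2 := hconj E₁ μ h1 ⟨by linarith, by linarith⟩
    have e3 := mul_le_mul (mul_le_mul_of_nonneg_left e1 (norm_nonneg (VInfUp m 0 1)))
      ((norm_mul_le (A * twist h μ * (Ψ μ).adjugate) _).trans
        (mul_le_mul_of_nonneg_left e2 (norm_nonneg _))) (norm_nonneg _) (by positivity)
    refine e3.trans ?_
    have : K₁ ≤ K := by rw [hK]; linarith
    calc _ = K₁ * (‖h‖ * ‖A * twist h μ * (Ψ μ).adjugate‖ * Real.exp (-(2 * μ.re))) := by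
            rw [hK₁]; ring
      _ ≤ K * (‖h‖ * ‖A * twist h μ * (Ψ μ).adjugate‖ * Real.exp (-(2 * μ.re))) := by gcongr
      _ = _ := by ring
  · obtain ⟨h3, h4⟩ := abs_le.1 h2
    rw [quot_jump_low n m (d := dd Θ x μ) (hdet μ), norm_smul, norm_mul]
    have e1 := hdecay h (-(h * exp μ)) (exp (2 * dd Θ x μ)) μ C₂ hC₂ hh
      (by rw [norm_neg, norm_mul, norm_exp])
      (h₂ μ (by linarith) (abs_le.2 ⟨by linarith, by linarith⟩)
        (half_le_cos (abs_le.2 ⟨by linarith, by linarith⟩)))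
    have e2 := hconj E₂ μ h1 ⟨by linarith, by linarith⟩
    have e3 := mul_le_mul (mul_le_mul_of_nonneg_left e1
      (norm_nonneg (stokesLow n m 1 0 * stokesLow n m 1 1)))
      ((norm_mul_le (A * twist h μ * (Ψ μ).adjugate) _).trans
        (mul_le_mul_of_nonneg_left e2 (norm_nonneg _))) (norm_nonneg _) (by positivity)
    refine e3.trans ?_
    have : K₂ ≤ K := by rw [hK]; linarith
    calc _ = K₂ * (‖h‖ * ‖A * twist h μ * (Ψ μ).adjugate‖ * Real.exp (-(2 * μ.re))) := by
            rw [hK₂]; ring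
      _ ≤ K * (‖h‖ * ‖A * twist h μ * (Ψ μ).adjugate‖ * Real.exp (-(2 * μ.re))) := by gcongr
      _ = _ := by ring
  · have ht : ‖twist h μ - 1‖ ≤ ‖h‖ * T := by
      refine (norm_twist_sub_one_le h μ).trans ?_
      have h3 : Real.exp μ.re ≤ Real.exp 3 := Real.exp_le_exp.2 h1.2
      have h4 : ‖h‖ * Real.exp μ.re ≤ Real.exp 3 := by
        have := mul_le_mul hh1 h3 (Real.exp_pos _).le zero_le_one
        linarith
      have h5 := Real.exp_le_exp.2 h4
      rw [hT]; gcongr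
    have hgen : ∀ (B G : Mat) (r : ℝ), B.det = 1 → ‖B‖ ≤ r →
        ‖G * twist h μ * B.adjugate - G * B.adjugate‖ ≤ |r| * T * (2 * |r|) * ‖h‖ * ‖G * B.adjugate‖ := by
      intro B G r hB hr
      have e : G * twist h μ * B.adjugate - G * B.adjugate
          = G * B.adjugate * (B * (twist h μ - 1) * B.adjugate) := by
        calc _ = G * 1 * (twist h μ - 1) * B.adjugate := by rw [mul_one]; noncomm_ring
          _ = _ := by rw [← adj_mul_self hB]; simp only [mul_assoc]
      have hr' := hr.trans (le_abs_self r)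
      rw [e]
      refine (norm_mul_le _ _).trans ?_
      have e2 : ‖B * (twist h μ - 1) * B.adjugate‖ ≤ |r| * (‖h‖ * T) * (2 * |r|) :=
        (norm_mul_le _ _).trans (mul_le_mul ((norm_mul_le _ _).trans
          (mul_le_mul hr' ht (norm_nonneg _) (abs_nonneg _))) ((norm_adj_le _).trans (by linarith))
          (norm_nonneg _) (by positivity))
      refine (mul_le_mul_of_nonneg_left e2 (norm_nonneg _)).trans_eq (by ring)
    constructor
    · refine (hgen _ A P (hdet μ) (hP μ h1 h2)).trans ?_
      have : |P| * T * (2 * |P|) ≤ K := by rw [hK]; linarith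
      gcongr
    · have h3 : A * (Ψ μ).adjugate = A * VZeroUp m * (Ψ μ * VZeroUp m).adjugate := by
        rw [Matrix.adjugate_mul_distrib, mul_assoc, ← mul_assoc (VZeroUp m),
          mul_adj_self (det_VZeroUp m), one_mul]
      rw [h3]
      refine (hgen _ (A * VZeroUp m) Q (by rw [Matrix.det_mul, hdet, det_VZeroUp, one_mul])
        (hQ μ h1 h2)).trans ?_
      have : |Q| * T * (2 * |Q|) ≤ K := by rw [hK]; linarith
      gcongr

end

/-! ### Matrix-valued estimates and the self-improving bound. -/

section

open scoped Matrix.Norms.Operator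

/-- `SmallJump` for matrix-valued functions. -/
structure SmallJumpMat (β δ : ℝ) (c : Mat) (sP sN : ℂ → Mat) : Prop where
  dP : Differentiable ℂ sP
  dN : Differentiable ℂ sN
  up : ∀ μ : ℂ, 1 ≤ μ.re → |μ.im - (β + Real.pi)| ≤ 1 / 8 →
    ‖sP μ - sN μ‖ ≤ δ * Real.exp (-(2 * μ.re))
  low : ∀ μ : ℂ, 1 ≤ μ.re → |μ.im - β| ≤ 1 / 8 →
    ‖sP μ - sN (μ + 2 * Real.pi * I)‖ ≤ δ * Real.exp (-(2 * μ.re))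
  limP : Tendsto sP (stripAt (β - 1 / 8) (β + Real.pi + 1 / 8)) (𝓝 c)
  limN : Tendsto sN (stripAt (β + Real.pi - 1 / 8) (β + 2 * Real.pi + 1 / 8)) (𝓝 c)

theorem tendsto_entry {α : Type*} {l : Filter α} {f : α → Mat} {c : Mat} (h : Tendsto f l (𝓝 c))
    (i j : Fin 2) : Tendsto (fun z => f z i j) l (𝓝 (c i j)) :=
  ((continuous_id.matrix_elem i j : Continuous fun A : Mat => A i j).tendsto c).comp h

theorem SmallJumpMat.entry {β δ : ℝ} {c : Mat} {sP sN : ℂ → Mat} (h : SmallJumpMat β δ c sP sN)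
    (i j : Fin 2) : SmallJump β δ (c i j) (fun μ => sP μ i j) (fun μ => sN μ i j) where
  dP := differentiable_mat.1 h.dP i j
  dN := differentiable_mat.1 h.dN i j
  up μ h1 h2 := (norm_entry_le (sP μ - sN μ) i j).trans (h.up μ h1 h2)
  low μ h1 h2 := (norm_entry_le (sP μ - sN (μ + 2 * Real.pi * I)) i j).trans (h.low μ h1 h2)
  limP := tendsto_entry h.limP i j
  limN := tendsto_entry h.limN i j

theorem cylinder_estimate_mat {β δ : ℝ} {c c₀ : Mat} {r sP sN tP tN : ℂ → Mat}
    (hr : Differentiable ℂ r) (hper : ∀ μ, r (μ + 2 * Real.pi * I) = r μ)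
    (hs : SmallJumpMat β δ c sP sN) (ht : SmallJumpMat β δ c₀ tP tN)
    (hsP : ∀ μ : ℂ, μ.re ∈ Set.Icc 1 3 → μ.im ∈ Set.Icc (β - 1 / 8) (β + Real.pi + 1 / 8) →
      ‖sP μ - r μ‖ ≤ δ)
    (hsN : ∀ μ : ℂ, μ.re ∈ Set.Icc 1 3 →
      μ.im ∈ Set.Icc (β + Real.pi - 1 / 8) (β + 2 * Real.pi + 1 / 8) → ‖sN μ - r μ‖ ≤ δ)
    (htP : ∀ μ : ℂ, μ.re ∈ Set.Icc 1 3 → μ.im ∈ Set.Icc (β - 1 / 8) (β + Real.pi + 1 / 8) →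
      ‖tP μ - r (-μ)‖ ≤ δ)
    (htN : ∀ μ : ℂ, μ.re ∈ Set.Icc 1 3 →
      μ.im ∈ Set.Icc (β + Real.pi - 1 / 8) (β + 2 * Real.pi + 1 / 8) → ‖tN μ - r (-μ)‖ ≤ δ) :
    (∀ l : ℂ, |l.re| ≤ 2 → ‖r l - c‖ ≤ 800 * δ) ∧
    (∀ l : ℂ, 2 ≤ l.re → l.im ∈ Set.Icc β (β + Real.pi) →
      ‖sP l - c‖ ≤ 800 * δ * Real.exp (-l.re)) ∧
    (∀ l : ℂ, 2 ≤ l.re → l.im ∈ Set.Icc (β + Real.pi) (β + 2 * Real.pi) →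
      ‖sN l - c‖ ≤ 800 * δ * Real.exp (-l.re)) ∧
    (∀ l : ℂ, 2 ≤ l.re → l.im ∈ Set.Icc β (β + Real.pi) → ‖tP l - c‖ ≤ 800 * δ) ∧
    (∀ l : ℂ, 2 ≤ l.re → l.im ∈ Set.Icc (β + Real.pi) (β + 2 * Real.pi) →
      ‖tN l - c‖ ≤ 800 * δ) := by
  have key := fun i j => cylinder_estimate (r := fun μ => r μ i j) (differentiable_mat.1 hr i j)
    (fun μ => by rw [hper]) (hs.entry i j) (ht.entry i j)
    (fun μ h1 h2 => (norm_entry_le (sP μ - r μ) i j).trans (hsP μ h1 h2))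
    (fun μ h1 h2 => (norm_entry_le (sN μ - r μ) i j).trans (hsN μ h1 h2))
    (fun μ h1 h2 => (norm_entry_le (tP μ - r (-μ)) i j).trans (htP μ h1 h2))
    (fun μ h1 h2 => (norm_entry_le (tN μ - r (-μ)) i j).trans (htN μ h1 h2))
  refine ⟨fun l h1 => ?_, fun l h1 h2 => ?_, fun l h1 h2 => ?_, fun l h1 h2 => ?_,
    fun l h1 h2 => ?_⟩
  · exact (norm_le_of_entries fun i j => (key i j).1 l h1).trans_eq (by ring)
  · exact (norm_le_of_entries fun i j => (key i j).2.1 l h1 h2).trans_eq (by ring)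
  · exact (norm_le_of_entries fun i j => (key i j).2.2.1 l h1 h2).trans_eq (by ring)
  · exact (norm_le_of_entries fun i j => (key i j).2.2.2.1 l h1 h2).trans_eq (by ring)
  · exact (norm_le_of_entries fun i j => (key i j).2.2.2.2 l h1 h2).trans_eq (by ring)

/-- The quotients of two solutions at one end of the cylinder. -/
structure EndData (β ε : ℝ) (c : Mat) (r sP sN : ℂ → Mat) : Prop where
  dP : Differentiable ℂ sP
  dN : Differentiable ℂ sN
  up : ∀ μ : ℂ, 1 ≤ μ.re → |μ.im - (β + Real.pi)| ≤ 1 / 8 →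
    ‖sP μ - sN μ‖ ≤ ε * ‖sP μ‖ * Real.exp (-(2 * μ.re))
  low : ∀ μ : ℂ, 1 ≤ μ.re → |μ.im - β| ≤ 1 / 8 →
    ‖sP μ - sN (μ + 2 * Real.pi * I)‖ ≤ ε * ‖sP μ‖ * Real.exp (-(2 * μ.re))
  midP : ∀ μ : ℂ, μ.re ∈ Set.Icc 1 3 → μ.im ∈ Set.Icc (β - 1 / 8) (β + 2 * Real.pi + 1 / 8) →
    ‖sP μ - r μ‖ ≤ ε * ‖r μ‖
  midN : ∀ μ : ℂ, μ.re ∈ Set.Icc 1 3 → μ.im ∈ Set.Icc (β - 1 / 8) (β + 2 * Real.pi + 1 / 8) →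
    ‖sN μ - r μ‖ ≤ ε * ‖r μ‖
  limP : Tendsto sP (stripAt (β - 1 / 8) (β + Real.pi + 1 / 8)) (𝓝 c)
  limN : Tendsto sN (stripAt (β + Real.pi - 1 / 8) (β + 2 * Real.pi + 1 / 8)) (𝓝 c)

/-- A bound for the quotient in the half-strip `P` and in the middle of the cylinder. -/
def EndBound (β : ℝ) (r sP : ℂ → Mat) (N : ℝ) : Prop :=
  (∀ μ : ℂ, 1 ≤ μ.re → μ.im ∈ Set.Icc (β - 1 / 8) (β + Real.pi + 1 / 8) → ‖sP μ‖ ≤ N) ∧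
  ∀ μ : ℂ, μ.re ∈ Set.Icc 1 3 → ‖r μ‖ ≤ N

theorem EndData.exists_bound {β ε : ℝ} {c : Mat} {r sP sN : ℂ → Mat} (h : EndData β ε c r sP sN)
    (hr : Differentiable ℂ r) (hper : ∀ μ, r (μ + 2 * Real.pi * I) = r μ) :
    ∃ N, EndBound β r sP N := by
  obtain ⟨C, -, hC⟩ := exists_bound_half h.dP.continuous (h.limP.isBigO_one ℂ)
  obtain ⟨C', hC'⟩ := exists_bound_rect hr.continuous 1 3 β (β + 2 * Real.pi)
  exact ⟨max C C', fun μ h1 h2 => (hC μ h1 h2).trans (le_max_left _ _),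
    fun μ h1 => (periodic_bound hper hC' μ h1).trans (le_max_right _ _)⟩

theorem EndBound.mono {β N N' : ℝ} {r sP : ℂ → Mat} (h : EndBound β r sP N) (hN : N ≤ N') :
    EndBound β r sP N' :=
  ⟨fun μ h1 h2 => (h.1 μ h1 h2).trans hN, fun μ h1 => (h.2 μ h1).trans hN⟩

theorem EndBound.nonneg {β N : ℝ} {r sP : ℂ → Mat} (h : EndBound β r sP N) : 0 ≤ N :=
  (norm_nonneg _).trans (h.2 1 (by simp))

theorem EndData.smallJump {β ε N : ℝ} {c : Mat} {r sP sN : ℂ → Mat} (h : EndData β ε c r sP sN)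
    (hε : 0 ≤ ε) (hN : EndBound β r sP N) :
    SmallJumpMat β (ε * N) c sP sN ∧
    (∀ μ : ℂ, μ.re ∈ Set.Icc 1 3 → μ.im ∈ Set.Icc (β - 1 / 8) (β + Real.pi + 1 / 8) →
      ‖sP μ - r μ‖ ≤ ε * N) ∧
    (∀ μ : ℂ, μ.re ∈ Set.Icc 1 3 →
      μ.im ∈ Set.Icc (β + Real.pi - 1 / 8) (β + 2 * Real.pi + 1 / 8) → ‖sN μ - r μ‖ ≤ ε * N) := by
  have hpi := Real.pi_gt_three
  refine ⟨⟨h.dP, h.dN, fun μ h1 h2 => ?_, fun μ h1 h2 => ?_, h.limP, h.limN⟩, fun μ h1 h2 => ?_,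
    fun μ h1 h2 => ?_⟩
  · obtain ⟨h3, h4⟩ := abs_le.1 h2
    have := hN.1 μ h1 ⟨by linarith, by linarith⟩
    exact (h.up μ h1 h2).trans (by gcongr)
  · obtain ⟨h3, h4⟩ := abs_le.1 h2
    have := hN.1 μ h1 ⟨by linarith, by linarith⟩
    exact (h.low μ h1 h2).trans (by gcongr)
  · exact (h.midP μ h1 ⟨h2.1, by linarith [h2.2]⟩).trans (mul_le_mul_of_nonneg_left (hN.2 μ h1) hε)
  · exact (h.midN μ h1 ⟨by linarith [h2.1], h2.2⟩).trans
      (mul_le_mul_of_nonneg_left (hN.2 μ h1) hε)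

/-- The improved bound that follows from the comparison estimates. -/
theorem EndData.improve {β ε N : ℝ} {c : Mat} {r sP sN : ℂ → Mat} (h : EndData β ε c r sP sN)
    (hε : 0 ≤ ε) (hper : ∀ μ, r (μ + 2 * Real.pi * I) = r μ) (hN : EndBound β r sP N)
    (h1 : ∀ l : ℂ, 1 ≤ l.re → l.re ≤ 2 → ‖r l - 1‖ ≤ 800 * (ε * N))
    (h2 : ∀ l : ℂ, 2 ≤ l.re → l.im ∈ Set.Icc β (β + Real.pi) → ‖sP l - 1‖ ≤ 800 * (ε * N))
    (h3 : ∀ l : ℂ, 2 ≤ l.re → l.im ∈ Set.Icc (β + Real.pi) (β + 2 * Real.pi) →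
      ‖sN l - 1‖ ≤ 800 * (ε * N)) : EndBound β r sP (1 + 801 * (ε * N)) := by
  have hpi := Real.pi_gt_three
  obtain ⟨hj, hmP, hmN⟩ := h.smallJump hε hN
  have hδ : 0 ≤ ε * N := mul_nonneg hε hN.nonneg
  have tri : ∀ {A B : Mat} {a : ℝ}, ‖B - 1‖ ≤ 800 * (ε * N) → ‖A - B‖ ≤ a → ‖A‖ ≤ 1 + 800 * (ε * N) + a := by
    intro A B a hB hA
    have e : A = 1 + (B - 1) + (A - B) := by abel
    rw [e]
    refine (norm_add_le _ _).trans (add_le_add ((norm_add_le _ _).trans (add_le_add ?_ hB)) hA)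
    rw [norm_one]
  have h0 : ∀ B : Mat, ‖B - B‖ ≤ ε * N := fun B => by rw [sub_self, norm_zero]; exact hδ
  have hexp : ∀ μ : ℂ, 1 ≤ μ.re → ε * N * Real.exp (-(2 * μ.re)) ≤ ε * N := fun μ h =>
    mul_le_of_le_one_right hδ (Real.exp_le_one_iff.2 (by linarith))
  constructor
  · intro μ h4 h5
    suffices h6 : ‖sP μ‖ ≤ 1 + 800 * (ε * N) + ε * N by linarith
    rcases le_or_gt μ.re 2 with h6 | h6
    · exact tri (h1 μ h4 h6) (hmP μ ⟨h4, by linarith⟩ h5)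
    · rcases lt_or_ge μ.im β with h7 | h7
      · refine tri (h3 (μ + 2 * Real.pi * I) (by simpa using h6.le) ?_) ((hj.low μ h4 ?_).trans (hexp μ h4))
        · simp; constructor <;> linarith [h5.1]
        · exact abs_le.2 ⟨by linarith [h5.1], by linarith⟩
      · rcases le_or_gt μ.im (β + Real.pi) with h8 | h8
        · exact tri (h2 μ h6.le ⟨h7, h8⟩) (h0 _)
        · refine tri (h3 μ h6.le ⟨h8.le, by linarith [h5.2]⟩) ((hj.up μ h4 ?_).trans (hexp μ h4))
          exact abs_le.2 ⟨by linarith, by linarith [h5.2]⟩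
  · refine fun μ h4 => periodic_bound hper (s := Set.Icc 1 3) (lo := β) (fun ν h5 h6 => ?_) μ h4
    suffices h7 : ‖r ν‖ ≤ 1 + 800 * (ε * N) + ε * N by linarith
    rcases le_or_gt ν.re 2 with h7 | h7
    · exact tri (h1 ν h5.1 h7) (h0 _)
    · rcases le_or_gt ν.im (β + Real.pi) with h8 | h8
      · refine tri (h2 ν h7.le ⟨h6.1, h8⟩) ?_
        rw [norm_sub_rev]
        exact hmP ν h5 ⟨by linarith [h6.1], by linarith⟩
      · refine tri (h3 ν h7.le ⟨h8.le, h6.2⟩) ?_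
        rw [norm_sub_rev]
        exact hmN ν h5 ⟨by linarith, by linarith [h6.2]⟩

/-- A bound that improves itself. -/
theorem bound_of_self_improving {P : ℝ → Prop} (hne : ∃ N, P N) (h0 : ∀ N, P N → 0 ≤ N)
    (hmono : ∀ N N', P N → N ≤ N' → P N')
    (hinf : ∀ s : Set ℝ, s.Nonempty → (∀ N ∈ s, P N) → P (sInf s)) (himp : ∀ N, P N → P (1 + N / 2)) :
    P 2 := by
  have hs : P (sInf {N | P N}) := hinf _ hne fun N h => h
  -- The infimum of the admissible bounds is itself admissible, so the improvement cannot go below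
  -- it.
  have h1 : sInf {N | P N} ≤ 1 + sInf {N | P N} / 2 := csInf_le ⟨0, fun N h => h0 N h⟩ (himp _ hs)
  exact hmono _ _ hs (by linarith)

theorem EndBound.sInf {β : ℝ} {r sP : ℂ → Mat} {s : Set ℝ} (hne : s.Nonempty)
    (h : ∀ N ∈ s, EndBound β r sP N) : EndBound β r sP (sInf s) :=
  ⟨fun μ h1 h2 => le_csInf hne fun N hN => (h N hN).1 μ h1 h2,
    fun μ h1 => le_csInf hne fun N hN => (h N hN).2 μ h1⟩

/-- The jumps are ε times the unknown size of the quotients, so no smallness is available a priori.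
A common bound N exists, however, and `cylinder_estimate_mat` with δ = εN replaces it by 1 + 801εN ≤
1 + N/2. Hence N = 2 is admissible. The limit c at the other end is arbitrary. -/
theorem EndData.estimates {β ε : ℝ} {c : Mat} {r sP sN tP tN : ℂ → Mat}
    (hs : EndData β ε 1 r sP sN) (ht : EndData β ε c (fun μ => r (-μ)) tP tN)
    (hr : Differentiable ℂ r) (hper : ∀ μ, r (μ + 2 * Real.pi * I) = r μ) (hε : 0 ≤ ε)
    (hε1 : 1602 * ε ≤ 1) :
    (∀ l : ℂ, |l.re| ≤ 2 → ‖r l - 1‖ ≤ 1600 * ε) ∧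
    (∀ l : ℂ, 2 ≤ l.re → l.im ∈ Set.Icc β (β + Real.pi) →
      ‖sP l - 1‖ ≤ 1600 * ε * Real.exp (-l.re)) ∧
    (∀ l : ℂ, 2 ≤ l.re → l.im ∈ Set.Icc (β + Real.pi) (β + 2 * Real.pi) →
      ‖sN l - 1‖ ≤ 1600 * ε * Real.exp (-l.re)) ∧
    (∀ l : ℂ, 2 ≤ l.re → l.im ∈ Set.Icc β (β + Real.pi) → ‖tP l - 1‖ ≤ 1600 * ε) ∧
    (∀ l : ℂ, 2 ≤ l.re → l.im ∈ Set.Icc (β + Real.pi) (β + 2 * Real.pi) →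
      ‖tN l - 1‖ ≤ 1600 * ε) := by
  have hr' : Differentiable ℂ fun μ => r (-μ) := hr.comp differentiable_neg
  have hper' : ∀ μ, r (-(μ + 2 * Real.pi * I)) = r (-μ) := fun μ => by
    rw [← hper (-(μ + 2 * Real.pi * I))]; ring_nf
  have key : ∀ N, EndBound β r sP N → EndBound β (fun μ => r (-μ)) tP N → _ := fun N h1 h2 =>
    cylinder_estimate_mat hr hper (hs.smallJump hε h1).1 (ht.smallJump hε h2).1
      (hs.smallJump hε h1).2.1 (hs.smallJump hε h1).2.2 (ht.smallJump hε h2).2.1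
      (ht.smallJump hε h2).2.2
  have h2 : EndBound β r sP 2 ∧ EndBound β (fun μ => r (-μ)) tP 2 := by
    refine bound_of_self_improving
      (P := fun N => EndBound β r sP N ∧ EndBound β (fun μ => r (-μ)) tP N) ?_ (fun N h => h.1.nonneg)
      (fun N N' h hN => ⟨h.1.mono hN, h.2.mono hN⟩)
      (fun s hne h => ⟨EndBound.sInf hne fun N hN => (h N hN).1,
        EndBound.sInf hne fun N hN => (h N hN).2⟩) ?_
    · obtain ⟨N, hN⟩ := hs.exists_bound hr hper
      obtain ⟨N', hN'⟩ := ht.exists_bound hr' hper'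
      exact ⟨max N N', hN.mono (le_max_left _ _), hN'.mono (le_max_right _ _)⟩
    · rintro N ⟨h1, h2⟩
      obtain ⟨k1, k2, k3, k4, k5⟩ := key N h1 h2
      have hN := h1.nonneg
      have hδ : 0 ≤ 800 * (ε * N) := by positivity
      have hle : 1 + 801 * (ε * N) ≤ 1 + N / 2 := by nlinarith
      have hexp : ∀ l : ℂ, 2 ≤ l.re → 800 * (ε * N) * Real.exp (-l.re) ≤ 800 * (ε * N) :=
        fun l hl => mul_le_of_le_one_right hδ (Real.exp_le_one_iff.2 (by linarith))
      constructor
      · exact (hs.improve hε hper h1 (fun l a b => k1 l (abs_le.2 ⟨by linarith, b⟩))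
          (fun l a b => (k2 l a b).trans (hexp l a))
          (fun l a b => (k3 l a b).trans (hexp l a))).mono hle
      · exact (ht.improve hε hper' h2
          (fun l a b => k1 (-l) (by rw [neg_re, abs_neg]; exact abs_le.2 ⟨by linarith, b⟩))
          k4 k5).mono hle
  obtain ⟨k1, k2, k3, k4, k5⟩ := key 2 h2.1 h2.2
  have e : 800 * (ε * 2) = 1600 * ε := by ring
  rw [e] at k1 k2 k3 k4 k5
  exact ⟨k1, k2, k3, k4, k5⟩

theorem mul_adj_mul_right {A B U : Mat} (hU : U.det = 1) :
    (A * U) * (B * U).adjugate = A * B.adjugate := by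
  rw [Matrix.adjugate_mul_distrib, mul_assoc, ← mul_assoc U, mul_adj_self hU, one_mul]

/-- The quotients of two solutions at nearby values of `x`. -/
theorem Asym.exists_endData {n : ℤ} {m x : ℂ} {β : ℝ} {Ψ : ℂ → Mat} {b0 b1 : Mat} (hx : x ≠ 0)
    (hβ : |β + arg x| < 1 / 8) (hΨ : Asym n m x β Ψ b0 b1) (hdet : ∀ μ, (Ψ μ).det = 1) :
    ∃ K > 0, ∀ (h : ℂ) (Φ : ℂ → Mat) (a0 a1 : Mat), ‖h‖ ≤ ‖x‖ / 4 → ‖h‖ ≤ 1 →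
      Asym n m (x + h) β Φ a0 a1 →
      EndData β (K * ‖h‖) (a0 * b0.adjugate) (fun μ => Φ μ * (Ψ μ).adjugate) (quot h Φ Ψ)
        (quot h (fun μ => Φ μ * VZeroUp m) (fun μ => Ψ μ * VZeroUp m)) := by
  obtain ⟨K, hK, hb⟩ := hΨ.exists_end_bounds hx hβ hdet
  refine ⟨K, hK, fun h Φ a0 a1 h1 h2 hΦ => ?_⟩
  have hd : ∀ {f g : ℂ → Mat}, Differentiable ℂ f → Differentiable ℂ g →
      Differentiable ℂ (quot h f g) := fun hf hg =>
    (hf.mul (differentiable_twist h)).mul (differentiable_adj hg)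
  refine ⟨hd hΦ.diff hΨ.diff, hd (hΦ.diff.mul_const _) (hΨ.diff.mul_const _), fun μ h3 h4 => ?_,
    fun μ h3 h4 => ?_, fun μ h3 h4 => ((hb h (Φ μ) μ h1 h2).2.2 h3 h4).1,
    fun μ h3 h4 => ((hb h (Φ μ) μ h1 h2).2.2 h3 h4).2,
    tendsto_quot hΦ.asympP hΨ.asympP (by linarith) (by linarith),
    tendsto_quot hΦ.asympN hΨ.asympN (by linarith) (by linarith)⟩
  · rw [norm_sub_rev]
    exact (hb h (Φ μ) μ h1 h2).1 h3 h4
  · rw [norm_sub_rev]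
    have := (hb h (Φ μ) μ h1 h2).2.1 h3 h4
    simp only [quot]
    -- After a full turn the second strip meets the first, and the monodromy matrix combined with
    -- the Stokes matrix is the triangular jump `stokesLow`.
    rw [twist_add, hΦ.per, hΨ.per, mul_assoc (Φ μ), mul_assoc (Ψ μ), monod_mul_VZeroUp]
    exact this

end

section

open scoped Matrix.Norms.Operator

/-! ### Differentiability in `x` -/

theorem norm_exp_sub_one_sub_le (z : ℂ) : ‖exp z - 1 - z‖ ≤ ‖z‖ ^ 2 * Real.exp ‖z‖ := by
  have := Complex.norm_exp_sub_sum_le_norm_mul_exp z 2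
  simpa [Finset.sum_range_succ, sub_sub] using this

theorem norm_twist_neg_sub_le {h : ℂ} (hh : ‖h‖ ≤ 1) (μ : ℂ) :
    ‖twist (-h) μ - 1 - (h * exp μ / 2) • sigma3‖
      ≤ ‖h‖ ^ 2 * (2 * (Real.exp μ.re ^ 2 * Real.exp (Real.exp μ.re))) := by
  have hz : ‖h * exp μ / 2‖ = ‖h‖ * Real.exp μ.re / 2 := by
    rw [norm_div, norm_mul, norm_exp]; simp
  have key : ∀ w : ℂ, ‖w‖ = ‖h‖ * Real.exp μ.re / 2 →
      ‖exp w - 1 - w‖ ≤ ‖h‖ ^ 2 * (Real.exp μ.re ^ 2 * Real.exp (Real.exp μ.re)) := fun w hw => by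
    refine (norm_exp_sub_one_sub_le w).trans ?_
    have h1 : ‖w‖ ≤ ‖h‖ * Real.exp μ.re := by
      rw [hw]; exact half_le_self (by positivity)
    have h2 : ‖h‖ * Real.exp μ.re ≤ Real.exp μ.re := mul_le_of_le_one_left (Real.exp_pos _).le hh
    calc ‖w‖ ^ 2 * Real.exp ‖w‖ ≤ (‖h‖ * Real.exp μ.re) ^ 2 * Real.exp (Real.exp μ.re) := by
          have := Real.exp_le_exp.2 (h1.trans h2)
          gcongr
      _ = _ := by ring
  have h1 := key _ hz
  have h2 := key (-(h * exp μ / 2)) (by rw [norm_neg, hz])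
  have h3 : 0 ≤ ‖h‖ ^ 2 * (Real.exp μ.re ^ 2 * Real.exp (Real.exp μ.re)) := by positivity
  refine (norm_le_of_entries (b := ‖h‖ ^ 2 * (Real.exp μ.re ^ 2 * Real.exp (Real.exp μ.re)))
    fun i j => ?_).trans_eq (by ring)
  unfold twist expSigma3 sigma3
  fin_cases i <;> fin_cases j
  · simpa [neg_div, sub_eq_add_neg] using h1
  · simpa using h3
  · simpa using h3
  · simpa [neg_div, sub_eq_add_neg] using h2

theorem twist_mul_twist_neg (h μ : ℂ) : twist h μ * twist (-h) μ = 1 := by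
  unfold twist
  rw [expSigma3_mul, ← expSigma3_zero]; congr 1; ring

/-- From the quotient in a half-strip to the quotient proper. -/
theorem HalfAsymp.exists_first_order {Θ x : ℂ} {lo hi lo' hi' : ℝ} {Ψ : ℂ → Mat} {b0 b1 : Mat}
    (hΨ : HalfAsymp Θ x lo hi Ψ b0 b1) (hd : Differentiable ℂ Ψ) (hdet : ∀ μ, (Ψ μ).det = 1)
    (hlo : lo < lo') (hhi : hi' < hi) :
    ∃ C A : ℝ, ∀ ρ ≥ A, ∃ D ≥ 0, ∀ (h : ℂ) (κ : ℝ) (Φ : ℂ → Mat) (μ : ℂ), ‖h‖ ≤ 1 → μ.re = ρ →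
      μ.im ∈ Set.Icc lo' hi' → ‖quot h Φ Ψ μ - 1‖ ≤ κ * ‖h‖ →
      ‖Φ μ * (Ψ μ).adjugate - 1 - h • ((exp μ / 2) • (b0 * sigma3 * b0.adjugate)
        + (I / 2) • (b1 * sigma3 * b0.adjugate + b0 * sigma3 * b1.adjugate))‖
        ≤ ‖h‖ * (C * Real.exp (-ρ) + κ + (κ + 1) * D * ‖h‖) := by
  set K := b0 * sigma3 * b0.adjugate
  set N := b1 * sigma3 * b0.adjugate + b0 * sigma3 * b1.adjugate
  have hc := isBigO_conj sigma3 (hΨ.isBigO hlo hhi)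
  have hc1 : (fun μ => (exp μ / 2) • (Ψ μ * sigma3 * (Ψ μ).adjugate) - (exp μ / 2) • K - (I / 2) • N)
      =O[stripAt lo' hi'] fun μ => (lam μ)⁻¹ := by
    have h1 := (isBigO_refl (fun μ => exp μ / 2) (stripAt lo' hi')).smul hc
    refine (h1.congr_left fun μ => ?_).trans (IsBigO.of_bound 1 (Eventually.of_forall fun μ => ?_))
    · have e : (exp μ / 2) * (lam μ)⁻¹ = I / 2 := by
        rw [div_mul_eq_mul_div, exp_mul_inv_lam]
      rw [conj_sigma3_expSigma3, smul_sub, smul_sub, smul_smul, e]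
    · rw [smul_eq_mul, pow_two, ← mul_assoc, div_mul_eq_mul_div, exp_mul_inv_lam, norm_mul, one_mul]
      refine mul_le_of_le_one_left (norm_nonneg _) ?_
      rw [norm_div, norm_I]; norm_num
  obtain ⟨C, hC⟩ := hc1.bound
  obtain ⟨A, hA⟩ := eventually_stripAt.1 hC
  refine ⟨C, A, fun ρ hρ => ?_⟩
  obtain ⟨P, hP⟩ := exists_bound_rect hd.continuous ρ ρ lo' hi'
  set T := 2 * (Real.exp ρ ^ 2 * Real.exp (Real.exp ρ)) with hT
  set E := Real.exp ρ * ‖sigma3‖ with hE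
  have hT0 : 0 ≤ T := by positivity
  have hE0 : 0 ≤ E := by positivity
  refine ⟨|P| * (T + E) * (2 * |P|), by positivity, fun h κ Φ μ hh h1 h2 h3 => ?_⟩
  have hκ : 0 ≤ κ * ‖h‖ := (norm_nonneg _).trans h3
  have hPμ := (hP μ ⟨h1.ge, h1.le⟩ h2).trans (le_abs_self P)
  have hAμ : ‖(Ψ μ).adjugate‖ ≤ 2 * |P| := (norm_adj_le _).trans (by linarith)
  have ht := norm_twist_neg_sub_le hh μ
  rw [h1, ← hT] at ht
  have hconj : ∀ (X : Mat) (b : ℝ), ‖X‖ ≤ b → ‖Ψ μ * X * (Ψ μ).adjugate‖ ≤ |P| * b * (2 * |P|) := by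
    intro X b hX
    have hb := (norm_nonneg _).trans hX
    exact (norm_mul_le _ _).trans (mul_le_mul ((norm_mul_le _ _).trans
      (mul_le_mul hPμ hX (norm_nonneg _) (abs_nonneg _))) hAμ (norm_nonneg _) (by positivity))
  set S := quot h Φ Ψ μ with hS
  -- The quotient proper is the twisted quotient S, which is near 1, times a factor that involves
  -- only the solution at the base point and can be expanded explicitly in h.
  have hr : Φ μ * (Ψ μ).adjugate = S * (Ψ μ * twist (-h) μ * (Ψ μ).adjugate) := by
    rw [hS]; unfold quot
    calc _ = Φ μ * (twist h μ * 1 * twist (-h) μ) * (Ψ μ).adjugate := by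
            rw [mul_one, twist_mul_twist_neg, mul_one]
      _ = _ := by rw [← adj_mul_self (hdet μ)]; simp only [mul_assoc]
  set G := Ψ μ * twist (-h) μ * (Ψ μ).adjugate with hG
  have hG1 : G - 1 = h • ((exp μ / 2) • (Ψ μ * sigma3 * (Ψ μ).adjugate))
      + Ψ μ * (twist (-h) μ - 1 - (h * exp μ / 2) • sigma3) * (Ψ μ).adjugate := by
    rw [mul_sub, mul_sub, sub_mul, sub_mul, mul_one, mul_adj_self (hdet μ), mul_smul_comm,
      smul_mul_assoc, smul_smul, mul_div_assoc, hG]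
    abel
  have hG2 : ‖G - 1‖ ≤ ‖h‖ * (|P| * (T + E) * (2 * |P|)) := by
    have e : G - 1 = Ψ μ * (twist (-h) μ - 1) * (Ψ μ).adjugate := by
      rw [mul_sub, sub_mul, mul_one, mul_adj_self (hdet μ)]
    have e2 : ‖twist (-h) μ - 1‖ ≤ ‖h‖ * (T + E) := by
      have e3 : twist (-h) μ - 1 = (twist (-h) μ - 1 - (h * exp μ / 2) • sigma3)
          + (h * exp μ / 2) • sigma3 := by abel
      rw [e3]
      refine (norm_add_le _ _).trans ?_
      rw [mul_add]
      refine add_le_add (ht.trans ?_) ?_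
      · have : ‖h‖ ^ 2 ≤ ‖h‖ := by
          rw [pow_two]; exact mul_le_of_le_one_left (norm_nonneg _) hh
        gcongr
      · rw [norm_smul, norm_div, norm_mul, norm_exp, h1, hE, norm_ofNat, ← mul_assoc]
        gcongr
        exact half_le_self (by positivity)
    rw [e]
    exact (hconj _ _ e2).trans_eq (by ring)
  have hmain : Φ μ * (Ψ μ).adjugate - 1 - h • ((exp μ / 2) • K + (I / 2) • N)
      = (S - 1) + (S - 1) * (G - 1)
        + Ψ μ * (twist (-h) μ - 1 - (h * exp μ / 2) • sigma3) * (Ψ μ).adjugate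
        + h • ((exp μ / 2) • (Ψ μ * sigma3 * (Ψ μ).adjugate) - (exp μ / 2) • K - (I / 2) • N) := by
    have e1 : Φ μ * (Ψ μ).adjugate - 1 = (S - 1) + (S - 1) * (G - 1) + (G - 1) := by
      rw [hr]; noncomm_ring
    rw [e1]
    nth_rewrite 2 [hG1]
    rw [smul_sub, smul_sub, smul_add]
    abel
  rw [hmain]
  have b1 : ‖(S - 1) * (G - 1)‖ ≤ κ * ‖h‖ * (‖h‖ * (|P| * (T + E) * (2 * |P|))) :=
    (norm_mul_le _ _).trans (mul_le_mul h3 hG2 (norm_nonneg _) hκ)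
  have b2 := hconj _ _ ht
  have b3 : ‖h • ((exp μ / 2) • (Ψ μ * sigma3 * (Ψ μ).adjugate) - (exp μ / 2) • K - (I / 2) • N)‖
      ≤ ‖h‖ * (C * Real.exp (-ρ)) := by
    rw [norm_smul]
    have := hA μ (h1 ▸ hρ) h2
    rw [norm_inv_lam, h1] at this
    gcongr
  have b4 : |P| * (‖h‖ ^ 2 * T) * (2 * |P|) ≤ ‖h‖ * (|P| * (T + E) * (2 * |P|) * ‖h‖) := by
    have : |P| * (‖h‖ ^ 2 * T) * (2 * |P|) ≤ |P| * (‖h‖ ^ 2 * (T + E)) * (2 * |P|) := by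
      have : T ≤ T + E := by linarith
      gcongr
    refine this.trans_eq (by ring)
  refine (norm_add_le _ _).trans ((add_le_add ((norm_add_le _ _).trans (add_le_add ((norm_add_le _ _).trans
    (add_le_add h3 b1)) (b2.trans b4))) b3).trans_eq ?_)
  ring

/-- Phragmén–Lindelöf for periodic functions, with the weight `exp (μ / 2)`. -/
theorem norm_le_of_periodic {E : Type*} [NormedAddCommGroup E] [NormedSpace ℂ E] {f : ℂ → E}
    (hf : Differentiable ℂ f) (hper : Function.Periodic f (2 * Real.pi * I)) {ρ a b : ℝ}
    (h1 : ∀ μ : ℂ, μ.re = ρ → ‖f μ‖ ≤ a) (h2 : ∀ μ : ℂ, μ.re = -ρ → ‖f μ‖ ≤ b) (μ : ℂ)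
    (hμ : |μ.re| ≤ ρ) :
    ‖f μ‖ ≤ Real.exp (-μ.re / 2) * (a * Real.exp (ρ / 2) + b * Real.exp (-ρ / 2)) := by
  obtain ⟨hμ1, hμ2⟩ := abs_le.1 hμ
  have ha : 0 ≤ a := (norm_nonneg _).trans (h1 ρ (by simp))
  have hb : 0 ≤ b := (norm_nonneg _).trans (h2 (-ρ : ℝ) (by simp))
  obtain ⟨C, hC⟩ := exists_bound_rect hf.continuous (-ρ) ρ 0 (0 + 2 * Real.pi)
  have hb' : ∀ z : ℂ, z.re ∈ Set.Icc (-ρ) ρ → ‖f z‖ ≤ C := periodic_bound hper hC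
  have hn : ∀ z : ℂ, ‖exp (z / 2) • f z‖ = Real.exp (z.re / 2) * ‖f z‖ := fun z => by
    rw [norm_smul, norm_exp]; simp
  -- The three lines theorem for the entire function e^{μ/2} f. Periodicity of f supplies the
  -- boundedness in the strip that the theorem requires.
  have key : ‖exp (μ / 2) • f μ‖ ≤ a * Real.exp (ρ / 2) + b * Real.exp (-ρ / 2) := by
    rcases eq_or_lt_of_le (show -ρ ≤ ρ by linarith) with h0 | h0
    · rw [hn]
      have : μ.re = ρ := by linarith
      rw [this]
      have h3 := mul_le_mul_of_nonneg_left (h1 μ this) (Real.exp_pos (ρ / 2)).le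
      have h4 : 0 ≤ b * Real.exp (-ρ / 2) := by positivity
      linarith
    refine PhragmenLindelof.vertical_strip (f := fun z => exp (z / 2) • f z) (a := -ρ) (b := ρ) ?_ ?_
      (fun z hz => ?_) (fun z hz => ?_) hμ1 hμ2
    · exact (((differentiable_exp.comp (differentiable_id.div_const 2)).smul hf)).diffContOnCl
    · refine ⟨0, div_pos Real.pi_pos (by linarith), 0, ?_⟩
      refine IsBigO.of_bound (Real.exp (ρ / 2) * C) ?_
      rw [eventually_inf_principal]
      refine Eventually.of_forall fun z hz => ?_
      rw [hn]
      have h5 : z.re ∈ Set.Icc (-ρ) ρ := ⟨hz.1.le, hz.2.le⟩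
      have h6 := hb' z h5
      have h7 : Real.exp (z.re / 2) ≤ Real.exp (ρ / 2) := Real.exp_le_exp.2 (by linarith [h5.2])
      simp only [zero_mul, Real.exp_zero, norm_one, mul_one]
      gcongr
    · rw [hn, hz, mul_comm]
      have h3 := mul_le_mul_of_nonneg_right (h2 z hz) (Real.exp_pos (-ρ / 2)).le
      have h4 : 0 ≤ a * Real.exp (ρ / 2) := by positivity
      linarith
    · rw [hn, hz, mul_comm]
      have h3 := mul_le_mul_of_nonneg_right (h1 z hz) (Real.exp_pos (ρ / 2)).le
      have h4 : 0 ≤ b * Real.exp (-ρ / 2) := by positivity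
      linarith
  rw [hn] at key
  have h8 : Real.exp (-μ.re / 2) * Real.exp (μ.re / 2) = 1 := by
    rw [← Real.exp_add]; ring_nf; simp
  calc ‖f μ‖ = Real.exp (-μ.re / 2) * (Real.exp (μ.re / 2) * ‖f μ‖) := by
        rw [← mul_assoc, h8, one_mul]
    _ ≤ _ := mul_le_mul_of_nonneg_left key (Real.exp_pos _).le

end

/-! ### First-order expansion of the quotient in x. -/

section

open scoped Matrix.Norms.Operator

theorem EndData.mono {β ε ε' : ℝ} {c : Mat} {r sP sN : ℂ → Mat} (h : EndData β ε c r sP sN)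
    (hε : ε ≤ ε') : EndData β ε' c r sP sN where
  dP := h.dP
  dN := h.dN
  up μ h1 h2 := (h.up μ h1 h2).trans (by gcongr)
  low μ h1 h2 := (h.low μ h1 h2).trans (by gcongr)
  midP μ h1 h2 := (h.midP μ h1 h2).trans (by gcongr)
  midN μ h1 h2 := (h.midN μ h1 h2).trans (by gcongr)
  limP := h.limP
  limN := h.limN

theorem quot_periodic {n : ℤ} {m : ℂ} {Φ Ψ : ℂ → Mat}
    (hΦ : ∀ μ, Φ (μ + 2 * Real.pi * I) = Φ μ * monod n m)
    (hΨ : ∀ μ, Ψ (μ + 2 * Real.pi * I) = Ψ μ * monod n m) (μ : ℂ) :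
    Φ (μ + 2 * Real.pi * I) * (Ψ (μ + 2 * Real.pi * I)).adjugate = Φ μ * (Ψ μ).adjugate := by
  rw [hΦ, hΨ, mul_adj_mul_right (det_monod n m)]

theorem Asym.exists_first_order {n : ℤ} {m x : ℂ} {β : ℝ} {Ψ : ℂ → Mat} {b0 b1 : Mat}
    (hΨ : Asym n m x β Ψ b0 b1) (hdet : ∀ μ, (Ψ μ).det = 1) :
    ∃ C A : ℝ, ∀ ρ ≥ A, ∃ D ≥ 0, ∀ (h : ℂ) (κ : ℝ) (Φ : ℂ → Mat), ‖h‖ ≤ 1 → 0 ≤ κ →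
      (∀ μ, Φ (μ + 2 * Real.pi * I) = Φ μ * monod n m) →
      (∀ μ : ℂ, μ.re = ρ → μ.im ∈ Set.Icc β (β + Real.pi) → ‖quot h Φ Ψ μ - 1‖ ≤ κ * ‖h‖) →
      (∀ μ : ℂ, μ.re = ρ → μ.im ∈ Set.Icc (β + Real.pi) (β + 2 * Real.pi) →
        ‖quot h (fun μ => Φ μ * VZeroUp m) (fun μ => Ψ μ * VZeroUp m) μ - 1‖ ≤ κ * ‖h‖) →
      ∀ μ : ℂ, μ.re = ρ →
      ‖Φ μ * (Ψ μ).adjugate - 1 - h • ((exp μ / 2) • (b0 * sigma3 * b0.adjugate)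
        + (I / 2) • (b1 * sigma3 * b0.adjugate + b0 * sigma3 * b1.adjugate))‖
        ≤ ‖h‖ * (C * Real.exp (-ρ) + κ + (κ + 1) * D * ‖h‖) := by
  obtain ⟨C₁, A₁, h₁⟩ := hΨ.asympP.exists_first_order hΨ.diff hdet (lo' := β) (hi' := β + Real.pi)
    (by linarith) (by linarith)
  obtain ⟨C₂, A₂, h₂⟩ := hΨ.asympN.exists_first_order (hΨ.diff.mul_const _)
    (fun μ => by rw [Matrix.det_mul, hdet, det_VZeroUp, one_mul]) (lo' := β + Real.pi)
    (hi' := β + 2 * Real.pi) (by linarith) (by linarith)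
  refine ⟨max C₁ C₂, max A₁ A₂, fun ρ hρ => ?_⟩
  obtain ⟨D₁, hD₁, h₁⟩ := h₁ ρ ((le_max_left _ _).trans hρ)
  obtain ⟨D₂, hD₂, h₂⟩ := h₂ ρ ((le_max_right _ _).trans hρ)
  refine ⟨max D₁ D₂, hD₁.trans (le_max_left _ _), fun h κ Φ hh hκ hΦ hP hN => ?_⟩
  have hper : Function.Periodic (fun μ => Φ μ * (Ψ μ).adjugate - 1
      - h • ((exp μ / 2) • (b0 * sigma3 * b0.adjugate)
        + (I / 2) • (b1 * sigma3 * b0.adjugate + b0 * sigma3 * b1.adjugate))) (2 * Real.pi * I) :=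
    fun μ => by simp only; rw [quot_periodic hΦ hΨ.per, exp_periodic]
  refine periodic_bound hper (s := {ρ}) (lo := β) (fun μ h3 h4 => ?_)
  rcases le_total μ.im (β + Real.pi) with h5 | h5
  · refine (h₁ h κ Φ μ hh h3 ⟨h4.1, h5⟩ (hP μ h3 ⟨h4.1, h5⟩)).trans ?_
    have h6 := le_max_left C₁ C₂
    have h7 := le_max_left D₁ D₂
    gcongr
  · have := h₂ h κ (fun μ => Φ μ * VZeroUp m) μ hh h3 ⟨h5, h4.2⟩ (hN μ h3 ⟨h5, h4.2⟩)
    rw [mul_adj_mul_right (det_VZeroUp m)] at this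
    refine this.trans ?_
    have h6 := le_max_right C₁ C₂
    have h7 := le_max_right D₁ D₂
    gcongr

/-- A solution on the cylinder with its expansions at both ends. -/
structure SolPair (n : ℤ) (m x : ℂ) (β : ℝ) (Φ : ℂ → Mat) (a1 b0 b1 : Mat) : Prop where
  main : Asym n m x β Φ 1 a1
  mirror : Asym (1 - n) m x β (fun μ => Φ (-μ) * monod n m) b0 b1

/-- The matrix of the differential equation in `x`. -/
def matB (a1 b0 : Mat) (μ : ℂ) : Mat :=
  (exp μ / 2) • sigma3 + (I / 2) • (a1 * sigma3 + sigma3 * a1.adjugate)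
    + (exp (-μ) / 2) • (b0 * sigma3 * b0.adjugate)

theorem matB_periodic (a1 b0 : Mat) : Function.Periodic (matB a1 b0) (2 * Real.pi * I) := fun μ => by
  unfold matB
  rw [exp_periodic, neg_add, (exp_periodic.neg : Function.Periodic exp _) (-μ)]

theorem differentiable_matB (a1 b0 : Mat) : Differentiable ℂ (matB a1 b0) :=
  ((((differentiable_exp.div_const 2).smul_const _)).add_const _).add
    (((differentiable_exp.comp differentiable_neg).div_const 2).smul_const _)

namespace SolPair

variable {n : ℤ} {m x : ℂ} {β : ℝ} {Ψ : ℂ → Mat} {a1 b0 b1 : Mat}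

theorem det_eq_one (h : SolPair n m x β Ψ a1 b0 b1) (μ : ℂ) : (Ψ μ).det = 1 := by
  rw [(h.main.det_eq h.mirror).1, Matrix.det_one]

theorem det_b0 (h : SolPair n m x β Ψ a1 b0 b1) : b0.det = 1 := by
  rw [(h.main.det_eq h.mirror).2, Matrix.det_one]

theorem mirror_det (h : SolPair n m x β Ψ a1 b0 b1) (μ : ℂ) : (Ψ (-μ) * monod n m).det = 1 := by
  rw [Matrix.det_mul, h.det_eq_one, det_monod, one_mul]

set_option maxHeartbeats 1000000 in
/-- First-order expansion in `x`. -/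
theorem exists_first_order (hx : x ≠ 0) (hβ : |β + arg x| < 1 / 8) (hΨ : SolPair n m x β Ψ a1 b0 b1)
    (M : ℝ) {η : ℝ} (hη : 0 < η) : ∃ ε > 0, ∀ (h : ℂ) (Φ : ℂ → Mat) (a1' b0' b1' : Mat), ‖h‖ < ε →
      SolPair n m (x + h) β Φ a1' b0' b1' → ∀ μ : ℂ, |μ.re| ≤ M →
      ‖Φ μ * (Ψ μ).adjugate - 1 - h • matB a1 b0 μ‖ ≤ η * ‖h‖ := by
  obtain ⟨K₁, hK₁, h₁⟩ := hΨ.main.exists_endData hx hβ hΨ.det_eq_one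
  obtain ⟨K₂, hK₂, h₂⟩ := hΨ.mirror.exists_endData hx hβ hΨ.mirror_det
  obtain ⟨C₁, A₁, hf₁⟩ := hΨ.main.exists_first_order hΨ.det_eq_one
  obtain ⟨C₂, A₂, hf₂⟩ := hΨ.mirror.exists_first_order hΨ.mirror_det
  set K := max K₁ K₂ with hK
  have hKpos : 0 < K := lt_max_of_lt_left hK₁
  set Kb := b0 * sigma3 * b0.adjugate with hKb
  set N₁ := a1 * sigma3 + sigma3 * a1.adjugate with hN₁
  set N₂ := b1 * sigma3 * b0.adjugate + b0 * sigma3 * b1.adjugate with hN₂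
  set a : ℝ := |C₁| + 1600 * K + ‖Kb‖ with ha
  set b : ℝ := |C₂| + 1600 * K + ‖(I / 2) • N₂‖ + ‖(I / 2) • N₁‖ + ‖sigma3‖ with hb
  have ha0 : 0 ≤ a := by positivity
  have hb0 : 0 ≤ b := by positivity
  -- On Re μ = ρ the first-order error is O(e^{-ρ}), on Re μ = -ρ only O(1). The weight e^{μ/2}
  -- balances the two at O(e^{-ρ/2}), which is small for large ρ. Only afterwards is h chosen, in
  -- terms of the constants D₁, D₂ that depend on ρ.
  obtain ⟨ρ, hρ1, hρ2⟩ : ∃ ρ : ℝ, max (max A₁ A₂) (max 2 M) ≤ ρ ∧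
      Real.exp (M / 2) * ((a + b) * Real.exp (-ρ / 2)) < η / 2 := by
    have h1 : Tendsto (fun ρ : ℝ => Real.exp (M / 2) * ((a + b) * Real.exp (-(ρ / 2)))) atTop
        (𝓝 (Real.exp (M / 2) * ((a + b) * 0))) :=
      ((Real.tendsto_exp_neg_atTop_nhds_zero.comp (tendsto_id.atTop_div_const two_pos)).const_mul
        _).const_mul _
    rw [mul_zero, mul_zero] at h1
    obtain ⟨ρ, hρ⟩ := ((eventually_ge_atTop (max (max A₁ A₂) (max 2 M))).and
      (h1.eventually_lt_const (half_pos hη))).exists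
    exact ⟨ρ, hρ.1, by rw [neg_div]; exact hρ.2⟩
  obtain ⟨h3, h4⟩ := max_le_iff.1 hρ1
  obtain ⟨hρA1, hρA2⟩ := max_le_iff.1 h3
  obtain ⟨hρ2', hρM⟩ := max_le_iff.1 h4
  obtain ⟨D₁, hD₁, hf₁⟩ := hf₁ ρ hρA1
  obtain ⟨D₂, hD₂, hf₂⟩ := hf₂ ρ hρA2
  set D : ℝ := (1600 * K + 1) * (D₁ + D₂) with hD
  have hD0 : 0 ≤ D := by positivity
  set Z : ℝ := Real.exp (M / 2) * (D * (Real.exp (ρ / 2) + Real.exp (-ρ / 2))) with hZ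
  have hZ0 : 0 ≤ Z := by positivity
  have hx4 : 0 < ‖x‖ / 4 := by have := norm_pos_iff.2 hx; positivity
  refine ⟨min (min (‖x‖ / 4) 1) (min (1 / (1602 * K)) (η / (2 * (Z + 1)))), by positivity,
    fun h Φ a1' b0' b1' hh hΦ μ hμ => ?_⟩
  obtain ⟨hh1, hh2⟩ := lt_min_iff.1 hh
  obtain ⟨hhx, hh1⟩ := lt_min_iff.1 hh1
  obtain ⟨hhK, hhη⟩ := lt_min_iff.1 hh2
  have hε1 : 1602 * (K * ‖h‖) ≤ 1 := by
    rw [lt_div_iff₀ (by positivity)] at hhK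
    linarith
  set r : ℂ → Mat := fun μ => Φ μ * (Ψ μ).adjugate with hr
  have hrd : Differentiable ℂ r := hΦ.main.diff.mul (Asym.differentiable_adj hΨ.main.diff)
  have hrper : ∀ μ, r (μ + 2 * Real.pi * I) = r μ := quot_periodic hΦ.main.per hΨ.main.per
  have hrm : (fun μ => Φ (-μ) * monod n m * (Ψ (-μ) * monod n m).adjugate) = fun μ => r (-μ) :=
    funext fun μ => mul_adj_mul_right (det_monod n m)
  have e₁ := (h₁ h Φ 1 a1' hhx.le hh1.le hΦ.main).mono
    (mul_le_mul_of_nonneg_right (le_max_left K₁ K₂) (norm_nonneg h))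
  have e₂ := (h₂ h (fun μ => Φ (-μ) * monod n m) b0' b1' hhx.le hh1.le hΦ.mirror).mono
    (mul_le_mul_of_nonneg_right (le_max_right K₁ K₂) (norm_nonneg h))
  rw [hrm] at e₂
  rw [Matrix.adjugate_one, mul_one] at e₁
  obtain ⟨-, k2, k3, k4, k5⟩ := e₁.estimates e₂ hrd hrper (by positivity) hε1
  have hE1 : Real.exp (-ρ) ≤ 1 := Real.exp_le_one_iff.2 (by linarith)
  have w₁ := hf₁ h (1600 * K * Real.exp (-ρ)) Φ hh1.le (by positivity) hΦ.main.per
    (fun ν h5 h6 => (k2 ν (by linarith) h6).trans_eq (by rw [h5]; ring))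
    (fun ν h5 h6 => (k3 ν (by linarith) h6).trans_eq (by rw [h5]; ring))
  have w₂ := hf₂ h (1600 * K) (fun μ => Φ (-μ) * monod n m) hh1.le (by positivity) hΦ.mirror.per
    (fun ν h5 h6 => (k4 ν (by linarith) h6).trans_eq (by ring))
    (fun ν h5 h6 => (k5 ν (by linarith) h6).trans_eq (by ring))
  simp only [Matrix.adjugate_one, mul_one, one_mul] at w₁
  set f : ℂ → Mat := fun μ => r μ - 1 - h • matB a1 b0 μ with hf
  have hfd : Differentiable ℂ f := (hrd.sub_const 1).sub ((differentiable_matB a1 b0).const_smul h)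
  have hfper : Function.Periodic f (2 * Real.pi * I) := fun μ => by
    simp only [hf]; rw [hrper, matB_periodic]
  have hbound₁ : ∀ ν : ℂ, ν.re = ρ → ‖f ν‖ ≤ ‖h‖ * (a * Real.exp (-ρ) + D * ‖h‖) := by
    intro ν hν
    have e : f ν = (Φ ν * (Ψ ν).adjugate - 1 - h • ((exp ν / 2) • sigma3 + (I / 2) • N₁))
        - h • (exp (-ν) / 2) • Kb := by
      simp only [hf, hr, matB]
      rw [← hKb, ← hN₁, smul_add h _ ((exp (-ν) / 2) • Kb)]
      abel
    have e2 : ‖h • (exp (-ν) / 2) • Kb‖ ≤ ‖h‖ * (‖Kb‖ * Real.exp (-ρ)) := by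
      rw [norm_smul, norm_smul, norm_div, norm_exp, neg_re, hν, norm_ofNat, mul_comm ‖Kb‖]
      have := Real.exp_pos (-ρ)
      gcongr
      linarith
    rw [e]
    refine (norm_sub_le _ _).trans ((add_le_add (w₁ ν hν) e2).trans ?_)
    rw [← mul_add]
    refine mul_le_mul_of_nonneg_left ?_ (norm_nonneg h)
    have e3 : C₁ * Real.exp (-ρ) ≤ |C₁| * Real.exp (-ρ) :=
      mul_le_mul_of_nonneg_right (le_abs_self _) (Real.exp_pos _).le
    have e4 : (1600 * K * Real.exp (-ρ) + 1) * D₁ * ‖h‖ ≤ D * ‖h‖ := by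
      refine mul_le_mul_of_nonneg_right ?_ (norm_nonneg _)
      rw [hD]
      refine mul_le_mul ?_ (by linarith) hD₁ (by positivity)
      have : 1600 * K * Real.exp (-ρ) ≤ 1600 * K := mul_le_of_le_one_right (by positivity) hE1
      linarith
    rw [ha]
    linarith
  -- The constant terms of the expansions at the two ends are not known to agree, so on the left
  -- their difference is merely bounded. The weighted estimate tolerates this.
  have hbound₂ : ∀ ν : ℂ, ν.re = -ρ → ‖f ν‖ ≤ ‖h‖ * (b + D * ‖h‖) := by
    intro ν hν
    have hν' : (-ν).re = ρ := by rw [neg_re, hν, neg_neg]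
    have w := w₂ (-ν) hν'
    simp only [neg_neg] at w
    rw [mul_adj_mul_right (det_monod n m)] at w
    have e : f ν = (Φ ν * (Ψ ν).adjugate - 1 - h • ((exp (-ν) / 2) • Kb + (I / 2) • N₂))
        + h • ((I / 2) • N₂ - (I / 2) • N₁ - (exp ν / 2) • sigma3) := by
      simp only [hf, hr, matB]
      rw [← hKb, ← hN₁, smul_add h, smul_add h, smul_add h, smul_sub h, smul_sub h]
      abel
    have e2 : ‖h • ((I / 2) • N₂ - (I / 2) • N₁ - (exp ν / 2) • sigma3)‖
        ≤ ‖h‖ * (‖(I / 2) • N₂‖ + ‖(I / 2) • N₁‖ + ‖sigma3‖) := by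
      rw [norm_smul]
      refine mul_le_mul_of_nonneg_left ?_ (norm_nonneg h)
      refine (norm_sub_le _ _).trans (add_le_add (norm_sub_le _ _) ?_)
      rw [norm_smul, norm_div, norm_exp, hν, norm_ofNat]
      refine mul_le_of_le_one_left (norm_nonneg _) ?_
      linarith
    rw [e]
    refine (norm_add_le _ _).trans ((add_le_add w e2).trans ?_)
    rw [← mul_add]
    refine mul_le_mul_of_nonneg_left ?_ (norm_nonneg h)
    have e3 : C₂ * Real.exp (-ρ) ≤ |C₂| :=
      (mul_le_mul_of_nonneg_right (le_abs_self _) (Real.exp_pos _).le).trans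
        (mul_le_of_le_one_right (abs_nonneg _) hE1)
    have e4 : (1600 * K + 1) * D₂ * ‖h‖ ≤ D * ‖h‖ := by
      refine mul_le_mul_of_nonneg_right ?_ (norm_nonneg _)
      rw [hD]
      exact mul_le_mul_of_nonneg_left (by linarith) (by positivity)
    rw [hb]
    linarith
  have hfin := norm_le_of_periodic hfd hfper hbound₁ hbound₂ μ (hμ.trans hρM)
  refine hfin.trans ?_
  have q1 : Real.exp (-μ.re / 2) ≤ Real.exp (M / 2) :=
    Real.exp_le_exp.2 (by linarith [(abs_le.1 hμ).1])
  have q2 : Real.exp (-ρ) * Real.exp (ρ / 2) = Real.exp (-ρ / 2) := by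
    rw [← Real.exp_add]; congr 1; ring
  have q3 : ‖h‖ * (a * Real.exp (-ρ) + D * ‖h‖) * Real.exp (ρ / 2)
      + ‖h‖ * (b + D * ‖h‖) * Real.exp (-ρ / 2)
      = ‖h‖ * ((a + b) * Real.exp (-ρ / 2) + D * (Real.exp (ρ / 2) + Real.exp (-ρ / 2)) * ‖h‖) := by
    linear_combination ‖h‖ * a * q2
  rw [q3]
  have q4 : Z * ‖h‖ ≤ η / 2 := by
    rw [lt_div_iff₀ (by positivity)] at hhη
    have e : ‖h‖ * (2 * (Z + 1)) = 2 * (Z * ‖h‖) + 2 * ‖h‖ := by ring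
    linarith only [hhη, e, norm_nonneg h]
  calc _ ≤ Real.exp (M / 2) * (‖h‖ * ((a + b) * Real.exp (-ρ / 2)
          + D * (Real.exp (ρ / 2) + Real.exp (-ρ / 2)) * ‖h‖)) := by gcongr
    _ = ‖h‖ * (Real.exp (M / 2) * ((a + b) * Real.exp (-ρ / 2)) + Z * ‖h‖) := by rw [hZ]; ring
    _ ≤ ‖h‖ * (η / 2 + η / 2) := mul_le_mul_of_nonneg_left (add_le_add hρ2.le q4) (norm_nonneg h)
    _ = η * ‖h‖ := by ring

end SolPair

end

/-! ### Derivatives with respect to x and the zero-curvature equation. -/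

section

open scoped Matrix.Norms.Operator

theorem hasDerivAt_of_forall_norm_le {E : Type*} [NormedAddCommGroup E] [NormedSpace ℂ E]
    {f : ℂ → E} {f' : E} {x : ℂ}
    (hf : ∀ η > 0, ∀ᶠ h in 𝓝 (0 : ℂ), ‖f (x + h) - f x - h • f'‖ ≤ η * ‖h‖) :
    HasDerivAt f f' x := by
  rw [hasDerivAt_iff_isLittleO_nhds_zero]
  exact isLittleO_iff.2 fun η hη => hf η hη

/-- Solutions on the cylinder for all parameters near `x`. -/
structure SolFamily (n : ℤ) (m x : ℂ) (β : ℝ) (Φ : ℂ → ℂ → Mat) (a1 b0 b1 : ℂ → Mat) : Prop where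
  ne_zero : x ≠ 0
  angle : |β + arg x| < 1 / 8
  pair : ∀ᶠ z in 𝓝 x, SolPair n m z β (Φ z) (a1 z) (b0 z) (b1 z)

namespace SolFamily

variable {n : ℤ} {m x : ℂ} {β : ℝ} {Φ : ℂ → ℂ → Mat} {a1 b0 b1 : ℂ → Mat}

theorem self (hΦ : SolFamily n m x β Φ a1 b0 b1) : SolPair n m x β (Φ x) (a1 x) (b0 x) (b1 x) :=
  hΦ.pair.self_of_nhds

theorem pair_add (hΦ : SolFamily n m x β Φ a1 b0 b1) :
    ∀ᶠ h in 𝓝 (0 : ℂ), SolPair n m (x + h) β (Φ (x + h)) (a1 (x + h)) (b0 (x + h)) (b1 (x + h)) := by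
  have : Tendsto (fun h : ℂ => x + h) (𝓝 0) (𝓝 x) := by
    simpa using (tendsto_id (x := 𝓝 (0 : ℂ))).const_add x
  exact this.eventually hΦ.pair

theorem first_order (hΦ : SolFamily n m x β Φ a1 b0 b1) (M : ℝ) {η : ℝ} (hη : 0 < η) :
    ∀ᶠ h in 𝓝 (0 : ℂ), ∀ μ : ℂ, |μ.re| ≤ M →
      ‖Φ (x + h) μ * (Φ x μ).adjugate - 1 - h • matB (a1 x) (b0 x) μ‖ ≤ η * ‖h‖ := by
  obtain ⟨ε, hε, h1⟩ := SolPair.exists_first_order hΦ.ne_zero hΦ.angle hΦ.self M hη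
  filter_upwards [hΦ.pair_add, Metric.ball_mem_nhds (0 : ℂ) hε] with h h2 h3
  exact h1 h _ _ _ _ (by simpa using h3) h2

theorem hasDerivAt_quot (hΦ : SolFamily n m x β Φ a1 b0 b1) (μ : ℂ) :
    HasDerivAt (fun z => Φ z μ * (Φ x μ).adjugate) (matB (a1 x) (b0 x) μ) x := by
  refine hasDerivAt_of_forall_norm_le fun η hη => ?_
  filter_upwards [hΦ.first_order |μ.re| hη] with h h1
  have := h1 μ le_rfl
  rwa [Matrix.mul_adjugate (Φ x μ), hΦ.self.det_eq_one, one_smul]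

theorem hasDerivAt_param (hΦ : SolFamily n m x β Φ a1 b0 b1) (μ : ℂ) :
    HasDerivAt (fun z => Φ z μ) (matB (a1 x) (b0 x) μ * Φ x μ) x := by
  have h := (hΦ.hasDerivAt_quot μ).mul_const (Φ x μ)
  have e : (fun z => Φ z μ) = fun z => Φ z μ * (Φ x μ).adjugate * Φ x μ := by
    funext z
    rw [mul_assoc, Matrix.adjugate_mul, hΦ.self.det_eq_one, one_smul, mul_one]
  rw [e]
  exact h

theorem differentiable_quot {Ψ Ψ₀ : ℂ → Mat} (h : Differentiable ℂ Ψ) (h₀ : Differentiable ℂ Ψ₀) :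
    Differentiable ℂ fun μ => Ψ μ * (Ψ₀ μ).adjugate :=
  h.mul (Asym.differentiable_adj h₀)

/-- The first-order remainder is small uniformly on a unit disk in μ, so by Cauchy's estimate its
μ-derivative is small too. -/
theorem hasDerivAt_deriv_quot (hΦ : SolFamily n m x β Φ a1 b0 b1) (μ : ℂ) :
    HasDerivAt (fun z => deriv (fun ν => Φ z ν * (Φ x ν).adjugate) μ)
      (deriv (matB (a1 x) (b0 x)) μ) x := by
  refine hasDerivAt_of_forall_norm_le fun η hη => ?_
  filter_upwards [hΦ.first_order (|μ.re| + 1) hη, hΦ.pair_add] with h h1 h2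
  have hd : Differentiable ℂ fun ν => Φ (x + h) ν * (Φ x ν).adjugate :=
    differentiable_quot h2.main.diff hΦ.self.main.diff
  have hB := differentiable_matB (a1 x) (b0 x)
  have e1 : deriv (fun ν => Φ x ν * (Φ x ν).adjugate) μ = 0 := by
    have : (fun ν => Φ x ν * (Φ x ν).adjugate) = fun _ => 1 := by
      funext ν
      rw [Matrix.mul_adjugate, hΦ.self.det_eq_one, one_smul]
    rw [this]
    exact deriv_const _ _
  have e2 : HasDerivAt (fun ν => Φ (x + h) ν * (Φ x ν).adjugate - 1 - h • matB (a1 x) (b0 x) ν)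
      (deriv (fun ν => Φ (x + h) ν * (Φ x ν).adjugate) μ - h • deriv (matB (a1 x) (b0 x)) μ) μ :=
    ((hd μ).hasDerivAt.sub_const 1).sub ((hB μ).hasDerivAt.const_smul h)
  rw [e1, sub_zero]
  have e3 := norm_deriv_le_of_forall_mem_sphere_norm_le (c := μ) (R := 1) (C := η * ‖h‖)
    (f := fun ν => Φ (x + h) ν * (Φ x ν).adjugate - 1 - h • matB (a1 x) (b0 x) ν) one_pos
    (((hd.sub_const 1).sub (hB.const_smul h)).diffContOnCl) (fun ν hν => h1 ν ?_)
  · rw [div_one] at e3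
    have e4 : deriv (fun ν => Φ (x + h) ν * (Φ x ν).adjugate - 1 - h • matB (a1 x) (b0 x) ν) μ = _ :=
      e2.deriv
    exact e4 ▸ e3
  · have h5 := abs_re_le_norm (ν - μ)
    rw [mem_sphere_iff_norm] at hν
    rw [hν, sub_re] at h5
    have := abs_sub_abs_le_abs_sub ν.re μ.re
    linarith

end SolFamily

/-- The logarithmic derivative of a solution. -/
def logDer (Φ : ℂ → Mat) (μ : ℂ) : Mat := deriv Φ μ * (Φ μ).adjugate

theorem logDer_eq {Ψ Ψ₀ : ℂ → Mat} (h : Differentiable ℂ Ψ) (h₀ : Differentiable ℂ Ψ₀)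
    (hdet₀ : ∀ μ, (Ψ₀ μ).det = 1) (μ : ℂ) :
    logDer Ψ μ = (deriv (fun ν => Ψ ν * (Ψ₀ ν).adjugate) μ + Ψ μ * (Ψ₀ μ).adjugate * logDer Ψ₀ μ)
      * (Ψ μ * (Ψ₀ μ).adjugate).adjugate := by
  have e0 : ∀ ν, (Ψ₀ ν).adjugate * Ψ₀ ν = 1 := fun ν => by
    rw [Matrix.adjugate_mul, hdet₀, one_smul]
  have e0' : ∀ ν, Ψ₀ ν * (Ψ₀ ν).adjugate = 1 := fun ν => by
    rw [Matrix.mul_adjugate, hdet₀, one_smul]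
  have hr := (SolFamily.differentiable_quot h h₀ μ).hasDerivAt
  have e1 : HasDerivAt (fun ν => Ψ ν * (Ψ₀ ν).adjugate * Ψ₀ ν)
      (deriv (fun ν => Ψ ν * (Ψ₀ ν).adjugate) μ * Ψ₀ μ + Ψ μ * (Ψ₀ μ).adjugate * deriv Ψ₀ μ) μ :=
    hr.mul (h₀ μ).hasDerivAt
  have e2 : (fun ν => Ψ ν * (Ψ₀ ν).adjugate * Ψ₀ ν) = Ψ := by
    funext ν; rw [mul_assoc, e0, mul_one]
  rw [e2] at e1
  have e3 : deriv Ψ μ = _ := e1.deriv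
  unfold logDer
  rw [e3, Matrix.adjugate_mul_distrib, Matrix.adjugate_adjugate', Fintype.card_fin, pow_zero, one_smul]
  simp only [add_mul, mul_assoc]
  rw [← mul_assoc ((Ψ₀ μ).adjugate) (Ψ₀ μ), e0, one_mul]

theorem HasDerivAt.adj {f : ℂ → Mat} {f' : Mat} {x : ℂ} (h : HasDerivAt f f' x) :
    HasDerivAt (fun z => (f z).adjugate) f'.adjugate x := by
  rw [hasDerivAt_mat] at h ⊢
  intro i j
  simp only [adj_eq]
  fin_cases i <;> fin_cases j
  · exact h 1 1
  · exact (h 0 1).neg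
  · exact (h 1 0).neg
  · exact h 0 0

namespace SolFamily

variable {n : ℤ} {m x : ℂ} {β : ℝ} {Φ : ℂ → ℂ → Mat} {a1 b0 b1 : ℂ → Mat}

/-- The zero-curvature equation ∂A/∂x = ∂B/∂μ + BA - AB: the matrix B is traceless, so its adjugate
is -B. The quotient with the solution at the base point makes it unnecessary to exchange mixed
derivatives. -/
theorem hasDerivAt_logDer (hΦ : SolFamily n m x β Φ a1 b0 b1) (μ : ℂ) :
    HasDerivAt (fun z => logDer (Φ z) μ) (deriv (matB (a1 x) (b0 x)) μ
      + matB (a1 x) (b0 x) μ * logDer (Φ x) μ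
      + logDer (Φ x) μ * (matB (a1 x) (b0 x) μ).adjugate) x := by
  have h1 := hΦ.hasDerivAt_quot μ
  have h2 := hΦ.hasDerivAt_deriv_quot μ
  have h3 := (h2.add (h1.mul_const (logDer (Φ x) μ))).mul (HasDerivAt.adj h1)
  have e0 : ∀ ν, Φ x ν * (Φ x ν).adjugate = 1 := fun ν => mul_adj_self (hΦ.self.det_eq_one ν)
  have e1 : deriv (fun ν => Φ x ν * (Φ x ν).adjugate) μ = 0 := by
    have : (fun ν => Φ x ν * (Φ x ν).adjugate) = fun _ => 1 := funext e0
    rw [this]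
    exact deriv_const _ _
  refine (h3.congr_of_eventuallyEq ?_).congr_deriv ?_
  · filter_upwards [hΦ.pair] with z hz
    exact logDer_eq hz.main.diff hΦ.self.main.diff hΦ.self.det_eq_one μ
  · simp only [Pi.add_apply]
    rw [e0, e1, Matrix.adjugate_one, mul_one, one_mul, zero_add]

end SolFamily

end

/-! ### Differential equations and algebraic relations for the potentials. -/

section

open scoped Matrix.Norms.Operator

/-- The conjugate `b σ₃ b⁻¹`. -/
def matK (b : Mat) : Mat := b * sigma3 * b.adjugate

theorem matK_one_one (b : Mat) : matK b 1 1 = -matK b 0 0 := by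
  simp [matK, sigma3, adj_eq, Matrix.mul_apply, Fin.sum_univ_two]; ring

theorem matK_eq (b : Mat) : matK b = !![matK b 0 0, matK b 0 1; matK b 1 0, -matK b 0 0] := by
  rw [← matK_one_one]; exact Matrix.eta_fin_two _

theorem matK_sq {b : Mat} (hb : b.det = 1) : matK b 0 0 ^ 2 + matK b 0 1 * matK b 1 0 = 1 := by
  rw [Matrix.det_fin_two] at hb
  simp [matK, sigma3, adj_eq, Matrix.mul_apply, Fin.sum_univ_two]
  linear_combination (b 0 0 * b 1 1 - b 0 1 * b 1 0 + 1) * hb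

namespace SolPair

variable {n : ℤ} {m x : ℂ} {β : ℝ} {Ψ : ℂ → Mat} {a1 b0 b1 : Mat}

theorem a1_trace (h : SolPair n m x β Ψ a1 b0 b1) : a1 1 1 = -a1 0 0 := by
  have h1 := h.main.trace_relation (fun μ => by rw [h.det_eq_one, Matrix.det_one])
  have h2 := congrFun (congrFun h1 0) 0
  simp [adj_eq] at h2
  linear_combination h2

theorem laxConst_eq (h : SolPair n m x β Ψ a1 b0 b1) (Θ : ℂ) :
    laxConst Θ x 1 a1 = !![-(Θ / 2), -(I * x * a1 0 1); I * x * a1 1 0, Θ / 2] := by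
  have h1 := h.a1_trace
  ext i j
  fin_cases i <;> fin_cases j <;>
    simp [laxConst, sigma3, adj_eq, h1, Matrix.mul_apply, Fin.sum_univ_two] <;> ring

theorem matB_eq (h : SolPair n m x β Ψ a1 b0 b1) (μ : ℂ) :
    matB a1 b0 μ = (exp μ / 2) • sigma3 + !![0, -(I * a1 0 1); I * a1 1 0, 0]
      + (exp (-μ) / 2) • matK b0 := by
  have h1 := h.a1_trace
  have : (I / 2) • (a1 * sigma3 + sigma3 * a1.adjugate) = !![0, -(I * a1 0 1); I * a1 1 0, 0] := by
    ext i j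
    fin_cases i <;> fin_cases j <;>
      simp [sigma3, adj_eq, h1, Matrix.mul_apply, Fin.sum_univ_two] <;> ring
  unfold matB matK
  rw [this]

/-- The constant term of the logarithmic derivative, seen from the other end, is (Θ₀/2)K - (ix/2)Z.
Multiplying by K and taking traces gives Θ₀, since tr K² = 2 and tr(ZK) = 0 by
`Asym.trace_relation`. -/
theorem trace_rel (h : SolPair n m x β Ψ a1 b0 b1) :
    -(thetaInf n m) * matK b0 0 0 - I * x * a1 0 1 * matK b0 1 0 + I * x * a1 1 0 * matK b0 0 1
      = theta0 n m := by
  have h0 := h.det_b0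
  rw [Matrix.det_fin_two] at h0
  have h1 := h.mirror.trace_relation (fun μ => by rw [h.mirror_det, h.det_b0])
  have h1' := congrArg Matrix.trace h1
  have hs := matK_sq h.det_b0
  have hθ : thetaInf (1 - n) m = theta0 n m := by
    unfold thetaInf theta0; push_cast; ring
  have h2 := (h.main.logDeriv h.mirror 0).2
  rw [h.laxConst_eq, hθ] at h2
  have e := fun i j => congrFun (congrFun h2 i) j
  have e00 := e 0 0
  have e01 := e 0 1
  have e10 := e 1 0
  have e11 := e 1 1
  have hK : ∀ i j, (b0 * sigma3 * b0.adjugate) i j = matK b0 i j := fun _ _ => rfl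
  set Z := b1 * sigma3 * b0.adjugate + b0 * sigma3 * b1.adjugate with hZ
  have hZK : Z 0 0 * matK b0 0 0 + Z 0 1 * matK b0 1 0 + Z 1 0 * matK b0 0 1
      + Z 1 1 * matK b0 1 1 = 0 := by
    simp [Matrix.trace_fin_two, adj_eq, Matrix.mul_apply, Fin.sum_univ_two] at h1'
    simp [hZ, matK, sigma3, adj_eq, Matrix.mul_apply, Fin.sum_univ_two]
    linear_combination (b0 0 0 * b0 1 1 - b0 0 1 * b0 1 0) * h1'
  simp [laxConst, ← hZ, hK] at e00 e01 e10 e11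
  have h11 := matK_one_one b0
  rw [h11] at hZK e11
  linear_combination matK b0 0 0 * e00 + matK b0 1 0 * e01 + matK b0 0 1 * e10
    - matK b0 0 0 * e11 + theta0 n m * hs - (I * x / 2) * hZK

theorem logDer_eq (h : SolPair n m x β Ψ a1 b0 b1) (μ : ℂ) :
    logDer Ψ μ = (x * exp μ / 2) • sigma3
      + !![-(thetaInf n m / 2), -(I * x * a1 0 1); I * x * a1 1 0, thetaInf n m / 2]
      - (x * exp (-μ) / 2) • matK b0 := by
  rw [← h.laxConst_eq]
  exact (h.main.logDeriv h.mirror μ).1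

end SolPair

theorem hasDerivAt_matB (a1 b0 : Mat) (μ : ℂ) :
    HasDerivAt (matB a1 b0) ((exp μ / 2) • sigma3 - (exp (-μ) / 2) • matK b0) μ := by
  have h1 : HasDerivAt (fun μ : ℂ => (exp μ / 2) • sigma3) ((exp μ / 2) • sigma3) μ :=
    ((Complex.hasDerivAt_exp μ).div_const 2).smul_const _
  have h2 : HasDerivAt (fun μ : ℂ => (exp (-μ) / 2) • matK b0) ((exp (-μ) * -1 / 2) • matK b0) μ :=
    (((Complex.hasDerivAt_exp (-μ)).comp μ (hasDerivAt_neg μ)).div_const 2).smul_const _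
  have h3 := (h1.add_const ((I / 2) • (a1 * sigma3 + sigma3 * a1.adjugate))).add h2
  refine HasDerivAt.congr_deriv h3 ?_
  rw [mul_neg_one, neg_div, neg_smul, sub_eq_add_neg]

namespace SolFamily

variable {n : ℤ} {m x : ℂ} {β : ℝ} {Φ : ℂ → ℂ → Mat} {a1 b0 b1 : ℂ → Mat}

theorem hasDerivAt_entries (hΦ : SolFamily n m x β Φ a1 b0 b1) (μ : ℂ) (i j : Fin 2) :
    HasDerivAt (fun z => logDer (Φ z) μ i j) (((exp μ / 2) • sigma3 - (exp (-μ) / 2) • matK (b0 x)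
      + matB (a1 x) (b0 x) μ * logDer (Φ x) μ
      + logDer (Φ x) μ * (matB (a1 x) (b0 x) μ).adjugate) i j) x := by
  have h := hΦ.hasDerivAt_logDer μ
  have e : deriv (matB (a1 x) (b0 x)) μ = _ := (hasDerivAt_matB (a1 x) (b0 x) μ).deriv
  rw [e] at h
  exact hasDerivAt_mat.1 h i j

theorem exp_pi_I_eq : exp (Real.pi * I) = -1 ∧ exp (-(Real.pi * I)) = -1 := by
  refine ⟨exp_pi_mul_I, ?_⟩
  rw [exp_neg, exp_pi_mul_I]; norm_num

/-- The zero-curvature equation is evaluated at μ = 0 and μ = πi, where e^μ = ±1. Half the sum of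
the two values of the logarithmic derivative is its constant term, and their difference is x(K -
σ₃). These two points suffice to separate the potentials. -/
theorem hasDerivAt_potentials (hΦ : SolFamily n m x β Φ a1 b0 b1) :
    HasDerivAt (fun z => -(I * z * a1 z 0 1))
      (-(x * matK (b0 x) 0 1) - thetaInf n m * I * a1 x 0 1) x ∧
    HasDerivAt (fun z => I * z * a1 z 1 0)
      (x * matK (b0 x) 1 0 - thetaInf n m * I * a1 x 1 0) x ∧
    HasDerivAt (fun z => z * matK (b0 z) 0 0) (matK (b0 x) 0 0
      - 2 * x * I * (matK (b0 x) 0 1 * a1 x 1 0 + matK (b0 x) 1 0 * a1 x 0 1)) x ∧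
    HasDerivAt (fun z => z * matK (b0 z) 0 1) (matK (b0 x) 0 1 
      + 4 * x * I * matK (b0 x) 0 0 * a1 x 0 1 - thetaInf n m * matK (b0 x) 0 1) x ∧
    HasDerivAt (fun z => z * matK (b0 z) 1 0) (matK (b0 x) 1 0 
      + 4 * x * I * matK (b0 x) 0 0 * a1 x 1 0 + thetaInf n m * matK (b0 x) 1 0) x := by
  obtain ⟨E1, E2⟩ := exp_pi_I_eq
  have h0 := hΦ.hasDerivAt_entries 0
  have h1 := hΦ.hasDerivAt_entries (Real.pi * I)
  have eK := matK_eq (b0 x)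
  set K := matK (b0 x) with hK
  set k := K 0 0
  set a := K 0 1
  set b := K 1 0
  rw [hΦ.self.logDer_eq, hΦ.self.matB_eq, ← hK, eK] at h0 h1
  simp only [E1, E2, exp_zero, neg_zero] at h0 h1
  have half : ∀ {f : ℂ → ℂ} (i j) {f' : ℂ}, (∀ z, SolPair n m z β (Φ z) (a1 z) (b0 z) (b1 z) →
      f z = (logDer (Φ z) 0 i j + logDer (Φ z) (Real.pi * I) i j) / 2) → _ → HasDerivAt f f' x :=
    fun i j f' hf (hf' : _ = f') => ((((h0 i j).add (h1 i j)).div_const 2).congr_of_eventuallyEq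
      (hΦ.pair.mono fun z hz => hf z hz)).congr_deriv hf'
  have diff : ∀ {f : ℂ → ℂ} (i j) {f' : ℂ}, (∀ z, SolPair n m z β (Φ z) (a1 z) (b0 z) (b1 z) →
      f z = z * sigma3 i j + (logDer (Φ z) (Real.pi * I) i j - logDer (Φ z) 0 i j)) → _ →
      HasDerivAt f f' x :=
    fun i j f' hf (hf' : _ = f') => ((((hasDerivAt_id x).mul_const (sigma3 i j)).add
      ((h1 i j).sub (h0 i j))).congr_of_eventuallyEq
      (hΦ.pair.mono fun z hz => hf z hz)).congr_deriv hf'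
  refine ⟨half 0 1 (fun z hz => ?_) ?_, half 1 0 (fun z hz => ?_) ?_, diff 0 0 (fun z hz => ?_) ?_,
    diff 0 1 (fun z hz => ?_) ?_, diff 1 0 (fun z hz => ?_) ?_⟩
  all_goals first
    | (rw [hz.logDer_eq, hz.logDer_eq]
       simp [sigma3, E1, E2]
       try ring)
    | (simp [sigma3]
       try ring)

end SolFamily

end

/-! ### Return to the variable λ. -/

section

open scoped Matrix.Norms.Operator

theorem matK_mul_expSigma3 (b : Mat) (d : ℂ) : matK (b * expSigma3 d) = matK b := by
  have h : expSigma3 d * sigma3 * (expSigma3 d).adjugate = sigma3 := by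
    have := exp_ne_zero d
    ext i j
    fin_cases i <;> fin_cases j <;>
      simp [expSigma3, sigma3, Matrix.mul_apply, Fin.sum_univ_two, exp_neg, this]
  unfold matK
  rw [Matrix.adjugate_mul_distrib]
  calc _ = b * (expSigma3 d * sigma3 * (expSigma3 d).adjugate) * b.adjugate := by
        simp only [mul_assoc]
    _ = _ := by rw [h]

theorem det_side (m z : ℂ) : (side m z).det = 1 := by
  unfold side
  split_ifs
  · exact Matrix.det_one
  · simp [VInfUp]

theorem ne_neg_I_of_notMem_contour {x l : ℂ} (h : l ∉ contour x) : l ≠ 0 ∧ l ≠ -I := by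
  refine ⟨fun h0 => h (Or.inl h0), ?_⟩
  rintro rfl
  refine h (Or.inr ?_)
  rw [zeta_eq x (by simp)]
  simp

/-- The coordinate on the universal cover in which `λ = -i exp μ`. -/
def coord (x l : ℂ) : ℂ := branchLog x l + I * (Real.pi / 2)

theorem lam_coord {x l : ℂ} (hx : x ≠ 0) (h : l ∉ contour x) : lam (coord x l) = l := by
  obtain ⟨h0, h1⟩ := ne_neg_I_of_notMem_contour h
  rw [← exp_eq_lam, coord, add_sub_cancel_right, exp_branchLog hx h0 h1]

theorem exp_coord {x l : ℂ} (hx : x ≠ 0) (h : l ∉ contour x) : exp (coord x l) = I * l := by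
  conv_rhs => rw [← lam_coord hx h]
  rw [lam, ← mul_assoc, mul_neg, I_mul_I, neg_neg, one_mul]

theorem eventually_side_eq {f : ℂ → ℂ} {a m : ℂ} (hf : ContinuousAt f a) (h : (f a).im ≠ 0) :
    ∀ᶠ z in 𝓝 a, side m (f z) = side m (f a) ∧ (f z).im ≠ 0 := by
  have hc : ContinuousAt (fun z => (f z).im) a := continuous_im.continuousAt.comp hf
  rcases lt_or_gt_of_ne h with h1 | h1
  · filter_upwards [hc.eventually_lt_const h1] with z hz
    exact ⟨by rw [side, side, if_neg hz.not_gt, if_neg h1.not_gt], hz.ne⟩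
  · filter_upwards [hc.eventually_const_lt h1] with z hz
    exact ⟨by rw [side, side, if_pos hz, if_pos h1], hz.ne'⟩

theorem IsCont.eq_mul_adj {n : ℤ} {m x : ℂ} {F Φ : ℂ → Mat} (hx : x ≠ 0) (h : IsCont n m x F Φ)
    {l : ℂ} (hl : l ∉ contour x) :
    F l = Φ (coord x l) * (side m (zeta x l)).adjugate := by
  have e := lam_coord hx hl
  have h1 := h (coord x l) 0 (by rwa [e]) (by rw [e, coord]; push_cast; ring)
  rw [e, zpow_zero, Units.val_one, mul_one] at h1
  rw [h1, mul_assoc, mul_adj_self (det_side _ _), mul_one]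

theorem notMem_contour {x l : ℂ} (h0 : l ≠ 0) (h : (zeta x l).im ≠ 0) : l ∉ contour x := by
  rintro (h1 | h1)
  exacts [h0 h1, h h1]

theorem zeta_im_ne_zero {x l : ℂ} (h : l ∉ contour x) : (zeta x l).im ≠ 0 := fun h1 => h (Or.inr h1)

theorem hasDerivAt_coord {x l : ℂ} (hx : x ∈ slitPlane) (h : l ∉ contour x) :
    HasDerivAt (coord x) l⁻¹ l := by
  obtain ⟨h0, -⟩ := ne_neg_I_of_notMem_contour h
  have hx0 := slitPlane_ne_zero hx
  have hd : HasDerivAt (coord x) (deriv (branchLog x) l) l :=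
    (differentiableAt_branchLog hx h0 (neg_zeta_mem_slitPlane h)).hasDerivAt.add_const _
  have h1 : HasDerivAt (fun w => exp (coord x w)) (exp (coord x l) * deriv (branchLog x) l) l := hd.cexp
  have h2 : HasDerivAt (fun w => I * w) (I * 1) l := (hasDerivAt_id l).const_mul I
  have h3 : (fun w => exp (coord x w)) =ᶠ[𝓝 l] fun w => I * w := by
    filter_upwards [eventually_side_eq (m := 0) (continuousAt_zeta h0) (zeta_im_ne_zero h),
      eventually_ne_nhds h0] with w hw hw0
    exact exp_coord hx0 (notMem_contour hw0 hw.2)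
  have h4 := h1.unique (h2.congr_of_eventuallyEq h3)
  rw [exp_coord hx0 h] at h4
  refine hd.congr_deriv (eq_inv_of_mul_eq_one_right ?_)
  have := I_ne_zero
  field_simp at h4
  linear_combination h4

/-- At fixed λ the coordinate is a logarithm of iλ that is continuous in x, hence locally constant.
So differentiating the solution in x at fixed λ is the same as at fixed μ, although the branch and
the contour depend on x. -/
theorem eventually_coord_eq {m x l : ℂ} (hx : x ∈ slitPlane) (h : l ∉ contour x) :
    ∀ᶠ z in 𝓝 x, coord z l = coord x l ∧ side m (zeta z l) = side m (zeta x l) ∧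
      l ∉ contour z ∧ z ≠ 0 := by
  obtain ⟨h0, h1⟩ := ne_neg_I_of_notMem_contour h
  have hx0 := slitPlane_ne_zero hx
  have hz := neg_zeta_mem_slitPlane h
  have hzc : ContinuousAt (fun z => zeta z l) x := by unfold zeta; fun_prop
  have hne : (-zeta x l) ^ (1 / 2 : ℂ) ≠ 0 := by
    rw [Ne, cpow_eq_zero_iff]
    exact fun h => slitPlane_ne_zero hz h.1
  have hroot : ContinuousAt (fun z => branchRoot z l) x := by
    unfold branchRoot
    exact (continuousAt_const.mul (continuousAt_id.cpow continuousAt_const hx)).div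
      (hzc.neg.cpow continuousAt_const hz) hne
  have hlog : ContinuousAt (fun z => coord z l) x := by
    unfold coord branchLog
    exact ((continuousAt_const.mul (hroot.clog (branchRoot_mem_slitPlane hx h0 hz))).add
      continuousAt_const).add continuousAt_const
  filter_upwards [eventually_side_eq (m := m) hzc (zeta_im_ne_zero h), eventually_ne_nhds hx0,
    hlog (Metric.ball_mem_nhds _ one_pos)] with z h2 h3 h4
  have h5 := notMem_contour h0 h2.2
  refine ⟨?_, h2.1, h5, h3⟩
  obtain ⟨k, hk⟩ := exists_int_of_exp_eq ((exp_coord h3 h5).trans (exp_coord hx0 h).symm)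
  have h4' : ‖coord z l - coord x l‖ < 1 := by simpa [dist_eq_norm] using h4
  rw [hk, add_sub_cancel_left] at h4'
  have hk0 : k = 0 := by
    by_contra hk0
    have h6 : (1 : ℝ) ≤ |(k : ℝ)| := by exact_mod_cast Int.one_le_abs hk0
    simp only [norm_mul, norm_ofNat, norm_I, norm_real, norm_intCast, mul_one,
      Real.norm_of_nonneg Real.pi_pos.le] at h4'
    have := Real.pi_gt_three
    nlinarith
  rw [hk, hk0]; simp

/-- The coefficient of `λ⁻²` in the first Lax matrix. -/
def matM (c0 : ℂ → ℕ → Mat) (x : ℂ) : Mat := (I * x / 2) • matK (c0 x 0)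

/-- The matrix on the left is polynomial in the leading coefficient at 0, so it provides the
extension over the zeros of its (1,1) entry. -/
theorem matM_eq_laxM {c0 : ℂ → ℕ → Mat} {x : ℂ} (hdet : (c0 x 0).det = 1) (h : c0 x 0 0 0 ≠ 0) :
    matM c0 x = laxM x (potS c0 x) (potT c0 x) := by
  rw [Matrix.det_fin_two] at hdet
  ext i j
  fin_cases i <;> fin_cases j <;>
    simp [matM, laxM, matK, sigma3, adj_eq, Matrix.mul_apply, Fin.sum_univ_two, potS, potT] <;>
    field_simp
  · linear_combination x * hdet
  · ring
  · linear_combination (2 * x * c0 x 0 1 0) * hdet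
  · linear_combination -x * hdet

theorem matB_coord {n : ℤ} {m x l : ℂ} {β : ℝ} {Ψ : ℂ → Mat} {cInf c0 : ℂ → ℕ → Mat} {b1 : Mat}
    {d : ℂ} (hx : x ≠ 0) (hl : l ∉ contour x)
    (h : SolPair n m x β Ψ (cInf x 1) (c0 x 0 * expSigma3 d) b1) :
    matB (cInf x 1) (c0 x 0 * expSigma3 d) (coord x l)
      = laxB x (potY cInf x) (potV cInf x) (matM c0 x) l := by
  have h0 := (ne_neg_I_of_notMem_contour hl).1
  rw [h.matB_eq, matK_mul_expSigma3, exp_neg, exp_coord hx hl, mul_inv, inv_I]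
  unfold matM laxB potY potV
  ext i j
  fin_cases i <;> fin_cases j <;> simp [sigma3] <;> field_simp <;> ring

theorem logDer_coord {n : ℤ} {m x l : ℂ} {β : ℝ} {Ψ : ℂ → Mat} {cInf c0 : ℂ → ℕ → Mat} {b1 : Mat}
    {d : ℂ} (hx : x ≠ 0) (hl : l ∉ contour x)
    (h : SolPair n m x β Ψ (cInf x 1) (c0 x 0 * expSigma3 d) b1) :
    l⁻¹ • logDer Ψ (coord x l)
      = laxA (thetaInf n m) x (potY cInf x) (potV cInf x) (matM c0 x) l := by
  have h0 := (ne_neg_I_of_notMem_contour hl).1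
  rw [h.logDer_eq, matK_mul_expSigma3, exp_neg, exp_coord hx hl, mul_inv, inv_I]
  unfold matM laxA potY potV
  ext i j
  fin_cases i <;> fin_cases j <;> simp [sigma3] <;> field_simp <;> ring

end

/-! ### The Lax system and the equations of the potentials in the original variables. -/

section

open scoped Matrix.Norms.Operator

/-- The solutions of the inverse monodromy problems for `x ∈ D`, continued to the cylinder. -/
theorem exists_solFamily {n : ℤ} {m : ℂ} {D : Set ℂ} (hDo : IsOpen D) (hDs : D ⊆ slitPlane)
    {Psi : ℂ → ℂ → Mat} {cInf c0 : ℂ → ℕ → Mat}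
    (hsol : ∀ x ∈ D, IsSolution n m x (Psi x) (cInf x) (c0 x)) :
    ∃ (d : ℂ) (Φ : ℂ → ℂ → Mat), ∀ x ∈ D, IsCont n m x (Psi x) (Φ x) ∧
      SolFamily n m x (-arg x) Φ (fun z => cInf z 1) (fun z => c0 z 0 * expSigma3 d)
        (fun z => -(c0 z 1 * expSigma3 d)) := by
  choose! Φ h1 h2 using fun x (hx : x ∈ D) => (hsol x hx).exists_asym (hDs hx)
  refine ⟨theta0 n m / 2 * (I * Real.pi), Φ, fun x hx => ⟨h1 x hx, slitPlane_ne_zero (hDs hx), by simp, ?_⟩⟩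
  have hc : ContinuousAt (fun z => |-arg x + arg z|) x :=
    (continuousAt_const.add (continuousAt_arg (hDs hx))).abs
  have h3 : |-arg x + arg x| < 1 / 8 := by simp
  filter_upwards [hDo.mem_nhds hx, hc.eventually_lt_const h3] with z hz hz2
  obtain ⟨h4, h5⟩ := h2 z hz _ hz2
  exact ⟨h4, h5⟩

section

variable {n : ℤ} {m x d : ℂ} {β : ℝ} {Φ Psi : ℂ → ℂ → Mat} {cInf c0 : ℂ → ℕ → Mat} {b1 : ℂ → Mat}

theorem SolFamily.hasDerivAt_lambda (hx : x ∈ slitPlane) (hc : IsCont n m x (Psi x) (Φ x))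
    (h : SolFamily n m x β Φ (fun z => cInf z 1) (fun z => c0 z 0 * expSigma3 d) b1)
    {l : ℂ} (hl : l ∉ contour x) :
    HasDerivAt (Psi x) (laxA (thetaInf n m) x (potY cInf x) (potV cInf x) (matM c0 x) l * Psi x l)
      l := by
  obtain ⟨h0, -⟩ := ne_neg_I_of_notMem_contour hl
  have hx0 := slitPlane_ne_zero hx
  have h1 : HasDerivAt (Φ x ∘ coord x) (l⁻¹ • deriv (Φ x) (coord x l)) l :=
    HasDerivAt.scomp l (h.self.main.diff _).hasDerivAt (hasDerivAt_coord hx hl)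
  have h2 := h1.mul_const (side m (zeta x l)).adjugate
  refine (h2.congr_of_eventuallyEq ?_).congr_deriv ?_
  · filter_upwards [eventually_side_eq (m := m) (continuousAt_zeta h0) (zeta_im_ne_zero hl),
      eventually_ne_nhds h0] with w hw hw0
    rw [hc.eq_mul_adj hx0 (notMem_contour hw0 hw.2), hw.1]
    rfl
  · rw [← logDer_coord hx0 hl h.self, hc.eq_mul_adj hx0 hl]
    simp only [logDer, smul_mul_assoc, mul_assoc]
    rw [← mul_assoc (Φ x (coord x l)).adjugate, adj_mul_self (h.self.det_eq_one _), one_mul]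

theorem SolFamily.hasDerivAt_x (hx : x ∈ slitPlane) (hc : ∀ᶠ z in 𝓝 x, IsCont n m z (Psi z) (Φ z))
    (h : SolFamily n m x β Φ (fun z => cInf z 1) (fun z => c0 z 0 * expSigma3 d) b1)
    {l : ℂ} (hl : l ∉ contour x) :
    HasDerivAt (fun z => Psi z l)
      (laxB x (potY cInf x) (potV cInf x) (matM c0 x) l * Psi x l) x := by
  have hx0 := slitPlane_ne_zero hx
  have h2 := (h.hasDerivAt_param (coord x l)).mul_const (side m (zeta x l)).adjugate
  refine (h2.congr_of_eventuallyEq ?_).congr_deriv ?_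
  · filter_upwards [eventually_coord_eq (m := m) hx hl, hc] with z ⟨h3, h4, h5, h6⟩ h7
    rw [h7.eq_mul_adj h6 h5, h3, h4]
  · rw [← matB_coord hx0 hl h.self, hc.self_of_nhds.eq_mul_adj hx0 hl, mul_assoc]

theorem SolPair.det_c0 {Ψ : ℂ → Mat} {a1 c b1 : Mat} (h : SolPair n m x β Ψ a1 (c * expSigma3 d) b1) :
    c.det = 1 := by
  have := h.det_b0
  rwa [Matrix.det_mul, det_expSigma3, mul_one] at this

theorem SolFamily.hasDerivAt_pot
    (h : SolFamily n m x β Φ (fun z => cInf z 1) (fun z => c0 z 0 * expSigma3 d) b1) :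
    HasDerivAt (potY cInf) (2 * I * matM c0 x 0 1 + thetaInf n m * potY cInf x / x) x ∧
    HasDerivAt (fun z => matM c0 z 0 0) (matM c0 x 0 0 / x
      + 2 / x * (potY cInf x * matM c0 x 1 0 - matM c0 x 0 1 * potV cInf x)) x ∧
    HasDerivAt (fun z => matM c0 z 0 1) (matM c0 x 0 1 * (1 - thetaInf n m) / x
      - 4 * potY cInf x * matM c0 x 0 0 / x) x ∧
    HasDerivAt (fun z => matM c0 z 1 0) (matM c0 x 1 0 * (1 + thetaInf n m) / x
      + 4 * potV cInf x * matM c0 x 0 0 / x) x := by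
  have hx0 := h.ne_zero
  obtain ⟨h1, -, h3, h4, h5⟩ := h.hasDerivAt_potentials
  simp only [matK_mul_expSigma3] at h1 h3 h4 h5
  have e : ∀ i j, (fun z => matM c0 z i j) = fun z => I / 2 * (z * matK (c0 z 0) i j) := fun i j => by
    funext z; simp [matM]; ring
  rw [e, e, e]
  refine ⟨h1.congr_deriv ?_, (h3.const_mul (I / 2)).congr_deriv ?_,
    (h4.const_mul (I / 2)).congr_deriv ?_, (h5.const_mul (I / 2)).congr_deriv ?_⟩ <;>
  · simp [potY, potV, matM]
    field_simp
    ring_nf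
    try (simp only [I_sq]; try ring)

end

end

/-! ### Exclusion of triangular solutions. -/

section

open scoped Matrix.Norms.Operator

theorem HalfAsymp.tendsto {Θ x : ℂ} {lo hi lo' hi' : ℝ} {Ψ : ℂ → Mat} {a0 a1 : Mat}
    (h : HalfAsymp Θ x lo hi Ψ a0 a1) (h1 : lo < lo') (h2 : hi' < hi) :
    Tendsto (fun μ => Ψ μ * expSigma3 (dd Θ x μ)) (stripAt lo' hi') (𝓝 a0) := by
  have hl := tendsto_inv_lam_stripAt (lo := lo') (hi := hi')
  have h3 := (h.isBigO h1 h2).trans_tendsto (by simpa using hl.pow 2)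
  have h4 := (h3.add (hl.smul_const a1)).add_const a0
  rw [zero_smul, zero_add, zero_add] at h4
  exact h4.congr fun μ => by abel

theorem tendsto_exp_two_dd (Θ : ℂ) {x : ℂ} (hx : x ≠ 0) {β : ℝ} (hβ : |β + arg x| < 1 / 8) :
    Tendsto (fun μ => exp (2 * dd Θ x μ)) (stripAt β β) (𝓝 0) := by
  obtain ⟨C, hC, h⟩ := norm_exp_two_dd_le Θ hx
  refine squeeze_zero_norm' (eventually_stripAt.2 ⟨0, fun μ h0 h1 => ?_⟩)
    (by simpa using tendsto_exp_neg_stripAt.const_mul C)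
  have h2 : μ.im = β := le_antisymm h1.2 h1.1
  have h3 := abs_le.1 (abs_arg_le_pi x)
  have h4 := abs_lt.1 hβ
  have h5 := Real.pi_lt_four
  refine (h μ h0 (by rw [h2, abs_le]; constructor <;> linarith)
    (half_le_cos (by rw [h2]; linarith))).trans ?_
  have : 0 ≤ ‖x‖ / 4 * Real.exp μ.re := by positivity
  gcongr
  linarith

namespace SolPair

variable {n : ℤ} {m x : ℂ} {β : ℝ} {Ψ : ℂ → Mat} {a1 b0 b1 : Mat}

theorem hasDerivAt (h : SolPair n m x β Ψ a1 b0 b1) (μ : ℂ) :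
    HasDerivAt Ψ (logDer Ψ μ * Ψ μ) μ := by
  have := (h.main.diff μ).hasDerivAt
  rwa [logDer, mul_assoc, adj_mul_self (h.det_eq_one μ), mul_one]

/-- If the differential equation is lower triangular, then so is the solution. -/
theorem upper_eq_zero (hx : x ≠ 0) (hβ : |β + arg x| < 1 / 8) (h : SolPair n m x β Ψ a1 b0 b1)
    (h1 : a1 0 1 = 0) (h2 : matK b0 0 1 = 0) (μ : ℂ) : Ψ μ 0 1 = 0 := by
  -- An antiderivative of the (1,1) entry of the logarithmic derivative. In the triangular case both
  -- entries of the first row are constant multiples of e^g.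
  set g : ℂ → ℂ := fun μ => x * exp μ / 2 - thetaInf n m / 2 * μ + x * exp (-μ) / 2 * matK b0 0 0 with hg
  have hgd : ∀ μ, HasDerivAt g (logDer Ψ μ 0 0) μ := fun μ => by
    have e1 : HasDerivAt (fun μ : ℂ => x * exp μ / 2) (x * exp μ / 2) μ :=
      ((Complex.hasDerivAt_exp μ).const_mul x).div_const 2
    have e2 : HasDerivAt (fun μ : ℂ => x * exp (-μ) / 2 * matK b0 0 0)
        (x * (exp (-μ) * -1) / 2 * matK b0 0 0) μ :=
      ((((Complex.hasDerivAt_exp (-μ)).comp μ (hasDerivAt_neg μ)).const_mul x).div_const 2).mul_const _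
    refine ((e1.sub ((hasDerivAt_id μ).const_mul _)).add e2).congr_deriv ?_
    rw [h.logDer_eq]
    simp [sigma3]
    ring
  have hrow : ∀ j μ, Ψ μ 0 j * exp (-g μ) = Ψ 0 0 j * exp (-g 0) := fun j μ => by
    have hd : ∀ μ, HasDerivAt (fun μ => Ψ μ 0 j * exp (-g μ)) 0 μ := fun μ => by
      have e1 := hasDerivAt_mat.1 (h.hasDerivAt μ) 0 j
      refine (e1.mul (hgd μ).neg.cexp).congr_deriv ?_
      have e3 : logDer Ψ μ 0 1 = 0 := by
        rw [h.logDer_eq]; simp [sigma3, h1, h2]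
      rw [Matrix.mul_apply, Fin.sum_univ_two, e3]
      simp only [Pi.neg_apply]
      ring
    exact is_const_of_deriv_eq_zero (fun μ => (hd μ).differentiableAt) (fun μ => (hd μ).deriv) μ 0
  have hcross : ∀ μ, Ψ 0 0 1 * Ψ μ 0 0 = Ψ 0 0 0 * Ψ μ 0 1 := fun μ => by
    have e0 := hrow 0 μ
    have e1 := hrow 1 μ
    have n1 := exp_ne_zero (-g μ)
    have n2 := exp_ne_zero (-g 0)
    refine mul_right_cancel₀ (mul_ne_zero n1 n2) ?_
    linear_combination Ψ 0 0 1 * exp (-g 0) * e0 - Ψ 0 0 0 * exp (-g 0) * e1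
  have ht := h.main.asympP.tendsto (lo' := β) (hi' := β) (by linarith) (by linarith [Real.pi_pos])
  have ht' := fun i j => tendsto_pi_nhds.1 (tendsto_pi_nhds.1 ht i) j
  have t0 : Tendsto (fun μ => Ψ μ 0 0 * exp (dd (thetaInf n m) x μ)) (stripAt β β) (𝓝 1) := by
    simpa [expSigma3, Matrix.mul_apply, Fin.sum_univ_two] using ht' 0 0
  have t1 : Tendsto (fun μ => Ψ μ 0 1 * exp (-dd (thetaInf n m) x μ)) (stripAt β β) (𝓝 0) := by
    simpa [expSigma3, Matrix.mul_apply, Fin.sum_univ_two] using ht' 0 1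
  have t2 := tendsto_exp_two_dd (thetaInf n m) hx hβ
  -- On the line Im μ = β the entries of the first row, times e^d and e^{-d} respectively, tend to 1
  -- and 0, while e^{2d} tends to 0. Proportionality then forces the coefficient of the second entry
  -- to vanish.
  have hB : Ψ 0 0 1 = 0 := by
    have : Tendsto (fun a : ℝ => (a : ℂ) + β * I) atTop (stripAt β β) :=
      tendsto_inf.2 ⟨tendsto_comap_iff.2 (tendsto_id.congr fun a => by simp),
        tendsto_principal.2 (Eventually.of_forall fun a => by simp)⟩
    have := this.neBot
    have t3 := t0.const_mul (Ψ 0 0 1)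
    have t4 := (t1.mul t2).const_mul (Ψ 0 0 0)
    rw [mul_one] at t3
    rw [mul_zero, mul_zero] at t4
    refine tendsto_nhds_unique t3 (t4.congr fun μ => ?_)
    have e : exp (-dd (thetaInf n m) x μ) * exp (2 * dd (thetaInf n m) x μ)
        = exp (dd (thetaInf n m) x μ) := by rw [← exp_add]; ring_nf
    linear_combination Ψ 0 0 0 * Ψ μ 0 1 * e - exp (dd (thetaInf n m) x μ) * hcross μ
  have hA : Ψ 0 0 0 ≠ 0 := fun hA => by
    have := h.det_eq_one 0
    rw [Matrix.det_fin_two, hA, hB] at this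
    simp at this
  have := hcross μ
  rw [hB, zero_mul] at this
  exact (mul_eq_zero.1 this.symm).resolve_left hA

theorem theta_ne (n : ℤ) (m : ℂ) : thetaInf n m ≠ theta0 n m := fun h => by
  have h1 : ((1 : ℤ) : ℂ) = ((2 * n : ℤ) : ℂ) := by
    unfold thetaInf theta0 at h; push_cast; linear_combination h
  have h2 : (1 : ℤ) = 2 * n := by exact_mod_cast h1
  omega

/-- In the triangular case K₁₁ = ±1 and the trace relation reads -Θ_∞K₁₁ = Θ₀. For K₁₁ = 1 this
means m = -1/2. The solution is then lower triangular, hence so is the monodromy matrix, but its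
upper right entry is a non-zero multiple of 1/Γ(1). For K₁₁ = -1 it means Θ_∞ = Θ₀, which fails by
parity. -/
theorem not_lower_triangular (hx : x ≠ 0) (hβ : |β + arg x| < 1 / 8)
    (h : SolPair n m x β Ψ a1 b0 b1) : ¬(a1 0 1 = 0 ∧ matK b0 0 1 = 0) := by
  rintro ⟨h1, h2⟩
  have hs := matK_sq h.det_b0
  have htr := h.trace_rel
  rw [h1, h2] at htr
  rw [h2] at hs
  rcases eq_or_eq_neg_of_sq_eq_sq (matK b0 0 0) 1 (by linear_combination hs) with h3 | h3
  · rw [h3] at htr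
    have hm : m = -(1 / 2) := by
      unfold thetaInf theta0 at htr; linear_combination -htr / 2
    have h0 := h.upper_eq_zero hx hβ h1 h2
    have hp := congrFun (congrFun (h.main.per 0) 0) 1
    rw [h0, Matrix.mul_apply, Fin.sum_univ_two, h0, zero_mul, add_zero] at hp
    have hdet := h.det_eq_one 0
    rw [Matrix.det_fin_two, h0, zero_mul, sub_zero] at hdet
    have hC : monod n m 0 1 = 0 := (mul_eq_zero.1 hp.symm).resolve_left (left_ne_zero_of_mul_eq_one hdet)
    have hn : ((-1 : ℂ) ^ n) ≠ 0 := zpow_ne_zero _ (by norm_num)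
    simp [monod, VInfLow, VInfUp, hn, hm] at hC
    norm_num [Complex.Gamma_one, exp_ne_zero] at hC
    exact (Real.sqrt_pos.2 Real.pi_pos).ne' hC
  · rw [h3] at htr
    exact theta_ne n m (by linear_combination htr)

end SolPair

end

/-! ### The Painlevé-III equation and the non-vanishing of the potentials. -/

section

open scoped Matrix.Norms.Operator

/-- The differential system satisfied by the coefficients of the Lax pair, with the algebraic
relations between them. -/
structure LaxSystem (Θ₀ Θ : ℂ) (y v p q r : ℂ → ℂ) (x : ℂ) : Prop where
  ne_zero : x ≠ 0
  deriv_y : HasDerivAt y (2 * I * q x + Θ * y x / x) x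
  deriv_p : HasDerivAt p (p x / x + 2 / x * (y x * r x - q x * v x)) x
  deriv_q : HasDerivAt q (q x * (1 - Θ) / x - 4 * y x * p x / x) x
  deriv_r : HasDerivAt r (r x * (1 + Θ) / x + 4 * v x * p x / x) x
  det_eq : p x ^ 2 + q x * r x = -(x ^ 2) / 4
  trace_eq : -Θ * p x + y x * r x + v x * q x = I * x * Θ₀ / 2

namespace LaxSystem

variable {Θ₀ Θ x : ℂ} {y v p q r : ℂ → ℂ}

theorem hasDerivAt_u (h : LaxSystem Θ₀ Θ y v p q r x) (hq : q x ≠ 0) :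
    HasDerivAt (fun z => -I * y z / q z) (2 + (2 * Θ - 1) * (-I * y x / q x) / x
      + 4 * I / x * (p x * (-I * y x / q x) ^ 2)) x := by
  have hx := h.ne_zero
  refine ((h.deriv_y.const_mul (-I)).div h.deriv_q hq).congr_deriv ?_
  field_simp
  ring_nf
  simp only [I_sq, I_pow_three]
  ring

/-- The determinant relation removes r and the trace relation removes v, which leaves a closed
system for u = -iy/q and p. -/
theorem deriv_p_eq (h : LaxSystem Θ₀ Θ y v p q r x) (hq : q x ≠ 0) :
    p x / x + 2 / x * (y x * r x - q x * v x) = p x / x + 2 / x * (-2 * I * (-I * y x / q x)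
      * (x ^ 2 / 4 + p x ^ 2) - I * x * Θ₀ / 2 - Θ * p x) := by
  have h1 := h.det_eq
  have h2 := h.trace_eq
  have h3 : -2 * I * (-I * y x / q x) * (x ^ 2 / 4 + p x ^ 2) = 2 * (y x * r x) := by
    have h4 : x ^ 2 / 4 + p x ^ 2 = -(q x * r x) := by linear_combination h1
    rw [h4]
    field_simp
    linear_combination (-(y x * r x)) * I_sq
  rw [h3]
  linear_combination (-2 / x) * h2

/-- The formula for u' holds near x, so it can be differentiated. Substituting u' and p' leaves an
identity of rational functions in x, u and p. -/
theorem piii (h : ∀ᶠ z in 𝓝 x, LaxSystem Θ₀ Θ y v p q r z) (hy : y x ≠ 0) (hq : q x ≠ 0) :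
    PIIIAt Θ₀ Θ (fun z => -I * y z / q z) x := by
  have hx := h.self_of_nhds.ne_zero
  set u : ℂ → ℂ := fun z => -I * y z / q z with hu
  have hu0 : u x ≠ 0 := div_ne_zero (mul_ne_zero (neg_ne_zero.2 I_ne_zero) hy) hq
  have h1 : deriv u =ᶠ[𝓝 x] fun z => 2 + (2 * Θ - 1) * u z / z + 4 * I / z * (p z * u z ^ 2) := by
    filter_upwards [h, h.self_of_nhds.deriv_q.continuousAt.eventually_ne hq] with z hz hqz
    exact (hz.hasDerivAt_u hqz).deriv
  have hd := h.self_of_nhds.hasDerivAt_u hq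
  have hp := h.self_of_nhds.deriv_p
  rw [h.self_of_nhds.deriv_p_eq hq] at hp
  change HasDerivAt u (2 + (2 * Θ - 1) * u x / x + 4 * I / x * (p x * u x ^ 2)) x at hd
  change HasDerivAt p (p x / x + 2 / x * (-2 * I * u x
      * (x ^ 2 / 4 + p x ^ 2) - I * x * Θ₀ / 2 - Θ * p x)) x at hp
  have h2 := (((hd.const_mul (2 * Θ - 1)).div (hasDerivAt_id x) hx).const_add 2).add
    (((hasDerivAt_const x (4 * I)).div (hasDerivAt_id x) hx).mul (hp.mul (hd.pow 2)))
  have h3 : deriv (deriv u) x = _ := (h2.congr_of_eventuallyEq (h1.trans (by rfl))).deriv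
  unfold PIIIAt
  rw [h3, hd.deriv]
  simp only [id_eq, Pi.pow_apply, Pi.div_apply, Pi.mul_apply]
  generalize u x = w at hu0 ⊢
  generalize p x = c
  field_simp
  ring_nf
  simp only [I_sq]
  ring

end LaxSystem

/-- The system is satisfied by the coefficients of a solution of the inverse monodromy problem. -/
theorem SolFamily.laxSystem {n : ℤ} {m x d : ℂ} {β : ℝ} {Φ : ℂ → ℂ → Mat} {cInf c0 : ℂ → ℕ → Mat}
    {b1 : ℂ → Mat} (h : SolFamily n m x β Φ (fun z => cInf z 1) (fun z => c0 z 0 * expSigma3 d) b1) :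
    LaxSystem (theta0 n m) (thetaInf n m) (potY cInf) (potV cInf) (fun z => matM c0 z 0 0)
      (fun z => matM c0 z 0 1) (fun z => matM c0 z 1 0) x := by
  obtain ⟨h1, h2, h3, h4⟩ := h.hasDerivAt_pot
  refine ⟨h.ne_zero, h1, h2, h3, h4, ?_, ?_⟩
  · have := matK_sq h.self.det_c0
    simp only [matM, Matrix.smul_apply, smul_eq_mul]
    linear_combination (I * x / 2) ^ 2 * this + x ^ 2 / 4 * I_sq
  · have := h.self.trace_rel
    simp only [matK_mul_expSigma3] at this
    simp only [matM, potY, potV, Matrix.smul_apply, smul_eq_mul]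
    linear_combination I * x / 2 * this

theorem matM_zero_one (c0 : ℂ → ℕ → Mat) (x : ℂ) : matM c0 x 0 1 = I * potS c0 x := by
  simp [matM, matK, sigma3, adj_eq, Matrix.mul_apply, Fin.sum_univ_two, potS]; ring

section

variable {n : ℤ} {m x d : ℂ} {β : ℝ} {Φ : ℂ → ℂ → Mat} {cInf c0 : ℂ → ℕ → Mat} {b1 : ℂ → Mat}

theorem SolFamily.not_both_zero
    (h : SolFamily n m x β Φ (fun z => cInf z 1) (fun z => c0 z 0 * expSigma3 d) b1) :
    ¬(potY cInf x = 0 ∧ matM c0 x 0 1 = 0) := by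
  rintro ⟨h1, h2⟩
  have hx := h.ne_zero
  refine h.self.not_lower_triangular hx h.angle ⟨?_, ?_⟩
  · simpa [potY, hx] using h1
  · rw [matK_mul_expSigma3]
    simpa [matM, hx] using h2

/-- If y vanished near x, its differential equation would give q = 0 at x as well, and y and q have
no common zero. -/
theorem SolFamily.potY_not_eventually_zero
    (h : SolFamily n m x β Φ (fun z => cInf z 1) (fun z => c0 z 0 * expSigma3 d) b1) :
    ¬∀ᶠ z in 𝓝 x, potY cInf z = 0 := fun h0 => by
  have h1 := h.laxSystem.deriv_y.unique ((hasDerivAt_const x (0 : ℂ)).congr_of_eventuallyEq h0)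
  have hy := h0.self_of_nhds
  refine h.not_both_zero ⟨hy, ?_⟩
  simpa [hy] using h1

/-- If q vanished near x, its equation would give yp = 0 while the determinant relation gives p² =
-x²/4 ≠ 0. Hence y would vanish together with q. -/
theorem SolFamily.matM_zero_one_not_eventually_zero
    (h : SolFamily n m x β Φ (fun z => cInf z 1) (fun z => c0 z 0 * expSigma3 d) b1) :
    ¬∀ᶠ z in 𝓝 x, matM c0 z 0 1 = 0 := fun h0 => by
  have hL := h.laxSystem
  have hx := h.ne_zero
  have h1 := hL.deriv_q.unique ((hasDerivAt_const x (0 : ℂ)).congr_of_eventuallyEq h0)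
  have hq : matM c0 x 0 1 = 0 := h0.self_of_nhds
  have hdet := hL.det_eq
  refine h.not_both_zero ⟨?_, hq⟩
  simp only [hq] at h1 hdet
  have hp : matM c0 x 0 0 ≠ 0 := fun hp => by
    rw [hp] at hdet
    exact hx (pow_eq_zero_iff two_ne_zero |>.1 (by linear_combination 4 * hdet))
  simpa [hx, hp] using h1

/-- The entry `(2, 2)` of the leading coefficient at `0` does not vanish identically. -/
theorem SolFamily.c0_one_one_not_eventually_zero
    (h : SolFamily n m x β Φ (fun z => cInf z 1) (fun z => c0 z 0 * expSigma3 d) b1) :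
    ¬∀ᶠ z in 𝓝 x, c0 z 0 1 1 = 0 := fun h0 => by
  have hL := h.laxSystem
  have hx := h.ne_zero
  have e1 : ∀ z, c0 z 0 1 1 = 0 → matM c0 z 1 0 = 0 := fun z hz => by
    simp [matM, matK, sigma3, adj_eq, Matrix.mul_apply, Fin.sum_univ_two, hz]
  -- With r vanishing near x and p = -ix/2, the equation for r gives v = 0, and the trace relation
  -- then becomes Θ_∞ = Θ₀, which is impossible.
  have h1 := hL.deriv_r.unique ((hasDerivAt_const x (0 : ℂ)).congr_of_eventuallyEq (h0.mono e1))
  have hr := e1 x h0.self_of_nhds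
  have hp : matM c0 x 0 0 = -(I * x / 2) := by
    have hd := h.self.det_c0
    rw [Matrix.det_fin_two, h0.self_of_nhds] at hd
    simp [matM, matK, sigma3, adj_eq, Matrix.mul_apply, Fin.sum_univ_two, h0.self_of_nhds]
    linear_combination (-(I * x / 2)) * hd
  have htr := hL.trace_eq
  simp only [hr, hp] at h1 htr
  have hv : potV cInf x = 0 := by simpa [hx] using h1
  rw [hv] at htr
  refine SolPair.theta_ne n m ?_
  have h2 : I * x / 2 * (thetaInf n m - theta0 n m) = 0 := by linear_combination htr
  rcases mul_eq_zero.1 h2 with h3 | h3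
  · simp [hx] at h3
  · exact sub_eq_zero.1 h3

end

theorem eventually_codiscreteWithin_ne_zero {D : Set ℂ} {f : ℂ → ℂ} (hf : ∀ x ∈ D, AnalyticAt ℂ f x)
    (h0 : ∀ x ∈ D, ¬∀ᶠ z in 𝓝 x, f z = 0) : ∀ᶠ x in codiscreteWithin D, f x ≠ 0 := by
  refine mem_codiscreteWithin_iff_forall_mem_nhdsNE.2 fun x hx => ?_
  have := (hf x hx).eventually_eq_zero_or_eventually_ne_zero.resolve_left (h0 x hx)
  exact mem_of_superset this Set.subset_union_left

end

end

end PIII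

theorem mainTheorem3 (n : ℤ) (m : ℂ) (D : Set ℂ) (hDo : IsOpen D) (hDc : IsConnected D)
    (hDs : D ⊆ Complex.slitPlane) (Psi : ℂ → ℂ → PIII.Mat) (cInf c0 : ℂ → ℕ → PIII.Mat)
    (hsol : ∀ x ∈ D, PIII.IsSolution n m x (Psi x) (cInf x) (c0 x)) :
    -- the Lax pair, the coefficient `M` extending analytically over the poles of `t`
    (∃ M : ℂ → PIII.Mat,
      (∀ i j, DifferentiableOn ℂ (fun x => M x i j) D) ∧
      (∀ x ∈ D, c0 x 0 0 0 ≠ 0 → M x = PIII.laxM x (PIII.potS c0 x) (PIII.potT c0 x)) ∧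
      ∀ x ∈ D, ∀ l ∉ PIII.contour x, ∀ i j,
        HasDerivAt (fun z => Psi x z i j)
          ((PIII.laxA (PIII.thetaInf n m) x (PIII.potY cInf x) (PIII.potV cInf x) (M x) l
            * Psi x l) i j) l ∧
        HasDerivAt (fun z => Psi z l i j)
          ((PIII.laxB x (PIII.potY cInf x) (PIII.potV cInf x) (M x) l * Psi x l) i j) x) ∧
    -- non-vanishing of the entries of the leading coefficient at `0`
    (∃ x ∈ D, c0 x 0 0 0 ≠ 0) ∧ (∃ x ∈ D, c0 x 0 0 1 ≠ 0) ∧ (∃ x ∈ D, c0 x 0 1 1 ≠ 0) ∧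
    -- the Painlevé-III equation
    PIII.IsMeromorphicPIIISolution (PIII.theta0 n m) (PIII.thetaInf n m)
      (fun x => -PIII.potY cInf x / PIII.potS c0 x) D := by
  obtain ⟨d, Φ, hΦ⟩ := PIII.exists_solFamily hDo hDs hsol
  have hI := Complex.I_ne_zero
  have hL := fun x hx => (hΦ x hx).2.laxSystem
  have hnhds : ∀ x ∈ D, ∀ᶠ z in 𝓝 x, z ∈ D := fun x hx => hDo.mem_nhds hx
  have han : ∀ {f : ℂ → ℂ}, (∀ x ∈ D, DifferentiableAt ℂ f x) → ∀ x ∈ D, AnalyticAt ℂ f x :=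
    fun hf x hx => DifferentiableOn.analyticAt (s := D)
      (fun z hz => (hf z hz).differentiableWithinAt) (hDo.mem_nhds hx)
  have hM : ∀ x ∈ D, ∀ i j, DifferentiableAt ℂ (fun x => PIII.matM c0 x i j) x := by
    intro x hx i j
    have h11 : (fun x => PIII.matM c0 x 1 1) = fun x => -PIII.matM c0 x 0 0 := by
      funext z
      simp [PIII.matM, PIII.matK_one_one]
    fin_cases i <;> fin_cases j
    · exact (hL x hx).deriv_p.differentiableAt
    · exact (hL x hx).deriv_q.differentiableAt
    · exact (hL x hx).deriv_r.differentiableAt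
    · change DifferentiableAt ℂ (fun x => PIII.matM c0 x 1 1) x
      rw [h11]
      exact (hL x hx).deriv_p.differentiableAt.neg
  have hYa := han (f := PIII.potY cInf) fun x hx => (hL x hx).deriv_y.differentiableAt
  have hQa := han (f := fun z => PIII.matM c0 z 0 1) fun x hx => hM x hx 0 1
  have hY0 : ∀ x ∈ D, _ := fun x hx => (hΦ x hx).2.potY_not_eventually_zero
  have hQ0 : ∀ x ∈ D, _ := fun x hx => (hΦ x hx).2.matM_zero_one_not_eventually_zero
  -- The entry q of M is is, so u = -iy/q is a quotient of functions whose analyticity is already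
  -- known, whereas the entries of the leading coefficient at 0 are never shown to be analytic one
  -- by one.
  have hSu : (fun x => -PIII.potY cInf x / PIII.potS c0 x)
      = fun x => -Complex.I * PIII.potY cInf x / PIII.matM c0 x 0 1 := by
    funext z
    rw [PIII.matM_zero_one, neg_mul, neg_div, neg_div, mul_div_mul_left _ _ hI]
  obtain ⟨a, ha⟩ := hDc.nonempty
  have hex : ∀ f : ℂ → ℂ, (¬∀ᶠ z in 𝓝 a, f z = 0) → ∃ x ∈ D, f x ≠ 0 := fun f hf => by
    by_contra! hcon
    exact hf ((hnhds a ha).mono hcon)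
  refine ⟨⟨PIII.matM c0, fun i j x hx => (hM x hx i j).differentiableWithinAt,
    fun x hx h => PIII.matM_eq_laxM (hΦ x hx).2.self.det_c0 h, fun x hx l hl i j =>
    ⟨PIII.hasDerivAt_mat.1 ((hΦ x hx).2.hasDerivAt_lambda (hDs hx) (hΦ x hx).1 hl) i j,
      PIII.hasDerivAt_mat.1 ((hΦ x hx).2.hasDerivAt_x (hDs hx)
        ((hnhds x hx).mono fun z hz => (hΦ z hz).1) hl) i j⟩⟩, ?_, ?_, ?_, ?_⟩
  -- Both (1,1) and (1,2) entries are factors of s, and s does not vanish identically near any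
  -- point.
  · refine hex _ fun h => hQ0 a ha (h.mono fun z hz => ?_)
    rw [PIII.matM_zero_one, PIII.potS, hz]; ring
  · refine hex _ fun h => hQ0 a ha (h.mono fun z hz => ?_)
    rw [PIII.matM_zero_one, PIII.potS, hz]; ring
  · exact hex _ (hΦ a ha).2.c0_one_one_not_eventually_zero
  · rw [hSu]
    refine ⟨fun x hx => ?_, ?_, fun x hx _ hu => ?_⟩
    · exact ((analyticAt_const.mul (hYa x hx)).meromorphicAt).div (hQa x hx).meromorphicAt
    · filter_upwards [PIII.eventually_codiscreteWithin_ne_zero hYa hY0,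
        PIII.eventually_codiscreteWithin_ne_zero hQa hQ0] with x h1 h2
      exact div_ne_zero (mul_ne_zero (neg_ne_zero.2 hI) h1) h2
    · have h1 : PIII.potY cInf x ≠ 0 := fun h => hu (by simp [h])
      have h2 : PIII.matM c0 x 0 1 ≠ 0 := fun h => hu (by simp [h])
      exact PIII.LaxSystem.piii ((hnhds x hx).mono hL) h1 h2
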